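/- **Setting.** Let $\Lambda\subset\mathbb R^d$ be a Delone set such that every point of $\mathbb R^d$ is within some distance $\Delta<1/2$ of $\Lambda$, and attach to each site $j\in\Lambda$ a Hilbert space of finite dimension $d_j\ge 1$. For finite $\Gamma\subset\Lambda$ let $\mathscr A_\Gamma=\bigotimes_{j\in\Gamma}\mathrm{End}(\mathbb C^{d_j})$, for $X\subset\mathbb R^d$ let $\mathscr A_X=\bigcup_{\Gamma\subset X}\mathscr A_\Gamma$, let $\mathscr A$ be the norm completion of $\mathscr A_\ell=\mathscr A_{\mathbb R^d}$, and let $\langle\cdot\rangle_\infty$ be its tracial state. Put $f_x(A,r)=\inf_{B\in\mathscr A_{B_x(r)}}\|A-B\|$, where $B_x(r)$ is the open ball. Let $\mathfrak d_X$ (resp. $\mathfrak d_l$) be the real space of anti-self-adjoint traceless elements of $\mathscr A_X$ (resp. $\mathscr A_\ell$), and $\mathfrak d_{al}$ the real space of anti-self-adjoint traceless $A\in\mathscr A$ with $\sup_{r\ge 0}(1+r)^\alpha f_j(A,r)<\infty$ for all $\alpha\in\mathbb N_0$ and $j\in\Lambda$. A brick is $\emptyset$ or a set $\{n_i\le x_i<m_i,\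 i=1,\dots,d\}$ with integers $n_i<m_i$; for a brick $Y$ let $\mathfrak d^Y$ be the orthogonal complement in $\mathfrak d_Y$ of $\sum_{Z\subsetneq Y}\mathfrak d_Z$ ($Z$ bricks) for $\langle A^*B\rangle_\infty$, and let $A^Y$ be the component of $A$ in $\mathfrak d^Y$. For $q\ge0$ let $C_q(\mathfrak d_{al})$ be the space of skew-symmetric functions $\mathsf a:\Lambda^{q+1}\to\mathfrak d_{al}$ such that $\|\mathsf a\|_\alpha=\sup_{a}\sup_{j_0,\dots,j_q}\sup_{r\ge 0}(1+r)^\alpha f_{j_a}(\mathsf a_{j_0\dots j_q},r)<\infty$ for all $\alpha\in\mathbb N_0$, and let $\mathfrak D_{al}$ be the space of functions $\mathsf F$ on bricks with $\mathsf F^Y\in\mathfrak d^Y$ and $\sup_Y(1+\mathrm{diam}\,Y)^\alpha\|\mathsf F^Y\|<\infty$ for all $\alpha\in\mathbb N_0$; both are topologized by these norms. Let $C_q(\mathfrak d_l)$ be the subspace of those $\mathsf a$ for which there are $C,R>0$ with $\|\mathsf a_{j_0\dots j_q}\|\le C$ and $\mathsf a_{j_0\dots j_q}\in\mathscr A_{B_{j_a}(R)}$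 for all $a$ and all $j_0,\dots,j_q$, and $\mathfrak D_l$ the subspace of those $\mathsf F$ with $\mathsf F^Y=0$ for all $Y$ of sufficiently large diameter. On these subspaces define * $(\partial_q\mathsf a)_{j_1\dots j_q}=\sum_{j_0}\mathsf a_{j_0j_1\dots j_q}$ for $q\ge1$, and $(\partial_0\mathsf a)^Y=\sum_j\mathsf a_j^Y$; * $h_q(\mathsf a)_{j_0\dots j_{q+1}}=\sum_Y\sum_{k=0}^{q+1}(-1)^k\frac{\chi_Y(j_k)}{|Y\cap\Lambda|}\mathsf a^Y_{j_0\dots\widehat{j_k}\dots j_{q+1}}$ for $q\ge0$, and $h_{-1}(\mathsf F)_j=\sum_Y\frac{\chi_Y(j)}{|Y\cap\Lambda|}\mathsf F^Y$; * for $\mathsf f\in C_p(\mathfrak d_l)$, $\mathsf g\in C_q(\mathfrak d_l)$, $\mathsf F\in\mathfrak D_l$: $\{\mathsf f,\mathsf g\}_{j_0\dots j_{p+q+1}}=\frac1{(p+1)!(q+1)!}\sum_{\sigma}\mathrm{sgn}(\sigma)[\mathsf f_{j_{\sigma(0)}\dots j_{\sigma(p)}},\mathsf g_{j_{\sigma(p+1)}\dots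 j_{\sigma(p+q+1)}}]$ (sum over all permutations $\sigma$ of $\{0,\dots,p+q+1\}$), $\{\mathsf F,\mathsf g\}_{j_0\dots j_q}=\sum_Y[\mathsf F^Y,\mathsf g_{j_0\dots j_q}]=-\{\mathsf g,\mathsf F\}_{j_0\dots j_q}$, and $\{\partial_0\mathsf f,\partial_0\mathsf g\}=\partial_0\big(j\mapsto\sum_k[\mathsf f_k,\mathsf g_j]\big)$ for $\mathsf f,\mathsf g\in C_0(\mathfrak d_l)$. Let $|\cdot|$ denote the degree; elements of $C_q$ have degree $q$ and elements of $\mathfrak D_{al}$ have degree $-1$. Put $\partial=0$ on $\mathfrak D_{al}$. **Proposition.** All $C_q(\mathfrak d_{al})$, $q\ge 0$, and $\mathfrak D_{al}$ are Fréchet spaces, in which $C_q(\mathfrak d_l)$ and $\mathfrak D_l$ are dense. The maps $\partial_q$ ($q\ge0$), $h_q$ ($q\ge-1$) and the bracket map uniformly local elements (those of $C_q(\mathfrak d_l)$ and $\mathfrak D_l$) to uniformly local elements, and extend to continuous linear maps, respectively jointly continuous bilinear maps, between the spaces $C_\bullet(\mathfrak d_{al})$ and $\mathfrak D_{al}$,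 such that: 1. $\cdots\to C_1(\mathfrak d_{al})\xrightarrow{\partial_1}C_0(\mathfrak d_{al})\xrightarrow{\partial_0}\mathfrak D_{al}\to0$ is a complex, contracted by $h$: $\partial_q\partial_{q+1}=0$ and $h_{q-1}\partial_q+\partial_{q+1}h_q=\mathrm{id}$ for $q\ge0$, and $\partial_0h_{-1}=\mathrm{id}$. 2. It is a 1-shifted dg-Fréchet–Lie algebra: for all $\mathsf f,\mathsf g,\mathsf k$ of degrees $\ge -1$, $\{\mathsf f,\mathsf g\}=-(-1)^{(|\mathsf f|+1)(|\mathsf g|+1)}\{\mathsf g,\mathsf f\}$, $(-1)^{(|\mathsf f|+1)(|\mathsf k|+1)}\{\mathsf f,\{\mathsf g,\mathsf k\}\}+(-1)^{(|\mathsf g|+1)(|\mathsf f|+1)}\{\mathsf g,\{\mathsf k,\mathsf f\}\}+(-1)^{(|\mathsf k|+1)(|\mathsf g|+1)}\{\mathsf k,\{\mathsf f,\mathsf g\}\}=0$, and $\partial\{\mathsf f,\mathsf g\}=\{\partial\mathsf f,\mathsf g\}+(-1)^{|\mathsf f|+1}\{\mathsf f,\partial\mathsf g\}$. 3. Conserved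 currents exist, with ambiguity exactly an exact 1-chain. If $\mathsf h\in C_0(\mathfrak d_{al})$ and $\mathsf H=\partial\mathsf h$, then the solutions $\mathsf j\in C_1(\mathfrak d_{al})$ of $\{\mathsf H,\mathsf h\}=-\partial\mathsf j$ are exactly $\mathsf j=-\frac12\{\mathsf h,\mathsf h\}+\partial\mathsf c$, $\mathsf c\in C_2(\mathfrak d_{al})$. If $\mathsf H\in\mathfrak D_{al}$ and $\mathsf q\in C_0(\mathfrak d_{al})$ satisfy $\{\partial\mathsf q,\mathsf H\}=0$, then there is $\mathsf j_0\in C_1(\mathfrak d_{al})$ such that the solutions of $\{\mathsf H,\mathsf q\}=-\partial\mathsf j$ are exactly $\mathsf j=\mathsf j_0+\partial\mathsf c$, $\mathsf c\in C_2(\mathfrak d_{al})$. If $\mathsf h,\mathsf q\in C_0(\mathfrak d_{al})$, $\mathsf H=\partial\mathsf h$ and $\{\partial\mathsf q,\mathsf h\}=0$, then $\mathsf j=-\{\mathsf h,\mathsf q\}$ is a solution of $\{\mathsf H,\mathsf q\}=-\partial\mathsf j$. -/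

import Mathlib

open scoped NNReal Topology

noncomputable section

namespace UAL

/-! ### The spin system and its algebra of quasi-local observables -/

/-- A lattice spin system in `ℝ^d`: a Delone set `Λ ⊂ ℝ^d` of sites, with the metric normalised so
that every point of `ℝ^d` is within some distance `Δ < 1/2` of `Λ`, and for each site `j` an on-site
Hilbert space `ℂ^(dim j)` of arbitrary finite nonzero dimension. -/
structure SpinSystem (d : ℕ) where
  lattice : Delone.DeloneSet (EuclideanSpace ℝ (Fin d))
  coveringRadius_lt : lattice.coveringRadius < 1 / 2
  dim : lattice.carrier → ℕ
  dim_pos : ∀ j, 0 < dim j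

variable {d : ℕ} (L : SpinSystem d)

/-- The set `Λ` of sites, as a type. -/
abbrev SpinSystem.Site : Type := L.lattice.carrier

/-- Basis configurations: a basis vector of `ℂ^(dim j)` for each site `j`. -/
abbrev SpinSystem.Config : Type := ∀ j : L.Site, Fin (L.dim j)

/-- The Hilbert space `ℓ²(Config)`. It carries a faithful representation of `⨂_{j ∈ Γ} End(ℂ^(dim j))`
for each finite set of sites `Γ` (a multiple of the standard one). -/
abbrev SpinSystem.Hilb : Type := lp (fun _ : L.Config => ℂ) 2

/-- Bounded operators on `ℓ²(Config)`, a C⋆-algebra. -/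
abbrev SpinSystem.Op : Type := L.Hilb →L[ℂ] L.Hilb

/-- Configurations of a finite set of sites `Γ`: a basis of `⨂_{j ∈ Γ} ℂ^(dim j)`. -/
abbrev SpinSystem.LocConfig (Γ : Finset L.Site) : Type := ∀ j : Γ, Fin (L.dim j)

variable {L}

open Classical in
/-- Replace the restriction of `σ` to `Γ` by `t`. -/
def overwrite (Γ : Finset L.Site) (t : L.LocConfig Γ) (σ : L.Config) : L.Config :=
  fun j => if h : j ∈ Γ then t ⟨j, h⟩ else σ j

open Classical in
/-- The function `σ ↦ [σ|_Γ = s] ψ(t ∪ σ|_{Λ ∖ Γ})`. -/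
def matUnitFun (Γ : Finset L.Site) (s t : L.LocConfig Γ) (ψ : L.Config → ℂ) : L.Config → ℂ :=
  fun σ => if (∀ j : Γ, σ j = s j) then ψ (overwrite Γ t σ) else 0

theorem matUnitFun_sum_le (Γ : Finset L.Site) (s t : L.LocConfig Γ) (ψ : L.Hilb)
    (S : Finset L.Config) :
    ∑ σ ∈ S, ‖matUnitFun Γ s t ψ σ‖ ^ (2 : ENNReal).toReal ≤ ‖ψ‖ ^ (2 : ENNReal).toReal := by
  classical
  have hp : 0 < (2 : ENNReal).toReal := by norm_num
  set S' := S.filter (fun σ => ∀ j : Γ, σ j = s j) with hS'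
  have h1 : ∑ σ ∈ S, ‖matUnitFun Γ s t ψ σ‖ ^ (2 : ENNReal).toReal
      = ∑ σ ∈ S', ‖ψ (overwrite Γ t σ)‖ ^ (2 : ENNReal).toReal := by
    rw [hS', Finset.sum_filter]
    refine Finset.sum_congr rfl fun σ _ => ?_
    unfold matUnitFun
    split_ifs
    · rfl
    · rw [norm_zero, Real.zero_rpow hp.ne']
  have hinj : Set.InjOn (overwrite Γ t) (S' : Set L.Config) := by
    intro σ hσ τ hτ h
    have hσ' := (Finset.mem_filter.1 (Finset.mem_coe.1 hσ)).2
    have hτ' := (Finset.mem_filter.1 (Finset.mem_coe.1 hτ)).2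
    funext j
    by_cases hj : j ∈ Γ
    · exact (hσ' ⟨j, hj⟩).trans (hτ' ⟨j, hj⟩).symm
    · have := congrFun h j
      simpa [overwrite, hj] using this
  rw [h1, ← Finset.sum_image (f := fun σ => ‖ψ σ‖ ^ (2 : ENNReal).toReal) hinj]
  exact lp.sum_rpow_le_norm_rpow hp ψ _

/-- The matrix unit `|s⟩⟨t| ⊗ 1` acting on the factor `Γ` of the configuration space. -/
def matUnit (Γ : Finset L.Site) (s t : L.LocConfig Γ) : L.Op :=
  LinearMap.mkContinuous
    { toFun := fun ψ => ⟨matUnitFun Γ s t ψ, memℓp_gen' (matUnitFun_sum_le Γ s t ψ)⟩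
      map_add' := fun ψ φ => by
        ext σ
        simp only [matUnitFun, lp.coeFn_add, Pi.add_apply]
        split_ifs <;> simp
      map_smul' := fun c ψ => by
        ext σ
        simp only [matUnitFun, lp.coeFn_smul, Pi.smul_apply, RingHom.id_apply]
        split_ifs <;> simp }
    1
    (fun ψ => by
      rw [one_mul]
      exact lp.norm_le_of_forall_sum_le (by norm_num) (norm_nonneg ψ)
        (matUnitFun_sum_le Γ s t ψ))

theorem matUnit_apply (Γ : Finset L.Site) (s t : L.LocConfig Γ) (ψ : L.Hilb) (σ : L.Config) :
    matUnit Γ s t ψ σ = matUnitFun Γ s t ψ σ := rfl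

/-- `𝒜_Γ = ⨂_{j ∈ Γ} End(ℂ^(dim j))`, for a finite set of sites `Γ`. -/
def algFin (Γ : Finset L.Site) : Submodule ℂ L.Op :=
  Submodule.span ℂ {T | ∃ s t, T = matUnit Γ s t}

/-- `𝒜_X`, the union of the increasing family `𝒜_Γ` over finite sets of sites `Γ ⊂ X`. -/
def alg (L : SpinSystem d) (X : Set (EuclideanSpace ℝ (Fin d))) : Submodule ℂ L.Op :=
  ⨆ (Γ : Finset L.Site) (_ : ∀ j ∈ Γ, (j : EuclideanSpace ℝ (Fin d)) ∈ X), algFin Γ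

/-- The averaging map `Π_Γ` over local unitaries supported on the finite set of sites `Γ`,
`Π_Γ(T) = (∏_{j ∈ Γ} dim j)⁻¹ ∑_{s,t} |s⟩⟨t| T |t⟩⟨s|` (the Haar average `∫ U T U⋆` over the unitary
group of `𝒜_Γ`). -/
def siteAvg (Γ : Finset L.Site) (T : L.Op) : L.Op :=
  (∏ j ∈ Γ, (L.dim j : ℂ))⁻¹ •
    ∑ s : L.LocConfig Γ, ∑ t : L.LocConfig Γ, matUnit Γ s t * T * matUnit Γ t s

/-- `⟨T⟩_∞ = c`: the infinite temperature state of `T`, `lim_Γ Π_Γ(T) = ⟨T⟩_∞ 1`, exists and equals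
`c`. (The limit exists for each quasi-local `T`.) -/
def HasInfTemp (T : L.Op) (c : ℂ) : Prop :=
  Filter.Tendsto (fun Γ : Finset L.Site => siteAvg Γ T) Filter.atTop (𝓝 (c • (1 : L.Op)))

theorem siteAvg_add (Γ : Finset L.Site) (S T : L.Op) :
    siteAvg Γ (S + T) = siteAvg Γ S + siteAvg Γ T := by
  simp only [siteAvg, mul_add, add_mul, Finset.sum_add_distrib, smul_add]

theorem siteAvg_smul (Γ : Finset L.Site) (r : ℝ) (T : L.Op) :
    siteAvg Γ (r • T) = r • siteAvg Γ T := by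
  simp only [siteAvg, mul_smul_comm, smul_mul_assoc, ← Finset.smul_sum]
  rw [smul_comm]

theorem HasInfTemp.zero : HasInfTemp (0 : L.Op) 0 := by
  simp [HasInfTemp, siteAvg]

theorem HasInfTemp.add {S T : L.Op} (hS : HasInfTemp S 0) (hT : HasInfTemp T 0) :
    HasInfTemp (S + T) 0 := by
  unfold HasInfTemp at *
  simp only [siteAvg_add]
  simpa using Filter.Tendsto.add hS hT

theorem HasInfTemp.smul {T : L.Op} (r : ℝ) (hT : HasInfTemp T 0) : HasInfTemp (r • T) 0 := by
  unfold HasInfTemp at *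
  simp only [siteAvg_smul]
  simpa using Filter.Tendsto.const_smul hT r

/-! ### Traceless anti-self-adjoint observables, almost locality -/

theorem real_smul_op (r : ℝ) (A : L.Op) : r • A = (r : ℂ) • A := by
  ext ψ : 1
  exact (Complex.coe_smul r (A ψ)).symm

theorem star_real_smul_op (r : ℝ) (A : L.Op) : star (r • A) = r • star A := by
  rw [real_smul_op, real_smul_op, star_smul, Complex.star_def, Complex.conj_ofReal]

/-- `inf_{B ∈ 𝒜_X} ‖A - B‖`, as a seminorm in `A`. -/
def distAlg (L : SpinSystem d) (X : Set (EuclideanSpace ℝ (Fin d))) : Seminorm ℝ L.Op :=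
  Seminorm.ofSMulLE (fun A => Metric.infDist A (alg L X : Set L.Op))
    (Metric.infDist_zero_of_mem (alg L X).zero_mem)
    (fun A B => by
      have h := norm_add_le (QuotientAddGroup.mk A : L.Op ⧸ (alg L X).toAddSubgroup)
        (QuotientAddGroup.mk B)
      rw [← QuotientAddGroup.mk_add] at h
      simp only [QuotientAddGroup.norm_mk] at h
      exact h)
    (fun r A => by
      refine le_of_forall_pos_le_add fun ε hε => ?_
      have hδ : 0 < ε / (‖r‖ + 1) := by positivity
      obtain ⟨B, hB, hAB⟩ := (Metric.infDist_lt_iff (s := (alg L X : Set L.Op)) (x := A)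
        ⟨0, (alg L X).zero_mem⟩).1 (lt_add_of_pos_right _ hδ)
      have hrB : r • B ∈ (alg L X : Set L.Op) := by
        rw [real_smul_op]; exact (alg L X).smul_mem _ hB
      calc Metric.infDist (r • A) (alg L X : Set L.Op) ≤ dist (r • A) (r • B) :=
            Metric.infDist_le_dist_of_mem hrB
        _ = ‖r‖ * dist A B := dist_smul₀ r A B
        _ ≤ ‖r‖ * (Metric.infDist A (alg L X : Set L.Op) + ε / (‖r‖ + 1)) := by gcongr
        _ = ‖r‖ * Metric.infDist A (alg L X : Set L.Op) + ‖r‖ * ε / (‖r‖ + 1) := by ring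
        _ ≤ _ := by
          gcongr
          rw [div_le_iff₀ (by positivity)]
          nlinarith [norm_nonneg r])

theorem distAlg_apply (L : SpinSystem d) (X : Set (EuclideanSpace ℝ (Fin d))) (A : L.Op) :
    distAlg L X A = Metric.infDist A (alg L X : Set L.Op) := rfl

/-- `f_x(A, r) = inf_{B ∈ 𝒜_{B_x(r)}} ‖A - B‖`, where `B_x(r)` is the open ball. -/
def locErr (L : SpinSystem d) (x : EuclideanSpace ℝ (Fin d)) (r : ℝ≥0) : Seminorm ℝ L.Op :=
  distAlg L (Metric.ball x r)

/-- `𝔡_X`: the traceless anti-self-adjoint elements of `𝒜_X`. -/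
def lieLoc (L : SpinSystem d) (X : Set (EuclideanSpace ℝ (Fin d))) : Submodule ℝ L.Op where
  carrier := {A | A ∈ alg L X ∧ star A = -A ∧ HasInfTemp A 0}
  zero_mem' := ⟨(alg L X).zero_mem, by simp, HasInfTemp.zero⟩
  add_mem' := fun {A B} hA hB =>
    ⟨(alg L X).add_mem hA.1 hB.1, by rw [star_add, hA.2.1, hB.2.1, neg_add], hA.2.2.add hB.2.2⟩
  smul_mem' := fun r A hA =>
    ⟨by rw [real_smul_op]; exact (alg L X).smul_mem _ hA.1,
      by rw [star_real_smul_op, hA.2.1, smul_neg], hA.2.2.smul r⟩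

/-- `𝔡_al`: the traceless anti-self-adjoint almost local observables, i.e. those elements `A` of the
norm closure of the algebra of local observables for which `sup_r (1 + r)^α f_j(A, r) < ∞` for all
`α` (and each, equivalently one, site `j`). -/
def lieAl (L : SpinSystem d) : Submodule ℝ L.Op where
  carrier := {A | A ∈ (alg L Set.univ).topologicalClosure ∧ star A = -A ∧ HasInfTemp A 0 ∧
    ∀ (j : L.Site) (α : ℕ), BddAbove (Set.range fun r : ℝ≥0 => (1 + (r : ℝ)) ^ α * locErr L j r A)}
  zero_mem' := ⟨Submodule.zero_mem _, by simp, HasInfTemp.zero,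
    fun j α => ⟨0, by rintro _ ⟨r, rfl⟩; simp⟩⟩
  add_mem' := by
    rintro A B ⟨hA, hA', hA'', hA3⟩ ⟨hB, hB', hB'', hB3⟩
    refine ⟨Submodule.add_mem _ hA hB, by rw [star_add, hA', hB', neg_add], hA''.add hB'', ?_⟩
    intro j α
    obtain ⟨a, ha⟩ := hA3 j α
    obtain ⟨b, hb⟩ := hB3 j α
    refine ⟨a + b, ?_⟩
    rintro _ ⟨r, rfl⟩
    calc (1 + (r : ℝ)) ^ α * locErr L j r (A + B)
        ≤ (1 + (r : ℝ)) ^ α * (locErr L j r A + locErr L j r B) := by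
          gcongr; exact map_add_le_add _ _ _
      _ ≤ a + b := by
          rw [mul_add]; exact add_le_add (ha ⟨r, rfl⟩) (hb ⟨r, rfl⟩)
  smul_mem' := by
    rintro c A ⟨hA, hA', hA'', hA3⟩
    refine ⟨by rw [real_smul_op]; exact Submodule.smul_mem _ _ hA,
      by rw [star_real_smul_op, hA', smul_neg], hA''.smul c, ?_⟩
    intro j α
    obtain ⟨a, ha⟩ := hA3 j α
    refine ⟨‖c‖ * a, ?_⟩
    rintro _ ⟨r, rfl⟩
    calc (1 + (r : ℝ)) ^ α * locErr L j r (c • A)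
        = ‖c‖ * ((1 + (r : ℝ)) ^ α * locErr L j r A) := by rw [map_smul_eq_mul]; ring
      _ ≤ ‖c‖ * a := by gcongr; exact ha ⟨r, rfl⟩

/-! ### Bricks -/

/-- A brick: the empty set, or `{x | n_i ≤ x_i < m_i for all i}` with integers `n_i < m_i`. -/
def IsBrick (Y : Set (EuclideanSpace ℝ (Fin d))) : Prop :=
  Y = ∅ ∨ ∃ n m : Fin d → ℤ, (∀ i, n i < m i) ∧
    Y = {x : EuclideanSpace ℝ (Fin d) | ∀ i, (n i : ℝ) ≤ x i ∧ x i < (m i : ℝ)}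

/-- The set `𝔹_d` of all bricks in `ℝ^d`. -/
abbrev Brick (d : ℕ) : Type := {Y : Set (EuclideanSpace ℝ (Fin d)) // IsBrick Y}

/-- `𝔡^Y`: the orthogonal complement in `𝔡_Y` of `∑_{Z ⊊ Y} 𝔡_Z`, the sum being over bricks `Z`, for
the inner product `⟨A⋆ B⟩_∞`. -/
def brickSpace (L : SpinSystem d) (Y : Brick d) : Submodule ℝ L.Op where
  carrier := {A | A ∈ lieLoc L Y.1 ∧
    ∀ Z : Brick d, Z.1 ⊂ Y.1 → ∀ B ∈ lieLoc L Z.1, HasInfTemp (star B * A) 0}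
  zero_mem' := ⟨Submodule.zero_mem _, fun Z _ B _ => by rw [mul_zero]; exact HasInfTemp.zero⟩
  add_mem' := fun {A B} hA hB => ⟨Submodule.add_mem _ hA.1 hB.1, fun Z hZ C hC => by
    rw [mul_add]; exact (hA.2 Z hZ C hC).add (hB.2 Z hZ C hC)⟩
  smul_mem' := fun r A hA => ⟨Submodule.smul_mem _ _ hA.1, fun Z hZ C hC => by
    rw [mul_smul_comm]; exact (hA.2 Z hZ C hC).smul r⟩

open Classical in
/-- `A^Y`: the component of `A` in `𝔡^Y`, i.e. its orthogonal projection to `𝔡^Y` for the inner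
product `⟨A⋆ B⟩_∞`. (For distinct bricks the spaces `𝔡^Y` are orthogonal to each other, they are
finite dimensional, and `𝔡_l = ⨁_Y 𝔡^Y`.) -/
def brickComp (Y : Brick d) (A : L.Op) : L.Op :=
  if h : ∃ B ∈ brickSpace L Y, ∀ C ∈ brickSpace L Y, HasInfTemp (star C * (A - B)) 0
  then h.choose else 0

open Classical in
/-- The weight `χ_Y(j) / |Y ∩ Λ|`. -/
def brickWeight (L : SpinSystem d) (Y : Brick d) (j : L.Site) : ℝ :=
  (if (j : EuclideanSpace ℝ (Fin d)) ∈ Y.1 then 1 else 0) / ((Y.1 ∩ L.lattice.carrier).ncard : ℝ)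

/-! ### Uniformly almost local chains and derivations, as Fréchet spaces -/

/-- The index set of the suprema in the norms of `q`-chains: a position `a`, a multi-index
`(j_0, …, j_q)`, and a radius `r ≥ 0`. -/
abbrev ChainIdx (L : SpinSystem d) (q : ℕ) : Type :=
  Fin (q + 1) × (Fin (q + 1) → L.Site) × ℝ≥0

/-- The seminorm `a ↦ (1 + r)^α f_{j_a}(a_{j_0 … j_q}, r)`. -/
def chainTerm (L : SpinSystem d) (q α : ℕ) (i : ChainIdx L q) :
    Seminorm ℝ ((Fin (q + 1) → L.Site) → L.Op) :=
  ((1 + i.2.2) ^ α : ℝ≥0) • (locErr L (i.2.1 i.1) i.2.2).comp (LinearMap.proj i.2.1)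

theorem chainTerm_apply (q α : ℕ) (i : ChainIdx L q) (a : (Fin (q + 1) → L.Site) → L.Op) :
    chainTerm L q α i a = (1 + (i.2.2 : ℝ)) ^ α * locErr L (i.2.1 i.1) i.2.2 (a i.2.1) := by
  simp [chainTerm, NNReal.smul_def]

/-- Skew-symmetric functions `a : Λ^{q+1} → 𝔡_al` with
`‖a‖_α = sup_a sup_{j_0, …, j_q} sup_r (1 + r)^α f_{j_a}(a_{j_0 … j_q}, r) < ∞` for all `α`. -/
def ualChainSubmodule (L : SpinSystem d) (q : ℕ) :
    Submodule ℝ ((Fin (q + 1) → L.Site) → L.Op) where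
  carrier := {a | (∀ j, a j ∈ lieAl L) ∧
    (∀ (σ : Equiv.Perm (Fin (q + 1))) j, a (j ∘ σ) = (Equiv.Perm.sign σ : ℤ) • a j) ∧
    ∀ α : ℕ, BddAbove (Set.range fun i : ChainIdx L q => chainTerm L q α i a)}
  zero_mem' := ⟨fun _ => Submodule.zero_mem _, fun σ j => by simp,
    fun α => ⟨0, by rintro _ ⟨i, rfl⟩; simp⟩⟩
  add_mem' := by
    rintro a b ⟨ha, ha', ha''⟩ ⟨hb, hb', hb''⟩
    refine ⟨fun j => Submodule.add_mem _ (ha j) (hb j),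
      fun σ j => by simp only [Pi.add_apply, ha' σ j, hb' σ j, smul_add], fun α => ?_⟩
    obtain ⟨x, hx⟩ := ha'' α
    obtain ⟨y, hy⟩ := hb'' α
    refine ⟨x + y, ?_⟩
    rintro _ ⟨i, rfl⟩
    exact (map_add_le_add _ _ _).trans (add_le_add (hx ⟨i, rfl⟩) (hy ⟨i, rfl⟩))
  smul_mem' := by
    rintro c a ⟨ha, ha', ha''⟩
    refine ⟨fun j => Submodule.smul_mem _ c (ha j),
      fun σ j => by simp only [Pi.smul_apply, ha' σ j]; rw [smul_comm], fun α => ?_⟩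
    obtain ⟨x, hx⟩ := ha'' α
    refine ⟨‖c‖ * x, ?_⟩
    rintro _ ⟨i, rfl⟩
    simp only [map_smul_eq_mul]
    exact mul_le_mul_of_nonneg_left (hx ⟨i, rfl⟩) (norm_nonneg c)

/-- The space `C_q(𝔡_al)` of uniformly almost local `q`-chains. -/
def UALChain (L : SpinSystem d) (q : ℕ) : Type := ualChainSubmodule L q

instance (q : ℕ) : AddCommGroup (UALChain L q) :=
  inferInstanceAs (AddCommGroup (ualChainSubmodule L q))
instance (q : ℕ) : Module ℝ (UALChain L q) := inferInstanceAs (Module ℝ (ualChainSubmodule L q))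

/-- The underlying function `(j_0, …, j_q) ↦ a_{j_0 … j_q}` of a chain. -/
def UALChain.fn {q : ℕ} : UALChain L q →ₗ[ℝ] ((Fin (q + 1) → L.Site) → L.Op) :=
  (ualChainSubmodule L q).subtype

/-- The seminorms `‖a‖_α`, `α ∈ ℕ`, on `C_q(𝔡_al)`. -/
def UALChain.norms (L : SpinSystem d) (q : ℕ) : SeminormFamily ℝ (UALChain L q) ℕ :=
  fun α => ⨆ i : ChainIdx L q, (chainTerm L q α i).comp UALChain.fn

theorem UALChain.norms_apply {q : ℕ} (α : ℕ) (a : UALChain L q) :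
    UALChain.norms L q α a = ⨆ i : ChainIdx L q,
      (1 + (i.2.2 : ℝ)) ^ α * locErr L (i.2.1 i.1) i.2.2 (a.fn i.2.1) := by
  unfold UALChain.norms
  rw [Seminorm.iSup_apply]
  · simp only [Seminorm.comp_apply, chainTerm_apply]
  · rw [Seminorm.bddAbove_range_iff]
    exact fun b => b.2.2.2 α

instance (q : ℕ) : TopologicalSpace (UALChain L q) :=
  (UALChain.norms L q).moduleFilterBasis.topology
instance (q : ℕ) : IsTopologicalAddGroup (UALChain L q) :=
  (UALChain.norms L q).addGroupFilterBasis.isTopologicalAddGroup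

/-- A chain is uniformly local (belongs to `C_q(𝔡_l)`) if for some `C, R > 0` all its components have
norm at most `C` and `a_{j_0 … j_q} ∈ 𝒜_{B_{j_k}(R)}` for all `k`. -/
def UALChain.IsUL {q : ℕ} (a : UALChain L q) : Prop :=
  ∃ C > (0 : ℝ), ∃ R > (0 : ℝ), ∀ j, ‖a.fn j‖ ≤ C ∧
    ∀ k, a.fn j ∈ alg L (Metric.ball (j k : EuclideanSpace ℝ (Fin d)) R)

/-- Functions `F` on bricks with `F^Y ∈ 𝔡^Y` and `sup_Y (1 + diam Y)^α ‖F^Y‖ < ∞` for all `α`. -/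
def ualDerSubmodule (L : SpinSystem d) : Submodule ℝ (Brick d → L.Op) where
  carrier := {F | (∀ Y, F Y ∈ brickSpace L Y) ∧
    ∀ α : ℕ, BddAbove (Set.range fun Y : Brick d => (1 + Metric.diam Y.1) ^ α * ‖F Y‖)}
  zero_mem' := ⟨fun _ => Submodule.zero_mem _, fun α => ⟨0, by rintro _ ⟨i, rfl⟩; simp⟩⟩
  add_mem' := by
    rintro a b ⟨ha, ha''⟩ ⟨hb, hb''⟩
    refine ⟨fun j => Submodule.add_mem _ (ha j) (hb j), fun α => ?_⟩
    obtain ⟨x, hx⟩ := ha'' α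
    obtain ⟨y, hy⟩ := hb'' α
    refine ⟨x + y, ?_⟩
    rintro _ ⟨Y, rfl⟩
    have h0 : 0 ≤ (1 + Metric.diam Y.1) ^ α := by
      have := Metric.diam_nonneg (s := Y.1)
      positivity
    calc (1 + Metric.diam Y.1) ^ α * ‖a Y + b Y‖
        ≤ (1 + Metric.diam Y.1) ^ α * (‖a Y‖ + ‖b Y‖) :=
          mul_le_mul_of_nonneg_left (norm_add_le _ _) h0
      _ ≤ x + y := by rw [mul_add]; exact add_le_add (hx ⟨Y, rfl⟩) (hy ⟨Y, rfl⟩)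
  smul_mem' := by
    rintro c a ⟨ha, ha''⟩
    refine ⟨fun j => Submodule.smul_mem _ c (ha j), fun α => ?_⟩
    obtain ⟨x, hx⟩ := ha'' α
    refine ⟨‖c‖ * x, ?_⟩
    rintro _ ⟨Y, rfl⟩
    calc (1 + Metric.diam Y.1) ^ α * ‖c • a Y‖
        = ‖c‖ * ((1 + Metric.diam Y.1) ^ α * ‖a Y‖) := by rw [norm_smul]; ring
      _ ≤ ‖c‖ * x := mul_le_mul_of_nonneg_left (hx ⟨Y, rfl⟩) (norm_nonneg c)

/-- The space `𝔇_al` of uniformly almost local derivations. -/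
def UALDer (L : SpinSystem d) : Type := ualDerSubmodule L

instance : AddCommGroup (UALDer L) := inferInstanceAs (AddCommGroup (ualDerSubmodule L))
instance : Module ℝ (UALDer L) := inferInstanceAs (Module ℝ (ualDerSubmodule L))

/-- The underlying function `Y ↦ F^Y`. -/
def UALDer.fn : UALDer L →ₗ[ℝ] (Brick d → L.Op) := (ualDerSubmodule L).subtype

/-- The seminorm `F ↦ (1 + diam Y)^α ‖F^Y‖`. -/
def derTerm (L : SpinSystem d) (α : ℕ) (Y : Brick d) : Seminorm ℝ (Brick d → L.Op) :=
  ((1 + ⟨Metric.diam Y.1, Metric.diam_nonneg⟩) ^ α : ℝ≥0) •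
    (normSeminorm ℝ L.Op).comp (LinearMap.proj Y)

/-- The seminorms `‖F‖_α = sup_Y (1 + diam Y)^α ‖F^Y‖`, `α ∈ ℕ`, on `𝔇_al`. -/
def UALDer.norms (L : SpinSystem d) : SeminormFamily ℝ (UALDer L) ℕ :=
  fun α => ⨆ Y : Brick d, (derTerm L α Y).comp UALDer.fn

theorem UALDer.norms_apply (α : ℕ) (F : UALDer L) :
    UALDer.norms L α F = ⨆ Y : Brick d, (1 + Metric.diam Y.1) ^ α * ‖F.fn Y‖ := by
  have h : ∀ (G : UALDer L) (Y : Brick d),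
      derTerm L α Y G.fn = (1 + Metric.diam Y.1) ^ α * ‖G.fn Y‖ := fun G Y => by
    simp only [derTerm, smul_apply, Seminorm.comp_apply, NNReal.smul_def, smul_eq_mul]
    rfl
  unfold UALDer.norms
  rw [Seminorm.iSup_apply]
  · simp only [Seminorm.comp_apply, h]
  · rw [Seminorm.bddAbove_range_iff]
    intro G
    simp only [Seminorm.comp_apply, h]
    exact G.2.2 α

instance : TopologicalSpace (UALDer L) := (UALDer.norms L).moduleFilterBasis.topology
instance : IsTopologicalAddGroup (UALDer L) :=
  (UALDer.norms L).addGroupFilterBasis.isTopologicalAddGroup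

/-- `F` is uniformly local (belongs to `𝔇_l`) if it is bounded and `F^Y = 0` for all `Y` of
sufficiently large diameter. -/
def UALDer.IsUL (F : UALDer L) : Prop :=
  (∃ C : ℝ, ∀ Y, ‖F.fn Y‖ ≤ C) ∧ ∃ D : ℝ, ∀ Y : Brick d, D < Metric.diam Y.1 → F.fn Y = 0

/-- The terms of the augmented complex `… → C_1(𝔡_al) → C_0(𝔡_al) → 𝔇_al`, indexed by the shifted
degree `n = |·| + 1`: `NoetherCx L 0 = 𝔇_al` has degree `-1` and `NoetherCx L (q + 1) = C_q(𝔡_al)` has degree `q`. -/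
def NoetherCx (L : SpinSystem d) : ℕ → Type
  | 0 => UALDer L
  | q + 1 => UALChain L q

instance : ∀ n, AddCommGroup (NoetherCx L n)
  | 0 => inferInstanceAs (AddCommGroup (UALDer L))
  | q + 1 => inferInstanceAs (AddCommGroup (UALChain L q))
instance : ∀ n, Module ℝ (NoetherCx L n)
  | 0 => inferInstanceAs (Module ℝ (UALDer L))
  | q + 1 => inferInstanceAs (Module ℝ (UALChain L q))
instance : ∀ n, TopologicalSpace (NoetherCx L n)
  | 0 => inferInstanceAs (TopologicalSpace (UALDer L))
  | q + 1 => inferInstanceAs (TopologicalSpace (UALChain L q))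
instance : ∀ n, IsTopologicalAddGroup (NoetherCx L n)
  | 0 => inferInstanceAs (IsTopologicalAddGroup (UALDer L))
  | q + 1 => inferInstanceAs (IsTopologicalAddGroup (UALChain L q))

/-- The uniformly local elements `𝔇_l ⊂ 𝔇_al` and `C_q(𝔡_l) ⊂ C_q(𝔡_al)`. -/
def IsUL : ∀ n, NoetherCx L n → Prop
  | 0 => UALDer.IsUL
  | _ + 1 => UALChain.IsUL

/-- The function `Y ↦ F^Y` of an element of degree `-1`. -/
abbrev der (F : NoetherCx L 0) : Brick d → L.Op := UALDer.fn F

/-- The function `(j_0, …, j_q) ↦ a_{j_0 … j_q}` of an element of degree `q ≥ 0`. -/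
abbrev chain {q : ℕ} (a : NoetherCx L (q + 1)) : (Fin (q + 1) → L.Site) → L.Op := UALChain.fn (q := q) a

/-- A Fréchet space: a complete Hausdorff topological vector space whose topology is given by a
countable family of seminorms. -/
def IsFrechet (E : Type) [AddCommGroup E] [Module ℝ E] [TopologicalSpace E]
    [IsTopologicalAddGroup E] : Prop :=
  T2Space E ∧ @CompleteSpace E (IsTopologicalAddGroup.rightUniformSpace E) ∧
    ∃ p : SeminormFamily ℝ E ℕ, WithSeminorms p

/-! ### The operations on uniformly local chains

All sums below have finitely many nonzero terms when the arguments are uniformly local. -/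

/-- `(∂_q a)_{j_1 … j_q} = ∑_{j_0} a_{j_0 j_1 … j_q}`, for `q ≥ 1`. -/
def bdry {q : ℕ} (a : (Fin (q + 2) → L.Site) → L.Op) : (Fin (q + 1) → L.Site) → L.Op :=
  fun j => ∑ᶠ j₀ : L.Site, a (Fin.cons j₀ j)

/-- `(∂_0 a)^Y = ∑_j a_j^Y`. -/
def bdryZero (a : (Fin 1 → L.Site) → L.Op) : Brick d → L.Op :=
  fun Y => ∑ᶠ j : L.Site, brickComp Y (a fun _ => j)

/-- `h_q(a)_{j_0 … j_{q+1}} = ∑_Y ∑_k (-1)^k (χ_Y(j_k) / |Y ∩ Λ|) a^Y_{j_0 … ĵ_k … j_{q+1}}`, for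
`q ≥ 0`. -/
def htpy {q : ℕ} (a : (Fin (q + 1) → L.Site) → L.Op) : (Fin (q + 2) → L.Site) → L.Op :=
  fun j => ∑ᶠ Y : Brick d, ∑ k : Fin (q + 2),
    ((-1) ^ (k : ℕ) * brickWeight L Y (j k)) • brickComp Y (a (k.removeNth j))

/-- `h_{-1}(F)_j = ∑_Y (χ_Y(j) / |Y ∩ Λ|) F^Y`. -/
def htpyNeg (F : Brick d → L.Op) : (Fin 1 → L.Site) → L.Op :=
  fun j => ∑ᶠ Y : Brick d, brickWeight L Y (j 0) • F Y

/-- `F(A) = ∑_Y [F^Y, A]`. -/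
def derAct (F : Brick d → L.Op) (A : L.Op) : L.Op := ∑ᶠ Y : Brick d, ⁅F Y, A⁆

/-- `{f, g}_{j_0 … j_{p+q+1}}`: the sum of `± [f_{i_0 … i_p}, g_{i_{p+1} … i_{p+q+1}}]` over all
signed permutations `i` of `j`, divided by `(p+1)! (q+1)!`. -/
def chainBracket {p q : ℕ} (f : (Fin (p + 1) → L.Site) → L.Op)
    (g : (Fin (q + 1) → L.Site) → L.Op) : (Fin (p + 1 + (q + 1)) → L.Site) → L.Op :=
  fun j => (1 / ((p + 1).factorial * (q + 1).factorial) : ℝ) •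
    ∑ σ : Equiv.Perm (Fin (p + 1 + (q + 1))), (Equiv.Perm.sign σ : ℤ) •
      ⁅f fun i => j (σ (Fin.castAdd (q + 1) i)), g fun i => j (σ (Fin.natAdd (p + 1) i))⁆

/-- `[f, g}_j = ∑_k [f_k, g_j]`, for `0`-chains `f`, `g`. -/
def derivedBracket (f g : (Fin 1 → L.Site) → L.Op) : (Fin 1 → L.Site) → L.Op :=
  fun j => ∑ᶠ k : L.Site, ⁅f fun _ => k, g j⁆

end UAL

end

open UAL

open scoped NNReal Topology
noncomputable section
namespace UAL
variable {d : ℕ} {L : SpinSystem d}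

/-! ### Matrix units -/

/-! The analytic tool is the conditional expectation. Averaging over matrix units on larger and
larger finite subsets of the complement of a finite `Γ` gives a norm-contracting projection `condExp
Γ` of the quasi-local algebra onto `𝒜_Γ`. These projections satisfy `E_Γ E_Γ' = E_{Γ ∩ Γ'}`, and
`E_∅` is the tracial state times the identity, faithful on local observables. Up to a factor 2, `E_Γ
A` is the best approximation of `A` in `𝒜_Γ`. Hence a traceless observable well approximated in two
disjoint regions has small norm (`norm_le_of_disjoint`), and chain components decay in the distance
between their indices.

Orthogonal projection to `𝔡^Y` is explicit: it is `E_Y ∏ (1 - E_{Y'})`, with `Y'` running over the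
`2d` bricks obtained from `Y` by removing a unit layer at a face. This works because a brick not
containing `Y` is either disjoint from `Y` or meets it inside one such `Y'`. It follows that brick
components have norm at most `4^d ‖A‖`, depend continuously on `A`, vanish on the other brick spaces
(`brickComp_of_ne`) and jointly determine `A` (`eq_zero_of_brickComp`). The same geometry makes them
decay in the size of `Y` and in its distance from where `A` is localized (`brickComp_decay`). Sites
are separated and bricks are given by `2d` integers, so polynomial decay makes all sums over sites
and bricks converge absolutely.

The contracting homotopy comes from a partition of unity. With `W_x(A) = ∑_Y χ_Y(x)/|Y ∩ Λ| A^Y` one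
has `∑_x W_x(A) = A` (`tsum_part`). The homotopy is the antisymmetrization of `W` with `a`, hence
`h(a)(x, j) = W_x(a_j) - h(a(x, ·))_j`; summing over `x` gives `h∂ + ∂h = id`. The identity `∂∂ = 0`
is antisymmetry together with absolute convergence.

A family `f` acts on observables by `A ↦ ∑_x [f_x, A]`, and boundaries of 1-chains act by zero, so a
derivation `F` acts through its density `h_{-1}F`. The bracket of derivations is `{F, G} = ∂_0(F ·
h_{-1}G)`, and any other density of `G` gives the same result. It is skew because `{F, G} + {G, F}`
is `∂∂` of a 1-chain. The derivations acting on `𝔡_al` then form a semidirect product Lie algebra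
`ExtLie`. An element of any degree, including `-1`, is a skew function on some power of `Λ` with
values in this single Lie algebra, and the graded bracket is the antisymmetrized product `wedge`.
Fixing the first variable is an antiderivation of this product (`contr_wedge`). Graded skew-symmetry
and Jacobi therefore follow by induction on the number of variables from the ungraded identities,
and summing over the fixed variable gives the Leibniz rule.

Currents follow from Leibniz and exactness: the given right-hand sides are cycles, and two solutions
differ by a cycle, which is a boundary.

Every operation obeys a bound of its seminorm of order `α` by a seminorm of some higher order `N`,
which gives continuity. Completeness is taken componentwise. Density comes from discarding bricks of
large diameter, and for chains from projecting to the intersection of balls around all the indices.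
On uniformly local arguments the infinite sums are finite, and the operations reduce to the stated
formulas. -/

theorem overwrite_of_mem {Γ : Finset L.Site} (t : L.LocConfig Γ) (σ : L.Config) {j : L.Site}
    (h : j ∈ Γ) : overwrite Γ t σ j = t ⟨j, h⟩ := by simp [overwrite, h]

theorem overwrite_of_notMem {Γ : Finset L.Site} (t : L.LocConfig Γ) (σ : L.Config) {j : L.Site}
    (h : j ∉ Γ) : overwrite Γ t σ j = σ j := by simp [overwrite, h]

@[simp] theorem overwrite_coe (Γ : Finset L.Site) (t : L.LocConfig Γ) (σ : L.Config) (j : Γ) :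
    overwrite Γ t σ j = t j := overwrite_of_mem t σ j.2

@[simp] theorem overwrite_overwrite (Γ : Finset L.Site) (s t : L.LocConfig Γ) (σ : L.Config) :
    overwrite Γ s (overwrite Γ t σ) = overwrite Γ s σ := by
  funext j
  by_cases h : j ∈ Γ
  · simp [overwrite_of_mem, h]
  · simp [overwrite_of_notMem, h]

theorem overwrite_eq_self {Γ : Finset L.Site} {s : L.LocConfig Γ} {σ : L.Config}
    (h : ∀ j : Γ, σ j = s j) : overwrite Γ s σ = σ := by
  funext j
  by_cases hj : j ∈ Γ
  · rw [overwrite_of_mem _ _ hj]; exact (h ⟨j, hj⟩).symm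
  · rw [overwrite_of_notMem _ _ hj]

open Classical in
theorem matUnit_app (Γ : Finset L.Site) (s t : L.LocConfig Γ) (ψ : L.Hilb) (σ : L.Config) :
    matUnit Γ s t ψ σ = if (∀ j : Γ, σ j = s j) then ψ (overwrite Γ t σ) else 0 := rfl

theorem Op.ext_apply {S T : L.Op} (h : ∀ ψ σ, S ψ σ = T ψ σ) : S = T := by
  refine ContinuousLinearMap.ext fun ψ => ?_
  apply lp.ext
  funext σ
  exact h ψ σ

theorem matUnit_mul_same (Γ : Finset L.Site) (s t v : L.LocConfig Γ) :
    matUnit Γ s t * matUnit Γ t v = matUnit Γ s v := by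
  classical
  refine Op.ext_apply fun ψ σ => ?_
  rw [mul_apply_eq_comp]
  simp [matUnit_app]

theorem matUnit_mul_of_ne (Γ : Finset L.Site) (s v : L.LocConfig Γ) {t u : L.LocConfig Γ}
    (h : t ≠ u) : matUnit Γ s t * matUnit Γ u v = 0 := by
  classical
  refine Op.ext_apply fun ψ σ => ?_
  rw [mul_apply_eq_comp]
  have h' : ¬ ∀ j : Γ, t j = u j := fun H => h (funext H)
  simp only [matUnit_app, overwrite_coe, if_neg h', ite_self]
  rfl

theorem matUnit_mul (Γ : Finset L.Site) (s t u v : L.LocConfig Γ) :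
    matUnit Γ s t * matUnit Γ u v = if t = u then matUnit Γ s v else 0 := by
  split_ifs with h
  · rw [h, matUnit_mul_same]
  · exact matUnit_mul_of_ne Γ s v h

theorem lp_sum_apply {ι : Type*} (S : Finset ι) (f : ι → L.Hilb) (σ : L.Config) :
    (∑ i ∈ S, f i : L.Hilb) σ = ∑ i ∈ S, f i σ := by
  rw [lp.coeFn_sum, Finset.sum_apply]

theorem sum_matUnit_self (Γ : Finset L.Site) :
    ∑ s : L.LocConfig Γ, matUnit Γ s s = (1 : L.Op) := by
  classical
  refine Op.ext_apply fun ψ σ => ?_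
  rw [sum_apply, lp_sum_apply]
  simp only [matUnit_app, one_apply_eq_self]
  rw [Finset.sum_eq_single (fun j : Γ => σ j)]
  · rw [if_pos fun _ => rfl, overwrite_eq_self fun _ => rfl]
  · intro s _ hs
    rw [if_neg fun H => hs (funext fun j => (H j).symm)]
  · simp

open Classical in
-- Adjoints are computed from inner products with basis vectors, so the action on basis vectors is
-- what `star_matUnit` needs.
theorem matUnit_single (Γ : Finset L.Site) (s t : L.LocConfig Γ) (σ : L.Config) :
    matUnit Γ s t (lp.single 2 σ (1 : ℂ)) =
      if (∀ j : Γ, σ j = t j) then lp.single 2 (overwrite Γ s σ) (1 : ℂ) else 0 := by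
  apply lp.ext
  funext τ
  rw [matUnit_app]
  by_cases h1 : ∀ j : Γ, σ j = t j
  · rw [if_pos h1]
    by_cases h2 : ∀ j : Γ, τ j = s j
    · rw [if_pos h2]
      simp only [lp.single_apply, Pi.single_apply]
      congr 1
      refine propext ⟨fun H => ?_, fun H => ?_⟩
      · rw [← H, overwrite_overwrite, overwrite_eq_self h2]
      · rw [H, overwrite_overwrite, overwrite_eq_self h1]
    · rw [if_neg h2]
      simp only [lp.single_apply, Pi.single_apply]
      rw [if_neg]
      rintro rfl
      exact h2 fun j => by simp
  · rw [if_neg h1]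
    split_ifs with h2
    · simp only [lp.single_apply, Pi.single_apply]
      rw [if_neg]
      · rfl
      rintro rfl
      exact h1 fun j => by simp
    · rfl

theorem star_matUnit (Γ : Finset L.Site) (s t : L.LocConfig Γ) :
    star (matUnit Γ s t) = matUnit Γ t s := by
  classical
  refine Op.ext_apply fun ψ σ => ?_
  have h := lp.inner_single_left (𝕜 := ℂ) σ (1 : ℂ) (star (matUnit Γ s t) ψ)
  rw [ContinuousLinearMap.star_eq_adjoint, ContinuousLinearMap.adjoint_inner_right,
    matUnit_single] at h
  rw [ContinuousLinearMap.star_eq_adjoint, matUnit_app]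
  have h1 : ∀ z : ℂ, inner ℂ (1 : ℂ) z = z := fun z => by simp
  rw [h1] at h
  rw [← h]
  split_ifs with h2
  · rw [lp.inner_single_left, h1]
  · rw [inner_zero_left]

/-! ### The local algebras -/

theorem matUnit_mem (Γ : Finset L.Site) (s t : L.LocConfig Γ) : matUnit Γ s t ∈ algFin Γ :=
  Submodule.subset_span ⟨s, t, rfl⟩

theorem algFin_induction {Γ : Finset L.Site} {p : L.Op → Prop} (h : ∀ s t, p (matUnit Γ s t))
    (h0 : p 0) (hadd : ∀ A B, p A → p B → p (A + B)) (hsmul : ∀ (c : ℂ) A, p A → p (c • A))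
    {A : L.Op} (hA : A ∈ algFin Γ) : p A := by
  refine Submodule.span_induction (p := fun A _ => p A) ?_ h0 (fun A B _ _ => hadd A B)
    (fun c A _ => hsmul c A) hA
  rintro _ ⟨s, t, rfl⟩
  exact h s t

theorem mul_mem_algFin {Γ : Finset L.Site} {A B : L.Op} (hA : A ∈ algFin Γ) (hB : B ∈ algFin Γ) :
    A * B ∈ algFin Γ := by
  refine algFin_induction (p := fun A => A * B ∈ algFin Γ) (fun s t => ?_) (by simp)
    (fun A A' h h' => by rw [add_mul]; exact add_mem h h')
    (fun c A h => by rw [smul_mul_assoc]; exact Submodule.smul_mem _ c h) hA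
  refine algFin_induction (p := fun B => matUnit Γ s t * B ∈ algFin Γ) (fun u v => ?_) (by simp)
    (fun A A' h h' => by rw [mul_add]; exact add_mem h h')
    (fun c A h => by rw [mul_smul_comm]; exact Submodule.smul_mem _ c h) hB
  rw [matUnit_mul]
  split_ifs
  · exact matUnit_mem Γ _ _
  · exact zero_mem _

theorem star_mem_algFin {Γ : Finset L.Site} {A : L.Op} (hA : A ∈ algFin Γ) :
    star A ∈ algFin Γ := by
  refine algFin_induction (p := fun A => star A ∈ algFin Γ) (fun s t => ?_) (by simp)
    (fun A A' h h' => by rw [star_add]; exact add_mem h h')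
    (fun c A h => by rw [star_smul]; exact Submodule.smul_mem _ _ h) hA
  rw [star_matUnit]
  exact matUnit_mem Γ t s

/-- Restriction of a configuration of `Γ` to a subset. -/
def LocConfig.res {Γ' Γ : Finset L.Site} (h : Γ' ⊆ Γ) (s : L.LocConfig Γ) : L.LocConfig Γ' :=
  fun j => s ⟨j, h j.2⟩

open Classical in
-- The tensor factorization over a disjoint union. No order of the two factors is preferred, which
-- is where commutation of disjoint local algebras comes from.
theorem matUnit_eq_mul {Γ₁ Γ₂ Γ : Finset L.Site} (h₁ : Γ₁ ⊆ Γ) (h₂ : Γ₂ ⊆ Γ)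
    (hd : Disjoint Γ₁ Γ₂) (hu : ∀ j ∈ Γ, j ∈ Γ₁ ∨ j ∈ Γ₂) (s t : L.LocConfig Γ) :
    matUnit Γ s t = matUnit Γ₁ (LocConfig.res h₁ s) (LocConfig.res h₁ t) *
      matUnit Γ₂ (LocConfig.res h₂ s) (LocConfig.res h₂ t) := by
  refine Op.ext_apply fun ψ σ => ?_
  rw [mul_apply_eq_comp]
  simp only [matUnit_app]
  rw [← ite_and]
  have key : overwrite Γ t σ = overwrite Γ₂ (LocConfig.res h₂ t)
      (overwrite Γ₁ (LocConfig.res h₁ t) σ) := by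
    funext j
    by_cases hj₂ : j ∈ Γ₂
    · rw [overwrite_of_mem _ _ hj₂, overwrite_of_mem _ _ (h₂ hj₂)]; rfl
    · rw [overwrite_of_notMem _ _ hj₂]
      by_cases hj₁ : j ∈ Γ₁
      · rw [overwrite_of_mem _ _ hj₁, overwrite_of_mem _ _ (h₁ hj₁)]; rfl
      · rw [overwrite_of_notMem _ _ hj₁, overwrite_of_notMem]
        intro hj
        rcases hu j hj with h | h
        exacts [hj₁ h, hj₂ h]
  rw [key]
  congr 1
  have e2 : ∀ j : Γ₂, overwrite Γ₁ (LocConfig.res h₁ t) σ j = σ j := fun j =>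
    overwrite_of_notMem _ _ (Finset.disjoint_right.1 hd j.2)
  simp only [e2]
  refine propext ⟨fun H => ⟨fun j => H ⟨j, h₁ j.2⟩, fun j => H ⟨j, h₂ j.2⟩⟩, fun H j => ?_⟩
  rcases hu j j.2 with h | h
  · exact H.1 ⟨j, h⟩
  · exact H.2 ⟨j, h⟩

open Classical in
-- Glue the two pairs of configurations over the union; both orders of the product are then the same
-- matrix unit of `Γ₁ ∪ Γ₂`.
theorem matUnit_commute {Γ₁ Γ₂ : Finset L.Site} (hd : Disjoint Γ₁ Γ₂) (s t : L.LocConfig Γ₁)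
    (u v : L.LocConfig Γ₂) : Commute (matUnit Γ₁ s t) (matUnit Γ₂ u v) := by
  have key : ∀ (p : L.LocConfig Γ₁) (q : L.LocConfig Γ₂), ∃ w : L.LocConfig (Γ₁ ∪ Γ₂),
      LocConfig.res Finset.subset_union_left w = p ∧
      LocConfig.res Finset.subset_union_right w = q := by
    intro p q
    refine ⟨fun j => if h : (j : L.Site) ∈ Γ₁ then p ⟨j, h⟩ else
      q ⟨j, (Finset.mem_union.1 j.2).resolve_left h⟩, ?_, ?_⟩
    · funext j
      simp [LocConfig.res]
    · funext j
      simp [LocConfig.res, Finset.disjoint_right.1 hd j.2]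
  obtain ⟨w, rfl, rfl⟩ := key s u
  obtain ⟨x, rfl, rfl⟩ := key t v
  rw [Commute, SemiconjBy, ← matUnit_eq_mul Finset.subset_union_left Finset.subset_union_right hd
    (fun j hj => Finset.mem_union.1 hj), ← matUnit_eq_mul Finset.subset_union_right
      Finset.subset_union_left hd.symm (fun j hj => (Finset.mem_union.1 hj).symm)]

theorem algFin_commute {Γ₁ Γ₂ : Finset L.Site} (hd : Disjoint Γ₁ Γ₂) {A B : L.Op}
    (hA : A ∈ algFin Γ₁) (hB : B ∈ algFin Γ₂) : Commute A B := by
  refine algFin_induction (p := fun A => Commute A B) (fun s t => ?_) (Commute.zero_left _)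
    (fun A A' h h' => h.add_left h') (fun c A h => h.smul_left c) hA
  exact algFin_induction (p := fun B => Commute (matUnit Γ₁ s t) B)
    (fun u v => matUnit_commute hd s t u v) (Commute.zero_right _)
    (fun A A' h h' => h.add_right h') (fun c A h => h.smul_right c) hB

theorem algFin_mono {Γ₁ Γ : Finset L.Site} (h : Γ₁ ⊆ Γ) : algFin Γ₁ ≤ algFin Γ := by
  classical
  intro A hA
  refine algFin_induction (p := fun A => A ∈ algFin Γ) (fun s t => ?_) (zero_mem _)
    (fun _ _ => add_mem) (fun c _ => Submodule.smul_mem _ c) hA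
  -- Tensoring with the identity of `Γ \ Γ₁`, resolved into diagonal matrix units, expresses the
  -- operator through matrix units of `Γ`.
  rw [← mul_one (matUnit Γ₁ s t), ← sum_matUnit_self (Γ \ Γ₁), Finset.mul_sum]
  refine Submodule.sum_mem _ fun r _ => ?_
  have key : ∀ (p : L.LocConfig Γ₁), ∃ w : L.LocConfig Γ,
      LocConfig.res h w = p ∧ LocConfig.res Finset.sdiff_subset w = r := by
    intro p
    refine ⟨fun j => if h : (j : L.Site) ∈ Γ₁ then p ⟨j, h⟩ else
      r ⟨j, Finset.mem_sdiff.2 ⟨j.2, h⟩⟩, ?_, ?_⟩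
    · funext j
      simp [LocConfig.res]
    · funext j
      simp [LocConfig.res, (Finset.mem_sdiff.1 j.2).2]
  obtain ⟨w, rfl, hw⟩ := key s
  obtain ⟨x, rfl, hx⟩ := key t
  conv => enter [2, 2]; rw [← hw]
  have : matUnit (Γ \ Γ₁) (LocConfig.res Finset.sdiff_subset w) r =
    matUnit (Γ \ Γ₁) (LocConfig.res Finset.sdiff_subset w)
      (LocConfig.res Finset.sdiff_subset x) := by rw [hx]
  rw [hw] at this ⊢
  rw [this, ← hw, ← matUnit_eq_mul h Finset.sdiff_subset Finset.disjoint_sdiff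
    (fun j hj => by simp [hj]; tauto)]
  exact matUnit_mem Γ w x

theorem isClosed_algFin (Γ : Finset L.Site) : IsClosed (algFin Γ : Set L.Op) := by
  have : Set.Finite {T : L.Op | ∃ s t, T = matUnit Γ s t} := by
    refine (Set.finite_range (fun p : L.LocConfig Γ × L.LocConfig Γ =>
      matUnit Γ p.1 p.2)).subset ?_
    rintro _ ⟨s, t, rfl⟩
    exact ⟨(s, t), rfl⟩
  have : FiniteDimensional ℂ (algFin Γ) := FiniteDimensional.span_of_finite ℂ this
  exact Submodule.closed_of_finiteDimensional _

end UAL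
end

open scoped NNReal Topology
noncomputable section
namespace UAL
variable {d : ℕ} {L : SpinSystem d}

/-! ### The averages `Π_Γ` -/

theorem card_locConfig (Γ : Finset L.Site) :
    (Fintype.card (L.LocConfig Γ) : ℂ) = ∏ j ∈ Γ, (L.dim j : ℂ) := by
  classical
  rw [Fintype.card_pi]
  simp only [Fintype.card_fin]
  push_cast
  exact Finset.prod_coe_sort Γ fun j => (L.dim j : ℂ)

theorem prod_dim_ne_zero (Γ : Finset L.Site) : ∏ j ∈ Γ, (L.dim j : ℂ) ≠ 0 :=
  Finset.prod_ne_zero_iff.2 fun j _ => by exact_mod_cast (L.dim_pos j).ne'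

theorem siteAvg_csmul (Γ : Finset L.Site) (c : ℂ) (T : L.Op) :
    siteAvg Γ (c • T) = c • siteAvg Γ T := by
  simp only [siteAvg, mul_smul_comm, smul_mul_assoc, ← Finset.smul_sum]
  rw [smul_comm]

theorem siteAvg_sub (Γ : Finset L.Site) (S T : L.Op) :
    siteAvg Γ (S - T) = siteAvg Γ S - siteAvg Γ T := by
  simp only [siteAvg, mul_sub, sub_mul, Finset.sum_sub_distrib, smul_sub]

theorem siteAvg_zero (Γ : Finset L.Site) : siteAvg Γ (0 : L.Op) = 0 := by simp [siteAvg]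

theorem siteAvg_sum {ι : Type*} (Γ : Finset L.Site) (S : Finset ι) (f : ι → L.Op) :
    siteAvg Γ (∑ i ∈ S, f i) = ∑ i ∈ S, siteAvg Γ (f i) := by
  classical
  induction S using Finset.induction_on with
  | empty => simp [siteAvg_zero]
  | insert a S h ih => rw [Finset.sum_insert h, Finset.sum_insert h, siteAvg_add, ih]

theorem siteAvg_star (Γ : Finset L.Site) (T : L.Op) : siteAvg Γ (star T) = star (siteAvg Γ T) := by
  simp only [siteAvg, star_smul, star_sum, star_mul, star_matUnit, ← mul_assoc]
  congr 1
  simp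

theorem siteAvg_of_commute {Γ : Finset L.Site} {T : L.Op} (h : ∀ A ∈ algFin Γ, Commute A T) :
    siteAvg Γ T = T := by
  have : ∀ s t : L.LocConfig Γ, matUnit Γ s t * T * matUnit Γ t s = matUnit Γ s s * T := by
    intro s t
    rw [mul_assoc, ← (h _ (matUnit_mem Γ t s)).eq, ← mul_assoc, matUnit_mul_same]
  simp only [siteAvg, this, Finset.sum_const, ← Finset.smul_sum, ← Finset.sum_mul,
    sum_matUnit_self, one_mul, Finset.card_univ]
  rw [← Nat.cast_smul_eq_nsmul ℂ, card_locConfig, smul_smul, inv_mul_cancel₀ (prod_dim_ne_zero Γ),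
    one_smul]

theorem siteAvg_mul_left {Γ : Finset L.Site} {C : L.Op} (h : ∀ A ∈ algFin Γ, Commute A C)
    (T : L.Op) : siteAvg Γ (C * T) = C * siteAvg Γ T := by
  simp only [siteAvg, mul_smul_comm, Finset.mul_sum]
  refine congrArg (fun X => (∏ j ∈ Γ, (L.dim j : ℂ))⁻¹ • X) ?_
  refine Finset.sum_congr rfl fun s _ => Finset.sum_congr rfl fun t _ => ?_
  rw [← mul_assoc, (h _ (matUnit_mem Γ s t)).eq]
  simp only [mul_assoc]

theorem siteAvg_mul_right {Γ : Finset L.Site} {C : L.Op} (h : ∀ A ∈ algFin Γ, Commute A C)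
    (T : L.Op) : siteAvg Γ (T * C) = siteAvg Γ T * C := by
  simp only [siteAvg, smul_mul_assoc, Finset.sum_mul]
  refine congrArg (fun X => (∏ j ∈ Γ, (L.dim j : ℂ))⁻¹ • X) ?_
  refine Finset.sum_congr rfl fun s _ => Finset.sum_congr rfl fun t _ => ?_
  rw [mul_assoc, mul_assoc, ← (h _ (matUnit_mem Γ t s)).eq]
  simp only [mul_assoc]

/-- Cyclicity of the trace: orthogonality of matrix units leaves a single `t` in either double sum,
and both become `∑_s |s⟩⟨v| T |u⟩⟨s|`. -/
theorem siteAvg_matUnit_mul_comm (Γ : Finset L.Site) (u v : L.LocConfig Γ) (T : L.Op) :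
    siteAvg Γ (matUnit Γ u v * T) = siteAvg Γ (T * matUnit Γ u v) := by
  classical
  have h1 : ∀ s t, matUnit Γ s t * (matUnit Γ u v * T) * matUnit Γ t s =
      if t = u then matUnit Γ s v * T * matUnit Γ u s else 0 := by
    intro s t
    rw [← mul_assoc (matUnit Γ s t), matUnit_mul]
    split_ifs with h
    · rw [h]
    · rw [zero_mul, zero_mul]
  have h2 : ∀ s t, matUnit Γ s t * (T * matUnit Γ u v) * matUnit Γ t s =
      if v = t then matUnit Γ s v * T * matUnit Γ u s else 0 := by
    intro s t
    rw [mul_assoc, mul_assoc T, matUnit_mul]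
    split_ifs with h
    · rw [h, mul_assoc]
    · rw [mul_zero, mul_zero]
  rw [siteAvg, siteAvg]
  refine congrArg (fun X => (∏ j ∈ Γ, (L.dim j : ℂ))⁻¹ • X) ?_
  refine Finset.sum_congr rfl fun s _ => ?_
  rw [Finset.sum_congr rfl fun t _ => h1 s t, Finset.sum_congr rfl fun t _ => h2 s t]
  rw [Finset.sum_ite_eq' Finset.univ u, Finset.sum_ite_eq Finset.univ v]
  simp only [Finset.mem_univ, if_true]

theorem siteAvg_mul_comm {Γ : Finset L.Site} {A : L.Op} (hA : A ∈ algFin Γ) (T : L.Op) :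
    siteAvg Γ (A * T) = siteAvg Γ (T * A) := by
  refine algFin_induction (p := fun A => siteAvg Γ (A * T) = siteAvg Γ (T * A)) ?_ ?_ ?_ ?_ hA
  · exact fun u v => siteAvg_matUnit_mul_comm Γ u v T
  · rw [zero_mul, mul_zero]
  · intro A A' h h'
    rw [add_mul, mul_add, siteAvg_add, siteAvg_add, h, h']
  · intro c A h
    rw [smul_mul_assoc, mul_smul_comm, siteAvg_csmul, siteAvg_csmul, h]

/-- Under the larger average a matrix unit of `Γ₁` can be moved cyclically, and the diagonal matrix
units that result sum to the identity. -/
theorem siteAvg_siteAvg {Γ₁ Γ : Finset L.Site} (h : Γ₁ ⊆ Γ) (T : L.Op) :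
    siteAvg Γ (siteAvg Γ₁ T) = siteAvg Γ T := by
  have : ∀ s t : L.LocConfig Γ₁, siteAvg Γ (matUnit Γ₁ s t * T * matUnit Γ₁ t s) =
      siteAvg Γ (T * matUnit Γ₁ t t) := by
    intro s t
    rw [mul_assoc, siteAvg_mul_comm (algFin_mono h (matUnit_mem Γ₁ s t)), mul_assoc,
      matUnit_mul_same]
  conv_lhs => enter [2]; rw [siteAvg]
  rw [siteAvg_csmul]
  simp only [siteAvg_sum, this]
  simp only [← siteAvg_sum, ← Finset.mul_sum, sum_matUnit_self, mul_one, Finset.sum_const,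
    Finset.card_univ]
  rw [← Nat.cast_smul_eq_nsmul ℂ, card_locConfig, smul_smul, inv_mul_cancel₀ (prod_dim_ne_zero Γ₁),
    one_smul]

open Classical in
theorem siteAvg_matUnit (Γ : Finset L.Site) (s t : L.LocConfig Γ) :
    siteAvg Γ (matUnit Γ s t) = if s = t then (∏ j ∈ Γ, (L.dim j : ℂ))⁻¹ • 1 else 0 := by
  simp only [siteAvg, matUnit_mul, ite_mul, zero_mul]
  split_ifs with h
  · subst h
    simp [sum_matUnit_self]
  · rw [Finset.sum_eq_zero, smul_zero]
    intro u _
    refine Finset.sum_eq_zero fun v _ => ?_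
    split_ifs with h1 h2
    · exact (h (h1.symm.trans h2.symm)).elim
    · rfl
    · rfl

open Classical in
theorem siteAvg_mem {Γ₀ : Finset L.Site} (Δ : Finset L.Site) {A : L.Op} (hA : A ∈ algFin Γ₀) :
    siteAvg Δ A ∈ algFin (Γ₀ \ Δ) := by
  have key : ∀ (Γ : Finset L.Site), Δ ⊆ Γ → ∀ A ∈ algFin Γ, siteAvg Δ A ∈ algFin (Γ \ Δ) := by
    intro Γ hΔ A hA
    refine algFin_induction (p := fun A => siteAvg Δ A ∈ algFin (Γ \ Δ)) (fun s t => ?_)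
      (by rw [siteAvg_zero]; exact zero_mem _)
      (fun A A' h h' => by rw [siteAvg_add]; exact add_mem h h')
      (fun c A h => by rw [siteAvg_csmul]; exact Submodule.smul_mem _ c h) hA
    rw [matUnit_eq_mul hΔ Finset.sdiff_subset Finset.disjoint_sdiff
      (fun j hj => by simp [hj]; tauto), siteAvg_mul_right fun A hA =>
        algFin_commute Finset.disjoint_sdiff hA (matUnit_mem _ _ _), siteAvg_matUnit]
    split_ifs
    · rw [smul_one_mul]
      exact Submodule.smul_mem _ _ (matUnit_mem _ _ _)
    · rw [zero_mul]; exact zero_mem _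
  -- `A` need not be supported on a set containing `Δ`; the factorization is applied over `Γ₀ ∪ Δ`,
  -- which changes nothing once `Δ` is removed.
  have := key (Γ₀ ∪ Δ) Finset.subset_union_right A (algFin_mono Finset.subset_union_left hA)
  rwa [Finset.union_sdiff_right] at this

theorem siteAvg_eq_of_mem {Γ₀ Δ : Finset L.Site} (h : Disjoint Γ₀ Δ) {A : L.Op}
    (hA : A ∈ algFin Γ₀) : siteAvg Δ A = A :=
  siteAvg_of_commute fun _ hB => (algFin_commute h hA hB).symm

/-- The vectors `|t⟩⟨s|ψ`, over all pairs, form an isometric copy of `ψ` up to the dimension of the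
local Hilbert space. This is the input of the contraction estimate that follows. -/
theorem sum_norm_matUnit_sq (Γ : Finset L.Site) (ψ : L.Hilb) :
    ∑ s : L.LocConfig Γ, ∑ t : L.LocConfig Γ, ‖matUnit Γ t s ψ‖ ^ 2 =
      Fintype.card (L.LocConfig Γ) * ‖ψ‖ ^ 2 := by
  have h : ∀ s t : L.LocConfig Γ, ((‖matUnit Γ t s ψ‖ ^ 2 : ℝ) : ℂ) =
      inner ℂ ψ (matUnit Γ s s ψ) := by
    intro s t
    push_cast
    rw [← Complex.coe_algebraMap, ← inner_self_eq_norm_sq_to_K (𝕜 := ℂ),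
      ← ContinuousLinearMap.adjoint_inner_right, ← ContinuousLinearMap.star_eq_adjoint,
      star_matUnit, ← mul_apply_eq_comp, matUnit_mul_same]
  have h2 : ((∑ s : L.LocConfig Γ, ∑ t : L.LocConfig Γ, ‖matUnit Γ t s ψ‖ ^ 2 : ℝ) : ℂ) =
      ((Fintype.card (L.LocConfig Γ) * ‖ψ‖ ^ 2 : ℝ) : ℂ) := by
    push_cast
    simp only [← Complex.ofReal_pow, h, Finset.sum_const, Finset.card_univ, ← Finset.smul_sum]
    rw [← inner_sum, ← sum_apply, sum_matUnit_self, one_apply_eq_self,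
      inner_self_eq_norm_sq_to_K (𝕜 := ℂ)]
    simp
  exact_mod_cast h2

/-- Up to the dimension `D`, `⟨v, Π_Γ(T)ψ⟩` is a sum of the terms `⟨e v, T e ψ⟩` over matrix units
`e`. Cauchy–Schwarz over the matrix units and `sum_norm_matUnit_sq` bound it by `‖T‖ ‖v‖ ‖ψ‖`; the
choice `v = Π_Γ(T)ψ` concludes. No average over unitaries is needed. -/
theorem norm_siteAvg_le (Γ : Finset L.Site) (T : L.Op) : ‖siteAvg Γ T‖ ≤ ‖T‖ := by
  refine ContinuousLinearMap.opNorm_le_bound _ (norm_nonneg _) fun ψ => ?_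
  set v := siteAvg Γ T ψ with hv
  set D : ℝ := ((Fintype.card (L.LocConfig Γ) : ℕ) : ℝ) with hD
  have hDc : (∏ j ∈ Γ, (L.dim j : ℂ)) = (D : ℂ) := by rw [← card_locConfig, hD]; simp
  have hDpos : 0 < D := by
    have h0 : (D : ℂ) ≠ 0 := by rw [← hDc]; exact prod_dim_ne_zero Γ
    have h1 : D ≠ 0 := by exact_mod_cast h0
    exact lt_of_le_of_ne (Nat.cast_nonneg _) h1.symm
  have h1 : (D : ℂ) * inner ℂ v v =
      ∑ s : L.LocConfig Γ, ∑ t : L.LocConfig Γ,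
        inner ℂ (matUnit Γ t s v) (T (matUnit Γ t s ψ)) := by
    have : inner ℂ v v = (D : ℂ)⁻¹ * ∑ s : L.LocConfig Γ, ∑ t : L.LocConfig Γ,
        inner ℂ (matUnit Γ t s v) (T (matUnit Γ t s ψ)) := by
      conv_lhs => enter [3]; rw [hv, siteAvg, hDc]
      rw [smul_apply, inner_smul_right, sum_apply, inner_sum]
      congr 1
      refine Finset.sum_congr rfl fun s _ => ?_
      rw [sum_apply, inner_sum]
      refine Finset.sum_congr rfl fun t _ => ?_
      rw [mul_apply_eq_comp, mul_apply_eq_comp, ← ContinuousLinearMap.adjoint_inner_left,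
        ← ContinuousLinearMap.star_eq_adjoint, star_matUnit]
    rw [this, ← mul_assoc, mul_inv_cancel₀ (by exact_mod_cast hDpos.ne'), one_mul]
  have h2 : D * ‖v‖ ^ 2 ≤ ‖T‖ * (D * (‖v‖ * ‖ψ‖)) := by
    calc D * ‖v‖ ^ 2 = ‖(D : ℂ) * inner ℂ v v‖ := by
          rw [norm_mul, inner_self_eq_norm_sq_to_K (𝕜 := ℂ)]
          simp [abs_of_pos hDpos]
      _ ≤ ∑ s : L.LocConfig Γ, ∑ t : L.LocConfig Γ,
          ‖T‖ * (‖matUnit Γ t s v‖ * ‖matUnit Γ t s ψ‖) := by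
          rw [h1]
          refine (norm_sum_le _ _).trans (Finset.sum_le_sum fun s _ => ?_)
          refine (norm_sum_le _ _).trans (Finset.sum_le_sum fun t _ => ?_)
          refine (norm_inner_le_norm _ _).trans ?_
          calc _ ≤ ‖matUnit Γ t s v‖ * (‖T‖ * ‖matUnit Γ t s ψ‖) := by
                gcongr; exact T.le_opNorm _
            _ = _ := by ring
      _ ≤ ‖T‖ * (Real.sqrt (D * ‖v‖ ^ 2) * Real.sqrt (D * ‖ψ‖ ^ 2)) := by
          simp only [← Finset.mul_sum]
          gcongr
          rw [hD, ← sum_norm_matUnit_sq Γ v, ← sum_norm_matUnit_sq Γ ψ]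
          simp only [← Finset.sum_product']
          exact Real.sum_mul_le_sqrt_mul_sqrt _ _ _
      _ = ‖T‖ * (D * (‖v‖ * ‖ψ‖)) := by
          rw [Real.sqrt_mul hDpos.le, Real.sqrt_mul hDpos.le, Real.sqrt_sq (norm_nonneg _),
            Real.sqrt_sq (norm_nonneg _)]
          have := Real.mul_self_sqrt hDpos.le
          calc _ = ‖T‖ * ((Real.sqrt D * Real.sqrt D) * (‖v‖ * ‖ψ‖)) := by ring
            _ = _ := by rw [this]
  rcases (norm_nonneg v).eq_or_lt with h0 | h0
  · rw [← h0]; positivity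
  · have : (D * ‖v‖) * ‖v‖ ≤ (D * ‖v‖) * (‖T‖ * ‖ψ‖) := by nlinarith
    exact le_of_mul_le_mul_left this (by positivity)

/-- The average is a positive multiple of a sum of positive operators `(C e)⋆ (C e)`, so each `C e`
vanishes; the diagonal `e` add up to the identity. -/
theorem eq_zero_of_siteAvg_star_mul_self {Γ : Finset L.Site} {C : L.Op}
    (h : siteAvg Γ (star C * C) = 0) : C = 0 := by
  have hs : ∑ s : L.LocConfig Γ, ∑ t : L.LocConfig Γ,
      star (C * matUnit Γ t s) * (C * matUnit Γ t s) = 0 := by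
    have := (smul_eq_zero.1 h).resolve_left (inv_ne_zero (prod_dim_ne_zero Γ))
    rw [← this]
    refine Finset.sum_congr rfl fun s _ => Finset.sum_congr rfl fun t _ => ?_
    rw [star_mul, star_matUnit]
    simp only [mul_assoc]
  have h1 : ∀ t, C * matUnit Γ t t = 0 := by
    intro t
    have h0 : ∀ s, ∑ t : L.LocConfig Γ, star (C * matUnit Γ t s) * (C * matUnit Γ t s) = 0 :=
      fun s => (Finset.sum_eq_zero_iff_of_nonneg fun s _ =>
        Finset.sum_nonneg fun t _ => star_mul_self_nonneg _).1 hs s (Finset.mem_univ s)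
    have := (Finset.sum_eq_zero_iff_of_nonneg fun t _ => star_mul_self_nonneg _).1 (h0 t) t
      (Finset.mem_univ t)
    exact CStarRing.star_mul_self_eq_zero_iff _ |>.1 this
  rw [← mul_one C, ← sum_matUnit_self Γ, Finset.mul_sum]
  exact Finset.sum_eq_zero fun t _ => h1 t

end UAL
end

open scoped NNReal Topology
noncomputable section
namespace UAL
variable {d : ℕ} {L : SpinSystem d}

/-! ### Quasi-local observables and conditional expectations -/

/-- The algebras `𝒜_Γ` form a directed family, so the supremum defining `alg` is a union. -/
theorem mem_alg {X : Set (EuclideanSpace ℝ (Fin d))} {A : L.Op} :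
    A ∈ alg L X ↔ ∃ Γ : Finset L.Site, (∀ j ∈ Γ, (j : EuclideanSpace ℝ (Fin d)) ∈ X) ∧
      A ∈ algFin Γ := by
  classical
  let S : Submodule ℂ L.Op :=
    { carrier := {A | ∃ Γ : Finset L.Site, (∀ j ∈ Γ, (j : EuclideanSpace ℝ (Fin d)) ∈ X) ∧
        A ∈ algFin Γ}
      zero_mem' := ⟨∅, by simp, zero_mem _⟩
      add_mem' := by
        rintro A B ⟨Γ, h, hA⟩ ⟨Γ', h', hB⟩
        refine ⟨Γ ∪ Γ', fun j hj => ?_, add_mem (algFin_mono Finset.subset_union_left hA)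
          (algFin_mono Finset.subset_union_right hB)⟩
        rcases Finset.mem_union.1 hj with hj | hj
        exacts [h j hj, h' j hj]
      smul_mem' := by
        rintro c A ⟨Γ, h, hA⟩
        exact ⟨Γ, h, Submodule.smul_mem _ c hA⟩ }
  constructor
  · intro hA
    have : alg L X ≤ S := iSup₂_le fun Γ hΓ A hA => ⟨Γ, hΓ, hA⟩
    exact this hA
  · rintro ⟨Γ, h, hA⟩
    exact (le_iSup₂ (f := fun (Γ : Finset L.Site)
      (_ : ∀ j ∈ Γ, (j : EuclideanSpace ℝ (Fin d)) ∈ X) => algFin Γ) Γ h) hA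

theorem alg_mono {X Y : Set (EuclideanSpace ℝ (Fin d))} (h : X ⊆ Y) : alg L X ≤ alg L Y := by
  intro A hA
  obtain ⟨Γ, hΓ, hA⟩ := mem_alg.1 hA
  exact mem_alg.2 ⟨Γ, fun j hj => h (hΓ j hj), hA⟩

theorem mul_mem_alg {X : Set (EuclideanSpace ℝ (Fin d))} {A B : L.Op} (hA : A ∈ alg L X)
    (hB : B ∈ alg L X) : A * B ∈ alg L X := by
  classical
  obtain ⟨Γ, h, hA⟩ := mem_alg.1 hA
  obtain ⟨Γ', h', hB⟩ := mem_alg.1 hB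
  refine mem_alg.2 ⟨Γ ∪ Γ', fun j hj => ?_, mul_mem_algFin
    (algFin_mono Finset.subset_union_left hA) (algFin_mono Finset.subset_union_right hB)⟩
  rcases Finset.mem_union.1 hj with hj | hj
  exacts [h j hj, h' j hj]

/-- The algebra of quasi-local observables. -/
def QL (L : SpinSystem d) : Submodule ℂ L.Op := (alg L Set.univ).topologicalClosure

theorem isClosed_QL : IsClosed (QL L : Set L.Op) := Submodule.isClosed_topologicalClosure _

theorem algFin_le_QL (Γ : Finset L.Site) : algFin Γ ≤ QL L := fun _ hA =>
  Submodule.le_topologicalClosure _ (mem_alg.2 ⟨Γ, fun _ _ => Set.mem_univ _, hA⟩)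

theorem alg_le_QL (X : Set (EuclideanSpace ℝ (Fin d))) : alg L X ≤ QL L :=
  (alg_mono (Set.subset_univ X)).trans (Submodule.le_topologicalClosure _)

/-- A closed condition that holds for local observables holds for quasi-local ones. -/
theorem QL_induction {p : L.Op → Prop} (hp : IsClosed {A | p A})
    (h : ∀ Γ, ∀ A ∈ algFin Γ, p A) {A : L.Op} (hA : A ∈ QL L) : p A := by
  have hA' : A ∈ closure (alg L Set.univ : Set L.Op) := hA
  refine closure_minimal (t := {A | p A}) (fun B hB => ?_) hp hA'
  obtain ⟨Γ, -, hB⟩ := mem_alg.1 hB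
  exact h Γ B hB

theorem mul_mem_QL {A B : L.Op} (hA : A ∈ QL L) (hB : B ∈ QL L) : A * B ∈ QL L := by
  refine QL_induction (p := fun A => A * B ∈ QL L)
    (isClosed_QL.preimage (continuous_mul_const B)) (fun Γ A hA => ?_) hA
  refine QL_induction (p := fun B => A * B ∈ QL L)
    (isClosed_QL.preimage (continuous_const_mul A)) (fun Γ' B hB => ?_) hB
  exact alg_le_QL Set.univ (mul_mem_alg (mem_alg.2 ⟨Γ, fun _ _ => Set.mem_univ _, hA⟩)
    (mem_alg.2 ⟨Γ', fun _ _ => Set.mem_univ _, hB⟩))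

theorem star_mem_QL {A : L.Op} (hA : A ∈ QL L) : star A ∈ QL L :=
  QL_induction (p := fun A => star A ∈ QL L) (isClosed_QL.preimage continuous_star)
    (fun Γ _ hA => algFin_le_QL Γ (star_mem_algFin hA)) hA

theorem lie_mem_QL {A B : L.Op} (hA : A ∈ QL L) (hB : B ∈ QL L) : ⁅A, B⁆ ∈ QL L := by
  rw [Ring.lie_def]
  exact sub_mem (mul_mem_QL hA hB) (mul_mem_QL hB hA)

theorem real_smul_mem_QL (r : ℝ) {A : L.Op} (hA : A ∈ QL L) : r • A ∈ QL L := by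
  rw [real_smul_op]
  exact Submodule.smul_mem _ _ hA

/-! ### Conditional expectations as limits of averages over complements -/

open Classical in
-- On a local observable the net of averages over complements of `Γ` is eventually constant, since
-- sites outside the support average trivially. With contractivity this makes the net Cauchy on the
-- norm closure.
theorem siteAvg_sdiff_of_subset {Γ₀ Γ Γ' : Finset L.Site} (h : Γ₀ ⊆ Γ') {A : L.Op}
    (hA : A ∈ algFin Γ₀) : siteAvg (Γ' \ Γ) A = siteAvg (Γ₀ \ Γ) A := by
  rw [← siteAvg_siteAvg (Finset.sdiff_subset_sdiff h le_rfl) A]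
  refine siteAvg_eq_of_mem (Γ₀ := Γ₀ \ (Γ₀ \ Γ)) ?_ (siteAvg_mem _ hA)
  rw [Finset.disjoint_left]
  intro j hj hj'
  simp only [Finset.mem_sdiff, not_and, not_not] at hj hj'
  exact hj'.2 (hj.2 hj.1)

open Classical in
theorem cauchySeq_siteAvg (Γ : Finset L.Site) {A : L.Op} (hA : A ∈ QL L) :
    CauchySeq fun Γ' : Finset L.Site => siteAvg (Γ' \ Γ) A := by
  rw [Metric.cauchySeq_iff']
  intro ε hε
  obtain ⟨B, hB, hAB⟩ := Metric.mem_closure_iff.1 (show A ∈ closure (alg L Set.univ : Set L.Op)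
    from hA) (ε / 2) (half_pos hε)
  obtain ⟨Γ₀, -, hB⟩ := mem_alg.1 hB
  refine ⟨Γ₀, fun Γ' hΓ' => ?_⟩
  have h1 : ∀ Δ : Finset L.Site, dist (siteAvg Δ A) (siteAvg Δ B) < ε / 2 := fun Δ => by
    rw [dist_eq_norm, ← siteAvg_sub]
    exact (norm_siteAvg_le _ _).trans_lt (by rwa [← dist_eq_norm])
  calc dist (siteAvg (Γ' \ Γ) A) (siteAvg (Γ₀ \ Γ) A)
      ≤ dist (siteAvg (Γ' \ Γ) A) (siteAvg (Γ' \ Γ) B) +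
        dist (siteAvg (Γ₀ \ Γ) B) (siteAvg (Γ₀ \ Γ) A) := by
        rw [← siteAvg_sdiff_of_subset hΓ' hB]; exact dist_triangle _ _ _
    _ < ε / 2 + ε / 2 := by
        refine add_lt_add (h1 _) ?_
        rw [dist_comm]; exact h1 _
    _ = ε := add_halves ε

open Classical in
/-- The conditional expectation `E_Γ` onto `𝒜_Γ`, as a limit of averages over the complement. -/
def condExp (Γ : Finset L.Site) (A : L.Op) : L.Op :=
  Filter.limUnder Filter.atTop fun Γ' : Finset L.Site => siteAvg (Γ' \ Γ) A

open Classical in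
theorem tendsto_condExp (Γ : Finset L.Site) {A : L.Op} (hA : A ∈ QL L) :
    Filter.Tendsto (fun Γ' : Finset L.Site => siteAvg (Γ' \ Γ) A) Filter.atTop
      (𝓝 (condExp Γ A)) :=
  (cauchySeq_siteAvg Γ hA).tendsto_limUnder

open Classical in
theorem condExp_of_mem (Γ : Finset L.Site) {Γ₀ : Finset L.Site} {A : L.Op} (hA : A ∈ algFin Γ₀) :
    condExp Γ A = siteAvg (Γ₀ \ Γ) A := by
  refine tendsto_nhds_unique (tendsto_condExp Γ (algFin_le_QL Γ₀ hA)) ?_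
  refine tendsto_const_nhds.congr' ?_
  filter_upwards [Filter.eventually_ge_atTop Γ₀] with Γ' h
  exact (siteAvg_sdiff_of_subset h hA).symm

theorem condExp_add (Γ : Finset L.Site) {A B : L.Op} (hA : A ∈ QL L) (hB : B ∈ QL L) :
    condExp Γ (A + B) = condExp Γ A + condExp Γ B := by
  refine tendsto_nhds_unique (tendsto_condExp Γ (add_mem hA hB)) ?_
  simp only [siteAvg_add]
  exact (tendsto_condExp Γ hA).add (tendsto_condExp Γ hB)

theorem condExp_csmul (Γ : Finset L.Site) (c : ℂ) {A : L.Op} (hA : A ∈ QL L) :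
    condExp Γ (c • A) = c • condExp Γ A := by
  refine tendsto_nhds_unique (tendsto_condExp Γ (Submodule.smul_mem _ c hA)) ?_
  simp only [siteAvg_csmul]
  exact (tendsto_condExp Γ hA).const_smul c

theorem condExp_sub (Γ : Finset L.Site) {A B : L.Op} (hA : A ∈ QL L) (hB : B ∈ QL L) :
    condExp Γ (A - B) = condExp Γ A - condExp Γ B := by
  refine tendsto_nhds_unique (tendsto_condExp Γ (sub_mem hA hB)) ?_
  simp only [siteAvg_sub]
  exact (tendsto_condExp Γ hA).sub (tendsto_condExp Γ hB)

theorem condExp_star (Γ : Finset L.Site) {A : L.Op} (hA : A ∈ QL L) :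
    condExp Γ (star A) = star (condExp Γ A) := by
  refine tendsto_nhds_unique (tendsto_condExp Γ (star_mem_QL hA)) ?_
  simp only [siteAvg_star]
  exact (tendsto_condExp Γ hA).star

theorem norm_condExp_le (Γ : Finset L.Site) {A : L.Op} (hA : A ∈ QL L) : ‖condExp Γ A‖ ≤ ‖A‖ :=
  le_of_tendsto (tendsto_condExp Γ hA).norm (Filter.Eventually.of_forall fun _ =>
    norm_siteAvg_le _ _)

theorem continuousOn_condExp (Γ : Finset L.Site) : ContinuousOn (condExp Γ) (QL L : Set L.Op) := by
  refine LipschitzOnWith.continuousOn (K := 1) (LipschitzOnWith.of_dist_le_mul fun A hA B hB => ?_)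
  rw [dist_eq_norm, ← condExp_sub Γ hA hB, NNReal.coe_one, one_mul, dist_eq_norm]
  exact norm_condExp_le Γ (sub_mem hA hB)

theorem condExp_mem (Γ : Finset L.Site) {A : L.Op} (hA : A ∈ QL L) : condExp Γ A ∈ algFin Γ := by
  classical
  have h1 : ∀ Γ₀, ∀ B ∈ algFin Γ₀, condExp Γ B ∈ algFin Γ := by
    intro Γ₀ B hB
    rw [condExp_of_mem Γ hB]
    refine algFin_mono ?_ (siteAvg_mem _ hB)
    intro j hj
    simp only [Finset.mem_sdiff, not_and, not_not] at hj
    exact hj.2 hj.1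
  have hA' : A ∈ closure (alg L Set.univ : Set L.Op) := hA
  have h2 : Set.MapsTo (condExp Γ) (closure (alg L Set.univ : Set L.Op))
      (closure (algFin Γ : Set L.Op)) := by
    refine Set.MapsTo.closure_of_continuousOn (fun B hB => ?_) (continuousOn_condExp Γ)
    obtain ⟨Γ₀, -, hB⟩ := mem_alg.1 hB
    exact h1 Γ₀ B hB
  have := h2 hA'
  rwa [(isClosed_algFin Γ).closure_eq] at this

theorem condExp_mem_QL (Γ : Finset L.Site) {A : L.Op} (hA : A ∈ QL L) : condExp Γ A ∈ QL L :=
  algFin_le_QL Γ (condExp_mem Γ hA)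

theorem condExp_real_smul (Γ : Finset L.Site) (r : ℝ) {A : L.Op} (hA : A ∈ QL L) :
    condExp Γ (r • A) = r • condExp Γ A := by
  rw [real_smul_op, real_smul_op, condExp_csmul Γ _ hA]

theorem condExp_eq_self {Γ : Finset L.Site} {A : L.Op} (hA : A ∈ algFin Γ) : condExp Γ A = A := by
  classical
  rw [condExp_of_mem Γ hA]
  exact siteAvg_eq_of_mem (by simp) hA

open Classical in
-- On local observables both sides average over finite complements, and two successive averages
-- amount to one over the union. Continuity extends the identity to quasi-local observables.
-- Commutation of the expectations and most of the later geometry rest on it.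
theorem condExp_condExp (Γ' Γ : Finset L.Site) {A : L.Op} (hA : A ∈ QL L) :
    condExp Γ' (condExp Γ A) = condExp (Γ' ∩ Γ) A := by
  have key : Set.EqOn (fun A : L.Op => condExp Γ' (condExp Γ A)) (condExp (Γ' ∩ Γ))
      (alg L Set.univ) := by
    intro A hA
    obtain ⟨Γ₀, -, hA⟩ := mem_alg.1 hA
    change condExp Γ' (condExp Γ A) = condExp (Γ' ∩ Γ) A
    have h1 : condExp Γ A ∈ algFin (Γ₀ ∩ Γ) := by
      rw [condExp_of_mem Γ hA]
      refine algFin_mono ?_ (siteAvg_mem _ hA)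
      intro j
      simp only [Finset.mem_sdiff, Finset.mem_inter]
      tauto
    rw [condExp_of_mem Γ' h1]
    set Δ := Γ₀ \ (Γ' ∩ Γ)
    have h2 : siteAvg ((Γ₀ ∩ Γ) \ Γ') (condExp Γ A) ∈ algFin ((Γ₀ ∩ Γ) \ ((Γ₀ ∩ Γ) \ Γ')) :=
      siteAvg_mem _ h1
    have h3 : Disjoint ((Γ₀ ∩ Γ) \ ((Γ₀ ∩ Γ) \ Γ')) Δ := by
      rw [Finset.disjoint_left]
      intro j
      simp only [Δ, Finset.mem_sdiff, Finset.mem_inter]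
      tauto
    have s1 : (Γ₀ ∩ Γ) \ Γ' ⊆ Δ := by
      intro j
      simp only [Δ, Finset.mem_sdiff, Finset.mem_inter]
      tauto
    have s2 : Γ₀ \ Γ ⊆ Δ := by
      intro j
      simp only [Δ, Finset.mem_sdiff, Finset.mem_inter]
      tauto
    -- The left side is already supported away from `Δ`, so averaging it over `Δ` is harmless; that
    -- large average then absorbs both smaller ones.
    rw [← siteAvg_eq_of_mem h3 h2, siteAvg_siteAvg s1, condExp_of_mem Γ hA,
      siteAvg_siteAvg s2, condExp_of_mem _ hA]
  exact key.of_subset_closure ((continuousOn_condExp Γ').comp (continuousOn_condExp Γ)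
    fun _ => condExp_mem_QL Γ) (continuousOn_condExp _) (alg_le_QL _) (fun _ h => h) hA

theorem condExp_comm (Γ' Γ : Finset L.Site) {A : L.Op} (hA : A ∈ QL L) :
    condExp Γ' (condExp Γ A) = condExp Γ (condExp Γ' A) := by
  classical
  rw [condExp_condExp _ _ hA, condExp_condExp _ _ hA, Finset.inter_comm]

theorem condExp_zero (Γ : Finset L.Site) : condExp Γ (0 : L.Op) = 0 :=
  condExp_eq_self (zero_mem _)

theorem condExp_mul_left {Γ : Finset L.Site} {C A : L.Op} (hC : C ∈ algFin Γ) (hA : A ∈ QL L) :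
    condExp Γ (C * A) = C * condExp Γ A := by
  classical
  refine tendsto_nhds_unique (tendsto_condExp Γ (mul_mem_QL (algFin_le_QL Γ hC) hA)) ?_
  have : ∀ Γ' : Finset L.Site, siteAvg (Γ' \ Γ) (C * A) = C * siteAvg (Γ' \ Γ) A := fun Γ' =>
    siteAvg_mul_left (fun B hB => (algFin_commute Finset.disjoint_sdiff hC hB).symm) A
  simp only [this]
  exact (tendsto_condExp Γ hA).const_mul C

theorem condExp_empty_mul_comm {A B : L.Op} (hA : A ∈ QL L) (hB : B ∈ QL L) :
    condExp ∅ (A * B) = condExp ∅ (B * A) := by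
  classical
  have h1 : ∀ Γ, ∀ A ∈ algFin Γ, condExp ∅ (A * B) = condExp ∅ (B * A) := by
    intro Γ A hA
    have hA' := algFin_le_QL Γ hA
    refine tendsto_nhds_unique (tendsto_condExp ∅ (mul_mem_QL hA' hB)) ?_
    refine (tendsto_condExp ∅ (mul_mem_QL hB hA')).congr' ?_
    filter_upwards [Filter.eventually_ge_atTop Γ] with Γ' h
    rw [Finset.sdiff_empty]
    exact (siteAvg_mul_comm (algFin_mono h hA) B).symm
  rw [← sub_eq_zero, ← condExp_sub ∅ (mul_mem_QL hA hB) (mul_mem_QL hB hA), ← norm_eq_zero]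
  refine le_antisymm (le_of_forall_pos_le_add fun ε hε => ?_) (norm_nonneg _)
  obtain ⟨A₀, hA₀, hd⟩ := Metric.mem_closure_iff.1 (show A ∈ closure (alg L Set.univ : Set L.Op)
    from hA) (ε / (2 * (‖B‖ + 1))) (by positivity)
  have hA₀' := alg_le_QL Set.univ hA₀
  obtain ⟨Γ₀, -, hA₀⟩ := mem_alg.1 hA₀
  have hs := sub_mem hA hA₀'
  -- The commutator of the local approximant `A₀` with `B` has zero trace, and the remaining
  -- commutator of `A - A₀` with `B` is small in norm.
  have h3 : A * B - B * A = ((A - A₀) * B - B * (A - A₀)) + (A₀ * B - B * A₀) := by noncomm_ring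
  rw [h3, condExp_add ∅ (sub_mem (mul_mem_QL hs hB) (mul_mem_QL hB hs))
    (sub_mem (mul_mem_QL hA₀' hB) (mul_mem_QL hB hA₀')),
    condExp_sub ∅ (mul_mem_QL hA₀' hB) (mul_mem_QL hB hA₀'), h1 Γ₀ A₀ hA₀, sub_self, add_zero,
    zero_add]
  refine (norm_condExp_le ∅ (sub_mem (mul_mem_QL hs hB) (mul_mem_QL hB hs))).trans ?_
  rw [dist_eq_norm] at hd
  calc ‖(A - A₀) * B - B * (A - A₀)‖ ≤ ‖A - A₀‖ * ‖B‖ + ‖B‖ * ‖A - A₀‖ :=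
        (norm_sub_le _ _).trans (add_le_add (norm_mul_le _ _) (norm_mul_le _ _))
    _ ≤ ‖A - A₀‖ * (2 * (‖B‖ + 1)) := by nlinarith [norm_nonneg (A - A₀), norm_nonneg B]
    _ ≤ ε := ((lt_div_iff₀ (by positivity)).1 hd).le

/-! ### The infinite temperature state -/

theorem hasInfTemp_zero_iff {A : L.Op} (hA : A ∈ QL L) : HasInfTemp A 0 ↔ condExp ∅ A = 0 := by
  classical
  have h : Filter.Tendsto (fun Γ : Finset L.Site => siteAvg Γ A) Filter.atTop
      (𝓝 (condExp ∅ A)) := by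
    simpa only [Finset.sdiff_empty] using tendsto_condExp ∅ hA
  unfold HasInfTemp
  rw [zero_smul]
  exact ⟨fun h' => tendsto_nhds_unique h h', fun h' => h' ▸ h⟩

theorem eq_zero_of_condExp_star_mul_self {Γ : Finset L.Site} {C : L.Op} (hC : C ∈ algFin Γ)
    (h : condExp ∅ (star C * C) = 0) : C = 0 := by
  classical
  rw [condExp_of_mem ∅ (mul_mem_algFin (star_mem_algFin hC) hC)] at h
  exact eq_zero_of_siteAvg_star_mul_self h

end UAL
end

open scoped NNReal Topology
noncomputable section
namespace UAL
variable {d : ℕ} {L : SpinSystem d}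

/-! ### Counting lattice points and bricks -/

/-- Uniformity in the center `w` is the point: translation reduces to one convergent series on `ℤ`.
-/
theorem exists_sum_int_le : ∃ C : ℝ, 0 ≤ C ∧ ∀ (w : ℤ) (T : Finset ℤ),
    ∑ n ∈ T, ((1 + |(n : ℝ) - w|) ^ 2)⁻¹ ≤ C := by
  have hN : Summable fun n : ℕ => ((1 + |((n : ℤ) : ℝ)|) ^ 2)⁻¹ := by
    have h := (summable_nat_add_iff 1).2 (Real.summable_one_div_nat_pow.2 one_lt_two)
    refine h.congr fun n => ?_
    rw [one_div]
    push_cast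
    rw [abs_of_nonneg (Nat.cast_nonneg n), add_comm]
  have hs : Summable fun n : ℤ => ((1 + |(n : ℝ)|) ^ 2)⁻¹ :=
    Summable.of_nat_of_neg hN (by simpa using hN)
  refine ⟨∑' n : ℤ, ((1 + |(n : ℝ)|) ^ 2)⁻¹, tsum_nonneg fun n => by positivity, fun w T => ?_⟩
  have : ∑ n ∈ T, ((1 + |(n : ℝ) - w|) ^ 2)⁻¹ =
      ∑ n ∈ T.image (fun n => n - w), ((1 + |(n : ℝ)|) ^ 2)⁻¹ := by
    rw [Finset.sum_image fun a _ b _ h => by simpa using h]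
    push_cast
    rfl
  rw [this]
  exact hs.sum_le_tsum _ fun n _ => by positivity

theorem exists_sum_lattice_le (ι : Type*) [Fintype ι] : ∃ C : ℝ, 0 ≤ C ∧ ∀ (w : ι → ℤ)
    (T : Finset (ι → ℤ)), ∑ z ∈ T, ∏ i, ((1 + |(z i : ℝ) - w i|) ^ 2)⁻¹ ≤ C := by
  classical
  obtain ⟨C, hC, h⟩ := exists_sum_int_le
  refine ⟨C ^ Fintype.card ι, by positivity, fun w T => ?_⟩
  calc ∑ z ∈ T, ∏ i, ((1 + |(z i : ℝ) - w i|) ^ 2)⁻¹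
      ≤ ∑ z ∈ Fintype.piFinset fun i => T.image fun z : ι → ℤ => z i,
          ∏ i, ((1 + |(z i : ℝ) - w i|) ^ 2)⁻¹ := by
        refine Finset.sum_le_sum_of_subset_of_nonneg (fun z hz => ?_) fun z _ _ => by positivity
        exact Fintype.mem_piFinset.2 fun i => Finset.mem_image_of_mem _ hz
    _ = ∏ i, ∑ n ∈ T.image (fun z : ι → ℤ => z i), ((1 + |(n : ℝ) - w i|) ^ 2)⁻¹ := by
        rw [Finset.prod_univ_sum]
    _ ≤ ∏ _i : ι, C := Finset.prod_le_prod
        (fun i _ => Finset.sum_nonneg fun n _ => by positivity) fun i _ => h _ _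
    _ = C ^ Fintype.card ι := by rw [Finset.prod_const, Finset.card_univ]

/-- Sums of `(1 + t)^(-2|ι|)` over a set that embeds in the lattice `ℤ^ι` with `t` at least a
multiple of the distance to a fixed point. -/
theorem exists_sum_inv_pow_le (ι : Type*) [Fintype ι] (c : ℝ) : ∃ C : ℝ, 0 ≤ C ∧
    ∀ {β : Type} (φ : β → ι → ℤ) (w : ι → ℤ) (t : β → ℝ) (S : Finset β),
      Set.InjOn φ (S : Set β) → (∀ a ∈ S, 0 ≤ t a) →
      (∀ a ∈ S, ∀ i, 1 + |(φ a i : ℝ) - w i| ≤ c * (1 + t a)) →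
      ∑ a ∈ S, ((1 + t a) ^ (2 * Fintype.card ι))⁻¹ ≤ C := by
  classical
  obtain ⟨C, hC, h⟩ := exists_sum_lattice_le ι
  refine ⟨(c ^ 2) ^ Fintype.card ι * C, by positivity, fun φ w t S hφ ht hb => ?_⟩
  calc ∑ a ∈ S, ((1 + t a) ^ (2 * Fintype.card ι))⁻¹
      ≤ ∑ a ∈ S, (c ^ 2) ^ Fintype.card ι * ∏ i, ((1 + |(φ a i : ℝ) - w i|) ^ 2)⁻¹ := by
        refine Finset.sum_le_sum fun a ha => ?_
        have h0 := ht a ha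
        rw [pow_mul, ← inv_pow, ← Finset.card_univ, ← Finset.prod_const, ← Finset.prod_const,
          ← Finset.prod_mul_distrib]
        refine Finset.prod_le_prod (fun i _ => by positivity) fun i _ => ?_
        have h1 := hb a ha i
        have h2 : 0 < 1 + |(φ a i : ℝ) - w i| := by positivity
        rw [← div_eq_mul_inv, le_div_iff₀ (by positivity), inv_mul_le_iff₀ (by positivity)]
        calc (1 + |(φ a i : ℝ) - w i|) ^ 2 ≤ (c * (1 + t a)) ^ 2 := by gcongr
          _ = _ := by ring
    _ = (c ^ 2) ^ Fintype.card ι *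
          ∑ z ∈ S.image φ, ∏ i, ((1 + |(z i : ℝ) - w i|) ^ 2)⁻¹ := by
        rw [Finset.sum_image hφ, Finset.mul_sum]
    _ ≤ _ := by gcongr; exact h _ _

theorem abs_coord_sub_le (x y : EuclideanSpace ℝ (Fin d)) (i : Fin d) : |x i - y i| ≤ dist x y := by
  rw [dist_eq_norm, ← Real.norm_eq_abs]
  exact PiLp.norm_apply_le (x - y) i

theorem dist_le_of_coord {x y : EuclideanSpace ℝ (Fin d)} {c : ℝ} (hc : 0 ≤ c)
    (h : ∀ i, |x i - y i| ≤ c) : dist x y ≤ d * c := by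
  rw [EuclideanSpace.dist_eq, Real.sqrt_le_left (by positivity)]
  calc ∑ i, dist (x i) (y i) ^ 2 ≤ ∑ _i : Fin d, c ^ 2 := by
        gcongr with i
        rw [Real.dist_eq]; exact h i
    _ = d * c ^ 2 := by simp
    _ ≤ (d * c) ^ 2 := by
        rw [mul_pow]
        have : (d : ℝ) ≤ (d : ℝ) ^ 2 := by
          exact_mod_cast Nat.le_self_pow two_ne_zero d
        gcongr

theorem site_ext_of_dist {j k : L.Site} (h : dist (j : EuclideanSpace ℝ (Fin d)) k ≤
    L.lattice.packingRadius) : j = k := by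
  by_contra hne
  exact absurd (L.lattice.packingRadius_lt_dist_of_mem_ne j.2 k.2 fun h => hne (Subtype.ext h))
    (not_lt.2 h)

/-- The exponent that makes sums over sites and over bricks converge. -/
abbrev sumExp (d : ℕ) : ℕ := 4 * d

theorem exists_site_sum_le (L : SpinSystem d) : ∃ C : ℝ, 0 ≤ C ∧
    ∀ (y : EuclideanSpace ℝ (Fin d)) (S : Finset L.Site),
      ∑ j ∈ S, ((1 + dist (j : EuclideanSpace ℝ (Fin d)) y) ^ sumExp d)⁻¹ ≤ C := by
  -- A cube of side `δ` has diameter at most `d δ`, below the packing radius, so distinct sites have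
  -- distinct integer cells. The `d + 1` avoids dividing by zero when `d = 0`.
  set δ : ℝ := L.lattice.packingRadius / (d + 1) with hδ
  have hp : (0 : ℝ) < L.lattice.packingRadius := L.lattice.packingRadius_pos
  have hδ0 : 0 < δ := by positivity
  obtain ⟨C, hC, h⟩ := exists_sum_inv_pow_le (Fin d) (2 + 1 / δ)
  refine ⟨C, hC, fun y S => ?_⟩
  refine le_trans (Finset.sum_le_sum fun j _ => ?_) (h (fun (j : L.Site) i => ⌊(j.1 i) / δ⌋)
    (fun i => ⌊y i / δ⌋) (fun j : L.Site => dist (j : EuclideanSpace ℝ (Fin d)) y) S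
    (fun j _ k _ hjk => ?_) (fun _ _ => dist_nonneg) fun j _ i => ?_)
  · rw [Fintype.card_fin]
    refine inv_anti₀ (by positivity) (pow_le_pow_right₀ ?_ (by unfold sumExp; omega))
    linarith [dist_nonneg (x := (j : EuclideanSpace ℝ (Fin d))) (y := y)]
  · refine site_ext_of_dist ((dist_le_of_coord hδ0.le fun i => ?_).trans ?_)
    · have := Int.abs_sub_lt_one_of_floor_eq_floor (congrFun hjk i)
      rw [← sub_div, abs_div, abs_of_pos hδ0, div_lt_one hδ0] at this
      exact this.le
    · rw [hδ, mul_div_assoc', div_le_iff₀ (by positivity)]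
      nlinarith
  · have h1 := abs_coord_sub_le (j : EuclideanSpace ℝ (Fin d)) y i
    have h2 : |((⌊(j.1 i) / δ⌋ : ℤ) : ℝ) - ((⌊y i / δ⌋ : ℤ) : ℝ)| ≤ |j.1 i / δ - y i / δ| + 1 := by
      have a1 := Int.floor_le (j.1 i / δ)
      have a2 := Int.lt_floor_add_one (j.1 i / δ)
      have b1 := Int.floor_le (y i / δ)
      have b2 := Int.lt_floor_add_one (y i / δ)
      have c1 := le_abs_self (j.1 i / δ - y i / δ)
      have c2 := neg_abs_le (j.1 i / δ - y i / δ)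
      rw [abs_le]; constructor <;> linarith
    rw [← sub_div, abs_div, abs_of_pos hδ0] at h2
    have h3 : |j.1 i - y i| / δ ≤ dist (j : EuclideanSpace ℝ (Fin d)) y / δ := by gcongr
    have h4 : 0 ≤ dist (j : EuclideanSpace ℝ (Fin d)) y := dist_nonneg
    have h5 : 0 < 1 / δ := by positivity
    calc _ ≤ 2 + dist (j : EuclideanSpace ℝ (Fin d)) y * (1 / δ) := by
          rw [mul_one_div]; linarith
      _ ≤ _ := by nlinarith [mul_nonneg h4 h5.le]

/-- Infinitely many sites in a bounded set would contribute arbitrarily many terms bounded below to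
the uniformly bounded sum over sites. -/
theorem finite_sites {X : Set (EuclideanSpace ℝ (Fin d))} (hX : Bornology.IsBounded X) :
    {j : L.Site | (j : EuclideanSpace ℝ (Fin d)) ∈ X}.Finite := by
  obtain ⟨C, hC, h⟩ := exists_site_sum_le L
  obtain ⟨R, hR⟩ := hX.subset_closedBall 0
  by_contra hinf
  obtain ⟨n, hn⟩ := exists_nat_gt (C * (1 + max R 0) ^ sumExp d)
  obtain ⟨S, hS, hcard⟩ := Set.Infinite.exists_subset_card_eq hinf n
  have h1 : ∑ _j ∈ S, ((1 + max R 0) ^ sumExp d)⁻¹ ≤ C := by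
    refine le_trans (Finset.sum_le_sum fun j hj => ?_) (h 0 S)
    have : dist (j : EuclideanSpace ℝ (Fin d)) 0 ≤ R := hR (hS hj)
    refine inv_anti₀ (by positivity) ?_
    gcongr
    exact this.trans (le_max_left _ _)
  rw [Finset.sum_const, nsmul_eq_mul, hcard, ← div_eq_mul_inv, div_le_iff₀ (by positivity)] at h1
  linarith

open Classical in
/-- The sites in a bounded set. -/
def sites (L : SpinSystem d) (X : Set (EuclideanSpace ℝ (Fin d))) : Finset L.Site :=
  if h : {j : L.Site | (j : EuclideanSpace ℝ (Fin d)) ∈ X}.Finite then h.toFinset else ∅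

theorem mem_sites {X : Set (EuclideanSpace ℝ (Fin d))} (hX : Bornology.IsBounded X) {j : L.Site} :
    j ∈ sites L X ↔ (j : EuclideanSpace ℝ (Fin d)) ∈ X := by
  unfold sites
  rw [dif_pos (finite_sites hX)]
  simp

@[simp] theorem sites_empty : sites L ∅ = ∅ := by
  ext j
  rw [mem_sites Bornology.isBounded_empty]
  simp

theorem alg_eq_algFin {X : Set (EuclideanSpace ℝ (Fin d))} (hX : Bornology.IsBounded X) :
    alg L X = algFin (sites L X) := by
  refine le_antisymm (fun A hA => ?_) fun A hA => mem_alg.2 ⟨_, fun j hj => (mem_sites hX).1 hj, hA⟩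
  obtain ⟨Γ, h, hA⟩ := mem_alg.1 hA
  exact algFin_mono (fun j hj => (mem_sites hX).2 (h j hj)) hA

theorem isBrick_box (n m : Fin d → ℤ) : IsBrick
    {x : EuclideanSpace ℝ (Fin d) | ∀ i, (n i : ℝ) ≤ x i ∧ x i < (m i : ℝ)} := by
  by_cases h : ∀ i, n i < m i
  · exact Or.inr ⟨n, m, h, rfl⟩
  · left
    push Not at h
    obtain ⟨i, hi⟩ := h
    ext x
    simp only [Set.mem_ofPred_eq, Set.mem_empty_iff_false, iff_false]
    intro H
    have h1 : (n i : ℝ) < m i := (H i).1.trans_lt (H i).2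
    exact absurd (by exact_mod_cast h1 : n i < m i) (not_lt.2 hi)

/-- The brick `{x | n_i ≤ x_i < m_i}`, empty if `n_i ≥ m_i` for some `i`. -/
def box (n m : Fin d → ℤ) : Brick d := ⟨_, isBrick_box n m⟩

theorem mem_box {n m : Fin d → ℤ} {x : EuclideanSpace ℝ (Fin d)} :
    x ∈ (box n m).1 ↔ ∀ i, (n i : ℝ) ≤ x i ∧ x i < (m i : ℝ) := Iff.rfl

theorem Brick.cases (Y : Brick d) : Y.1 = ∅ ∨ ∃ n m, (∀ i, n i < m i) ∧ Y = box n m := by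
  obtain ⟨Y, h | ⟨n, m, h, rfl⟩⟩ := Y
  · exact Or.inl h
  · exact Or.inr ⟨n, m, h, rfl⟩

theorem Brick.isBounded (Y : Brick d) : Bornology.IsBounded Y.1 := by
  rcases Y.cases with h | ⟨n, m, -, rfl⟩
  · rw [h]; exact Bornology.isBounded_empty
  · rw [Metric.isBounded_iff]
    refine ⟨d * ∑ i, |(m i : ℝ) - n i|, fun x hx y hy => dist_le_of_coord
      (Finset.sum_nonneg fun i _ => abs_nonneg _) fun i => ?_⟩
    refine le_trans ?_ (Finset.single_le_sum (f := fun i => |(m i : ℝ) - n i|)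
      (fun i _ => abs_nonneg _) (Finset.mem_univ i))
    have h1 := mem_box.1 hx i
    have h2 := mem_box.1 hy i
    refine le_trans ?_ (le_abs_self _)
    rw [abs_le]; constructor <;> linarith

theorem dist_le_diam_brick (Y : Brick d) {x y : EuclideanSpace ℝ (Fin d)} (hx : x ∈ Y.1)
    (hy : y ∈ Y.1) : dist x y ≤ Metric.diam Y.1 := Metric.dist_le_diam_of_mem Y.isBounded hx hy

/-- The sides of a brick have length at most one more than its diameter (a brick is half open). -/
theorem box_side_le {n m : Fin d → ℤ} (h : ∀ i, n i < m i) (i : Fin d) :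
    (m i : ℝ) - n i ≤ Metric.diam (box n m).1 + 1 := by
  classical
  set p : EuclideanSpace ℝ (Fin d) := WithLp.toLp 2 fun i => (n i : ℝ) with hp
  set q : EuclideanSpace ℝ (Fin d) :=
    WithLp.toLp 2 (Function.update (fun i => (n i : ℝ)) i ((m i : ℝ) - 1)) with hq
  have hn : ∀ k, (n k : ℝ) + 1 ≤ m k := fun k => by exact_mod_cast h k
  have hpm : p ∈ (box n m).1 := mem_box.2 fun k => by
    have := hn k
    simp only [hp]; constructor <;> linarith
  have hqm : q ∈ (box n m).1 := mem_box.2 fun k => by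
    have := hn k
    by_cases hk : k = i
    · subst hk
      simp only [hq, Function.update_self]; constructor <;> linarith
    · simp only [hq, Function.update_of_ne hk]; constructor <;> linarith
  have h1 := (abs_coord_sub_le q p i).trans (dist_le_diam_brick _ hqm hpm)
  simp only [hp, hq, Function.update_self] at h1
  linarith [le_abs_self ((m i : ℝ) - 1 - n i)]

/-- A brick is determined by its `2d` corner coordinates, each of them within a multiple of `1 +
diam Y` of the point `x ∈ Y`. Two powers per coordinate ensure convergence, which accounts for the
exponent `4d`. -/
theorem exists_brick_sum_le (d : ℕ) : ∃ C : ℝ, 0 ≤ C ∧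
    ∀ (x : EuclideanSpace ℝ (Fin d)) (S : Finset (Brick d)), (∀ Y ∈ S, x ∈ Y.1) →
      ∑ Y ∈ S, ((1 + Metric.diam Y.1) ^ sumExp d)⁻¹ ≤ C := by
  obtain ⟨C, hC, h⟩ := exists_sum_inv_pow_le (Fin d ⊕ Fin d) 3
  refine ⟨C, hC, fun x S hS => ?_⟩
  have key : ∀ Y : Brick d, ∃ p : (Fin d → ℤ) × (Fin d → ℤ), x ∈ Y.1 →
      (∀ i, p.1 i < p.2 i) ∧ Y = box p.1 p.2 := by
    intro Y
    rcases Y.cases with h | ⟨n, m, hnm, rfl⟩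
    · exact ⟨0, fun hx => by rw [h] at hx; exact hx.elim⟩
    · exact ⟨(n, m), fun _ => ⟨hnm, rfl⟩⟩
  choose p hp using key
  have := h (fun Y => Sum.elim (p Y).1 (p Y).2) (Sum.elim (fun i => ⌊x i⌋) fun i => ⌊x i⌋)
    (fun Y : Brick d => Metric.diam Y.1) S ?_ (fun _ _ => Metric.diam_nonneg) ?_
  · simpa [sumExp, ← two_mul, ← mul_assoc] using this
  · intro Y hY Z hZ hYZ
    have h1 := (hp Y (hS Y hY)).2
    have h2 := (hp Z (hS Z hZ)).2
    have e1 : (p Y).1 = (p Z).1 := funext fun i => congrFun hYZ (Sum.inl i)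
    have e2 : (p Y).2 = (p Z).2 := funext fun i => congrFun hYZ (Sum.inr i)
    rw [h1, h2, e1, e2]
  · intro Y hY
    obtain ⟨h1, h2⟩ := hp Y (hS Y hY)
    have hx : ∀ i, ((p Y).1 i : ℝ) ≤ x i ∧ x i < ((p Y).2 i : ℝ) := by
      have := hS Y hY
      rw [h2] at this
      exact mem_box.1 this
    have hside : ∀ i, ((p Y).2 i : ℝ) - (p Y).1 i ≤ Metric.diam Y.1 + 1 := by
      have := box_side_le h1
      rwa [← h2] at this
    have hd : 0 ≤ Metric.diam Y.1 := Metric.diam_nonneg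
    rintro (i | i)
    all_goals
      have a := hx i
      have b := hside i
      have a1 := Int.floor_le (x i)
      have a2 := Int.lt_floor_add_one (x i)
      have : ∀ z : ℝ, |z| ≤ 2 + 3 * Metric.diam Y.1 → 1 + |z| ≤ 3 * (1 + Metric.diam Y.1) :=
        fun z hz => by linarith
      refine this _ (abs_le.2 ?_)
      simp only [Sum.elim_inl, Sum.elim_inr]
      constructor <;> linarith

end UAL
end

open scoped NNReal Topology
noncomputable section
namespace UAL
variable {d : ℕ} {L : SpinSystem d}

/-! ### The commutator -/

/-- The commutator as a real bilinear map. -/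
def lieB (L : SpinSystem d) : L.Op →ₗ[ℝ] L.Op →ₗ[ℝ] L.Op :=
  LinearMap.mk₂ ℝ (fun A B => ⁅A, B⁆)
    (fun A B C => by simp only [Ring.lie_def]; noncomm_ring)
    (fun c A B => by simp only [Ring.lie_def, smul_mul_assoc, mul_smul_comm, smul_sub])
    (fun A B C => by simp only [Ring.lie_def]; noncomm_ring)
    (fun c A B => by simp only [Ring.lie_def, smul_mul_assoc, mul_smul_comm, smul_sub])

theorem lieB_apply (A B : L.Op) : lieB L A B = ⁅A, B⁆ := rfl

theorem op_lie_skew (A B : L.Op) : ⁅A, B⁆ = -⁅B, A⁆ := by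
  simp only [Ring.lie_def, neg_sub]

theorem op_lie_leibniz (A B C : L.Op) : ⁅A, ⁅B, C⁆⁆ = ⁅⁅A, B⁆, C⁆ + ⁅B, ⁅A, C⁆⁆ := by
  simp only [Ring.lie_def]
  noncomm_ring

/-! ### Traceless anti-self-adjoint quasi-local observables -/

/-- The traceless anti-self-adjoint quasi-local observables. -/
def lieQ (L : SpinSystem d) : Submodule ℝ L.Op where
  carrier := {A | A ∈ QL L ∧ star A = -A ∧ condExp ∅ A = 0}
  zero_mem' := ⟨zero_mem _, by simp, condExp_eq_self (zero_mem _)⟩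
  add_mem' := fun {A B} hA hB => ⟨add_mem hA.1 hB.1, by rw [star_add, hA.2.1, hB.2.1, neg_add],
    by rw [condExp_add ∅ hA.1 hB.1, hA.2.2, hB.2.2, add_zero]⟩
  smul_mem' := fun r A hA => ⟨real_smul_mem_QL r hA.1,
    by rw [star_real_smul_op, hA.2.1, smul_neg],
    by rw [condExp_real_smul ∅ r hA.1, hA.2.2, smul_zero]⟩

theorem isClosed_lieQ : IsClosed (lieQ L : Set L.Op) := by
  have h1 : IsClosed ((QL L : Set L.Op) ∩ condExp ∅ ⁻¹' {0}) :=
    (continuousOn_condExp ∅).preimage_isClosed_of_isClosed isClosed_QL isClosed_singleton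
  have h2 : IsClosed {A : L.Op | star A = -A} := isClosed_eq continuous_star continuous_neg
  convert h1.inter h2 using 1
  ext A
  exact ⟨fun h => ⟨⟨h.1, h.2.2⟩, h.2.1⟩, fun h => ⟨h.1.1, h.2, h.1.2⟩⟩

theorem lie_mem_lieQ {A B : L.Op} (hA : A ∈ lieQ L) (hB : B ∈ lieQ L) : ⁅A, B⁆ ∈ lieQ L := by
  refine ⟨lie_mem_QL hA.1 hB.1, ?_, ?_⟩
  · rw [Ring.lie_def, star_sub, star_mul, star_mul, hA.2.1, hB.2.1]
    noncomm_ring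
  · rw [Ring.lie_def, condExp_sub ∅ (mul_mem_QL hA.1 hB.1) (mul_mem_QL hB.1 hA.1),
      condExp_empty_mul_comm hA.1 hB.1, sub_self]

theorem condExp_mem_lieQ (Γ : Finset L.Site) {A : L.Op} (hA : A ∈ lieQ L) :
    condExp Γ A ∈ lieQ L := by
  classical
  refine ⟨condExp_mem_QL Γ hA.1, ?_, ?_⟩
  · rw [← condExp_star Γ hA.1, hA.2.1, ← neg_one_smul ℂ, condExp_csmul Γ _ hA.1, neg_one_smul]
  · rw [condExp_condExp _ _ hA.1, Finset.empty_inter, hA.2.2]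

theorem mem_lieLoc_iff {X : Set (EuclideanSpace ℝ (Fin d))} {A : L.Op} :
    A ∈ lieLoc L X ↔ A ∈ alg L X ∧ A ∈ lieQ L := by
  constructor
  · rintro ⟨h1, h2, h3⟩
    exact ⟨h1, alg_le_QL X h1, h2, (hasInfTemp_zero_iff (alg_le_QL X h1)).1 h3⟩
  · rintro ⟨h1, h2, h3, h4⟩
    exact ⟨h1, h3, (hasInfTemp_zero_iff h2).2 h4⟩

theorem lieAl_le_lieQ : lieAl L ≤ lieQ L := fun _ hA =>
  ⟨hA.1, hA.2.1, (hasInfTemp_zero_iff hA.1).1 hA.2.2.1⟩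

/-! ### Localization errors -/

theorem distAlg_le_norm_sub {X : Set (EuclideanSpace ℝ (Fin d))} {A B : L.Op} (hB : B ∈ alg L X) :
    distAlg L X A ≤ ‖A - B‖ := by
  rw [distAlg_apply, ← dist_eq_norm]
  exact Metric.infDist_le_dist_of_mem hB

theorem distAlg_le_norm (X : Set (EuclideanSpace ℝ (Fin d))) (A : L.Op) : distAlg L X A ≤ ‖A‖ := by
  simpa using distAlg_le_norm_sub (A := A) (zero_mem (alg L X))

theorem distAlg_eq_zero {X : Set (EuclideanSpace ℝ (Fin d))} {A : L.Op} (hA : A ∈ alg L X) :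
    distAlg L X A = 0 := by
  refine le_antisymm ?_ (apply_nonneg _ _)
  simpa using distAlg_le_norm_sub (A := A) hA

theorem distAlg_anti {X Y : Set (EuclideanSpace ℝ (Fin d))} (h : X ⊆ Y) (A : L.Op) :
    distAlg L Y A ≤ distAlg L X A :=
  Metric.infDist_le_infDist_of_subset (alg_mono h) ⟨0, zero_mem _⟩

/-- Any competitor `B` in `𝒜_X` is fixed by the projection, so `A - E A = (A - B) - E (A - B)`, and
the projection is contracting. -/
theorem norm_sub_condExp_le {X : Set (EuclideanSpace ℝ (Fin d))} (hX : Bornology.IsBounded X)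
    {A : L.Op} (hA : A ∈ QL L) : ‖A - condExp (sites L X) A‖ ≤ 2 * distAlg L X A := by
  have h : ‖A - condExp (sites L X) A‖ / 2 ≤ distAlg L X A := by
    rw [distAlg_apply, Metric.le_infDist ⟨0, zero_mem _⟩]
    intro B hB
    rw [dist_eq_norm, div_le_iff₀ two_pos]
    have hBQ := alg_le_QL X hB
    have hB' : B ∈ algFin (sites L X) := by rwa [← alg_eq_algFin hX]
    calc ‖A - condExp (sites L X) A‖ = ‖(A - B) - condExp (sites L X) (A - B)‖ := by
          rw [condExp_sub _ hA hBQ, condExp_eq_self hB']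
          congr 1; abel
      _ ≤ ‖A - B‖ + ‖A - B‖ := (norm_sub_le _ _).trans
          (add_le_add le_rfl (norm_condExp_le _ (sub_mem hA hBQ)))
      _ = ‖A - B‖ * 2 := by ring
  linarith

/-- For disjoint regions `E_X E_Y A = E_∅ A = 0`, so `A` is the sum of `A - E_X A` and `E_X (A - E_Y
A)`, both controlled by the approximation errors. This converts localization at two places into
decay of the norm. -/
theorem norm_le_of_disjoint {X Y : Set (EuclideanSpace ℝ (Fin d))} (hX : Bornology.IsBounded X)
    (hY : Bornology.IsBounded Y) (hXY : Disjoint X Y) {A : L.Op} (hA : A ∈ lieQ L) :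
    ‖A‖ ≤ 2 * (distAlg L X A + distAlg L Y A) := by
  classical
  have h1 := norm_sub_condExp_le hX hA.1
  have h2 := norm_sub_condExp_le hY hA.1
  have h0 : sites L X ∩ sites L Y = ∅ := by
    ext j
    simp only [Finset.mem_inter, mem_sites hX, mem_sites hY, Finset.notMem_empty, iff_false]
    exact fun h => Set.disjoint_left.1 hXY h.1 h.2
  have h3 : condExp (sites L X) (condExp (sites L Y) A) = 0 := by
    rw [condExp_condExp _ _ hA.1, h0, hA.2.2]
  have h4 : A = (A - condExp (sites L X) A) +
      condExp (sites L X) (A - condExp (sites L Y) A) := by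
    rw [condExp_sub _ hA.1 (condExp_mem_QL _ hA.1), h3]; abel
  calc ‖A‖ ≤ ‖A - condExp (sites L X) A‖ + ‖condExp (sites L X) (A - condExp (sites L Y) A)‖ := by
        conv_lhs => rw [h4]
        exact norm_add_le _ _
    _ ≤ 2 * distAlg L X A + 2 * distAlg L Y A := add_le_add h1
        ((norm_condExp_le _ (sub_mem hA.1 (condExp_mem_QL _ hA.1))).trans h2)
    _ = _ := by ring

theorem norm_lie_le (A B : L.Op) : ‖⁅A, B⁆‖ ≤ 2 * (‖A‖ * ‖B‖) := by
  rw [Ring.lie_def]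
  calc ‖A * B - B * A‖ ≤ ‖A‖ * ‖B‖ + ‖B‖ * ‖A‖ :=
        (norm_sub_le _ _).trans (add_le_add (norm_mul_le _ _) (norm_mul_le _ _))
    _ = _ := by ring

theorem alg_lie_eq_zero {X Y : Set (EuclideanSpace ℝ (Fin d))} (hXY : Disjoint X Y) {A B : L.Op}
    (hA : A ∈ alg L X) (hB : B ∈ alg L Y) : ⁅A, B⁆ = 0 := by
  obtain ⟨Γ, h, hA⟩ := mem_alg.1 hA
  obtain ⟨Γ', h', hB⟩ := mem_alg.1 hB
  rw [Ring.lie_def, sub_eq_zero]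
  refine (algFin_commute ?_ hA hB).eq
  exact Finset.disjoint_left.2 fun j hj hj' => Set.disjoint_left.1 hXY (h j hj) (h' j hj')

theorem lie_mem_alg {X : Set (EuclideanSpace ℝ (Fin d))} {A B : L.Op} (hA : A ∈ alg L X)
    (hB : B ∈ alg L X) : ⁅A, B⁆ ∈ alg L X := by
  rw [Ring.lie_def]
  exact sub_mem (mul_mem_alg hA hB) (mul_mem_alg hB hA)

theorem condExp_sites_mem {X : Set (EuclideanSpace ℝ (Fin d))} (hX : Bornology.IsBounded X)
    {A : L.Op} (hA : A ∈ QL L) : condExp (sites L X) A ∈ alg L X := by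
  rw [alg_eq_algFin hX]; exact condExp_mem _ hA

/-- Approximate both factors on balls of radius `r/4`. If the centers are closer than `r/2`, both
balls lie in the ball of radius `r` about `x`; otherwise they are disjoint and the approximants
commute. Either way the approximate commutator is supported in that ball. -/
theorem locErr_lie_le (x y : EuclideanSpace ℝ (Fin d)) (r : ℝ≥0) {A B : L.Op} (hA : A ∈ QL L)
    (hB : B ∈ QL L) : locErr L x r ⁅A, B⁆ ≤
      4 * (‖A‖ * locErr L y (r / 4) B + ‖B‖ * locErr L x (r / 4) A) := by
  set A' := condExp (sites L (Metric.ball x ((r / 4 : ℝ≥0) : ℝ))) A with hA'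
  set B' := condExp (sites L (Metric.ball y ((r / 4 : ℝ≥0) : ℝ))) B with hB'
  have h1 : ‖A - A'‖ ≤ 2 * locErr L x (r / 4) A := norm_sub_condExp_le Metric.isBounded_ball hA
  have h2 : ‖B - B'‖ ≤ 2 * locErr L y (r / 4) B := norm_sub_condExp_le Metric.isBounded_ball hB
  have h3 : A' ∈ alg L (Metric.ball x ((r / 4 : ℝ≥0) : ℝ)) :=
    condExp_sites_mem Metric.isBounded_ball hA
  have h4 : B' ∈ alg L (Metric.ball y ((r / 4 : ℝ≥0) : ℝ)) :=
    condExp_sites_mem Metric.isBounded_ball hB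
  have hr : ((r / 4 : ℝ≥0) : ℝ) = (r : ℝ) / 4 := by simp
  have hr0 : (0 : ℝ) ≤ r := r.2
  have h5 : ⁅A', B'⁆ ∈ alg L (Metric.ball x r) := by
    by_cases hd : dist x y < r / 2
    · refine lie_mem_alg (alg_mono (Metric.ball_subset_ball ?_) h3)
        (alg_mono (Metric.ball_subset_ball' ?_) h4)
      · rw [hr]; linarith
      · rw [hr, dist_comm]; linarith
    · rw [alg_lie_eq_zero (Metric.ball_disjoint_ball ?_) h3 h4]
      · exact zero_mem _
      · rw [hr]; linarith
  have h6 : ⁅A, B⁆ - ⁅A', B'⁆ = ⁅A - A', B⁆ + ⁅A', B - B'⁆ := by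
    simp only [Ring.lie_def]; noncomm_ring
  calc locErr L x r ⁅A, B⁆ ≤ ‖⁅A, B⁆ - ⁅A', B'⁆‖ := distAlg_le_norm_sub h5
    _ ≤ 2 * (‖A - A'‖ * ‖B‖) + 2 * (‖A'‖ * ‖B - B'‖) := by
        rw [h6]
        exact (norm_add_le _ _).trans (add_le_add (norm_lie_le _ _) (norm_lie_le _ _))
    _ ≤ 2 * (2 * locErr L x (r / 4) A * ‖B‖) + 2 * (‖A‖ * (2 * locErr L y (r / 4) B)) := by
        have := norm_condExp_le (sites L (Metric.ball x ((r / 4 : ℝ≥0) : ℝ))) hA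
        gcongr
    _ = _ := by ring

/-! ### Almost localized observables -/

/-- `(1 + r)^α f_x(A, r) ≤ K` for all `r`. -/
def Loc (x : EuclideanSpace ℝ (Fin d)) (α : ℕ) (K : ℝ) (A : L.Op) : Prop :=
  ∀ r : ℝ≥0, (1 + (r : ℝ)) ^ α * locErr L x r A ≤ K

variable {x y : EuclideanSpace ℝ (Fin d)} {α : ℕ} {K M : ℝ} {A B : L.Op}

theorem Loc.nonneg (h : Loc x α K A) : 0 ≤ K :=
  le_trans (mul_nonneg (by positivity) (apply_nonneg _ _)) (h 0)

theorem Loc.mono (h : Loc x α K A) (hK : K ≤ M) : Loc x α M A := fun r => (h r).trans hK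

theorem Loc.anti {β : ℕ} (h : Loc x α K A) (hβ : β ≤ α) : Loc x β K A := fun r => by
  refine le_trans ?_ (h r)
  have hr : (0 : ℝ) ≤ r := r.2
  have h0 : 0 ≤ locErr L x r A := apply_nonneg _ _
  gcongr
  linarith

theorem Loc.locErr_le (h : Loc x α K A) (r : ℝ≥0) : locErr L x r A ≤ K / (1 + (r : ℝ)) ^ α := by
  rw [le_div_iff₀ (by have := r.2; positivity), mul_comm]
  exact h r

theorem Loc.locErr_zero_le (h : Loc x α K A) : locErr L x 0 A ≤ K := by
  simpa using h 0

/-- The open ball of radius zero is empty, hence disjoint from itself, so the two-region bound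
applies with both regions equal to it. -/
theorem Loc.norm_le (h : Loc x α K A) (hA : A ∈ lieQ L) : ‖A‖ ≤ 4 * K := by
  have h1 := norm_le_of_disjoint (X := Metric.ball x 0) (Y := Metric.ball x 0)
    Metric.isBounded_ball Metric.isBounded_ball (by simp) hA
  have h2 := h.locErr_zero_le
  have h3 : distAlg L (Metric.ball x 0) A = locErr L x 0 A := rfl
  rw [h3] at h1
  linarith

theorem Loc.zero (hK : 0 ≤ K) : Loc x α K (0 : L.Op) := fun r => by
  rw [map_zero, mul_zero]; exact hK

theorem Loc.add (hA : Loc x α K A) (hB : Loc x α M B) : Loc x α (K + M) (A + B) := fun r =>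
  calc (1 + (r : ℝ)) ^ α * locErr L x r (A + B)
      ≤ (1 + (r : ℝ)) ^ α * (locErr L x r A + locErr L x r B) := by
        gcongr; exact map_add_le_add _ _ _
    _ ≤ K + M := by rw [mul_add]; exact add_le_add (hA r) (hB r)

theorem Loc.smul (c : ℝ) (hA : Loc x α K A) : Loc x α (|c| * K) (c • A) := fun r =>
  calc (1 + (r : ℝ)) ^ α * locErr L x r (c • A)
      = |c| * ((1 + (r : ℝ)) ^ α * locErr L x r A) := by
        rw [map_smul_eq_mul, Real.norm_eq_abs]; ring
    _ ≤ |c| * K := by gcongr; exact hA r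

theorem Loc.neg (hA : Loc x α K A) : Loc x α K (-A) := fun r => by
  rw [map_neg_eq_map]; exact hA r

theorem Loc.sub (hA : Loc x α K A) (hB : Loc x α M B) : Loc x α (K + M) (A - B) := by
  rw [sub_eq_add_neg]; exact hA.add hB.neg

theorem Loc.sum {ι : Type*} {S : Finset ι} {A : ι → L.Op} {K : ι → ℝ}
    (h : ∀ i ∈ S, Loc x α (K i) (A i)) : Loc x α (∑ i ∈ S, K i) (∑ i ∈ S, A i) := by
  classical
  induction S using Finset.induction_on with
  | empty => simpa using Loc.zero le_rfl
  | insert a S ha ih =>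
    rw [Finset.sum_insert ha, Finset.sum_insert ha]
    exact (h a (Finset.mem_insert_self _ _)).add
      (ih fun i hi => h i (Finset.mem_insert_of_mem hi))

/-- The factor `4^α` pays for the passage from `r` to `r/4`; the factor 32 is the 4 of
`locErr_lie_le` times the two norm bounds `4K` and `4M`. -/
theorem Loc.lie (hA : Loc x α K A) (hB : Loc y α M B) (hA' : A ∈ lieQ L) (hB' : B ∈ lieQ L) :
    Loc x α (4 ^ α * 32 * (K * M)) ⁅A, B⁆ := fun r => by
  have h1 := locErr_lie_le x y r hA'.1 hB'.1
  have hr : (1 + (r : ℝ)) ≤ 4 * (1 + ((r / 4 : ℝ≥0) : ℝ)) := by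
    simp only [NNReal.coe_div, NNReal.coe_ofNat]; linarith
  have hr0 : (0 : ℝ) ≤ r := r.2
  have nA := hA.norm_le hA'
  have nB := hB.norm_le hB'
  have hK := hA.nonneg
  have hM := hB.nonneg
  calc (1 + (r : ℝ)) ^ α * locErr L x r ⁅A, B⁆
      ≤ (4 * (1 + ((r / 4 : ℝ≥0) : ℝ))) ^ α *
        (4 * (‖A‖ * locErr L y (r / 4) B + ‖B‖ * locErr L x (r / 4) A)) := by
        gcongr
    _ = 4 ^ α * 4 * (‖A‖ * ((1 + ((r / 4 : ℝ≥0) : ℝ)) ^ α * locErr L y (r / 4) B) +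
          ‖B‖ * ((1 + ((r / 4 : ℝ≥0) : ℝ)) ^ α * locErr L x (r / 4) A)) := by
        rw [mul_pow]; ring
    _ ≤ 4 ^ α * 4 * (4 * K * M + 4 * M * K) := by
        have a1 := hA (r / 4)
        have a2 := hB (r / 4)
        gcongr
    _ = _ := by ring

theorem Loc.lie' (hA : Loc x α K A) (hB : Loc y α M B) (hA' : A ∈ lieQ L) (hB' : B ∈ lieQ L) :
    Loc y α (4 ^ α * 32 * (K * M)) ⁅A, B⁆ := by
  rw [op_lie_skew, mul_comm K]
  exact (hB.lie hA hB' hA').neg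

/-- A traceless observable localized near two points has norm decaying with their distance. -/
theorem Loc.norm_mul_dist_le (hx : Loc x α K A) (hy : Loc y α K A) (hA : A ∈ lieQ L) :
    ‖A‖ * (1 + dist x y) ^ α ≤ 2 ^ α * 4 * K := by
  set r : ℝ≥0 := ⟨dist x y / 2, by positivity⟩ with hr
  have hr' : (r : ℝ) = dist x y / 2 := rfl
  have h1 := norm_le_of_disjoint (X := Metric.ball x r) (Y := Metric.ball y r)
    Metric.isBounded_ball Metric.isBounded_ball
    (Metric.ball_disjoint_ball (by rw [hr']; linarith)) hA
  have h2 : ‖A‖ ≤ 2 * (locErr L x r A + locErr L y r A) := h1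
  have hd : 0 ≤ dist x y := dist_nonneg
  calc ‖A‖ * (1 + dist x y) ^ α
      ≤ 2 * (locErr L x r A + locErr L y r A) * (2 * (1 + (r : ℝ))) ^ α := by
        have e1 : 0 ≤ locErr L x r A := apply_nonneg _ _
        have e2 : 0 ≤ locErr L y r A := apply_nonneg _ _
        gcongr
        rw [hr']; linarith
    _ = 2 * 2 ^ α * ((1 + (r : ℝ)) ^ α * locErr L x r A +
          (1 + (r : ℝ)) ^ α * locErr L y r A) := by
        rw [mul_pow]; ring
    _ ≤ 2 * 2 ^ α * (K + K) := by
        have := hx r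
        have := hy r
        gcongr
    _ = _ := by ring

/-- An observable of norm decaying in `t` that is localized at a higher order is localized with a
constant decaying in `t`. -/
theorem Loc.interpolate {β : ℕ} {t : ℝ} (ht : 0 ≤ t) (h : Loc x (2 * α) K A)
    (hn : ‖A‖ * (1 + t) ^ (2 * β) ≤ K) : Loc x α (K * ((1 + t) ^ β)⁻¹) A := fun r => by
  have hr0 : (0 : ℝ) ≤ r := r.2
  have h1 : locErr L x r A * (1 + t) ^ (2 * β) ≤ K := by
    refine le_trans ?_ hn
    gcongr
    exact distAlg_le_norm _ _
  have h2 := h r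
  set f := locErr L x r A
  have hf : 0 ≤ f := apply_nonneg _ _
  rw [← div_eq_mul_inv, le_div_iff₀ (by positivity)]
  rw [pow_mul'] at h1 h2
  set u := (1 + (r : ℝ)) ^ α
  set v := (1 + t) ^ β
  -- The hypotheses bound `f u²` and `f v²` by `K`, so the arithmetic-geometric mean inequality
  -- bounds `f u v`. This is why both orders are doubled.
  have : u * v * 2 ≤ u ^ 2 + v ^ 2 := by nlinarith [sq_nonneg (u - v)]
  nlinarith

/-- The arithmetic-geometric mean inequality again: two separate decay rates of doubled order give
simultaneous decay in both quantities. -/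
theorem mul_le_of_mul_sq_le {u s t K : ℝ} {β : ℕ} (hu : 0 ≤ u)
    (h1 : u * (1 + s) ^ (2 * β) ≤ K) (h2 : u * (1 + t) ^ (2 * β) ≤ K) :
    u * ((1 + s) ^ β * (1 + t) ^ β) ≤ K := by
  rw [pow_mul'] at h1 h2
  nlinarith [sq_nonneg ((1 + s) ^ β - (1 + t) ^ β)]

/-- An observable localized in a ball. -/
theorem Loc.of_mem {t : ℝ} (ht : 0 ≤ t) {X : Set (EuclideanSpace ℝ (Fin d))}
    (hX : X ⊆ Metric.closedBall x t) (hA : A ∈ alg L X) : Loc x α ((1 + t) ^ α * ‖A‖) A :=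
  fun r => by
    by_cases h : (r : ℝ) ≤ t
    · have hr0 : (0 : ℝ) ≤ r := r.2
      gcongr
      exact distAlg_le_norm _ _
    · rw [locErr, distAlg_eq_zero (alg_mono (hX.trans
        (Metric.closedBall_subset_ball (not_le.1 h))) hA), mul_zero]
      exact mul_nonneg (pow_nonneg (by linarith) _) (norm_nonneg _)

/-- A ball about `y` of radius `r ≥ |x - y|` contains the ball of radius `r - |x - y|` about `x`;
for smaller `r` the norm bound suffices. -/
theorem Loc.change_center (h : Loc x α K A) (hA : A ∈ lieQ L) (y : EuclideanSpace ℝ (Fin d)) :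
    Loc y α ((1 + dist x y) ^ α * (4 * K)) A := fun r => by
  have hr0 : (0 : ℝ) ≤ r := r.2
  have hK := h.nonneg
  by_cases hr : (r : ℝ) < dist x y
  · have : locErr L y r A ≤ 4 * K := (distAlg_le_norm _ _).trans (h.norm_le hA)
    gcongr
  · set s : ℝ≥0 := ⟨r - dist x y, by linarith⟩
    have hs : (s : ℝ) = r - dist x y := rfl
    have hs0 : (0 : ℝ) ≤ s := s.2
    have h1 : locErr L y r A ≤ locErr L x s A :=
      distAlg_anti (Metric.ball_subset_ball' (by rw [hs]; linarith)) A
    have hd : 0 ≤ dist x y := dist_nonneg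
    calc (1 + (r : ℝ)) ^ α * locErr L y r A
        ≤ ((1 + dist x y) * (1 + s)) ^ α * locErr L x s A := by
          gcongr
          rw [hs] at hs0 ⊢
          nlinarith
      _ = (1 + dist x y) ^ α * ((1 + s) ^ α * locErr L x s A) := by rw [mul_pow]; ring
      _ ≤ (1 + dist x y) ^ α * (4 * K) := by
          have h2 : (1 + (s : ℝ)) ^ α * locErr L x s A ≤ 4 * K := (h s).trans (by linarith)
          gcongr

theorem mem_lieAl_of_loc (x : EuclideanSpace ℝ (Fin d)) (hA : A ∈ lieQ L)
    (h : ∀ α, ∃ K, Loc x α K A) : A ∈ lieAl L := by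
  refine ⟨hA.1, hA.2.1, (hasInfTemp_zero_iff hA.1).2 hA.2.2, fun j α => ?_⟩
  obtain ⟨K, hK⟩ := h α
  refine ⟨(1 + dist x j) ^ α * (4 * K), ?_⟩
  rintro _ ⟨r, rfl⟩
  exact hK.change_center hA j r

theorem exists_loc_of_mem_lieAl (hA : A ∈ lieAl L) (j : L.Site) (α : ℕ) :
    ∃ K, Loc (j : EuclideanSpace ℝ (Fin d)) α K A := by
  obtain ⟨K, hK⟩ := hA.2.2.2 j α
  exact ⟨K, fun r => hK ⟨r, rfl⟩⟩

theorem nonempty_site (L : SpinSystem d) : Nonempty L.Site :=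
  L.lattice.nonempty.to_subtype

theorem exists_loc (hA : A ∈ lieAl L) (x : EuclideanSpace ℝ (Fin d)) (α : ℕ) :
    ∃ K, Loc x α K A := by
  obtain ⟨j⟩ := nonempty_site L
  obtain ⟨K, hK⟩ := exists_loc_of_mem_lieAl hA j α
  exact ⟨_, hK.change_center (lieAl_le_lieQ hA) x⟩

theorem lie_mem_lieAl (hA : A ∈ lieAl L) (hB : B ∈ lieAl L) : ⁅A, B⁆ ∈ lieAl L := by
  refine mem_lieAl_of_loc 0 (lie_mem_lieQ (lieAl_le_lieQ hA) (lieAl_le_lieQ hB)) fun α => ?_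
  obtain ⟨K, hK⟩ := exists_loc hA 0 α
  obtain ⟨M, hM⟩ := exists_loc hB 0 α
  exact ⟨_, hK.lie hM (lieAl_le_lieQ hA) (lieAl_le_lieQ hB)⟩

theorem Loc.tsum {ι : Type*} {A : ι → L.Op} {K : ι → ℝ} (hs : Summable A)
    (h : ∀ i, Loc x α (K i) (A i)) (hK : ∀ S : Finset ι, ∑ i ∈ S, K i ≤ M) :
    Loc x α M (∑' i, A i) := fun r => by
  have hc : Continuous fun B : L.Op => (1 + (r : ℝ)) ^ α * locErr L x r B :=
    continuous_const.mul (Metric.continuous_infDist_pt _)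
  have := (hc.tendsto _).comp hs.hasSum
  refine le_of_tendsto this (Filter.Eventually.of_forall fun S => ?_)
  exact (Loc.sum (fun i _ => h i) r).trans (hK S)

theorem summable_of_norm_le_of_sum_le {ι : Type*} {A : ι → L.Op} {K : ι → ℝ}
    (h : ∀ i, ‖A i‖ ≤ K i) (hK : ∀ S : Finset ι, ∑ i ∈ S, K i ≤ M) : Summable A :=
  Summable.of_norm (summable_of_sum_le (fun _ => norm_nonneg _)
    fun S => (Finset.sum_le_sum fun i _ => h i).trans (hK S))

theorem tsum_mem_lieQ {ι : Type*} {A : ι → L.Op} (h : ∀ i, A i ∈ lieQ L) :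
    ∑' i, A i ∈ lieQ L := tsum_mem isClosed_lieQ h

end UAL
end

open scoped NNReal Topology
noncomputable section
namespace UAL
variable {d : ℕ} {L : SpinSystem d}

/-! ### Products of complementary conditional expectations -/

/-- `∏_{k ∈ l} (1 - E_{Γ k})`. -/
def prodCompl {ι : Type*} (Γ : ι → Finset L.Site) : List ι → L.Op → L.Op
  | [], A => A
  | k :: l, A => prodCompl Γ l A - condExp (Γ k) (prodCompl Γ l A)

section prodCompl
variable {ι : Type*} {Γ : ι → Finset L.Site} {l : List ι} {A B : L.Op}

theorem prodCompl_cons (Γ : ι → Finset L.Site) (k : ι) (l : List ι) (A : L.Op) :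
    prodCompl Γ (k :: l) A = prodCompl Γ l A - condExp (Γ k) (prodCompl Γ l A) := rfl

theorem prodCompl_mem_QL (l : List ι) (hA : A ∈ QL L) : prodCompl Γ l A ∈ QL L := by
  induction l with
  | nil => exact hA
  | cons k l ih => exact sub_mem ih (condExp_mem_QL _ ih)

theorem prodCompl_mem_lieQ (l : List ι) (hA : A ∈ lieQ L) : prodCompl Γ l A ∈ lieQ L := by
  induction l with
  | nil => exact hA
  | cons k l ih => exact sub_mem ih (condExp_mem_lieQ _ ih)

theorem prodCompl_add (l : List ι) (hA : A ∈ QL L) (hB : B ∈ QL L) :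
    prodCompl Γ l (A + B) = prodCompl Γ l A + prodCompl Γ l B := by
  induction l with
  | nil => rfl
  | cons k l ih =>
    rw [prodCompl_cons, prodCompl_cons, prodCompl_cons, ih,
      condExp_add _ (prodCompl_mem_QL l hA) (prodCompl_mem_QL l hB)]
    abel

theorem prodCompl_smul (l : List ι) (c : ℝ) (hA : A ∈ QL L) :
    prodCompl Γ l (c • A) = c • prodCompl Γ l A := by
  induction l with
  | nil => rfl
  | cons k l ih =>
    rw [prodCompl_cons, prodCompl_cons, ih, condExp_real_smul _ _ (prodCompl_mem_QL l hA), smul_sub]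

theorem condExp_prodCompl (Δ : Finset L.Site) (l : List ι) (hA : A ∈ QL L) :
    condExp Δ (prodCompl Γ l A) = prodCompl Γ l (condExp Δ A) := by
  induction l with
  | nil => rfl
  | cons k l ih =>
    have h := prodCompl_mem_QL (Γ := Γ) l hA
    rw [prodCompl_cons, prodCompl_cons, condExp_sub _ h (condExp_mem_QL _ h), condExp_comm _ _ h, ih]

open Classical in
theorem condExp_prodCompl_eq_zero {Δ : Finset L.Site} {k : ι} (hk : k ∈ l) (h : Δ ⊆ Γ k)
    (hA : A ∈ QL L) : condExp Δ (prodCompl Γ l A) = 0 := by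
  induction l with
  | nil => simp at hk
  | cons a l ih =>
    have hQ := prodCompl_mem_QL (Γ := Γ) l hA
    rw [prodCompl_cons, condExp_sub _ hQ (condExp_mem_QL _ hQ)]
    rcases List.mem_cons.1 hk with rfl | hk
    · rw [condExp_condExp _ _ hQ, Finset.inter_eq_left.2 h, sub_self]
    · rw [condExp_comm _ _ hQ, ih hk, condExp_zero, sub_self]

theorem norm_prodCompl_le (l : List ι) (hA : A ∈ QL L) :
    ‖prodCompl Γ l A‖ ≤ 2 ^ l.length * ‖A‖ := by
  induction l with
  | nil => simp [prodCompl]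
  | cons k l ih =>
    rw [prodCompl_cons, List.length_cons, pow_succ]
    have := norm_condExp_le (Γ k) (prodCompl_mem_QL (Γ := Γ) l hA)
    have := norm_sub_le (prodCompl Γ l A) (condExp (Γ k) (prodCompl Γ l A))
    linarith

theorem prodCompl_eq_self (h : ∀ k ∈ l, condExp (Γ k) A = 0) : prodCompl Γ l A = A := by
  induction l with
  | nil => rfl
  | cons k l ih =>
    rw [prodCompl_cons, ih fun k hk => h k (List.mem_cons_of_mem _ hk), h k List.mem_cons_self,
      sub_zero]

/-- Each conditional expectation is symmetric for `⟨A⋆ B⟩_∞`, so pairing `C` with `E_{Γ k} B` gives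
the pairing with `E_{Γ k} C = 0`. -/
theorem condExp_star_mul_prodCompl {C : L.Op} (hC : C ∈ QL L)
    (h : ∀ k ∈ l, condExp (Γ k) C = 0) (hA : A ∈ QL L) :
    condExp ∅ (star C * prodCompl Γ l A) = condExp ∅ (star C * A) := by
  classical
  have hC' := star_mem_QL hC
  induction l with
  | nil => rfl
  | cons k l ih =>
    have hB := prodCompl_mem_QL (Γ := Γ) l hA
    have h2 : condExp ∅ (star C * condExp (Γ k) (prodCompl Γ l A)) = 0 := by
      have hE := condExp_mem (Γ k) hB
      have hEQ := condExp_mem_QL (Γ k) hB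
      rw [condExp_empty_mul_comm hC' hEQ, ← Finset.empty_inter (Γ k),
        ← condExp_condExp _ _ (mul_mem_QL hEQ hC'), condExp_mul_left hE hC', condExp_star _ hC,
        h k List.mem_cons_self, star_zero, mul_zero, condExp_zero]
    rw [prodCompl_cons, mul_sub, condExp_sub _ (mul_mem_QL hC' hB)
      (mul_mem_QL hC' (condExp_mem_QL _ hB)), h2, sub_zero,
      ih fun k hk => h k (List.mem_cons_of_mem _ hk)]

end prodCompl

/-! ### Faces of bricks -/

/-- The brick obtained from `box n m` by cutting off the layer of unit thickness at one of its
`2d` faces. -/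
def boxCut (n m : Fin d → ℤ) (k : Fin d × Bool) : Brick d :=
  if k.2 then box (Function.update n k.1 (n k.1 + 1)) m
  else box n (Function.update m k.1 (m k.1 - 1))

theorem mem_boxCut_true {n m : Fin d → ℤ} {i : Fin d} {x : EuclideanSpace ℝ (Fin d)} :
    x ∈ (boxCut n m (i, true)).1 ↔ x ∈ (box n m).1 ∧ (n i : ℝ) + 1 ≤ x i := by
  simp only [boxCut, if_true, mem_box]
  constructor
  · refine fun h => ⟨fun j => ?_, by simpa using (h i).1⟩
    have := h j
    by_cases hj : j = i
    · subst hj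
      simp only [Function.update_self, Int.cast_add, Int.cast_one] at this
      exact ⟨by linarith, this.2⟩
    · simpa [Function.update_of_ne hj] using this
  · rintro ⟨h, h'⟩ j
    by_cases hj : j = i
    · subst hj
      simp only [Function.update_self, Int.cast_add, Int.cast_one]
      exact ⟨h', (h j).2⟩
    · simpa [Function.update_of_ne hj] using h j

theorem mem_boxCut_false {n m : Fin d → ℤ} {i : Fin d} {x : EuclideanSpace ℝ (Fin d)} :
    x ∈ (boxCut n m (i, false)).1 ↔ x ∈ (box n m).1 ∧ x i < (m i : ℝ) - 1 := by
  simp only [boxCut, mem_box]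
  constructor
  · refine fun h => ⟨fun j => ?_, by simpa using (h i).2⟩
    by_cases hj : j = i
    · subst hj
      have := h j
      simp only [Function.update_self, Int.cast_sub, Int.cast_one] at this
      exact ⟨this.1, by linarith⟩
    · simpa [Function.update_of_ne hj] using h j
  · rintro ⟨h, h'⟩ 
    simp only [Bool.false_eq_true, if_false, mem_box]
    intro j
    by_cases hj : j = i
    · subst hj
      simp only [Function.update_self, Int.cast_sub, Int.cast_one]
      exact ⟨(h j).1, h'⟩
    · simpa [Function.update_of_ne hj] using h j

theorem boxCut_subset (n m : Fin d → ℤ) (k : Fin d × Bool) : (boxCut n m k).1 ⊆ (box n m).1 := by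
  obtain ⟨i, b⟩ := k
  cases b
  · exact fun x hx => (mem_boxCut_false.1 hx).1
  · exact fun x hx => (mem_boxCut_true.1 hx).1

theorem boxCut_ssubset {n m : Fin d → ℤ} (h : ∀ i, n i < m i) (k : Fin d × Bool) :
    (boxCut n m k).1 ⊂ (box n m).1 := by
  refine ⟨boxCut_subset n m k, fun H => ?_⟩
  obtain ⟨i, b⟩ := k
  have hn : ∀ k, (n k : ℝ) + 1 ≤ m k := fun k => by exact_mod_cast h k
  cases b
  · have hq : (WithLp.toLp 2 fun i => (m i : ℝ) - 1 : EuclideanSpace ℝ (Fin d)) ∈ (box n m).1 :=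
      mem_box.2 fun j => by have := hn j; constructor <;> simp only <;> linarith
    have := (mem_boxCut_false.1 (H hq)).2
    simp only at this
    linarith
  · have hq : (WithLp.toLp 2 fun i => (n i : ℝ) : EuclideanSpace ℝ (Fin d)) ∈ (box n m).1 :=
      mem_box.2 fun j => by have := hn j; constructor <;> simp only <;> linarith
    have := (mem_boxCut_true.1 (H hq)).2
    simp only at this
    linarith

/-- A brick that does not contain a given brick meets it within one of its cuts. -/
theorem inter_subset_boxCut {n m : Fin d → ℤ} (Z : Brick d)
    (hZ : ¬ (box n m).1 ⊆ Z.1) : (Z.1 ∩ (box n m).1 = ∅) ∨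
      ∃ k, Z.1 ∩ (box n m).1 ⊆ (boxCut n m k).1 := by
  rcases Z.cases with h0 | ⟨n', m', -, rfl⟩
  · left; rw [h0, Set.empty_inter]
  · right
    by_contra! H
    refine hZ fun x hx => mem_box.2 fun i => ⟨?_, ?_⟩
    · obtain ⟨y, ⟨hy, hy'⟩, hy''⟩ := Set.not_subset.1 (H (i, true))
      rw [mem_boxCut_true, not_and] at hy''
      have h1 := not_le.1 (hy'' hy')
      have h2 := (mem_box.1 hy i).1
      have h3 : (n' i : ℝ) < n i + 1 := h2.trans_lt h1
      have h4 : n' i < n i + 1 := by exact_mod_cast h3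
      have h5 : (n' i : ℝ) ≤ n i := by exact_mod_cast Int.lt_add_one_iff.1 h4
      exact h5.trans (mem_box.1 hx i).1
    · obtain ⟨y, ⟨hy, hy'⟩, hy''⟩ := Set.not_subset.1 (H (i, false))
      rw [mem_boxCut_false, not_and] at hy''
      have h1 := not_lt.1 (hy'' hy')
      have h2 := (mem_box.1 hy i).2
      have h3 : (m i : ℝ) - 1 < m' i := h1.trans_lt h2
      have h4 : m i - 1 < m' i := by exact_mod_cast h3
      have h5 : (m i : ℝ) ≤ m' i := by
        have : m i ≤ m' i := by omega
        exact_mod_cast this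
      exact (mem_box.1 hx i).2.trans_le h5

/-- A brick all of whose boundary layers meet a ball is contained in a slightly larger ball. -/
theorem box_subset_closedBall {n m : Fin d → ℤ} {x : EuclideanSpace ℝ (Fin d)} {r : ℝ} (hr : 0 ≤ r)
    (h : ∀ k, ¬ Metric.ball x r ∩ (box n m).1 ⊆ (boxCut n m k).1) :
    (box n m).1 ⊆ Metric.closedBall x (d * (r + 1)) := by
  intro z hz
  refine dist_le_of_coord (by linarith) fun i => ?_
  obtain ⟨y, ⟨hy1, hy2⟩, hy3⟩ := Set.not_subset.1 (h (i, true))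
  obtain ⟨w, ⟨hw1, hw2⟩, hw3⟩ := Set.not_subset.1 (h (i, false))
  rw [mem_boxCut_true, not_and] at hy3
  rw [mem_boxCut_false, not_and] at hw3
  have a1 := not_le.1 (hy3 hy2)
  have a2 := not_lt.1 (hw3 hw2)
  have b1 := abs_le.1 ((abs_coord_sub_le y x i).trans (Metric.mem_ball.1 hy1).le)
  have b2 := abs_le.1 ((abs_coord_sub_le w x i).trans (Metric.mem_ball.1 hw1).le)
  have c := mem_box.1 hz i
  rw [abs_le]
  constructor <;> linarith

/-! ### Brick components -/

theorem sites_mono {X Y : Set (EuclideanSpace ℝ (Fin d))} (hY : Bornology.IsBounded Y)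
    (h : X ⊆ Y) : sites L X ⊆ sites L Y := fun _ hj =>
  (mem_sites hY).2 (h ((mem_sites (hY.subset h)).1 hj))

open Classical in
theorem sites_inter_subset {X Y Z : Set (EuclideanSpace ℝ (Fin d))} (hX : Bornology.IsBounded X)
    (hY : Bornology.IsBounded Y) (hZ : Bornology.IsBounded Z) (h : X ∩ Y ⊆ Z) :
    sites L X ∩ sites L Y ⊆ sites L Z := fun j hj => by
  rw [Finset.mem_inter, mem_sites hX, mem_sites hY] at hj
  exact (mem_sites hZ).2 (h hj)

/-- The orthogonal projection onto `𝔡^Y`, for `Y = box n m`. -/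
def boxProj (n m : Fin d → ℤ) (A : L.Op) : L.Op :=
  condExp (sites L (box n m).1) (prodCompl (fun k => sites L (boxCut n m k).1)
    (Finset.univ : Finset (Fin d × Bool)).toList A)

theorem boxProj_mem_lieQ (n m : Fin d → ℤ) {A : L.Op} (hA : A ∈ lieQ L) :
    boxProj n m A ∈ lieQ L := condExp_mem_lieQ _ (prodCompl_mem_lieQ _ hA)

theorem norm_boxProj_le (n m : Fin d → ℤ) {A : L.Op} (hA : A ∈ QL L) :
    ‖boxProj n m A‖ ≤ 4 ^ d * ‖A‖ := by
  refine (norm_condExp_le _ (prodCompl_mem_QL _ hA)).trans ((norm_prodCompl_le _ hA).trans_eq ?_)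
  congr 1
  rw [Finset.length_toList, Finset.card_univ, Fintype.card_prod, Fintype.card_fin,
    Fintype.card_bool, mul_comm, pow_mul]
  norm_num

/-- `E_X` combined with the leading `E_Y` of the projection is `E_{X ∩ Y}`, which the factor `1 - E`
of the corresponding face annihilates. -/
theorem condExp_boxProj {n m : Fin d → ℤ} {X : Set (EuclideanSpace ℝ (Fin d))}
    (hX : Bornology.IsBounded X) {k : Fin d × Bool}
    (h : X ∩ (box n m).1 ⊆ (boxCut n m k).1) {A : L.Op} (hA : A ∈ QL L) :
    condExp (sites L X) (boxProj n m A) = 0 := by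
  classical
  rw [boxProj, condExp_condExp _ _ (prodCompl_mem_QL _ hA)]
  exact condExp_prodCompl_eq_zero (k := k) (by simp)
    (sites_inter_subset hX (Brick.isBounded _) (Brick.isBounded _) h) hA

theorem boxProj_condExp {n m : Fin d → ℤ} {X : Set (EuclideanSpace ℝ (Fin d))}
    (hX : Bornology.IsBounded X) {k : Fin d × Bool}
    (h : X ∩ (box n m).1 ⊆ (boxCut n m k).1) {A : L.Op} (hA : A ∈ QL L) :
    boxProj n m (condExp (sites L X) A) = 0 := by
  rw [← condExp_boxProj hX h hA, boxProj, boxProj, ← condExp_prodCompl _ _ hA,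
    condExp_comm _ _ (prodCompl_mem_QL _ hA)]

theorem brickSpace_alg {Y : Brick d} {A : L.Op} (hA : A ∈ brickSpace L Y) : A ∈ alg L Y.1 :=
  (mem_lieLoc_iff.1 hA.1).1

theorem brickSpace_lieQ {Y : Brick d} {A : L.Op} (hA : A ∈ brickSpace L Y) : A ∈ lieQ L :=
  (mem_lieLoc_iff.1 hA.1).2

theorem eq_zero_of_mem_alg_empty {A : L.Op} (hA : A ∈ alg L ∅) (h : A ∈ lieQ L) : A = 0 := by
  rw [alg_eq_algFin Bornology.isBounded_empty, sites_empty] at hA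
  rw [← condExp_eq_self hA, h.2.2]

/-- The projection `D` of `C` to a cut is itself a traceless observable of a smaller brick, so it is
orthogonal to `C`. But `⟨D⋆ C⟩ = ⟨D⋆ D⟩`, and the trace is faithful. -/
theorem brickSpace_condExp {n m : Fin d → ℤ} (h : ∀ i, n i < m i) {C : L.Op}
    (hC : C ∈ brickSpace L (box n m)) (k : Fin d × Bool) :
    condExp (sites L (boxCut n m k).1) C = 0 := by
  classical
  have hCq := brickSpace_lieQ hC
  set Γ := sites L (boxCut n m k).1
  set D := condExp Γ C with hD
  have hDm : D ∈ algFin Γ := condExp_mem Γ hCq.1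
  have hDl : D ∈ lieLoc L (boxCut n m k).1 := mem_lieLoc_iff.2
    ⟨by rw [alg_eq_algFin (Brick.isBounded _)]; exact hDm, condExp_mem_lieQ _ hCq⟩
  have h1 := hC.2 _ (boxCut_ssubset h k) D hDl
  rw [hasInfTemp_zero_iff (mul_mem_QL (star_mem_QL (algFin_le_QL Γ hDm)) hCq.1)] at h1
  refine eq_zero_of_condExp_star_mul_self hDm ?_
  conv_lhs => enter [2, 2]; rw [hD]
  rw [← condExp_mul_left (star_mem_algFin hDm) hCq.1,
    condExp_condExp _ _ (mul_mem_QL (star_mem_QL (algFin_le_QL Γ hDm)) hCq.1), Finset.empty_inter, h1]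

/-- A proper subbrick `Z` is empty or lies in one of the `2d` cuts, so `E_Z` kills the image of the
projection, which is thus orthogonal to `𝔡_Z`. -/
theorem boxProj_mem (n m : Fin d → ℤ) {A : L.Op} (hA : A ∈ lieQ L) :
    boxProj n m A ∈ brickSpace L (box n m) := by
  classical
  have hq := boxProj_mem_lieQ n m hA
  refine ⟨mem_lieLoc_iff.2 ⟨condExp_sites_mem (Brick.isBounded _) (prodCompl_mem_QL _ hA.1), hq⟩,
    fun Z hZ C hC => ?_⟩
  obtain ⟨hC, hCq⟩ := mem_lieLoc_iff.1 hC
  rw [hasInfTemp_zero_iff (mul_mem_QL (star_mem_QL hCq.1) hq.1)]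
  rcases inter_subset_boxCut Z hZ.2 with h0 | ⟨k, hk⟩
  · rw [Set.inter_eq_left.2 hZ.1] at h0
    rw [h0] at hC
    rw [eq_zero_of_mem_alg_empty hC hCq, star_zero, zero_mul]
    exact condExp_zero _
  · have h1 : condExp (sites L Z.1) (boxProj n m A) = 0 :=
      condExp_boxProj Z.isBounded hk hA.1
    rw [alg_eq_algFin Z.isBounded] at hC
    rw [← Finset.empty_inter (sites L Z.1), ← condExp_condExp _ _
      (mul_mem_QL (star_mem_QL hCq.1) hq.1), condExp_mul_left (star_mem_algFin hC) hq.1, h1,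
      mul_zero]
    exact condExp_zero _

/-- Uniqueness of the orthogonal projection, by faithfulness of the trace. It frees the choice-based
`brickComp` from the choice. -/
theorem brickComp_eq_of {Y : Brick d} {A B : L.Op} (hA : A ∈ lieQ L) (hB : B ∈ brickSpace L Y)
    (h : ∀ C ∈ brickSpace L Y, condExp ∅ (star C * (A - B)) = 0) : brickComp Y A = B := by
  have hm : ∀ {B C}, B ∈ brickSpace L Y → C ∈ brickSpace L Y → star C * (A - B) ∈ QL L :=
    fun hB hC => mul_mem_QL (star_mem_QL (brickSpace_lieQ hC).1) (sub_mem hA.1 (brickSpace_lieQ hB).1)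
  have hex : ∃ B ∈ brickSpace L Y, ∀ C ∈ brickSpace L Y, HasInfTemp (star C * (A - B)) 0 :=
    ⟨B, hB, fun C hC => (hasInfTemp_zero_iff (hm hB hC)).2 (h C hC)⟩
  rw [brickComp, dif_pos hex]
  obtain ⟨h1, h2⟩ := hex.choose_spec
  set D := hex.choose
  have h3 : D - B ∈ brickSpace L Y := sub_mem h1 hB
  have h4 := h _ h3
  have h5 := (hasInfTemp_zero_iff (hm h1 h3)).1 (h2 _ h3)
  have h6 : condExp ∅ (star (D - B) * (D - B)) = 0 := by
    have : star (D - B) * (D - B) = star (D - B) * (A - B) - star (D - B) * (A - D) := by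
      noncomm_ring
    rw [this, condExp_sub _ (hm hB h3) (hm h1 h3), h4, h5, sub_zero]
  have h7 := brickSpace_alg h3
  rw [alg_eq_algFin Y.isBounded] at h7
  exact sub_eq_zero.1 (eq_zero_of_condExp_star_mul_self h7 h6)

/-- Elements of `𝔡^Y` are fixed by `E_Y` and killed by the expectations of the cuts, so pairing with
them does not see the difference between `A` and its explicit projection. From here on linearity,
continuity and norm bounds are read off from conditional expectations. -/
theorem brickComp_box {n m : Fin d → ℤ} (h : ∀ i, n i < m i) {A : L.Op} (hA : A ∈ lieQ L) :
    brickComp (box n m) A = boxProj n m A := by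
  classical
  refine brickComp_eq_of hA (boxProj_mem n m hA) fun C hC => ?_
  have hCq := brickSpace_lieQ hC
  have hCa := brickSpace_alg hC
  rw [alg_eq_algFin (Brick.isBounded _)] at hCa
  have hs := star_mem_QL hCq.1
  have hB := prodCompl_mem_QL (Γ := fun k => sites L (boxCut n m k).1)
    (Finset.univ : Finset (Fin d × Bool)).toList hA.1
  rw [mul_sub, condExp_sub _ (mul_mem_QL hs hA.1) (mul_mem_QL hs (boxProj_mem_lieQ n m hA).1),
    sub_eq_zero, ← condExp_star_mul_prodCompl (l := Finset.univ.toList) hCq.1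
      (fun k _ => brickSpace_condExp h hC k) hA.1, boxProj,
    ← condExp_mul_left (star_mem_algFin hCa) hB,
    condExp_condExp _ _ (mul_mem_QL hs hB), Finset.empty_inter]

theorem brickSpace_empty {Y : Brick d} (hY : Y.1 = ∅) {A : L.Op} (hA : A ∈ brickSpace L Y) :
    A = 0 :=
  eq_zero_of_mem_alg_empty (hY ▸ brickSpace_alg hA) (brickSpace_lieQ hA)

theorem brickComp_empty {Y : Brick d} (hY : Y.1 = ∅) {A : L.Op} (hA : A ∈ lieQ L) :
    brickComp Y A = 0 :=
  brickComp_eq_of hA (zero_mem _) fun C hC => by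
    rw [brickSpace_empty hY hC, star_zero, zero_mul]
    exact condExp_zero _

theorem brickComp_mem (Y : Brick d) {A : L.Op} (hA : A ∈ lieQ L) :
    brickComp Y A ∈ brickSpace L Y := by
  rcases Y.cases with h | ⟨n, m, h, rfl⟩
  · rw [brickComp_empty h hA]; exact zero_mem _
  · rw [brickComp_box h hA]; exact boxProj_mem n m hA

theorem brickComp_alg (Y : Brick d) {A : L.Op} (hA : A ∈ lieQ L) : brickComp Y A ∈ alg L Y.1 :=
  brickSpace_alg (brickComp_mem Y hA)

theorem norm_brickComp_le (Y : Brick d) {A : L.Op} (hA : A ∈ lieQ L) :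
    ‖brickComp Y A‖ ≤ 4 ^ d * ‖A‖ := by
  rcases Y.cases with h | ⟨n, m, h, rfl⟩
  · rw [brickComp_empty h hA, norm_zero]; positivity
  · rw [brickComp_box h hA]; exact norm_boxProj_le n m hA.1

theorem brickComp_add (Y : Brick d) {A B : L.Op} (hA : A ∈ lieQ L) (hB : B ∈ lieQ L) :
    brickComp Y (A + B) = brickComp Y A + brickComp Y B := by
  rcases Y.cases with h | ⟨n, m, h, rfl⟩
  · rw [brickComp_empty h hA, brickComp_empty h hB, brickComp_empty h (add_mem hA hB), add_zero]
  · rw [brickComp_box h hA, brickComp_box h hB, brickComp_box h (add_mem hA hB)]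
    rw [boxProj, prodCompl_add _ hA.1 hB.1, condExp_add _ (prodCompl_mem_QL _ hA.1)
      (prodCompl_mem_QL _ hB.1)]
    rfl

theorem brickComp_smul (Y : Brick d) (c : ℝ) {A : L.Op} (hA : A ∈ lieQ L) :
    brickComp Y (c • A) = c • brickComp Y A := by
  rcases Y.cases with h | ⟨n, m, h, rfl⟩
  · rw [brickComp_empty h hA, brickComp_empty h (Submodule.smul_mem _ c hA), smul_zero]
  · rw [brickComp_box h hA, brickComp_box h (Submodule.smul_mem _ c hA)]
    rw [boxProj, prodCompl_smul _ _ hA.1, condExp_real_smul _ _ (prodCompl_mem_QL _ hA.1)]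
    rfl

/-- `A ↦ A^Y` as a linear map. -/
def brickL (Y : Brick d) : lieQ L →ₗ[ℝ] L.Op where
  toFun A := brickComp Y A
  map_add' A B := brickComp_add Y A.2 B.2
  map_smul' c A := brickComp_smul Y c A.2

theorem continuous_brickL (Y : Brick d) : Continuous (brickL (L := L) Y) :=
  AddMonoidHomClass.continuous_of_bound (brickL Y) (4 ^ d) fun A => norm_brickComp_le Y A.2

theorem hasSum_lieQ {ι : Type*} {f : ι → L.Op} {S : L.Op} (h : HasSum f S)
    (hf : ∀ i, f i ∈ lieQ L) : ∃ hS : S ∈ lieQ L,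
      HasSum (fun i => (⟨f i, hf i⟩ : lieQ L)) ⟨S, hS⟩ := by
  have hS : S ∈ lieQ L := h.tsum_eq ▸ tsum_mem_lieQ hf
  refine ⟨hS, ?_⟩
  exact (Topology.IsInducing.subtypeVal (t := (lieQ L : Set L.Op))).hasSum_iff
    (g := (lieQ L).subtype) _ _ |>.1 h

theorem hasSum_brickComp (Y : Brick d) {ι : Type*} {f : ι → L.Op} {S : L.Op} (h : HasSum f S)
    (hf : ∀ i, f i ∈ lieQ L) : HasSum (fun i => brickComp Y (f i)) (brickComp Y S) := by
  obtain ⟨hS, h'⟩ := hasSum_lieQ h hf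
  exact h'.map (brickL Y) (continuous_brickL Y)

theorem brickComp_zero (Y : Brick d) : brickComp Y (0 : L.Op) = 0 := by
  simpa using brickComp_smul (L := L) Y 0 (zero_mem _)

theorem brickComp_neg (Y : Brick d) {A : L.Op} (hA : A ∈ lieQ L) :
    brickComp Y (-A) = -brickComp Y A := by
  simpa using brickComp_smul Y (-1) hA

theorem brickComp_sub (Y : Brick d) {A B : L.Op} (hA : A ∈ lieQ L) (hB : B ∈ lieQ L) :
    brickComp Y (A - B) = brickComp Y A - brickComp Y B := by
  rw [sub_eq_add_neg, brickComp_add Y hA (neg_mem hB), brickComp_neg Y hB, sub_eq_add_neg]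

theorem brickComp_self {Y : Brick d} {A : L.Op} (hA : A ∈ brickSpace L Y) : brickComp Y A = A :=
  brickComp_eq_of (brickSpace_lieQ hA) hA fun C _ => by
    rw [sub_self, mul_zero]
    exact condExp_zero _

/-- An observable supported in `X` has no component in bricks that have a layer outside `X`. -/
theorem brickComp_eq_zero {n m : Fin d → ℤ} (h : ∀ i, n i < m i)
    {X : Set (EuclideanSpace ℝ (Fin d))} (hX : Bornology.IsBounded X) {k : Fin d × Bool}
    (hk : X ∩ (box n m).1 ⊆ (boxCut n m k).1) {A : L.Op} (hA : A ∈ lieQ L) (hAX : A ∈ alg L X) :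
    brickComp (box n m) A = 0 := by
  rw [brickComp_box h hA]
  rw [alg_eq_algFin hX] at hAX
  rw [← condExp_eq_self hAX]
  exact boxProj_condExp hX hk hA.1

/-- If the brick `Z` is properly contained in `Y`, it is empty or lies in a cut of `Y`, and `E_Z A =
0`. If `Z` is not contained in `Y`, then `Y` misses `Z` or meets it within a cut of `Z`, and that
face's factor kills `A`. -/
theorem brickComp_of_ne {Y Z : Brick d} (hYZ : Z ≠ Y) {A : L.Op} (hA : A ∈ brickSpace L Y) :
    brickComp Z A = 0 := by
  have hAq := brickSpace_lieQ hA
  rcases Z.cases with h0 | ⟨n, m, h, rfl⟩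
  · exact brickComp_empty h0 hAq
  by_cases hs : (box n m).1 ⊆ Y.1
  · rcases Y.cases with h0 | ⟨n', m', h', rfl⟩
    · rw [brickSpace_empty h0 hA, brickComp_zero]
    · have hne : ¬ (box n' m').1 ⊆ (box n m).1 := fun H => hYZ (Subtype.ext (hs.antisymm H))
      have hE : condExp (sites L (box n m).1) A = 0 := by
        rcases inter_subset_boxCut _ hne with h1 | ⟨k, hk⟩
        · rw [Set.inter_eq_left.2 hs] at h1
          rw [h1, sites_empty, hAq.2.2]
        · classical
          rw [Set.inter_eq_left.2 hs] at hk
          rw [← Finset.inter_eq_left.2 (sites_mono (Brick.isBounded _) hk),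
            ← condExp_condExp _ _ hAq.1, brickSpace_condExp h' hA]
          exact condExp_zero _
      rw [brickComp_box h hAq]
      rw [boxProj, condExp_prodCompl _ _ hAq.1, hE, prodCompl_eq_self fun k _ => condExp_zero _]
  · rcases inter_subset_boxCut Y hs with h1 | ⟨k, hk⟩
    -- For an empty intersection any face of `Z` serves, provided there is one. In dimension zero a
    -- nonempty brick is the whole one-point space, so only an empty `Y` is left.
    · by_cases hd : Nonempty (Fin d)
      · obtain ⟨i⟩ := hd
        exact brickComp_eq_zero h Y.isBounded (k := (i, true)) (by rw [h1]; exact Set.empty_subset _)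
          hAq (brickSpace_alg hA)
      · rcases Y.cases with h0 | ⟨n', m', h', rfl⟩
        · rw [brickSpace_empty h0 hA, brickComp_zero]
        · exact (hs fun x _ => mem_box.2 fun i => (hd ⟨i⟩).elim).elim
    · exact brickComp_eq_zero h Y.isBounded hk hAq (brickSpace_alg hA)

/-! ### Brick components determine an observable -/

theorem condExp_box_eq_zero {A : L.Op} (hA : A ∈ lieQ L) (h0 : ∀ Y : Brick d, brickComp Y A = 0)
    (n m : Fin d → ℤ) : condExp (sites L (box n m).1) A = 0 := by
  -- Induction on the total side length, since a cut shortens one side by one. Once all cuts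
  -- annihilate `A`, every factor `1 - E` acts trivially, and the vanishing component is `E_Y A`
  -- itself.
  generalize hN : ∑ i, (m i - n i).toNat = N
  induction N using Nat.strong_induction_on generalizing n m with
  | _ N ih =>
    rcases (box n m).cases with he | ⟨n', m', h, hb⟩
    · rw [he, sites_empty, hA.2.2]
    by_cases h : ∀ i, n i < m i
    · have h1 : ∀ k, condExp (sites L (boxCut n m k).1) A = 0 := by
        rintro ⟨i, b⟩
        have hlt : ∀ n' m' : Fin d → ℤ, (∀ j, (m' j - n' j).toNat ≤ (m j - n j).toNat) →
            (m' i - n' i).toNat < (m i - n i).toNat → ∑ i, (m' i - n' i).toNat < N := by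
          intro n' m' h1 h2
          rw [← hN]
          exact Finset.sum_lt_sum (fun j _ => h1 j) ⟨i, Finset.mem_univ i, h2⟩
        have hi := h i
        cases b
        · refine ih _ (hlt n (Function.update m i (m i - 1)) (fun j => ?_) ?_) _ _ rfl
          · by_cases hj : j = i
            · subst hj; simp only [Function.update_self]; omega
            · rw [Function.update_of_ne hj]
          · simp only [Function.update_self]; omega
        · refine ih _ (hlt (Function.update n i (n i + 1)) m (fun j => ?_) ?_) _ _ rfl
          · by_cases hj : j = i
            · subst hj; simp only [Function.update_self]; omega
            · rw [Function.update_of_ne hj]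
          · simp only [Function.update_self]; omega
      have h2 := h0 (box n m)
      rw [brickComp_box h hA, boxProj, prodCompl_eq_self fun k _ => h1 k] at h2
      exact h2
    · push Not at h
      obtain ⟨i, hi⟩ := h
      have : (box n m).1 = ∅ := by
        ext x
        simp only [Set.mem_empty_iff_false, iff_false]
        intro H
        have h1 : (n i : ℝ) < m i := (mem_box.1 H i).1.trans_lt (mem_box.1 H i).2
        exact absurd (by exact_mod_cast h1 : n i < m i) (not_lt.2 hi)
      rw [this, sites_empty, hA.2.2]

/-- `A` is approximated by observables of large boxes, and its expectations on all boxes vanish, so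
its norm is at most twice an arbitrarily small error. -/
theorem eq_zero_of_brickComp {A : L.Op} (hA : A ∈ lieQ L)
    (h0 : ∀ Y : Brick d, brickComp Y A = 0) : A = 0 := by
  rw [← norm_eq_zero]
  refine le_antisymm (le_of_forall_pos_le_add fun ε hε => ?_) (norm_nonneg _)
  obtain ⟨B, hB, hd⟩ := Metric.mem_closure_iff.1 (show A ∈ closure (alg L Set.univ : Set L.Op)
    from hA.1) (ε / 2) (by positivity)
  obtain ⟨Γ, -, hB⟩ := mem_alg.1 hB
  obtain ⟨N, hN⟩ : ∃ N : ℕ, ∀ j ∈ Γ, (j : EuclideanSpace ℝ (Fin d)) ∈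
      (box (fun _ : Fin d => -(N : ℤ)) fun _ => (N : ℤ)).1 := by
    obtain ⟨R, hR⟩ := (Γ.finite_toSet.image
      (Subtype.val : L.Site → EuclideanSpace ℝ (Fin d))).isBounded.subset_closedBall 0
    obtain ⟨N, hN⟩ := exists_nat_gt R
    refine ⟨N, fun j hj => mem_box.2 fun i => ?_⟩
    have h1 : dist (j : EuclideanSpace ℝ (Fin d)) 0 ≤ R := hR (Set.mem_image_of_mem _ hj)
    have h2 := abs_le.1 ((abs_coord_sub_le (j : EuclideanSpace ℝ (Fin d)) 0 i).trans h1)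
    simp only [PiLp.zero_apply, sub_zero] at h2
    push_cast
    constructor <;> linarith
  set Y := box (fun _ : Fin d => -(N : ℤ)) fun _ => (N : ℤ)
  have hB' : B ∈ alg L Y.1 := mem_alg.2 ⟨Γ, hN, hB⟩
  have h1 := norm_sub_condExp_le Y.isBounded hA.1
  rw [condExp_box_eq_zero hA h0, sub_zero] at h1
  have h2 := distAlg_le_norm_sub (A := A) hB'
  rw [← dist_eq_norm] at h2
  linarith

/-! ### Decay of brick components -/

/-- The constant in the decay estimate for brick components. -/
def brickConst (d α : ℕ) : ℝ := 4 ^ d * 4 * (2 * (d + 1)) ^ α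

theorem brickConst_pos (d α : ℕ) : 0 < brickConst d α := by unfold brickConst; positivity

theorem brickComp_decay {x : EuclideanSpace ℝ (Fin d)} {α : ℕ} {K t : ℝ} {A : L.Op} {Y : Brick d}
    (h : Loc x α K A) (hA : A ∈ lieQ L) (ht : 0 ≤ t)
    (hY : ∀ s < t, ¬ Y.1 ⊆ Metric.closedBall x s) :
    ‖brickComp Y A‖ * (1 + t) ^ α ≤ brickConst d α * K := by
  have hK := h.nonneg
  have hd : (0 : ℝ) ≤ d := Nat.cast_nonneg d
  rcases Y.cases with h0 | ⟨n, m, hnm, rfl⟩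
  · rw [brickComp_empty h0 hA, norm_zero, zero_mul]
    have := brickConst_pos d α
    positivity
  by_cases htc : t < d + 1
  · calc ‖brickComp (box n m) A‖ * (1 + t) ^ α ≤ (4 ^ d * (4 * K)) * (2 * (d + 1)) ^ α := by
          have := norm_brickComp_le (box n m) hA
          have := h.norm_le hA
          gcongr
          · exact (norm_brickComp_le _ hA).trans (by gcongr)
          · linarith
      _ = _ := by unfold brickConst; ring
  · push Not at htc
    -- With this radius `d (r + 1) = d t/(d + 1) < t`, so the brick is not contained in the ball of
    -- `box_subset_closedBall` and some face layer must miss the ball of radius `r`. The part of `A`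
    -- supported in that ball then has no component in the brick, which leaves only the localization
    -- error at scale `r`, comparable to `t`.
    obtain ⟨r, hr⟩ : ∃ r : ℝ≥0, (r : ℝ) = t / (d + 1) - 1 := ⟨⟨t / (d + 1) - 1, by
      rw [sub_nonneg, le_div_iff₀ (by positivity)]; linarith⟩, rfl⟩
    have hr1 : 1 + (r : ℝ) = t / (d + 1) := by rw [hr]; ring
    have hex : ∃ k, Metric.ball x r ∩ (box n m).1 ⊆ (boxCut n m k).1 := by
      by_contra! H
      refine hY _ ?_ (box_subset_closedBall r.coe_nonneg H)
      rw [add_comm (r : ℝ) 1, hr1, mul_div_assoc', div_lt_iff₀ (by positivity)]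
      nlinarith
    obtain ⟨k, hk⟩ := hex
    set B := condExp (sites L (Metric.ball x r)) A
    have hB : B ∈ lieQ L := condExp_mem_lieQ _ hA
    have h1 : brickComp (box n m) A = brickComp (box n m) (A - B) := by
      rw [brickComp_sub _ hA hB, brickComp_eq_zero hnm Metric.isBounded_ball hk hB
        (condExp_sites_mem Metric.isBounded_ball hA.1), sub_zero]
    have h2 : ‖A - B‖ ≤ 2 * locErr L x r A := norm_sub_condExp_le Metric.isBounded_ball hA.1
    have h3 := h r
    have hle : 1 + t ≤ (2 * (d + 1)) * (1 + (r : ℝ)) := by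
      rw [hr1, mul_assoc, mul_div_cancel₀ _ (by positivity)]; linarith
    calc ‖brickComp (box n m) A‖ * (1 + t) ^ α
        ≤ (4 ^ d * (2 * locErr L x r A)) * ((2 * (d + 1)) * (1 + (r : ℝ))) ^ α := by
          have e1 : 0 ≤ locErr L x r A := apply_nonneg _ _
          gcongr
          rw [h1]
          exact (norm_brickComp_le _ (sub_mem hA hB)).trans (by gcongr)
      _ = 4 ^ d * 2 * (2 * (d + 1)) ^ α * ((1 + (r : ℝ)) ^ α * locErr L x r A) := by
          rw [mul_pow]; ring
      _ ≤ 4 ^ d * 4 * (2 * (d + 1)) ^ α * K := by gcongr; norm_num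
      _ = _ := rfl

theorem brickComp_decay_dist {x y : EuclideanSpace ℝ (Fin d)} {α : ℕ} {K : ℝ} {A : L.Op}
    {Y : Brick d} (h : Loc x α K A) (hA : A ∈ lieQ L) (hy : y ∈ Y.1) :
    ‖brickComp Y A‖ * (1 + dist y x) ^ α ≤ brickConst d α * K :=
  brickComp_decay h hA dist_nonneg fun _ hs H => absurd (H hy) (not_le.2 hs)

theorem brickComp_decay_diam {x : EuclideanSpace ℝ (Fin d)} {α : ℕ} {K : ℝ} {A : L.Op}
    (Y : Brick d) (h : Loc x α K A) (hA : A ∈ lieQ L) :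
    ‖brickComp Y A‖ * (1 + Metric.diam Y.1) ^ α ≤ 2 ^ α * (brickConst d α * K) := by
  have hD : 0 ≤ Metric.diam Y.1 := Metric.diam_nonneg
  rcases Y.1.eq_empty_or_nonempty with h0 | ⟨y, hy⟩
  · rw [brickComp_empty h0 hA, norm_zero, zero_mul]
    have := brickConst_pos d α
    have := h.nonneg
    positivity
  -- A ball of radius `s` has diameter at most `2s`, so a brick fits in no ball of radius less than
  -- half its diameter.
  have h1 := brickComp_decay (Y := Y) h hA (t := Metric.diam Y.1 / 2) (by positivity)
    fun s hs H => by
      have h0 : 0 ≤ s := dist_nonneg.trans (H hy)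
      have := Metric.diam_mono H Metric.isBounded_closedBall
      have := Metric.diam_closedBall (x := x) h0
      linarith
  calc ‖brickComp Y A‖ * (1 + Metric.diam Y.1) ^ α
      ≤ ‖brickComp Y A‖ * (2 * (1 + Metric.diam Y.1 / 2)) ^ α := by gcongr; linarith
    _ = 2 ^ α * (‖brickComp Y A‖ * (1 + Metric.diam Y.1 / 2) ^ α) := by rw [mul_pow]; ring
    _ ≤ _ := by gcongr

end UAL
end

open scoped NNReal Topology
noncomputable section
namespace UAL

/-! ### Products of skew-symmetric functions -/

section wedge
variable {X V V₁ V₂ V₃ : Type*} [AddCommGroup V] [AddCommGroup V₁] [AddCommGroup V₂]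
  [AddCommGroup V₃] [Module ℝ V₁] [Module ℝ V₂] [Module ℝ V₃]

/-- Skew-symmetric functions of `m` variables. -/
def IsSkew {m : ℕ} (f : (Fin m → X) → V) : Prop :=
  ∀ (σ : Equiv.Perm (Fin m)) j, f (j ∘ σ) = (Equiv.Perm.sign σ : ℤ) • f j

/-- Fixing the first variable (zero if there are no variables). -/
def contr (x : X) : ∀ {m : ℕ}, ((Fin m → X) → V) → ((Fin (m - 1) → X) → V)
  | 0, _ => 0
  | _ + 1, f => fun j => f (Fin.cons x j)

theorem contr_succ (x : X) {m : ℕ} (f : (Fin (m + 1) → X) → V) (j : Fin m → X) :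
    contr x f j = f (Fin.cons x j) := rfl

theorem contr_zero (x : X) (f : (Fin 0 → X) → V) : contr x f = 0 := rfl

theorem contr_add (x : X) {m : ℕ} (f g : (Fin m → X) → V) :
    contr x (f + g) = contr x f + contr x g := by
  cases m
  · simp [contr_zero]
  · rfl

theorem contr_smul [Module ℝ V] (x : X) (c : ℝ) {m : ℕ} (f : (Fin m → X) → V) :
    contr x (c • f) = c • contr x f := by
  cases m
  · simp [contr_zero]
  · rfl

/-- This makes induction on the number of variables possible for identities between antisymmetrized
products. -/
theorem ext_contr {m : ℕ} {f g : (Fin (m + 1) → X) → V} (h : ∀ x, contr x f = contr x g) :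
    f = g := by
  funext j
  have := congrFun (h (j 0)) (Fin.tail j)
  rwa [contr_succ, contr_succ, Fin.cons_self_tail] at this

/-- A permutation of `{1, …, k}` as a permutation of `{0, …, k}`. -/
def fixZero {k : ℕ} (e : Equiv.Perm (Fin k)) : Equiv.Perm (Fin (k + 1)) :=
  Equiv.Perm.decomposeFin.symm (0, e)

@[simp] theorem fixZero_zero {k : ℕ} (e : Equiv.Perm (Fin k)) : fixZero e 0 = 0 := by
  simp [fixZero]

@[simp] theorem fixZero_succ {k : ℕ} (e : Equiv.Perm (Fin k)) (i : Fin k) :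
    fixZero e i.succ = (e i).succ := by
  simp [fixZero]

theorem sign_fixZero {k : ℕ} (e : Equiv.Perm (Fin k)) :
    Equiv.Perm.sign (fixZero e) = Equiv.Perm.sign e := by
  simp [fixZero, Equiv.Perm.decomposeFin.symm_sign]

theorem cons_comp_fixZero {k : ℕ} (x : X) (j : Fin k → X) (e : Equiv.Perm (Fin k)) :
    (Fin.cons x j : Fin (k + 1) → X) ∘ fixZero e = Fin.cons x (j ∘ e) := by
  funext i
  refine Fin.cases ?_ (fun i => ?_) i <;> simp

theorem cons_comp_cycleRange {k : ℕ} (x : X) (j : Fin k → X) (p : Fin (k + 1)) :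
    (Fin.cons x j : Fin (k + 1) → X) ∘ p.cycleRange = p.insertNth (α := fun _ => X) x j := by
  funext i
  refine Fin.succAboveCases p ?_ (fun i => ?_) i
  · simp [Fin.cycleRange_self]
  · simp [Fin.cycleRange_succAbove]

theorem cons_comp_fixZero_mul {k : ℕ} (x : X) (j : Fin k → X) (e : Equiv.Perm (Fin k))
    (p : Fin (k + 1)) : (Fin.cons x j : Fin (k + 1) → X) ∘ (fixZero e * p.cycleRange) =
      p.insertNth (α := fun _ => X) x (j ∘ e) := by
  rw [Equiv.Perm.coe_mul, ← Function.comp_assoc, cons_comp_fixZero, cons_comp_cycleRange]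

/-- A permutation is determined by the position `p` that it sends to `0` and by the permutation it
induces on the rest; `cycleRange` moves `p` to the front. -/
theorem sum_perm_succ {k : ℕ} (F : Equiv.Perm (Fin (k + 1)) → V) :
    ∑ σ, F σ = ∑ p : Fin (k + 1), ∑ e : Equiv.Perm (Fin k), F (fixZero e * p.cycleRange) := by
  rw [← Fintype.sum_prod_type' fun p e => F (fixZero e * Fin.cycleRange p)]
  have hb : Function.Bijective fun q : Fin (k + 1) × Equiv.Perm (Fin k) =>
      fixZero q.2 * Fin.cycleRange q.1 := by
    rw [Fintype.bijective_iff_injective_and_card]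
    refine ⟨?_, ?_⟩
    · rintro ⟨p, e⟩ ⟨p', e'⟩ h
      have h' : fixZero e * Fin.cycleRange p = fixZero e' * Fin.cycleRange p' := h
      have hp : p = p' := by
        have h1 := congrArg (fun σ : Equiv.Perm (Fin (k + 1)) => σ.symm 0) h'
        simpa [Equiv.Perm.mul_def, Equiv.symm_trans_apply, (fixZero e).symm_apply_eq.2,
          (Equiv.symm_apply_eq (fixZero e)).2 (fixZero_zero e).symm,
          (Equiv.symm_apply_eq (fixZero e')).2 (fixZero_zero e').symm,
          (Equiv.symm_apply_eq (Fin.cycleRange p)).2 (Fin.cycleRange_self p).symm,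
          (Equiv.symm_apply_eq (Fin.cycleRange p')).2 (Fin.cycleRange_self p').symm] using h1
      subst hp
      have he : fixZero e = fixZero e' := mul_right_cancel h'
      refine Prod.ext rfl (Equiv.ext fun i => ?_)
      have := congrArg (fun σ : Equiv.Perm (Fin (k + 1)) => σ i.succ) he
      simpa using this
    · simp [Fintype.card_perm, Nat.factorial_succ]
  exact (hb.sum_comp F).symm

theorem sign_fixZero_mul {k : ℕ} (e : Equiv.Perm (Fin k)) (p : Fin (k + 1)) :
    ((Equiv.Perm.sign (fixZero e * p.cycleRange) : ℤˣ) : ℤ) =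
      (-1) ^ (p : ℕ) * (Equiv.Perm.sign e : ℤ) := by
  rw [Equiv.Perm.sign_mul, sign_fixZero, Fin.sign_cycleRange, mul_comm]
  push_cast
  ring

theorem IsSkew.contr {m : ℕ} {f : (Fin m → X) → V} (hf : IsSkew f) (x : X) :
    IsSkew (contr x f) := by
  cases m with
  | zero => intro σ j; simp [contr_zero]
  | succ m =>
    intro σ j
    change f (Fin.cons x (j ∘ σ)) = _ • f (Fin.cons x j)
    rw [← cons_comp_fixZero, hf, sign_fixZero]

theorem IsSkew.insertNth {m : ℕ} {f : (Fin (m + 1) → X) → V} (hf : IsSkew f) (x : X)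
    (j : Fin m → X) (p : Fin (m + 1)) :
    f (p.insertNth (α := fun _ => X) x j) = ((-1) ^ (p : ℕ) : ℤ) • f (Fin.cons x j) := by
  rw [← cons_comp_cycleRange, hf, Fin.sign_cycleRange]
  push_cast
  rfl

/-! ### Blocks of variables and the position of an inserted one -/

/-- The inclusion of the first `m` of `m + n` indices. -/
def lft {m n k : ℕ} (e : m + n = k) (i : Fin m) : Fin k := ⟨i, by omega⟩

/-- The inclusion of the last `n` of `m + n` indices. -/
def rgt {m n k : ℕ} (e : m + n = k) (i : Fin n) : Fin k := ⟨m + i, by omega⟩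

theorem sum_lft_rgt {m n k : ℕ} (e : m + n = k) (F : Fin k → V) :
    ∑ p, F p = ∑ a, F (lft e a) + ∑ b, F (rgt e b) := by
  subst e
  rw [Fin.sum_univ_add]
  rfl

theorem insertNth_lft_lft {m n k : ℕ} (e : m + 1 + n = k + 1) (e' : m + n = k) (x : X)
    (y : Fin k → X) (a : Fin (m + 1)) :
    (lft e a).insertNth (α := fun _ => X) x y ∘ lft e =
      a.insertNth (α := fun _ => X) x (y ∘ lft e') := by
  funext i
  refine Fin.succAboveCases a ?_ (fun i => ?_) i
  · simp
  · have : lft e (a.succAbove i) = (lft e a).succAbove (lft e' i) := by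
      ext
      simp only [lft, Fin.succAbove, Fin.lt_def, Fin.val_castSucc]
      split_ifs <;> simp
    simp [this]

theorem insertNth_lft_rgt {m n k : ℕ} (e : m + 1 + n = k + 1) (e' : m + n = k) (x : X)
    (y : Fin k → X) (a : Fin (m + 1)) :
    (lft e a).insertNth (α := fun _ => X) x y ∘ rgt e = y ∘ rgt e' := by
  funext i
  have : rgt e i = (lft e a).succAbove (rgt e' i) := by
    ext
    have := a.2
    simp only [lft, rgt, Fin.succAbove, Fin.lt_def, Fin.val_castSucc]
    split_ifs <;> simp <;> omega
  simp [this]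

theorem insertNth_rgt_lft {m n k : ℕ} (e : m + (n + 1) = k + 1) (e' : m + n = k) (x : X)
    (y : Fin k → X) (b : Fin (n + 1)) :
    (rgt e b).insertNth (α := fun _ => X) x y ∘ lft e = y ∘ lft e' := by
  funext i
  have : lft e i = (rgt e b).succAbove (lft e' i) := by
    ext
    have := i.2
    simp only [lft, rgt, Fin.succAbove, Fin.lt_def, Fin.val_castSucc]
    split_ifs <;> first | rfl | (simp; omega)
  simp [this]

theorem insertNth_rgt_rgt {m n k : ℕ} (e : m + (n + 1) = k + 1) (e' : m + n = k) (x : X)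
    (y : Fin k → X) (b : Fin (n + 1)) :
    (rgt e b).insertNth (α := fun _ => X) x y ∘ rgt e =
      b.insertNth (α := fun _ => X) x (y ∘ rgt e') := by
  funext i
  refine Fin.succAboveCases b ?_ (fun i => ?_) i
  · simp
  · have : rgt e (b.succAbove i) = (rgt e b).succAbove (rgt e' i) := by
      ext
      simp only [rgt, Fin.succAbove, Fin.lt_def, Fin.val_castSucc]
      split_ifs <;> simp <;> omega
    simp [this]

/-- The unnormalized antisymmetrized product. -/
def rawWedge (B : V₁ →ₗ[ℝ] V₂ →ₗ[ℝ] V₃) {m n k : ℕ} (e : m + n = k) (f : (Fin m → X) → V₁)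
    (g : (Fin n → X) → V₂) (j : Fin k → X) : V₃ :=
  ∑ σ : Equiv.Perm (Fin k), (Equiv.Perm.sign σ : ℤ) • B (f (j ∘ σ ∘ lft e)) (g (j ∘ σ ∘ rgt e))

/-- The antisymmetrized product of functions of `m` and `n = k - m` variables (zero if
`m + n ≠ k`). -/
def wedge (B : V₁ →ₗ[ℝ] V₂ →ₗ[ℝ] V₃) (m n k : ℕ) (f : (Fin m → X) → V₁)
    (g : (Fin n → X) → V₂) : (Fin k → X) → V₃ := fun j =>
  if e : m + n = k then (1 / (m.factorial * n.factorial) : ℝ) • rawWedge B e f g j else 0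

variable {B : V₁ →ₗ[ℝ] V₂ →ₗ[ℝ] V₃}

theorem wedge_of_ne {m n k : ℕ} (e : m + n ≠ k) (f : (Fin m → X) → V₁)
    (g : (Fin n → X) → V₂) : wedge B m n k f g = 0 := by
  funext j
  simp [wedge, e]

theorem wedge_apply {m n k : ℕ} (e : m + n = k) (f : (Fin m → X) → V₁)
    (g : (Fin n → X) → V₂) (j : Fin k → X) : wedge B m n k f g j =
      (1 / (m.factorial * n.factorial) : ℝ) • rawWedge B e f g j := by
  rw [wedge, dif_pos e]

theorem wedge_add_left {m n k : ℕ} (f f' : (Fin m → X) → V₁) (g : (Fin n → X) → V₂) :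
    wedge B m n k (f + f') g = wedge B m n k f g + wedge B m n k f' g := by
  by_cases e : m + n = k
  · funext j
    simp only [Pi.add_apply, wedge_apply e, rawWedge, map_add, LinearMap.add_apply, smul_add,
      Finset.sum_add_distrib]
  · simp [wedge_of_ne e]

theorem wedge_add_right {m n k : ℕ} (f : (Fin m → X) → V₁) (g g' : (Fin n → X) → V₂) :
    wedge B m n k f (g + g') = wedge B m n k f g + wedge B m n k f g' := by
  by_cases e : m + n = k
  · funext j
    simp only [Pi.add_apply, wedge_apply e, rawWedge, map_add, smul_add, Finset.sum_add_distrib]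
  · simp [wedge_of_ne e]

theorem wedge_smul_left {m n k : ℕ} (c : ℝ) (f : (Fin m → X) → V₁) (g : (Fin n → X) → V₂) :
    wedge B m n k (c • f) g = c • wedge B m n k f g := by
  by_cases e : m + n = k
  · funext j
    simp only [Pi.smul_apply, wedge_apply e, rawWedge, map_smul, LinearMap.smul_apply,
      smul_comm _ c, ← Finset.smul_sum]
  · simp [wedge_of_ne e]

theorem wedge_smul_right {m n k : ℕ} (c : ℝ) (f : (Fin m → X) → V₁) (g : (Fin n → X) → V₂) :
    wedge B m n k f (c • g) = c • wedge B m n k f g := by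
  by_cases e : m + n = k
  · funext j
    simp only [Pi.smul_apply, wedge_apply e, rawWedge, map_smul, smul_comm _ c, ← Finset.smul_sum]
  · simp [wedge_of_ne e]

theorem wedge_zero_left {m n k : ℕ} (g : (Fin n → X) → V₂) :
    wedge B m n k (0 : (Fin m → X) → V₁) g = 0 := by
  simpa using wedge_smul_left (B := B) (k := k) 0 (0 : (Fin m → X) → V₁) g

theorem wedge_zero_right {m n k : ℕ} (f : (Fin m → X) → V₁) :
    wedge B m n k f (0 : (Fin n → X) → V₂) = 0 := by
  simpa using wedge_smul_right (B := B) (k := k) 0 f (0 : (Fin n → X) → V₂)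

theorem wedge_zero_zero (f : (Fin 0 → X) → V₁) (g : (Fin 0 → X) → V₂) (j : Fin 0 → X) :
    wedge B 0 0 0 f g j = B (f j) (g j) := by
  rw [wedge_apply (add_zero 0)]
  simp [rawWedge, Subsingleton.elim (α := Fin 0 → X) _ j]

/-- Sums over the position of a new first variable in the first factor. -/
theorem sum_lft_eq {m n k : ℕ} (e : m + 1 + n = k + 1) (e' : m + n = k)
    {f : (Fin (m + 1) → X) → V₁} (hf : IsSkew f) (g : (Fin n → X) → V₂) (x : X) (j : Fin k → X) :
    ∑ a : Fin (m + 1), ∑ s : Equiv.Perm (Fin k),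
      (Equiv.Perm.sign (fixZero s * (lft e a).cycleRange) : ℤ) •
        B (f ((Fin.cons x j : Fin (k + 1) → X) ∘ (fixZero s * (lft e a).cycleRange) ∘ lft e))
          (g ((Fin.cons x j : Fin (k + 1) → X) ∘ (fixZero s * (lft e a).cycleRange) ∘ rgt e)) =
      ((m + 1 : ℕ) : ℝ) • rawWedge B e' (contr x f) g j := by
  have : ∀ a : Fin (m + 1), ∀ s : Equiv.Perm (Fin k),
      (Equiv.Perm.sign (fixZero s * (lft e a).cycleRange) : ℤ) •
        B (f ((Fin.cons x j : Fin (k + 1) → X) ∘ (fixZero s * (lft e a).cycleRange) ∘ lft e))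
          (g ((Fin.cons x j : Fin (k + 1) → X) ∘ (fixZero s * (lft e a).cycleRange) ∘ rgt e)) =
      (Equiv.Perm.sign s : ℤ) • B (contr x f (j ∘ s ∘ lft e')) (g (j ∘ s ∘ rgt e')) := by
    intro a s
    rw [← Function.comp_assoc, ← Function.comp_assoc, cons_comp_fixZero_mul,
      insertNth_lft_lft e e', insertNth_lft_rgt e e', hf.insertNth, sign_fixZero_mul, map_zsmul,
      LinearMap.smul_apply, smul_smul]
    congr 1
    have : ((lft e a : Fin (k + 1)) : ℕ) = a := rfl
    rw [this, mul_right_comm, ← mul_pow]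
    simp
  simp only [this, Finset.sum_const, Finset.card_univ, Fintype.card_fin, rawWedge]
  rw [Nat.cast_smul_eq_nsmul]

/-- Sums over the position of a new first variable in the second factor. -/
theorem sum_rgt_eq {m n k : ℕ} (e : m + (n + 1) = k + 1) (e' : m + n = k)
    (f : (Fin m → X) → V₁) {g : (Fin (n + 1) → X) → V₂} (hg : IsSkew g) (x : X) (j : Fin k → X) :
    ∑ b : Fin (n + 1), ∑ s : Equiv.Perm (Fin k),
      (Equiv.Perm.sign (fixZero s * (rgt e b).cycleRange) : ℤ) •
        B (f ((Fin.cons x j : Fin (k + 1) → X) ∘ (fixZero s * (rgt e b).cycleRange) ∘ lft e))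
          (g ((Fin.cons x j : Fin (k + 1) → X) ∘ (fixZero s * (rgt e b).cycleRange) ∘ rgt e)) =
      ((n + 1 : ℕ) : ℝ) • (-1 : ℝ) ^ m • rawWedge B e' f (contr x g) j := by
  have : ∀ b : Fin (n + 1), ∀ s : Equiv.Perm (Fin k),
      (Equiv.Perm.sign (fixZero s * (rgt e b).cycleRange) : ℤ) •
        B (f ((Fin.cons x j : Fin (k + 1) → X) ∘ (fixZero s * (rgt e b).cycleRange) ∘ lft e))
          (g ((Fin.cons x j : Fin (k + 1) → X) ∘ (fixZero s * (rgt e b).cycleRange) ∘ rgt e)) =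
      (-1 : ℝ) ^ m • (Equiv.Perm.sign s : ℤ) •
        B (f (j ∘ s ∘ lft e')) (contr x g (j ∘ s ∘ rgt e')) := by
    intro b s
    rw [← Function.comp_assoc, ← Function.comp_assoc, cons_comp_fixZero_mul,
      insertNth_rgt_lft e e', insertNth_rgt_rgt e e', hg.insertNth, sign_fixZero_mul, map_zsmul,
      smul_smul, ← Int.cast_smul_eq_zsmul ℝ, ← Int.cast_smul_eq_zsmul ℝ, smul_smul]
    congr 1
    have : ((rgt e b : Fin (k + 1)) : ℕ) = m + b := rfl
    rw [this, mul_right_comm, pow_add, mul_assoc ((-1) ^ m), ← mul_pow]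
    simp
  simp only [this, Finset.sum_const, Finset.card_univ, Fintype.card_fin, rawWedge,
    ← Finset.smul_sum]
  rw [Nat.cast_smul_eq_nsmul]

/-- Fixing the first variable is an antiderivation of the antisymmetrized product. -/
theorem contr_wedge {m n k : ℕ} (e : m + n = k) {f : (Fin m → X) → V₁} {g : (Fin n → X) → V₂}
    (hf : IsSkew f) (hg : IsSkew g) (x : X) : contr x (wedge B m n k f g) =
      wedge B (m - 1) n (k - 1) (contr x f) g +
        (-1 : ℝ) ^ m • wedge B m (n - 1) (k - 1) f (contr x g) := by
  cases k with
  | zero =>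
    obtain rfl : m = 0 := by omega
    obtain rfl : n = 0 := by omega
    simp [contr_zero, wedge_zero_left, wedge_zero_right]
  | succ k =>
    funext j
    -- Permutations are sorted by whether the fixed variable enters the first or the second factor.
    -- Skew-symmetry makes all its positions within a factor contribute equally, and their number
    -- cancels against one factor of the factorial.
    rw [contr_succ, wedge_apply e, rawWedge, sum_perm_succ, sum_lft_rgt e, smul_add, Pi.add_apply,
      Pi.smul_apply]
    congr 1
    · cases m with
      | zero => simp [contr_zero, wedge_zero_left]
      | succ m =>
        have e' : m + n = k := by omega
        rw [sum_lft_eq e e' hf]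
        change _ = wedge B m n k _ _ j
        rw [wedge_apply e', smul_smul]
        congr 1
        have h1 : (m.factorial : ℝ) ≠ 0 := by exact_mod_cast m.factorial_ne_zero
        have h2 : (n.factorial : ℝ) ≠ 0 := by exact_mod_cast n.factorial_ne_zero
        have h3 : ((m + 1 : ℕ) : ℝ) ≠ 0 := by positivity
        rw [Nat.factorial_succ, Nat.cast_mul]
        field_simp
    · cases n with
      | zero => simp [contr_zero, wedge_zero_right]
      | succ n =>
        have e' : m + n = k := by omega
        rw [sum_rgt_eq e e' f hg]
        change _ = _ • wedge B m n k _ _ j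
        rw [wedge_apply e', smul_comm ((-1 : ℝ) ^ m), smul_smul, smul_smul, smul_smul]
        congr 1
        have h1 : (m.factorial : ℝ) ≠ 0 := by exact_mod_cast m.factorial_ne_zero
        have h2 : (n.factorial : ℝ) ≠ 0 := by exact_mod_cast n.factorial_ne_zero
        have h3 : ((n + 1 : ℕ) : ℝ) ≠ 0 := by positivity
        rw [Nat.factorial_succ, Nat.cast_mul]
        field_simp

theorem isSkew_wedge (m n k : ℕ) (f : (Fin m → X) → V₁) (g : (Fin n → X) → V₂) :
    IsSkew (wedge B m n k f g) := by
  intro σ j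
  by_cases e : m + n = k
  · rw [wedge_apply e, wedge_apply e, smul_comm]
    congr 1
    rw [rawWedge, rawWedge, Finset.smul_sum, ← Equiv.sum_comp (Equiv.mulLeft σ⁻¹)]
    refine Finset.sum_congr rfl fun τ _ => ?_
    have h1 : ∀ {l : ℕ} (p : Fin l → Fin k), (j ∘ σ) ∘ (σ⁻¹ * τ : Equiv.Perm (Fin k)) ∘ p =
        j ∘ τ ∘ p := by
      intro l p
      funext i
      simp
    rw [Equiv.coe_mulLeft, h1, h1, smul_smul, Equiv.Perm.sign_mul, Equiv.Perm.sign_inv]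
    push_cast
    rfl
  · simp [wedge_of_ne e]

/-- Graded commutativity of the antisymmetrized product. -/
theorem wedge_comm {m n k : ℕ} (e : m + n = k) {f : (Fin m → X) → V₁} {g : (Fin n → X) → V₂}
    (hf : IsSkew f) (hg : IsSkew g) :
    wedge B m n k f g = (-1 : ℝ) ^ (m * n) • wedge B.flip n m k g f := by
  induction k generalizing m n with
  | zero =>
    obtain rfl : m = 0 := by omega
    obtain rfl : n = 0 := by omega
    funext j
    simp [wedge_zero_zero]
  | succ k ih =>
    -- Both sides contract by the antiderivation rule, and the contracted products have one variable
    -- fewer, so the induction hypothesis applies to each.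
    refine ext_contr fun x => ?_
    rw [contr_smul, contr_wedge e hf hg, contr_wedge (by omega) hg hf]
    have h1 : wedge B (m - 1) n (k + 1 - 1) (contr x f) g =
        ((-1 : ℝ) ^ (m * n) * (-1) ^ n) • wedge B.flip n (m - 1) (k + 1 - 1) g (contr x f) := by
      cases m with
      | zero => simp [contr_zero, wedge_zero_left, wedge_zero_right]
      | succ m =>
        refine (ih (m := m) (n := n) (by omega) (hf.contr x) hg).trans ?_
        refine congrArg (fun t : ℝ => t • wedge B.flip n m k g (contr x f)) ?_
        rw [add_mul, one_mul, pow_add, mul_assoc, ← mul_pow]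
        simp
    have h2 : (-1 : ℝ) ^ m • wedge B m (n - 1) (k + 1 - 1) f (contr x g) =
        (-1 : ℝ) ^ (m * n) • wedge B.flip (n - 1) m (k + 1 - 1) (contr x g) f := by
      cases n with
      | zero => simp [contr_zero, wedge_zero_left, wedge_zero_right]
      | succ n =>
        refine (congrArg ((-1 : ℝ) ^ m • ·)
          (ih (m := m) (n := n) (by omega) hf (hg.contr x))).trans ?_
        refine (smul_smul _ _ _).trans ?_
        refine congrArg (fun t : ℝ => t • wedge B.flip n m k (contr x g) f) ?_
        rw [← pow_add]
        congr 1
        ring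
    rw [h1, h2]
    module

/-- The graded Jacobi identity for the antisymmetrized product. -/
theorem wedge_jacobi [Module ℝ V] {B : V →ₗ[ℝ] V →ₗ[ℝ] V}
    (hB : ∀ x y z, B x (B y z) = B (B x y) z + B y (B x z)) {l m n a b c k : ℕ}
    (ha : m + n = a) (hb : l + m = b) (hc : l + n = c) (hk : l + m + n = k)
    {f : (Fin l → X) → V} {g : (Fin m → X) → V} {h : (Fin n → X) → V}
    (hf : IsSkew f) (hg : IsSkew g) (hh : IsSkew h) :
    wedge B l a k f (wedge B m n a g h) = wedge B b n k (wedge B l m b f g) h +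
      (-1 : ℝ) ^ (l * m) • wedge B m c k g (wedge B l n c f h) := by
  induction k generalizing l m n a b c with
  | zero =>
    obtain rfl : l = 0 := by omega
    obtain rfl : m = 0 := by omega
    obtain rfl : n = 0 := by omega
    obtain rfl : a = 0 := by omega
    obtain rfl : b = 0 := by omega
    obtain rfl : c = 0 := by omega
    funext j
    rw [Pi.add_apply, Pi.smul_apply]
    simp only [wedge_zero_zero]
    rw [hB]
    simp
  | succ k ih =>
    refine ext_contr fun x => ?_
    have s := fun (m n k : ℕ) (f : (Fin m → X) → V) (g : (Fin n → X) → V) =>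
      isSkew_wedge (B := B) m n k f g
    rw [contr_add, contr_smul, contr_wedge (by omega) hf (s _ _ _ _ _), contr_wedge ha hg hh,
      contr_wedge (by omega) (s _ _ _ _ _) hh, contr_wedge hb hf hg,
      contr_wedge (by omega) hg (s _ _ _ _ _), contr_wedge hc hf hh]
    rw [wedge_add_right, wedge_add_right, wedge_add_left, wedge_smul_right, wedge_smul_right,
      wedge_smul_left]
    have h1 : wedge B (l - 1) a (k + 1 - 1) (contr x f) (wedge B m n a g h) =
        wedge B (b - 1) n (k + 1 - 1) (wedge B (l - 1) m (b - 1) (contr x f) g) h +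
        ((-1 : ℝ) ^ (l * m) * (-1) ^ m) •
          wedge B m (c - 1) (k + 1 - 1) g (wedge B (l - 1) n (c - 1) (contr x f) h) := by
      -- A factor without variables has zero contraction, so the truncated degree `l - 1` does no
      -- harm. The other two factors are treated in the same way.
      cases l with
      | zero => rw [contr_zero, wedge_zero_left, wedge_zero_left, wedge_zero_left, wedge_zero_left,
          wedge_zero_right, smul_zero, add_zero]
      | succ l =>
        refine (ih (l := l) (m := m) (n := n) (a := a) (b := b - 1) (c := c - 1) ha (by omega)
          (by omega) (by omega) (hf.contr x) hg hh).trans ?_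
        refine congrArg (fun t : ℝ => wedge B (b - 1) n k (wedge B l m (b - 1) (contr x f) g) h +
          t • wedge B m (c - 1) k g (wedge B l n (c - 1) (contr x f) h)) ?_
        rw [add_mul, one_mul, pow_add, mul_assoc, ← mul_pow]
        simp
    have h2 : (-1 : ℝ) ^ l • wedge B l (a - 1) (k + 1 - 1) f
          (wedge B (m - 1) n (a - 1) (contr x g) h) =
        (-1 : ℝ) ^ l • wedge B (b - 1) n (k + 1 - 1) (wedge B l (m - 1) (b - 1) f (contr x g)) h +
        (-1 : ℝ) ^ (l * m) •
          wedge B (m - 1) c (k + 1 - 1) (contr x g) (wedge B l n c f h) := by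
      cases m with
      | zero => simp [contr_zero, wedge_zero_left, wedge_zero_right]
      | succ m =>
        refine (congrArg ((-1 : ℝ) ^ l • ·) (ih (l := l) (m := m) (n := n) (a := a - 1)
          (b := b - 1) (c := c) (by omega) (by omega) hc (by omega) hf (hg.contr x) hh)).trans ?_
        refine (smul_add _ _ _).trans (congrArg (_ + ·) ((smul_smul _ _ _).trans ?_))
        refine congrArg (fun t : ℝ => t • wedge B m c k (contr x g) (wedge B l n c f h)) ?_
        rw [← pow_add]
        congr 1
        ring
    have h3 : wedge B l (a - 1) (k + 1 - 1) f (wedge B m (n - 1) (a - 1) g (contr x h)) =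
        wedge B b (n - 1) (k + 1 - 1) (wedge B l m b f g) (contr x h) +
        (-1 : ℝ) ^ (l * m) •
          wedge B m (c - 1) (k + 1 - 1) g (wedge B l (n - 1) (c - 1) f (contr x h)) := by
      cases n with
      | zero => simp [contr_zero, wedge_zero_right]
      | succ n =>
        exact ih (l := l) (m := m) (n := n) (a := a - 1) (b := b) (c := c - 1) (by omega)
          hb (by omega) (by omega) hf hg (hh.contr x)
    rw [smul_add ((-1 : ℝ) ^ l), h1, h2, smul_comm ((-1 : ℝ) ^ l), h3,
      show (-1 : ℝ) ^ b = (-1) ^ l * (-1) ^ m by rw [← hb, pow_add]]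
    module

end wedge

end UAL
end

open scoped NNReal Topology
noncomputable section
namespace UAL
variable {d : ℕ} {L : SpinSystem d}

/-! ### Absolutely convergent sums over sites -/

theorem le_mul_inv_of_mul_le {u t K : ℝ} {n : ℕ} (ht : 0 ≤ t) (h : u * (1 + t) ^ n ≤ K) :
    u ≤ K * ((1 + t) ^ n)⁻¹ := by
  rw [← div_eq_mul_inv, le_div_iff₀ (by positivity)]
  exact h

theorem summable_site (L : SpinSystem d) (y : EuclideanSpace ℝ (Fin d)) :
    Summable fun x : L.Site => ((1 + dist (x : EuclideanSpace ℝ (Fin d)) y) ^ sumExp d)⁻¹ := by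
  obtain ⟨C, -, hC⟩ := exists_site_sum_le L
  exact summable_of_sum_le (fun x => by positivity) (hC y)

/-- Families of observables localized near their index and near `y`. -/
structure Fam (u : L.Site → L.Op) (y : EuclideanSpace ℝ (Fin d)) : Prop where
  mem : ∀ x, u x ∈ lieQ L
  loc : ∀ N, ∃ K, ∀ x : L.Site, Loc (x : EuclideanSpace ℝ (Fin d)) N K (u x) ∧ Loc y N K (u x)

theorem Fam.summable {u : L.Site → L.Op} {y : EuclideanSpace ℝ (Fin d)} (h : Fam u y) :
    Summable u := by
  obtain ⟨K, hK⟩ := h.loc (sumExp d)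
  refine Summable.of_norm_bounded ((summable_site L y).mul_left (2 ^ sumExp d * 4 * K))
    fun x => ?_
  exact le_mul_inv_of_mul_le dist_nonneg ((hK x).1.norm_mul_dist_le (hK x).2 (h.mem x))

/-- The sum of a family localized near its index and near `y` is localized near `y`. -/
theorem exists_loc_tsum (L : SpinSystem d) (α : ℕ) : ∃ (N : ℕ) (C : ℝ), 0 ≤ C ∧
    ∀ {u : L.Site → L.Op} {y : EuclideanSpace ℝ (Fin d)} {K : ℝ}, (∀ x, u x ∈ lieQ L) →
      (∀ x : L.Site, Loc (x : EuclideanSpace ℝ (Fin d)) N K (u x)) → (∀ x, Loc y N K (u x)) →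
      Loc y α (C * K) (∑' x, u x) := by
  obtain ⟨C, hC0, hC⟩ := exists_site_sum_le L
  -- Interpolation needs localization at order `2α` and norm decay at order `2 sumExp d`; what
  -- remains is decay at order `sumExp d`, which is summable over sites.
  refine ⟨2 * α + 2 * sumExp d, 2 ^ (2 * sumExp d) * 4 * C, by positivity, ?_⟩
  intro u y K hu hx hy
  have h1 : ∀ x : L.Site, ‖u x‖ * (1 + dist (x : EuclideanSpace ℝ (Fin d)) y) ^ (2 * sumExp d) ≤
      2 ^ (2 * sumExp d) * 4 * K := fun x =>
    ((hx x).anti (by omega)).norm_mul_dist_le ((hy x).anti (by omega)) (hu x)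
  have hs : Summable u := by
    refine Summable.of_norm_bounded
      ((summable_site L y).mul_left (2 ^ sumExp d * 4 * K)) fun x => ?_
    exact le_mul_inv_of_mul_le dist_nonneg
      (((hx x).anti (by omega)).norm_mul_dist_le ((hy x).anti (by omega)) (hu x))
  obtain ⟨x₀⟩ := nonempty_site L
  have hK : 0 ≤ K := (hx x₀).nonneg
  have hK' : K ≤ 2 ^ (2 * sumExp d) * 4 * K := by
    have : (1 : ℝ) ≤ 2 ^ (2 * sumExp d) := one_le_pow₀ (by norm_num)
    nlinarith
  refine Loc.tsum hs (fun x => (((hy x).anti (by omega)).mono hK').interpolate dist_nonneg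
    (h1 x)) fun S => ?_
  rw [← Finset.mul_sum]
  calc _ ≤ 2 ^ (2 * sumExp d) * 4 * K * C :=
        mul_le_mul_of_nonneg_left (hC y S) (by positivity)
    _ = _ := by ring

/-- Families of observables localized near both indices and near `y`. -/
structure Fam₂ (u : L.Site → L.Site → L.Op) (y : EuclideanSpace ℝ (Fin d)) : Prop where
  mem : ∀ x x', u x x' ∈ lieQ L
  loc : ∀ N, ∃ K, ∀ x x' : L.Site, Loc (x : EuclideanSpace ℝ (Fin d)) N K (u x x') ∧
    Loc (x' : EuclideanSpace ℝ (Fin d)) N K (u x x') ∧ Loc y N K (u x x')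

/-- Decay of doubled order in each index separately gives decay in the product of the two weights,
and that product is summable over pairs. -/
theorem summable_of_decay₂ {E : Type*} [NormedAddCommGroup E] [CompleteSpace E]
    {u : L.Site → L.Site → E} {y : EuclideanSpace ℝ (Fin d)} {K : ℝ}
    (h : ∀ x x' : L.Site, ‖u x x'‖ * (1 + dist (x : EuclideanSpace ℝ (Fin d)) y) ^
      (2 * sumExp d) ≤ K)
    (h' : ∀ x x' : L.Site, ‖u x x'‖ * (1 + dist (x' : EuclideanSpace ℝ (Fin d)) y) ^
      (2 * sumExp d) ≤ K) : Summable (Function.uncurry u) := by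
  refine Summable.of_norm_bounded (((summable_site L y).mul_of_nonneg (summable_site L y)
    (fun x => by positivity) (fun x => by positivity)).mul_left K) fun p => ?_
  have := mul_le_of_mul_sq_le (norm_nonneg (u p.1 p.2)) (h p.1 p.2) (h' p.1 p.2)
  rw [← mul_inv, ← div_eq_mul_inv, le_div_iff₀ (by positivity)]
  exact this

theorem Fam₂.summable {u : L.Site → L.Site → L.Op} {y : EuclideanSpace ℝ (Fin d)}
    (h : Fam₂ u y) : Summable (Function.uncurry u) := by
  obtain ⟨K, hK⟩ := h.loc (2 * sumExp d)
  exact summable_of_decay₂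
    (fun x x' => (hK x x').1.norm_mul_dist_le (hK x x').2.2 (h.mem x x'))
    (fun x x' => (hK x x').2.1.norm_mul_dist_le (hK x x').2.2 (h.mem x x'))

theorem tsum_comm_of_uncurry {ι E : Type*} [NormedAddCommGroup E] [CompleteSpace E]
    {u : ι → ι → E} (h : Summable (Function.uncurry u)) :
    ∑' x, ∑' y, u x y = ∑' y, ∑' x, u x y :=
  (Summable.tsum_comm (f := fun y x => u x y) ((Equiv.prodComm ι ι).summable_iff.1 h))

/-- Exchanging the order of summation turns the sum into its own negative. Every vanishing of a
double boundary rests on this. -/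
theorem tsum_tsum_eq_zero_of_skew {ι E : Type*} [NormedAddCommGroup E] [NormedSpace ℝ E]
    [CompleteSpace E] {u : ι → ι → E} (h : Summable (Function.uncurry u))
    (hu : ∀ x y, u x y = -u y x) : ∑' x, ∑' y, u x y = 0 := by
  have h1 := tsum_comm_of_uncurry h
  have h2 : ∑' y, ∑' x, u x y = -∑' y, ∑' x, u y x := by
    rw [← tsum_neg]
    refine tsum_congr fun y => ?_
    rw [← tsum_neg]
    exact tsum_congr fun x => hu x y
  rw [h2] at h1
  rw [eq_neg_iff_add_eq_zero, ← two_smul ℝ] at h1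
  exact (smul_eq_zero.1 h1).resolve_left two_ne_zero

/-! ### The action of a family of observables -/

/-- `A ↦ ∑_x [f_x, A]`. -/
def famAct (f : L.Site → L.Op) (A : L.Op) : L.Op := ∑' x, ⁅f x, A⁆

/-- Uniformly almost local functions of several sites. -/
structure IsUA {m : ℕ} (a : (Fin m → L.Site) → L.Op) : Prop where
  mem : ∀ j, a j ∈ lieQ L
  loc : ∀ N, ∃ K, ∀ j i, Loc (j i : EuclideanSpace ℝ (Fin d)) N K (a j)

/-- Uniformly almost local functions of one site. -/
structure IsUA₁ (f : L.Site → L.Op) : Prop where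
  mem : ∀ x, f x ∈ lieQ L
  loc : ∀ N, ∃ K, ∀ x : L.Site, Loc (x : EuclideanSpace ℝ (Fin d)) N K (f x)

theorem IsUA₁.mem_lieAl {f : L.Site → L.Op} (hf : IsUA₁ f) (x : L.Site) : f x ∈ lieAl L :=
  mem_lieAl_of_loc (x : EuclideanSpace ℝ (Fin d)) (hf.mem x)
    fun α => (hf.loc α).imp fun _ h => h x

theorem IsUA₁.fam_lie {f : L.Site → L.Op} (hf : IsUA₁ f) {A : L.Op} (hA : A ∈ lieAl L)
    (y : EuclideanSpace ℝ (Fin d)) : Fam (fun x => ⁅f x, A⁆) y where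
  mem x := lie_mem_lieQ (hf.mem x) (lieAl_le_lieQ hA)
  loc N := by
    obtain ⟨K, hK⟩ := hf.loc N
    obtain ⟨M, hM⟩ := exists_loc hA y N
    exact ⟨_, fun x => ⟨(hK x).lie hM (hf.mem x) (lieAl_le_lieQ hA),
      (hK x).lie' hM (hf.mem x) (lieAl_le_lieQ hA)⟩⟩

theorem IsUA₁.fam₂_lie {f : L.Site → L.Op} (hf : IsUA₁ f) {u : L.Site → L.Op}
    {y : EuclideanSpace ℝ (Fin d)} (hu : Fam u y) : Fam₂ (fun x z => ⁅f x, u z⁆) y where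
  mem x z := lie_mem_lieQ (hf.mem x) (hu.mem z)
  loc N := by
    obtain ⟨K, hK⟩ := hf.loc N
    obtain ⟨M, hM⟩ := hu.loc N
    exact ⟨_, fun x z => ⟨(hK x).lie (hM z).1 (hf.mem x) (hu.mem z),
      (hK x).lie' (hM z).1 (hf.mem x) (hu.mem z), (hK x).lie' (hM z).2 (hf.mem x) (hu.mem z)⟩⟩

theorem exists_loc_famAct (L : SpinSystem d) (α : ℕ) : ∃ (N : ℕ) (C : ℝ), 0 ≤ C ∧
    ∀ {f : L.Site → L.Op} {A : L.Op} {y : EuclideanSpace ℝ (Fin d)} {K M : ℝ},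
      (∀ x, f x ∈ lieQ L) → A ∈ lieQ L →
      (∀ x : L.Site, Loc (x : EuclideanSpace ℝ (Fin d)) N K (f x)) → Loc y N M A →
      Loc y α (C * (K * M)) (famAct f A) := by
  obtain ⟨N, C, hC, h⟩ := exists_loc_tsum L α
  refine ⟨N, C * (4 ^ N * 32), by positivity, ?_⟩
  intro f A y K M hf hA hK hM
  rw [mul_assoc]
  exact h (fun x => lie_mem_lieQ (hf x) hA) (fun x => (hK x).lie hM (hf x) hA)
    (fun x => (hK x).lie' hM (hf x) hA)

theorem famAct_mem_lieQ {f : L.Site → L.Op} (hf : ∀ x, f x ∈ lieQ L) {A : L.Op}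
    (hA : A ∈ lieQ L) : famAct f A ∈ lieQ L :=
  tsum_mem_lieQ fun x => lie_mem_lieQ (hf x) hA

theorem IsUA₁.famAct_mem {f : L.Site → L.Op} (hf : IsUA₁ f) {A : L.Op} (hA : A ∈ lieAl L) :
    famAct f A ∈ lieAl L := by
  refine mem_lieAl_of_loc (0 : EuclideanSpace ℝ (Fin d))
    (famAct_mem_lieQ hf.mem (lieAl_le_lieQ hA)) fun α => ?_
  obtain ⟨N, C, -, h⟩ := exists_loc_famAct L α
  obtain ⟨K, hK⟩ := hf.loc N
  obtain ⟨M, hM⟩ := exists_loc hA (0 : EuclideanSpace ℝ (Fin d)) N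
  exact ⟨_, h hf.mem (lieAl_le_lieQ hA) hK hM⟩

theorem IsUA₁.hasSum_lie {f : L.Site → L.Op} (hf : IsUA₁ f) {A : L.Op} (hA : A ∈ lieAl L) :
    HasSum (fun x => ⁅f x, A⁆) (famAct f A) :=
  (hf.fam_lie hA 0).summable.hasSum

theorem lieB_continuous_right (A : L.Op) : Continuous fun B : L.Op => ⁅A, B⁆ := by
  simp only [Ring.lie_def]
  fun_prop

theorem lieB_continuous_left (B : L.Op) : Continuous fun A : L.Op => ⁅A, B⁆ := by
  simp only [Ring.lie_def]
  fun_prop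

theorem hasSum_lie_right (A : L.Op) {ι : Type*} {u : ι → L.Op} {S : L.Op} (h : HasSum u S) :
    HasSum (fun x => ⁅A, u x⁆) ⁅A, S⁆ :=
  h.map (lieB L A) (lieB_continuous_right A)

theorem hasSum_lie_left (B : L.Op) {ι : Type*} {u : ι → L.Op} {S : L.Op} (h : HasSum u S) :
    HasSum (fun x => ⁅u x, B⁆) ⁅S, B⁆ :=
  h.map ((lieB L).flip B) (lieB_continuous_left B)

theorem IsUA₁.famAct_add {f : L.Site → L.Op} (hf : IsUA₁ f) {A B : L.Op} (hA : A ∈ lieAl L)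
    (hB : B ∈ lieAl L) : famAct f (A + B) = famAct f A + famAct f B := by
  refine HasSum.tsum_eq ?_
  simpa only [← lieB_apply, map_add] using (hf.hasSum_lie hA).add (hf.hasSum_lie hB)

theorem famAct_smul (f : L.Site → L.Op) (c : ℝ) (A : L.Op) :
    famAct f (c • A) = c • famAct f A := by
  simp only [famAct, ← lieB_apply, map_smul, tsum_const_smul'']

theorem IsUA₁.add_famAct {f g : L.Site → L.Op} (hf : IsUA₁ f) (hg : IsUA₁ g) {A : L.Op}
    (hA : A ∈ lieAl L) : famAct (f + g) A = famAct f A + famAct g A := by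
  refine HasSum.tsum_eq ?_
  simpa only [← lieB_apply, map_add, Pi.add_apply, LinearMap.add_apply] using
    (hf.hasSum_lie hA).add (hg.hasSum_lie hA)

theorem smul_famAct (f : L.Site → L.Op) (c : ℝ) (A : L.Op) :
    famAct (c • f) A = c • famAct f A := by
  simp only [famAct, ← lieB_apply, map_smul, Pi.smul_apply, LinearMap.smul_apply,
    tsum_const_smul'']

theorem IsUA₁.famAct_lie {f : L.Site → L.Op} (hf : IsUA₁ f) {A B : L.Op} (hA : A ∈ lieAl L)
    (hB : B ∈ lieAl L) : famAct f ⁅A, B⁆ = ⁅famAct f A, B⁆ + ⁅A, famAct f B⁆ := by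
  refine HasSum.tsum_eq ?_
  simpa only [op_lie_leibniz (f _) A B] using
    (hasSum_lie_left B (hf.hasSum_lie hA)).add (hasSum_lie_right A (hf.hasSum_lie hB))

/-- The action commutes with sums of families. -/
theorem IsUA₁.famAct_tsum {f : L.Site → L.Op} (hf : IsUA₁ f) {u : L.Site → L.Op}
    {y : EuclideanSpace ℝ (Fin d)} (hu : Fam u y) :
    famAct f (∑' x, u x) = ∑' x, famAct f (u x) := by
  have h := (hf.fam₂_lie hu).summable
  rw [famAct]
  simp only [famAct]
  rw [← tsum_comm_of_uncurry h]
  exact tsum_congr fun x => ((hasSum_lie_right (f x) hu.summable.hasSum).tsum_eq).symm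

end UAL
end

open scoped NNReal Topology
noncomputable section
namespace UAL
variable {d : ℕ} {L : SpinSystem d}

/-! ### Distributing brick components among sites -/

theorem brickWeight_of_notMem {Y : Brick d} {x : L.Site}
    (h : (x : EuclideanSpace ℝ (Fin d)) ∉ Y.1) : brickWeight L Y x = 0 := by
  simp [brickWeight, h]

theorem abs_brickWeight_le (Y : Brick d) (x : L.Site) : |brickWeight L Y x| ≤ 1 := by
  by_cases h : (x : EuclideanSpace ℝ (Fin d)) ∈ Y.1
  · rw [brickWeight, if_pos h, abs_of_nonneg (by positivity)]
    rcases Nat.eq_zero_or_pos (Y.1 ∩ L.lattice.carrier).ncard with h0 | h0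
    · simp [h0]
    · rw [div_le_one (by exact_mod_cast h0)]
      exact_mod_cast h0
  · simp [brickWeight_of_notMem h]

theorem ncard_brick (Y : Brick d) :
    (Y.1 ∩ L.lattice.carrier).ncard = (sites L Y.1).card := by
  rw [← Set.ncard_coe_finset, ← Set.ncard_image_of_injective _
    (Subtype.val_injective (p := fun x => x ∈ L.lattice.carrier))]
  congr 1
  ext p
  constructor
  · rintro ⟨hp, hp'⟩
    exact ⟨⟨p, hp'⟩, Finset.mem_coe.2 ((mem_sites Y.isBounded).2 hp), rfl⟩
  · rintro ⟨x, hx, rfl⟩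
    exact ⟨(mem_sites Y.isBounded).1 (Finset.mem_coe.1 hx), x.2⟩

theorem hasSum_brickWeight {Y : Brick d} {x₀ : L.Site}
    (hx₀ : (x₀ : EuclideanSpace ℝ (Fin d)) ∈ Y.1) :
    HasSum (fun x : L.Site => brickWeight L Y x) 1 := by
  have h : ∑ x ∈ sites L Y.1, brickWeight L Y x = 1 := by
    have h1 : ∀ x ∈ sites L Y.1, brickWeight L Y x = 1 / ((sites L Y.1).card : ℝ) := by
      intro x hx
      rw [brickWeight, if_pos ((mem_sites Y.isBounded).1 hx), ncard_brick]
    rw [Finset.sum_congr rfl h1, Finset.sum_const, nsmul_eq_mul, mul_one_div, div_self]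
    exact_mod_cast Finset.card_ne_zero_of_mem ((mem_sites Y.isBounded).2 hx₀)
  rw [← h]
  exact hasSum_sum_of_ne_finset_zero fun x hx =>
    brickWeight_of_notMem fun hx' => hx ((mem_sites Y.isBounded).2 hx')

/-- Observables attached to bricks without sites vanish. -/
theorem exists_site_of_brickSpace {Y : Brick d} {A : L.Op} (hA : A ∈ brickSpace L Y)
    (h : A ≠ 0) : ∃ x : L.Site, (x : EuclideanSpace ℝ (Fin d)) ∈ Y.1 := by
  by_contra! hx
  refine h (eq_zero_of_mem_alg_empty ?_ (brickSpace_lieQ hA))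
  obtain ⟨Γ, hΓ, hA'⟩ := mem_alg.1 (brickSpace_alg hA)
  exact mem_alg.2 ⟨Γ, fun j hj => (hx j (hΓ j hj)).elim, hA'⟩

theorem hasSum_brickWeight_smul {Y : Brick d} {A : L.Op} (hA : A ∈ brickSpace L Y) :
    HasSum (fun x : L.Site => brickWeight L Y x • A) A := by
  by_cases h : A = 0
  · simp [h]
  · obtain ⟨x₀, hx₀⟩ := exists_site_of_brickSpace hA h
    simpa using (hasSum_brickWeight hx₀).smul_const A

/-- `∑_Y (χ_Y(x) / |Y ∩ Λ|) G^Y`. -/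
def spread (x : L.Site) (G : Brick d → L.Op) : L.Op := ∑' Y, brickWeight L Y x • G Y

/-- The decay required for the sum defining `spread x G` to converge to an observable localized
near `z`. -/
def SpreadBound (x : L.Site) (z : EuclideanSpace ℝ (Fin d)) (α : ℕ) (K : ℝ)
    (G : Brick d → L.Op) : Prop :=
  ∀ Y : Brick d, (x : EuclideanSpace ℝ (Fin d)) ∈ Y.1 →
    ‖G Y‖ * ((1 + dist (x : EuclideanSpace ℝ (Fin d)) z) ^ (α + sumExp d) *
      (1 + Metric.diam Y.1) ^ (α + sumExp d)) ≤ K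

open Classical in
theorem exists_sum_brick_ite_le (d : ℕ) : ∃ C : ℝ, 0 ≤ C ∧
    ∀ (x : EuclideanSpace ℝ (Fin d)) (S : Finset (Brick d)),
      ∑ Y ∈ S, (if x ∈ Y.1 then ((1 + Metric.diam Y.1) ^ sumExp d)⁻¹ else 0) ≤ C := by
  obtain ⟨C, hC0, hC⟩ := exists_brick_sum_le d
  refine ⟨C, hC0, fun x S => ?_⟩
  rw [← Finset.sum_filter]
  exact hC x _ fun Y hY => (Finset.mem_filter.1 hY).2

/-- The unit cube of the integer lattice containing `x` is a brick, so the defining condition is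
never vacuous. -/
theorem SpreadBound.nonneg {x : L.Site} {z : EuclideanSpace ℝ (Fin d)} {α : ℕ} {K : ℝ}
    {G : Brick d → L.Op} (h : SpreadBound x z α K G) : 0 ≤ K := by
  let n : Fin d → ℤ := fun i => ⌊(x : EuclideanSpace ℝ (Fin d)) i⌋
  have hx : (x : EuclideanSpace ℝ (Fin d)) ∈ (box n fun i => n i + 1).1 :=
    mem_box.2 fun i => ⟨Int.floor_le _, by push_cast; exact Int.lt_floor_add_one _⟩
  have h1 := Metric.diam_nonneg (s := (box n fun i => n i + 1).1)
  exact le_trans (by positivity) (h _ hx)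

open Classical in
theorem SpreadBound.norm_le {x : L.Site} {z : EuclideanSpace ℝ (Fin d)} {α : ℕ} {K : ℝ}
    {G : Brick d → L.Op} (h : SpreadBound x z α K G) (Y : Brick d) :
    ‖brickWeight L Y x • G Y‖ * (1 + (dist (x : EuclideanSpace ℝ (Fin d)) z +
      Metric.diam Y.1)) ^ α ≤ K * (if (x : EuclideanSpace ℝ (Fin d)) ∈ Y.1 then
        ((1 + Metric.diam Y.1) ^ sumExp d)⁻¹ else 0) := by
  split_ifs with hx
  · have h1 := Metric.diam_nonneg (s := Y.1)
    have h2 := dist_nonneg (x := (x : EuclideanSpace ℝ (Fin d))) (y := z)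
    rw [← div_eq_mul_inv, le_div_iff₀ (by positivity)]
    refine le_trans ?_ (h Y hx)
    rw [mul_assoc]
    refine mul_le_mul ?_ ?_ (by positivity) (norm_nonneg _)
    · rw [norm_smul]
      exact mul_le_of_le_one_left (norm_nonneg _) (abs_brickWeight_le Y x)
    · rw [pow_add (1 + Metric.diam Y.1), ← mul_assoc]
      refine mul_le_mul_of_nonneg_right ?_ (by positivity)
      calc _ ≤ ((1 + dist (x : EuclideanSpace ℝ (Fin d)) z) * (1 + Metric.diam Y.1)) ^ α :=
            pow_le_pow_left₀ (by positivity) (by nlinarith) _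
        _ = (1 + dist (x : EuclideanSpace ℝ (Fin d)) z) ^ α * (1 + Metric.diam Y.1) ^ α :=
            mul_pow _ _ _
        _ ≤ _ := mul_le_mul_of_nonneg_right
            (pow_le_pow_right₀ (by linarith) (by omega)) (by positivity)
  · simp [brickWeight_of_notMem hx]

theorem SpreadBound.summable {x : L.Site} {z : EuclideanSpace ℝ (Fin d)} {α : ℕ} {K : ℝ}
    {G : Brick d → L.Op} (h : SpreadBound x z α K G) :
    Summable fun Y => brickWeight L Y x • G Y := by
  classical
  obtain ⟨C, hC0, hC⟩ := exists_sum_brick_ite_le d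
  refine summable_of_norm_le_of_sum_le (M := K * C) (fun Y => le_trans ?_ (h.norm_le Y))
    fun S => ?_
  · have h1 := Metric.diam_nonneg (s := Y.1)
    have h2 := dist_nonneg (x := (x : EuclideanSpace ℝ (Fin d))) (y := z)
    exact le_mul_of_one_le_right (norm_nonneg _) (one_le_pow₀ (by linarith))
  · rw [← Finset.mul_sum]
    exact mul_le_mul_of_nonneg_left (hC _ _) h.nonneg

/-- A brick `Y` containing `x` lies in the ball about `z` of radius `|x - z| + diam Y`, so its term
costs that radius to the power `α`. The bound pays for this and leaves `sumExp d` powers of the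
diameter for summation. -/
theorem exists_loc_spread (L : SpinSystem d) : ∃ C : ℝ, 0 ≤ C ∧
    ∀ {x : L.Site} {z : EuclideanSpace ℝ (Fin d)} {α : ℕ} {K : ℝ} {G : Brick d → L.Op},
      SpreadBound x z α K G → (∀ Y, G Y ∈ brickSpace L Y) → Loc z α (C * K) (spread x G) := by
  classical
  obtain ⟨C, hC0, hC⟩ := exists_sum_brick_ite_le d
  refine ⟨C, hC0, fun {x z α K G} h hG => ?_⟩
  refine Loc.tsum h.summable (K := fun Y => K * (if (x : EuclideanSpace ℝ (Fin d)) ∈ Y.1 then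
        ((1 + Metric.diam Y.1) ^ sumExp d)⁻¹ else 0)) (fun Y => ?_) fun S => ?_
  · by_cases hx : (x : EuclideanSpace ℝ (Fin d)) ∈ Y.1
    · refine (Loc.of_mem (t := dist (x : EuclideanSpace ℝ (Fin d)) z + Metric.diam Y.1)
        (add_nonneg dist_nonneg Metric.diam_nonneg) (X := Y.1) (fun p hp => ?_) ?_).mono ?_
      · rw [Metric.mem_closedBall]
        linarith [dist_triangle p x z, dist_le_diam_brick Y hp hx]
      · exact ((lieLoc L Y.1).smul_mem _ (hG Y).1).1
      · rw [mul_comm]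
        exact h.norm_le Y
    · simp only [brickWeight_of_notMem hx, zero_smul, hx, if_false, mul_zero]
      exact Loc.zero le_rfl
  · rw [← Finset.mul_sum, mul_comm C]
    exact mul_le_mul_of_nonneg_left (hC _ _) h.nonneg

theorem spread_mem_lieQ {x : L.Site} {G : Brick d → L.Op} (hG : ∀ Y, G Y ∈ brickSpace L Y) :
    spread x G ∈ lieQ L :=
  tsum_mem_lieQ fun Y => (lieQ L).smul_mem _ (brickSpace_lieQ (hG Y))

theorem brickComp_spread {x : L.Site} {G : Brick d → L.Op} (hG : ∀ Y, G Y ∈ brickSpace L Y)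
    (h : Summable fun Y => brickWeight L Y x • G Y) (Y : Brick d) :
    brickComp Y (spread x G) = brickWeight L Y x • G Y := by
  have h1 := hasSum_brickComp Y h.hasSum
    fun Z => (lieQ L).smul_mem _ (brickSpace_lieQ (hG Z))
  refine h1.unique ?_
  have h2 : brickComp Y (brickWeight L Y x • G Y) = brickWeight L Y x • G Y :=
    brickComp_self ((brickSpace L Y).smul_mem _ (hG Y))
  rw [← h2]
  exact hasSum_single Y fun Z hZ =>
    brickComp_of_ne hZ.symm ((brickSpace L Z).smul_mem _ (hG Z))

/-- `W_x(A) = ∑_Y (χ_Y(x) / |Y ∩ Λ|) A^Y`. -/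
def part (x : L.Site) (A : L.Op) : L.Op := spread x fun Y => brickComp Y A

/-- Components decay both in the diameter of the brick and in the distance from `y` to points of it.
Having each at doubled order yields the product bound. -/
theorem exists_spreadBound_brickComp (L : SpinSystem d) (α : ℕ) : ∃ (N : ℕ) (C : ℝ), 0 ≤ C ∧
    ∀ {x : L.Site} {y : EuclideanSpace ℝ (Fin d)} {A : L.Op} {K : ℝ}, A ∈ lieQ L → Loc y N K A →
      SpreadBound x x α (C * K) (fun Y => brickComp Y A) ∧
      SpreadBound x y α (C * K) (fun Y => brickComp Y A) := by
  set N := 2 * (α + sumExp d)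
  have hC := (brickConst_pos d N).le
  refine ⟨N, 2 ^ N * brickConst d N, by positivity, fun {x y A K} hA h => ?_⟩
  have hK := h.nonneg
  have key : ∀ Y : Brick d, (x : EuclideanSpace ℝ (Fin d)) ∈ Y.1 →
      ‖brickComp Y A‖ * ((1 + dist (x : EuclideanSpace ℝ (Fin d)) y) ^ (α + sumExp d) *
        (1 + Metric.diam Y.1) ^ (α + sumExp d)) ≤ 2 ^ N * brickConst d N * K := by
    intro Y hx
    refine mul_le_of_mul_sq_le (norm_nonneg _) ?_ ?_
    · refine (brickComp_decay_dist h hA hx).trans ?_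
      have : (1 : ℝ) ≤ 2 ^ N := one_le_pow₀ (by norm_num)
      nlinarith [mul_nonneg hC hK]
    · rw [mul_assoc]
      exact brickComp_decay_diam Y h hA
  refine ⟨fun Y hx => le_trans ?_ (key Y hx), key⟩
  refine mul_le_mul_of_nonneg_left ?_ (norm_nonneg _)
  have h1 := Metric.diam_nonneg (s := Y.1)
  have h2 := dist_nonneg (x := (x : EuclideanSpace ℝ (Fin d))) (y := y)
  refine mul_le_mul_of_nonneg_right ?_ (by positivity)
  rw [dist_self]
  exact pow_le_pow_left₀ (by norm_num) (by linarith) _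

/-- Localization near `x` as well as near `y` is what allows `x` to become a new index of a chain
whose old indices are near `y`. -/
theorem exists_loc_part (L : SpinSystem d) (α : ℕ) : ∃ (N : ℕ) (C : ℝ), 0 ≤ C ∧
    ∀ {x : L.Site} {y : EuclideanSpace ℝ (Fin d)} {A : L.Op} {K : ℝ}, A ∈ lieQ L → Loc y N K A →
      Loc (x : EuclideanSpace ℝ (Fin d)) α (C * K) (part x A) ∧ Loc y α (C * K) (part x A) := by
  obtain ⟨N, C, hC, h⟩ := exists_spreadBound_brickComp L α
  obtain ⟨C', hC', h'⟩ := exists_loc_spread L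
  refine ⟨N, C' * C, by positivity, fun {x y A K} hA hK => ?_⟩
  rw [mul_assoc]
  exact ⟨h' (h hA hK).1 fun Y => brickComp_mem Y hA, h' (h hA hK).2 fun Y => brickComp_mem Y hA⟩

theorem part_mem_lieQ (x : L.Site) {A : L.Op} (hA : A ∈ lieQ L) : part x A ∈ lieQ L :=
  spread_mem_lieQ fun Y => brickComp_mem Y hA

theorem summable_part (x : L.Site) {A : L.Op} (hA : A ∈ lieAl L) :
    Summable fun Y => brickWeight L Y x • brickComp Y A := by
  obtain ⟨N, C, -, h⟩ := exists_spreadBound_brickComp L 0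
  obtain ⟨K, hK⟩ := exists_loc hA (x : EuclideanSpace ℝ (Fin d)) N
  exact (h (lieAl_le_lieQ hA) hK).1.summable

theorem brickComp_part (x : L.Site) {A : L.Op} (hA : A ∈ lieAl L) (Y : Brick d) :
    brickComp Y (part x A) = brickWeight L Y x • brickComp Y A :=
  brickComp_spread (fun Y => brickComp_mem Y (lieAl_le_lieQ hA)) (summable_part x hA) Y

theorem eq_of_brickComp {A B : L.Op} (hA : A ∈ lieQ L) (hB : B ∈ lieQ L)
    (h : ∀ Y : Brick d, brickComp Y A = brickComp Y B) : A = B :=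
  sub_eq_zero.1 (eq_zero_of_brickComp ((lieQ L).sub_mem hA hB) fun Y => by
    rw [brickComp_sub Y hA hB, h, sub_self])

theorem part_add (x : L.Site) {A B : L.Op} (hA : A ∈ lieAl L) (hB : B ∈ lieAl L) :
    part x (A + B) = part x A + part x B := by
  refine HasSum.tsum_eq ?_
  simp only [brickComp_add _ (lieAl_le_lieQ hA) (lieAl_le_lieQ hB), smul_add]
  exact (summable_part x hA).hasSum.add (summable_part x hB).hasSum

theorem part_smul (x : L.Site) (c : ℝ) {A : L.Op} (hA : A ∈ lieQ L) :
    part x (c • A) = c • part x A := by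
  simp only [part, spread, brickComp_smul _ c hA, smul_comm _ c, tsum_const_smul'']

theorem fam_part {A : L.Op} (hA : A ∈ lieAl L) (y : EuclideanSpace ℝ (Fin d)) :
    Fam (fun x => part x A) y where
  mem x := part_mem_lieQ x (lieAl_le_lieQ hA)
  loc N := by
    obtain ⟨N', C, -, h⟩ := exists_loc_part L N
    obtain ⟨K, hK⟩ := exists_loc hA y N'
    exact ⟨_, fun x => h (lieAl_le_lieQ hA) hK⟩

/-- Observables are the sums of their parts. -/
theorem tsum_part {A : L.Op} (hA : A ∈ lieAl L) : ∑' x, part x A = A := by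
  have hs := (fam_part hA 0).summable
  refine eq_of_brickComp (tsum_mem_lieQ (fam_part hA 0).mem) (lieAl_le_lieQ hA) fun Y => ?_
  refine (hasSum_brickComp Y hs.hasSum (fam_part hA 0).mem).unique ?_
  simp only [brickComp_part _ hA]
  exact hasSum_brickWeight_smul (brickComp_mem Y (lieAl_le_lieQ hA))

/-! ### Derivations from families -/

/-- `Y ↦ ∑_x f_x^Y`. -/
def total (f : L.Site → L.Op) : Brick d → L.Op := fun Y => ∑' x, brickComp Y (f x)

theorem exists_brickComp_le (L : SpinSystem d) (α : ℕ) : ∃ (N : ℕ) (C : ℝ), 0 ≤ C ∧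
    ∀ {x : L.Site} {A : L.Op} {K : ℝ} {Y : Brick d} {p : EuclideanSpace ℝ (Fin d)}, p ∈ Y.1 →
      A ∈ lieQ L → Loc (x : EuclideanSpace ℝ (Fin d)) N K A →
      ‖brickComp Y A‖ * ((1 + dist (x : EuclideanSpace ℝ (Fin d)) p) ^ α *
        (1 + Metric.diam Y.1) ^ α) ≤ C * K := by
  set N := 2 * α
  have hC := (brickConst_pos d N).le
  refine ⟨N, 2 ^ N * brickConst d N, by positivity, fun {x A K Y p} hp hA h => ?_⟩
  have hK := h.nonneg
  refine mul_le_of_mul_sq_le (norm_nonneg _) ?_ ?_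
  · rw [dist_comm]
    refine (brickComp_decay_dist h hA hp).trans ?_
    have : (1 : ℝ) ≤ 2 ^ N := one_le_pow₀ (by norm_num)
    nlinarith [mul_nonneg hC hK]
  · rw [mul_assoc]
    exact brickComp_decay_diam Y h hA

theorem IsUA₁.summable_brickComp {f : L.Site → L.Op} (hf : IsUA₁ f) (Y : Brick d) :
    Summable fun x => brickComp Y (f x) := by
  rcases Set.eq_empty_or_nonempty Y.1 with hY | ⟨p, hp⟩
  · simp only [brickComp_empty hY (hf.mem _)]
    exact summable_zero
  · obtain ⟨N, C, -, h⟩ := exists_brickComp_le L (sumExp d)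
    obtain ⟨K, hK⟩ := hf.loc N
    refine Summable.of_norm_bounded ((summable_site L p).mul_left (C * K)) fun x => ?_
    refine le_mul_inv_of_mul_le dist_nonneg (le_trans ?_ (h hp (hf.mem x) (hK x)))
    have h1 := Metric.diam_nonneg (s := Y.1)
    refine mul_le_mul_of_nonneg_left (le_mul_of_one_le_right (by positivity) ?_) (norm_nonneg _)
    exact one_le_pow₀ (by linarith)

theorem hasSum_mem_brickSpace {ι : Type*} {Y : Brick d} {f : ι → L.Op} {S : L.Op}
    (h : HasSum f S) (hf : ∀ i, f i ∈ brickSpace L Y) : S ∈ brickSpace L Y := by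
  obtain ⟨hS, -⟩ := hasSum_lieQ h fun i => brickSpace_lieQ (hf i)
  have h1 := hasSum_brickComp Y h fun i => brickSpace_lieQ (hf i)
  simp only [brickComp_self (hf _)] at h1
  rw [h.unique h1]
  exact brickComp_mem Y hS

theorem IsUA₁.total_mem {f : L.Site → L.Op} (hf : IsUA₁ f) (Y : Brick d) :
    total f Y ∈ brickSpace L Y :=
  hasSum_mem_brickSpace (hf.summable_brickComp Y).hasSum fun x => brickComp_mem Y (hf.mem x)

/-- Fix a point of the brick. Decay in the distance from the site to that point makes the sum over
sites converge, while decay in the diameter is carried along. -/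
theorem exists_norm_total_le (L : SpinSystem d) (α : ℕ) : ∃ (N : ℕ) (C : ℝ), 0 ≤ C ∧
    ∀ {f : L.Site → L.Op} {K : ℝ}, (∀ x, f x ∈ lieQ L) →
      (∀ x : L.Site, Loc (x : EuclideanSpace ℝ (Fin d)) N K (f x)) → ∀ Y : Brick d,
      (1 + Metric.diam Y.1) ^ α * ‖total f Y‖ ≤ C * K := by
  obtain ⟨N, C, hC, h⟩ := exists_brickComp_le L (α + sumExp d)
  obtain ⟨C', hC', h'⟩ := exists_site_sum_le L
  refine ⟨N, C * C', by positivity, fun {f K} hf hK Y => ?_⟩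
  obtain ⟨x₀⟩ := nonempty_site L
  have hK0 := (hK x₀).nonneg
  rcases Set.eq_empty_or_nonempty Y.1 with hY | ⟨p, hp⟩
  · simp only [total, brickComp_empty hY (hf _), tsum_zero, norm_zero, mul_zero]
    positivity
  · have h1 := Metric.diam_nonneg (s := Y.1)
    have h2 : ∀ x : L.Site, ‖brickComp Y (f x)‖ ≤ C * K / (1 + Metric.diam Y.1) ^ α *
        ((1 + dist (x : EuclideanSpace ℝ (Fin d)) p) ^ sumExp d)⁻¹ := by
      intro x
      refine le_mul_inv_of_mul_le dist_nonneg ?_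
      rw [le_div_iff₀ (by positivity), mul_assoc]
      refine le_trans (mul_le_mul_of_nonneg_left ?_ (norm_nonneg _)) (h hp (hf x) (hK x))
      have h3 := dist_nonneg (x := (x : EuclideanSpace ℝ (Fin d))) (y := p)
      exact mul_le_mul (pow_le_pow_right₀ (by linarith) (by omega))
        (pow_le_pow_right₀ (by linarith) (by omega)) (by positivity) (by positivity)
    have h3 : ‖total f Y‖ ≤ C * K / (1 + Metric.diam Y.1) ^ α * C' := by
      refine tsum_of_norm_bounded ((summable_site L p).mul_left _).hasSum h2 |>.trans ?_
      rw [tsum_mul_left]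
      exact mul_le_mul_of_nonneg_left ((summable_site L p).tsum_le_of_sum_le (h' p))
        (by positivity)
    calc (1 + Metric.diam Y.1) ^ α * ‖total f Y‖
        ≤ (1 + Metric.diam Y.1) ^ α * (C * K / (1 + Metric.diam Y.1) ^ α * C') :=
          mul_le_mul_of_nonneg_left h3 (by positivity)
      _ = C * C' * K := by field_simp

theorem IsUA₁.total_add {f g : L.Site → L.Op} (hf : IsUA₁ f) (hg : IsUA₁ g) :
    total (f + g) = total f + total g := by
  funext Y
  refine HasSum.tsum_eq ?_
  simp only [Pi.add_apply, brickComp_add _ (hf.mem _) (hg.mem _)]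
  exact (hf.summable_brickComp Y).hasSum.add (hg.summable_brickComp Y).hasSum

theorem IsUA₁.total_smul {f : L.Site → L.Op} (hf : IsUA₁ f) (c : ℝ) :
    total (c • f) = c • total f := by
  funext Y
  simp only [total, Pi.smul_apply, brickComp_smul _ _ (hf.mem _), tsum_const_smul'']

theorem IsUA₁.fam_part {f : L.Site → L.Op} (hf : IsUA₁ f) (x : L.Site) :
    Fam (fun z => part x (f z)) x := by
  refine ⟨fun z => part_mem_lieQ x (hf.mem z), fun N => ?_⟩
  obtain ⟨N', C, -, h⟩ := exists_loc_part L N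
  obtain ⟨K, hK⟩ := hf.loc N'
  exact ⟨_, fun z => ⟨(h (hf.mem z) (hK z)).2, (h (hf.mem z) (hK z)).1⟩⟩

/-- Spreading the total of a family amounts to summing the parts. -/
theorem IsUA₁.spread_total {f : L.Site → L.Op} (hf : IsUA₁ f) (x : L.Site) :
    spread x (total f) = ∑' z, part x (f z) := by
  have hfam := hf.fam_part x
  have hsp : Summable fun Y => brickWeight L Y x • total f Y := by
    obtain ⟨N, C, -, h⟩ := exists_norm_total_le L (0 + sumExp d)
    obtain ⟨K, hK⟩ := hf.loc N
    refine SpreadBound.summable (z := x) (α := 0) (K := C * K) fun Y _ => ?_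
    rw [dist_self, add_zero, one_pow, one_mul, mul_comm]
    exact h hf.mem hK Y
  refine eq_of_brickComp (spread_mem_lieQ hf.total_mem) (tsum_mem_lieQ hfam.mem) fun Y => ?_
  rw [brickComp_spread hf.total_mem hsp]
  refine HasSum.unique ?_ (hasSum_brickComp Y hfam.summable.hasSum hfam.mem)
  simp only [brickComp_part _ (hf.mem_lieAl _)]
  exact (hf.summable_brickComp Y).hasSum.const_smul _

theorem Fam.isUA₁ {u : L.Site → L.Op} {y : EuclideanSpace ℝ (Fin d)} (h : Fam u y) : IsUA₁ u :=
  ⟨h.mem, fun N => (h.loc N).imp fun _ hK x => (hK x).1⟩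

theorem Fam.brickComp_tsum {u : L.Site → L.Op} {y : EuclideanSpace ℝ (Fin d)} (h : Fam u y)
    (Y : Brick d) : brickComp Y (∑' x, u x) = total u Y :=
  (hasSum_brickComp Y h.summable.hasSum h.mem).tsum_eq.symm

theorem Fam.part_tsum {u : L.Site → L.Op} {y : EuclideanSpace ℝ (Fin d)} (h : Fam u y)
    (x : L.Site) : part x (∑' z, u z) = ∑' z, part x (u z) := by
  rw [← h.isUA₁.spread_total x]
  exact congrArg (spread x) (funext h.brickComp_tsum)

end UAL
end

open scoped NNReal Topology
noncomputable section
namespace UAL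
variable {d : ℕ} {L : SpinSystem d}

/-! ### The boundary and the homotopy on almost local functions of several sites -/

/-- With no variables in the first factor all `n!` permutations contribute the same term, cancelling
the normalization. -/
theorem wedge_zero_apply {X V₁ V₂ V₃ : Type*} [AddCommGroup V₁] [AddCommGroup V₂]
    [AddCommGroup V₃] [Module ℝ V₁] [Module ℝ V₂] [Module ℝ V₃] (B : V₁ →ₗ[ℝ] V₂ →ₗ[ℝ] V₃)
    {n : ℕ} (f : (Fin 0 → X) → V₁) {g : (Fin n → X) → V₂} (hg : IsSkew g) (j : Fin n → X) :
    wedge B 0 n n f g j = B (f Fin.elim0) (g j) := by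
  have h1 : ∀ σ : Equiv.Perm (Fin n), (Equiv.Perm.sign σ : ℤ) •
      B (f (j ∘ σ ∘ lft (zero_add n))) (g (j ∘ σ ∘ rgt (zero_add n))) =
      B (f Fin.elim0) (g j) := by
    intro σ
    have h2 : j ∘ σ ∘ rgt (zero_add n) = j ∘ σ := by
      funext i
      simp [rgt]
    rw [h2, hg, Subsingleton.elim (j ∘ σ ∘ lft (zero_add n)) Fin.elim0, map_zsmul, smul_smul]
    simp [← Units.val_mul]
  rw [wedge_apply (zero_add n), rawWedge]
  simp only [h1, Finset.sum_const, Finset.card_univ, Fintype.card_perm, Fintype.card_fin]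
  rw [← Nat.cast_smul_eq_nsmul ℝ, smul_smul]
  have : (n.factorial : ℝ) ≠ 0 := by exact_mod_cast n.factorial_ne_zero
  simp [this]

/-- Summation over the first variable. -/
def sumFirst {m : ℕ} (a : (Fin (m + 1) → L.Site) → L.Op) : (Fin m → L.Site) → L.Op :=
  fun j => ∑' x, a (Fin.cons x j)

theorem IsUA.mem_lieAl {m : ℕ} {a : (Fin (m + 1) → L.Site) → L.Op} (ha : IsUA a)
    (j : Fin (m + 1) → L.Site) : a j ∈ lieAl L :=
  mem_lieAl_of_loc (j 0 : EuclideanSpace ℝ (Fin d)) (ha.mem j)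
    fun α => (ha.loc α).imp fun _ h => h j 0

theorem IsUA.fam {m : ℕ} {a : (Fin (m + 1) → L.Site) → L.Op} (ha : IsUA a)
    (j : Fin m → L.Site) (i : Fin m) :
    Fam (fun x => a (Fin.cons x j)) (j i : EuclideanSpace ℝ (Fin d)) where
  mem x := ha.mem _
  loc N := (ha.loc N).imp fun K hK x => by
    have h0 := hK (Fin.cons x j) 0
    have h1 := hK (Fin.cons x j) i.succ
    rw [Fin.cons_zero] at h0
    rw [Fin.cons_succ] at h1
    exact ⟨h0, h1⟩

theorem IsUA.fam₂ {m : ℕ} {a : (Fin (m + 2) → L.Site) → L.Op} (ha : IsUA a)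
    (j : Fin m → L.Site) (i : Fin m) :
    Fam₂ (fun x y => a (Fin.cons y (Fin.cons x j : Fin (m + 1) → L.Site)))
      (j i : EuclideanSpace ℝ (Fin d)) where
  mem x y := ha.mem _
  loc N := (ha.loc N).imp fun K hK x y => by
    have h0 := hK (Fin.cons y (Fin.cons x j : Fin (m + 1) → L.Site)) 0
    have h1 := hK (Fin.cons y (Fin.cons x j : Fin (m + 1) → L.Site)) (Fin.succ 0)
    have h2 := hK (Fin.cons y (Fin.cons x j : Fin (m + 1) → L.Site)) i.succ.succ
    rw [Fin.cons_zero] at h0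
    rw [Fin.cons_succ, Fin.cons_zero] at h1
    rw [Fin.cons_succ, Fin.cons_succ] at h2
    exact ⟨h1, h0, h2⟩

theorem IsUA.isUA₁ {a : (Fin 1 → L.Site) → L.Op} (ha : IsUA a) : IsUA₁ fun x => a fun _ => x :=
  ⟨fun _ => ha.mem _, fun N => (ha.loc N).imp fun _ hK x => hK (fun _ => x) 0⟩

theorem exists_loc_sumFirst (L : SpinSystem d) (α : ℕ) : ∃ (N : ℕ) (C : ℝ), 0 ≤ C ∧
    ∀ {m : ℕ} {a : (Fin (m + 1) → L.Site) → L.Op} {K : ℝ}, (∀ j, a j ∈ lieQ L) →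
      (∀ j i, Loc (j i : EuclideanSpace ℝ (Fin d)) N K (a j)) →
      ∀ j i, Loc (j i : EuclideanSpace ℝ (Fin d)) α (C * K) (sumFirst a j) := by
  obtain ⟨N, C, hC, h⟩ := exists_loc_tsum L α
  refine ⟨N, C, hC, fun {m a K} ha hK j i => h (fun x => ha _) (fun x => ?_) (fun x => ?_)⟩
  · simpa using hK (Fin.cons x j) 0
  · simpa using hK (Fin.cons x j) i.succ

theorem isUA_sumFirst {m : ℕ} {a : (Fin (m + 1) → L.Site) → L.Op} (ha : IsUA a) :
    IsUA (sumFirst a) where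
  mem j := tsum_mem_lieQ fun _ => ha.mem _
  loc α := by
    obtain ⟨N, C, -, h⟩ := exists_loc_sumFirst L α
    obtain ⟨K, hK⟩ := ha.loc N
    exact ⟨_, h ha.mem hK⟩

theorem zsmul_sign_eq {V : Type*} [AddCommGroup V] [Module ℝ V] (z : ℤ) (v : V) :
    z • v = (z : ℝ) • v := (Int.cast_smul_eq_zsmul ℝ z v).symm

theorem isSkew_sumFirst {m : ℕ} {a : (Fin (m + 1) → L.Site) → L.Op} (ha : IsSkew a) :
    IsSkew (sumFirst a) := by
  intro σ j
  have : ∀ x, a (Fin.cons x (j ∘ σ)) = ((Equiv.Perm.sign σ : ℤ) : ℝ) • a (Fin.cons x j) := by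
    intro x
    rw [← zsmul_sign_eq]
    exact ha.contr x σ j
  simp only [sumFirst, this, tsum_const_smul'', zsmul_sign_eq]

theorem IsSkew.cons_cons {X V : Type*} [AddCommGroup V] {m : ℕ} {a : (Fin (m + 2) → X) → V}
    (ha : IsSkew a) (x y : X) (j : Fin m → X) :
    a (Fin.cons x (Fin.cons y j : Fin (m + 1) → X)) =
      -a (Fin.cons y (Fin.cons x j : Fin (m + 1) → X)) := by
  have h := ha (Equiv.swap 0 1) (Fin.cons y (Fin.cons x j : Fin (m + 1) → X))
  have h1 : (Fin.cons y (Fin.cons x j : Fin (m + 1) → X) : Fin (m + 2) → X) ∘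
      (Equiv.swap 0 1 : Equiv.Perm (Fin (m + 2))) =
      Fin.cons x (Fin.cons y j : Fin (m + 1) → X) := by
    funext i
    refine Fin.cases ?_ (fun i => ?_) i
    · rw [Function.comp_apply, Equiv.swap_apply_left]
      rfl
    · refine Fin.cases ?_ (fun i => ?_) i
      · rw [Function.comp_apply, show Fin.succ (0 : Fin (m + 1)) = 1 from rfl,
          Equiv.swap_apply_right]
        rfl
      · have h2 : i.succ.succ ≠ (1 : Fin (m + 2)) := fun h =>
          Fin.succ_ne_zero i (Fin.succ_injective _ h)
        rw [Function.comp_apply, Equiv.swap_apply_of_ne_of_ne (Fin.succ_ne_zero _) h2]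
        rfl
  rw [h1, Equiv.Perm.sign_swap (by simp)] at h
  simpa using h

theorem sumFirst_sumFirst {m : ℕ} {a : (Fin (m + 3) → L.Site) → L.Op} (ha : IsUA a)
    (hs : IsSkew a) : sumFirst (sumFirst a) = 0 := by
  funext j
  exact tsum_tsum_eq_zero_of_skew (ha.fam₂ j 0).summable fun x y => hs.cons_cons y x j

theorem cons_elim0 {X : Type*} (x : X) :
    (Fin.cons x (Fin.elim0 : Fin 0 → X) : Fin 1 → X) = fun _ => x :=
  funext fun i => by rw [Fin.eq_zero i]; rfl

theorem total_sumFirst {a : (Fin 2 → L.Site) → L.Op} (ha : IsUA a) (hs : IsSkew a) :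
    total (fun x => sumFirst a fun _ => x) = 0 := by
  funext Y
  have h0 : ∀ x, brickComp Y (sumFirst a fun _ => x) =
      ∑' y, brickComp Y (a (Fin.cons y fun _ => x)) := fun x =>
    (ha.fam (fun _ => x) 0).brickComp_tsum Y
  simp only [total, h0]
  refine tsum_tsum_eq_zero_of_skew ?_ fun x y => ?_
  · rcases Set.eq_empty_or_nonempty Y.1 with hY | ⟨p, hp⟩
    · simp only [brickComp_empty hY (ha.mem _)]
      exact summable_zero
    · obtain ⟨K, hK⟩ := ha.loc (2 * sumExp d)
      refine summable_of_decay₂ (y := p) (K := brickConst d (2 * sumExp d) * K)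
        (fun x y => ?_) fun x y => ?_
      · rw [dist_comm]
        exact brickComp_decay_dist (hK (Fin.cons y fun _ => x) 1) (ha.mem _) hp
      · rw [dist_comm]
        exact brickComp_decay_dist (hK (Fin.cons y fun _ => x) 0) (ha.mem _) hp
  · rw [← brickComp_neg Y (ha.mem _)]
    congr 1
    have h := hs.cons_cons y x Fin.elim0
    rwa [cons_elim0, cons_elim0] at h

/-- The double sum of commutators is skew in its two indices. The action of a family thus depends
only on its class modulo boundaries, that is, on the derivation it defines. -/
theorem famAct_sumFirst_eq_zero {a : (Fin 2 → L.Site) → L.Op} (ha : IsUA a) (hs : IsSkew a)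
    {A : L.Op} (hA : A ∈ lieAl L) : famAct (fun x => sumFirst a fun _ => x) A = 0 := by
  have h0 : ∀ x, ⁅sumFirst a fun _ => x, A⁆ = ∑' y, ⁅a (Fin.cons y fun _ => x), A⁆ := fun x =>
    ((hasSum_lie_left A (ha.fam (fun _ => x) 0).summable.hasSum).tsum_eq).symm
  simp only [famAct, h0]
  refine tsum_tsum_eq_zero_of_skew (Fam₂.summable (y := 0) ⟨fun x y =>
    lie_mem_lieQ (ha.mem _) (lieAl_le_lieQ hA), fun N => ?_⟩) fun x y => ?_
  · obtain ⟨K, hK⟩ := ha.loc N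
    obtain ⟨M, hM⟩ := exists_loc hA (0 : EuclideanSpace ℝ (Fin d)) N
    exact ⟨_, fun x y => ⟨(hK (Fin.cons y fun _ => x) 1).lie hM (ha.mem _) (lieAl_le_lieQ hA),
      (hK (Fin.cons y fun _ => x) 0).lie hM (ha.mem _) (lieAl_le_lieQ hA),
      (hK (Fin.cons y fun _ => x) 0).lie' hM (ha.mem _) (lieAl_le_lieQ hA)⟩⟩
  · have h := hs.cons_cons y x Fin.elim0
    rw [cons_elim0, cons_elim0] at h
    rw [h, ← lieB_apply, map_neg]
    rfl

theorem sumFirst_famAct {f : L.Site → L.Op} (hf : IsUA₁ f) {m : ℕ}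
    {a : (Fin (m + 2) → L.Site) → L.Op} (ha : IsUA a) (j : Fin (m + 1) → L.Site) :
    sumFirst (fun j => famAct f (a j)) j = famAct f (sumFirst a j) :=
  (hf.famAct_tsum (ha.fam j 0)).symm

theorem isUA_famAct {f : L.Site → L.Op} (hf : IsUA₁ f) {m : ℕ} {a : (Fin m → L.Site) → L.Op}
    (ha : IsUA a) : IsUA fun j => famAct f (a j) where
  mem j := famAct_mem_lieQ hf.mem (ha.mem j)
  loc α := by
    obtain ⟨N, C, -, h⟩ := exists_loc_famAct L α
    obtain ⟨K, hK⟩ := hf.loc N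
    obtain ⟨M, hM⟩ := ha.loc N
    exact ⟨_, fun j i => h hf.mem (ha.mem j) hK (hM j i)⟩

theorem isSkew_famAct (f : L.Site → L.Op) {m : ℕ} {a : (Fin m → L.Site) → L.Op}
    (ha : IsSkew a) : IsSkew fun j => famAct f (a j) := fun σ j => by
  change famAct f (a (j ∘ σ)) = _ • famAct f (a j)
  rw [ha σ j, zsmul_sign_eq, zsmul_sign_eq, famAct_smul]

/-- The homotopy, `∑_k (-1)^k W_{j_k}(a_{j_0 … ĵ_k … j_m})`. -/
def parts {m : ℕ} (a : (Fin m → L.Site) → L.Op) : (Fin (m + 1) → L.Site) → L.Op :=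
  fun j => ∑ k : Fin (m + 1), (-1 : ℝ) ^ (k : ℕ) • part (j k) (a (k.removeNth j))

/-- Deleting the first variable gives the first term; deleting a later one leaves `x` in place and
shifts the sign. The homotopy identity is this recursion summed over `x`. -/
theorem parts_cons {m : ℕ} (a : (Fin (m + 1) → L.Site) → L.Op) (x : L.Site)
    (j : Fin (m + 1) → L.Site) : parts a (Fin.cons x j) =
      part x (a j) - parts (fun j' => a (Fin.cons x j')) j := by
  rw [parts, Fin.sum_univ_succ, parts, sub_eq_add_neg, ← Finset.sum_neg_distrib]
  congr 1
  · simp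
  · refine Finset.sum_congr rfl fun k _ => ?_
    rw [Fin.cons_succ, Fin.val_succ, pow_succ, mul_neg_one, neg_smul]
    congr 3
    refine congrArg a (funext fun i => ?_)
    refine Fin.cases ?_ (fun i => ?_) i <;> simp [Fin.removeNth]

theorem exists_loc_parts (L : SpinSystem d) (m α : ℕ) : ∃ (N : ℕ) (C : ℝ), 0 ≤ C ∧
    ∀ {a : (Fin (m + 1) → L.Site) → L.Op} {K : ℝ}, (∀ j, a j ∈ lieQ L) →
      (∀ j i, Loc (j i : EuclideanSpace ℝ (Fin d)) N K (a j)) →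
      ∀ j i, Loc (j i : EuclideanSpace ℝ (Fin d)) α (C * K) (parts a j) := by
  obtain ⟨N, C, hC, h⟩ := exists_loc_part L α
  refine ⟨N, (m + 2 : ℕ) * C, by positivity, fun {a K} ha hK j i => ?_⟩
  have h1 : ∀ k : Fin (m + 2), Loc (j i : EuclideanSpace ℝ (Fin d)) α (C * K)
      ((-1 : ℝ) ^ (k : ℕ) • part (j k) (a (k.removeNth j))) := by
    intro k
    have h2 : Loc (j i : EuclideanSpace ℝ (Fin d)) α (C * K) (part (j k) (a (k.removeNth j))) := by
      rcases Fin.eq_self_or_eq_succAbove k i with rfl | ⟨i', rfl⟩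
      · exact (h (ha _) (hK (i.removeNth j) 0)).1
      · exact (h (ha _) (hK (k.removeNth j) i')).2
    simpa using h2.smul ((-1 : ℝ) ^ (k : ℕ))
  refine (Loc.sum (S := Finset.univ) fun k _ => h1 k).mono (le_of_eq ?_)
  rw [Finset.sum_const, Finset.card_univ, Fintype.card_fin, nsmul_eq_mul, mul_assoc]

theorem parts_mem_lieQ {m : ℕ} {a : (Fin m → L.Site) → L.Op} (ha : ∀ j, a j ∈ lieQ L)
    (j : Fin (m + 1) → L.Site) : parts a j ∈ lieQ L :=
  (lieQ L).sum_mem fun _ _ => (lieQ L).smul_mem _ (part_mem_lieQ _ (ha _))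

theorem isUA_parts {m : ℕ} {a : (Fin (m + 1) → L.Site) → L.Op} (ha : IsUA a) :
    IsUA (parts a) where
  mem := parts_mem_lieQ ha.mem
  loc α := by
    obtain ⟨N, C, -, h⟩ := exists_loc_parts L m α
    obtain ⟨K, hK⟩ := ha.loc N
    exact ⟨_, h ha.mem hK⟩

/-- `part x` as a linear map. -/
def partL (x : L.Site) : lieAl L →ₗ[ℝ] L.Op where
  toFun A := part x A
  map_add' A B := part_add x A.2 B.2
  map_smul' c A := part_smul x c (lieAl_le_lieQ A.2)

/-- The homotopy is the antisymmetrized product of the operator-valued function `x ↦ W_x` with `a`,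
under evaluation; skew-symmetry then needs no separate computation. -/
theorem parts_eq_wedge {m : ℕ} {a : (Fin m → L.Site) → lieAl L} (ha : IsSkew a) :
    parts (fun j => (a j : L.Op)) =
      wedge LinearMap.id 1 m (m + 1) (fun j : Fin 1 → L.Site => partL (j 0)) a := by
  have hW : IsSkew fun j : Fin 1 → L.Site => partL (L := L) (j 0) := fun σ j => by
    simp [Subsingleton.elim σ 1]
  have h1 : ∀ (x : L.Site) {m : ℕ} {a : (Fin m → L.Site) → lieAl L}, IsSkew a → ∀ j,
      wedge LinearMap.id 0 m m (contr x fun j : Fin 1 → L.Site => partL (L := L) (j 0)) a j =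
      part x (a j) := by
    intro x m a ha j
    rw [wedge_zero_apply _ _ ha]
    rfl
  induction m with
  | zero =>
    funext j
    have h2 := contr_wedge (B := LinearMap.id) (k := 0 + 1) (rfl : 1 + 0 = 0 + 1) hW ha (j 0)
    rw [contr_zero, wedge_zero_right, smul_zero] at h2
    rw [← Fin.cons_self_tail j]
    refine Eq.trans ?_ ((h1 (j 0) ha (Fin.tail j)).symm.trans
      (congrFun (h2.trans (add_zero _)) (Fin.tail j)).symm)
    have h3 : ∀ j' : Fin 0 → L.Site, a j' = a (Fin.tail j) := fun j' => by
      rw [Subsingleton.elim j' (Fin.tail j)]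
    simp only [parts, h3]
    simp
  | succ m ih =>
    refine ext_contr fun x => ?_
    have h2 := contr_wedge (B := LinearMap.id) (k := m + 1 + 1)
      (by omega : 1 + (m + 1) = m + 1 + 1) hW ha x
    have h3 := ih (a := contr x a) (ha.contr x)
    refine Eq.trans (funext fun j => ?_) h2.symm
    have h6 := parts_cons (fun j => (a j : L.Op)) x j
    refine h6.trans ((sub_eq_add_neg _ _).trans (congrArg₂ (fun A B : L.Op => A + B)
      (h1 x ha j).symm (Eq.trans ?_ (congrArg (fun A : L.Op => (-1 : ℝ) ^ 1 • A)
        (congrFun h3 j)))))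
    rw [pow_one, neg_one_smul]
    rfl

theorem isSkew_parts {m : ℕ} {a : (Fin (m + 1) → L.Site) → L.Op} (ha : IsUA a)
    (hs : IsSkew a) : IsSkew (parts a : (Fin (m + 2) → L.Site) → L.Op) := by
  have h := parts_eq_wedge (a := fun j => (⟨a j, ha.mem_lieAl j⟩ : lieAl L)) fun σ j =>
    Subtype.ext (by
      rw [zsmul_sign_eq]
      refine (hs σ j).trans ?_
      rw [zsmul_sign_eq]
      rfl)
  rw [show parts a = _ from h]
  exact isSkew_wedge _ _ _ _ _

/-- Sum `parts_cons` over `x`: the terms `W_x(a_j)` add up to `a_j`, and `W` commutes with the sum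
over the first variable of `a`. -/
theorem sumFirst_parts {m : ℕ} {a : (Fin (m + 2) → L.Site) → L.Op} (ha : IsUA a)
    (j : Fin (m + 2) → L.Site) : parts (sumFirst a) j + sumFirst (parts a) j = a j := by
  have h1 : HasSum (fun x => part x (a j)) (a j) := by
    have h := (fam_part (ha.mem_lieAl j) 0).summable.hasSum
    rwa [tsum_part (ha.mem_lieAl j)] at h
  have h2 : HasSum (fun x => parts (fun j' => a (Fin.cons x j')) j) (parts (sumFirst a) j) := by
    refine hasSum_sum fun k _ => HasSum.const_smul _ ?_
    have hf := ha.fam (k.removeNth j) 0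
    have h := (hf.isUA₁.fam_part (j k)).summable.hasSum
    rwa [← hf.part_tsum] at h
  have h3 := h1.sub h2
  simp only [← parts_cons] at h3
  rw [sumFirst, h3.tsum_eq]
  abel

/-- In the lowest degree the sum over the first variable leaves a function of no sites; its place is
taken by the derivation `total`, and spreading that derivation back reproduces the sum of the parts.
-/
theorem sumFirst_parts_one {a : (Fin 1 → L.Site) → L.Op} (ha : IsUA a) (j : Fin 1 → L.Site) :
    spread (j 0) (total fun x => a fun _ => x) + sumFirst (parts a) j = a j := by
  have h1 : HasSum (fun x => part x (a j)) (a j) := by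
    have h := (fam_part (ha.mem_lieAl j) 0).summable.hasSum
    rwa [tsum_part (ha.mem_lieAl j)] at h
  have h2 : HasSum (fun x => parts (fun j' => a (Fin.cons x j')) j)
      (spread (j 0) (total fun x => a fun _ => x)) := by
    have h := (ha.isUA₁.fam_part (j 0)).summable.hasSum
    rw [← ha.isUA₁.spread_total] at h
    convert h using 2 with x
    have h3 : ∀ j' : Fin 0 → L.Site, (Fin.cons x j' : Fin 1 → L.Site) = fun _ => x := fun j' => by
      rw [Subsingleton.elim j' Fin.elim0, cons_elim0]
    simp [parts, h3]
  have h3 := h1.sub h2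
  simp only [← parts_cons] at h3
  rw [sumFirst, h3.tsum_eq]
  abel

end UAL
end

open scoped NNReal Topology
noncomputable section
namespace UAL
variable {d : ℕ} {L : SpinSystem d}

/-! ### Chains and derivations -/

theorem UALChain.ext {q : ℕ} {a b : UALChain L q} (h : a.fn = b.fn) : a = b := Subtype.ext h

theorem UALDer.ext {F G : UALDer L} (h : F.fn = G.fn) : F = G := Subtype.ext h

theorem UALChain.isSkew {q : ℕ} (a : UALChain L q) : IsSkew a.fn := a.2.2.1

theorem UALChain.mem_lieAl {q : ℕ} (a : UALChain L q) (j : Fin (q + 1) → L.Site) :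
    a.fn j ∈ lieAl L := a.2.1 j

theorem UALChain.mem_lieQ {q : ℕ} (a : UALChain L q) (j : Fin (q + 1) → L.Site) :
    a.fn j ∈ lieQ L := lieAl_le_lieQ (a.2.1 j)

theorem UALChain.loc_norms {q : ℕ} (a : UALChain L q) (α : ℕ) (j : Fin (q + 1) → L.Site)
    (i : Fin (q + 1)) :
    Loc (j i : EuclideanSpace ℝ (Fin d)) α (UALChain.norms L q α a) (a.fn j) := by
  intro r
  rw [UALChain.norms_apply]
  have h := a.2.2.2 α
  simp only [chainTerm_apply] at h
  exact le_ciSup h ((i, j, r) : ChainIdx L q)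

theorem UALChain.norms_le {q α : ℕ} {a : UALChain L q} {K : ℝ}
    (h : ∀ j i, Loc (j i : EuclideanSpace ℝ (Fin d)) α K (a.fn j)) :
    UALChain.norms L q α a ≤ K := by
  obtain ⟨x⟩ := nonempty_site L
  have : Nonempty (ChainIdx L q) := ⟨(0, fun _ => x, 0)⟩
  rw [UALChain.norms_apply]
  exact ciSup_le fun i => h i.2.1 i.1 i.2.2

theorem UALChain.isUA {q : ℕ} (a : UALChain L q) : IsUA a.fn :=
  ⟨a.mem_lieQ, fun N => ⟨_, a.loc_norms N⟩⟩

/-- The chain with a given underlying function. -/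
def mkChain {q : ℕ} (a : (Fin (q + 1) → L.Site) → L.Op) (ha : IsUA a) (hs : IsSkew a) :
    UALChain L q :=
  ⟨a, ha.mem_lieAl, hs, fun α => by
    obtain ⟨K, hK⟩ := ha.loc α
    refine ⟨K, ?_⟩
    rintro _ ⟨i, rfl⟩
    exact (chainTerm_apply q α i a).trans_le (hK i.2.1 i.1 i.2.2)⟩

theorem mkChain_fn {q : ℕ} (a : (Fin (q + 1) → L.Site) → L.Op) (ha : IsUA a) (hs : IsSkew a) :
    (mkChain a ha hs).fn = a := rfl

theorem UALDer.mem (F : UALDer L) (Y : Brick d) : F.fn Y ∈ brickSpace L Y := F.2.1 Y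

theorem UALDer.le_norms (F : UALDer L) (α : ℕ) (Y : Brick d) :
    (1 + Metric.diam Y.1) ^ α * ‖F.fn Y‖ ≤ UALDer.norms L α F := by
  rw [UALDer.norms_apply]
  exact le_ciSup (f := fun Y : Brick d => (1 + Metric.diam Y.1) ^ α * ‖F.fn Y‖) (F.2.2 α) Y

theorem UALDer.norms_le {α : ℕ} {F : UALDer L} {K : ℝ}
    (h : ∀ Y : Brick d, (1 + Metric.diam Y.1) ^ α * ‖F.fn Y‖ ≤ K) : UALDer.norms L α F ≤ K := by
  have : Nonempty (Brick d) := ⟨⟨∅, Or.inl rfl⟩⟩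
  rw [UALDer.norms_apply]
  exact ciSup_le h

/-- The derivation with given components. -/
def mkDer (F : Brick d → L.Op) (hF : ∀ Y, F Y ∈ brickSpace L Y)
    (hb : ∀ α : ℕ, ∃ K : ℝ, ∀ Y : Brick d, (1 + Metric.diam Y.1) ^ α * ‖F Y‖ ≤ K) : UALDer L :=
  ⟨F, hF, fun α => (hb α).imp fun _ hK => by
    rintro _ ⟨Y, rfl⟩
    exact hK Y⟩

/-- A `0`-chain as a family of observables. -/
def UALChain.fam (f : UALChain L 0) : L.Site → L.Op := fun x => f.fn fun _ => x

theorem UALChain.isUA₁ (f : UALChain L 0) : IsUA₁ f.fam := f.isUA.isUA₁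

theorem UALChain.fn_eq_fam (f : UALChain L 0) (j : Fin 1 → L.Site) : f.fn j = f.fam (j 0) :=
  congrArg f.fn (funext fun i => by rw [Fin.eq_zero i])

theorem UALDer.spreadBound (F : UALDer L) (α : ℕ) (x : L.Site) :
    SpreadBound x x α (UALDer.norms L (α + sumExp d) F) F.fn := fun Y _ => by
  rw [dist_self, add_zero, one_pow, one_mul, mul_comm]
  exact F.le_norms _ Y

theorem exists_loc_spread_der (L : SpinSystem d) (α : ℕ) : ∃ (N : ℕ) (C : ℝ), 0 ≤ C ∧
    ∀ (F : UALDer L) (x : L.Site), Loc (x : EuclideanSpace ℝ (Fin d)) α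
      (C * UALDer.norms L N F) (spread x F.fn) := by
  obtain ⟨C, hC, h⟩ := exists_loc_spread L
  exact ⟨_, C, hC, fun F x => h (F.spreadBound α x) F.mem⟩

theorem UALDer.isUA_spread (F : UALDer L) :
    IsUA fun j : Fin 1 → L.Site => spread (j 0) F.fn where
  mem j := spread_mem_lieQ F.mem
  loc α := by
    obtain ⟨N, C, -, h⟩ := exists_loc_spread_der L α
    exact ⟨_, fun j i => by rw [Fin.eq_zero i]; exact h F (j 0)⟩

theorem isSkew_one {X V : Type*} [AddCommGroup V] (a : (Fin 1 → X) → V) : IsSkew a :=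
  fun σ j => by simp [Subsingleton.elim σ 1]

theorem UALDer.summable_spread (F : UALDer L) (x : L.Site) :
    Summable fun Y => brickWeight L Y x • F.fn Y := (F.spreadBound 0 x).summable

/-- `∂_q`, `q ≥ 1`. -/
def bdChain (L : SpinSystem d) (q : ℕ) : UALChain L (q + 1) →ₗ[ℝ] UALChain L q where
  toFun a := mkChain (sumFirst a.fn) (isUA_sumFirst a.isUA) (isSkew_sumFirst a.isSkew)
  map_add' a b := UALChain.ext (funext fun j => by
    have := ((a.isUA.fam j 0).summable.hasSum.add (b.isUA.fam j 0).summable.hasSum).tsum_eq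
    exact this)
  map_smul' c a := UALChain.ext (funext fun _ => tsum_const_smul'' c)

/-- `∂_0`. -/
def bdDer (L : SpinSystem d) : UALChain L 0 →ₗ[ℝ] UALDer L where
  toFun f := mkDer (total f.fam) f.isUA₁.total_mem fun α => by
    obtain ⟨N, C, -, h⟩ := exists_norm_total_le L α
    exact ⟨_, h (fun x => f.mem_lieQ _) fun x => f.loc_norms N (fun _ => x) 0⟩
  map_add' f g := UALDer.ext (f.isUA₁.total_add g.isUA₁)
  map_smul' c f := UALDer.ext (f.isUA₁.total_smul c)

/-- `h_q`, `q ≥ 0`. -/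
def htChain (L : SpinSystem d) (q : ℕ) : UALChain L q →ₗ[ℝ] UALChain L (q + 1) where
  toFun a := mkChain (parts a.fn) (isUA_parts a.isUA) (isSkew_parts a.isUA a.isSkew)
  map_add' a b := UALChain.ext (funext fun j => by
    change parts (a.fn + b.fn) j = parts a.fn j + parts b.fn j
    simp only [parts, Pi.add_apply, part_add _ (a.mem_lieAl _) (b.mem_lieAl _), smul_add,
      Finset.sum_add_distrib])
  map_smul' c a := UALChain.ext (funext fun j => by
    change parts (c • a.fn) j = c • parts a.fn j
    simp only [parts, Pi.smul_apply, part_smul _ c (a.mem_lieQ _), Finset.smul_sum, smul_comm c])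

/-- `h_{-1}`. -/
def htDer (L : SpinSystem d) : UALDer L →ₗ[ℝ] UALChain L 0 where
  toFun F := mkChain (fun j => spread (j 0) F.fn) F.isUA_spread (isSkew_one _)
  map_add' F G := UALChain.ext (funext fun j => by
    have := ((F.summable_spread (j 0)).hasSum.add (G.summable_spread (j 0)).hasSum).tsum_eq
    simp only [← smul_add] at this
    exact this)
  map_smul' c F := UALChain.ext (funext fun j => by
    change spread (j 0) (c • F.fn) = c • spread (j 0) F.fn
    simp only [spread, Pi.smul_apply, smul_comm _ c, tsum_const_smul''])

theorem bdChain_bdChain {q : ℕ} (a : UALChain L (q + 2)) :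
    bdChain L q (bdChain L (q + 1) a) = 0 :=
  UALChain.ext (sumFirst_sumFirst a.isUA a.isSkew)

theorem bdDer_bdChain (a : UALChain L 1) : bdDer L (bdChain L 0 a) = 0 :=
  UALDer.ext (total_sumFirst a.isUA a.isSkew)

theorem htChain_bdChain {q : ℕ} (a : UALChain L (q + 1)) :
    htChain L q (bdChain L q a) + bdChain L (q + 1) (htChain L (q + 1) a) = a :=
  UALChain.ext (funext fun j => sumFirst_parts a.isUA j)

theorem htDer_bdDer (a : UALChain L 0) :
    htDer L (bdDer L a) + bdChain L 0 (htChain L 0 a) = a :=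
  UALChain.ext (funext fun j => sumFirst_parts_one a.isUA j)

theorem bdDer_htDer (F : UALDer L) : bdDer L (htDer L F) = F :=
  UALDer.ext (funext fun Y => HasSum.tsum_eq (by
    have h : ∀ x, brickComp Y ((htDer L F).fam x) = brickWeight L Y x • F.fn Y := fun x =>
      brickComp_spread F.mem (F.summable_spread x) Y
    simp only [h]
    exact hasSum_brickWeight_smul (F.mem Y)))

/-! ### The action of derivations -/

theorem lieAl_ext {A B : lieAl L} (h : (A : L.Op) = B) : A = B := Subtype.ext h

/-- `F(A) = ∑_Y [F^Y, A]`, as a bilinear map. -/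
def act (L : SpinSystem d) : UALDer L →ₗ[ℝ] lieAl L →ₗ[ℝ] lieAl L :=
  LinearMap.mk₂ ℝ
    (fun F A => ⟨famAct (htDer L F).fam A, (htDer L F).isUA₁.famAct_mem A.2⟩)
    (fun F G A => lieAl_ext (by
      rw [map_add]
      exact (htDer L F).isUA₁.add_famAct (htDer L G).isUA₁ A.2))
    (fun c F A => lieAl_ext (by
      rw [map_smul]
      exact smul_famAct _ c _))
    (fun F A B => lieAl_ext ((htDer L F).isUA₁.famAct_add A.2 B.2))
    (fun c F A => lieAl_ext (famAct_smul _ c _))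

theorem act_coe (F : UALDer L) (A : lieAl L) :
    (act L F A : L.Op) = famAct (htDer L F).fam A := rfl

/-- The commutator of almost local observables, as a bilinear map. -/
def ad (L : SpinSystem d) : lieAl L →ₗ[ℝ] lieAl L →ₗ[ℝ] lieAl L :=
  LinearMap.mk₂ ℝ (fun A B => ⟨⁅(A : L.Op), (B : L.Op)⁆, lie_mem_lieAl A.2 B.2⟩)
    (fun A B C => lieAl_ext (by
      change lieB L _ _ = lieB L _ _ + lieB L _ _
      simp))
    (fun c A B => lieAl_ext (by
      change lieB L _ _ = c • lieB L _ _
      simp))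
    (fun A B C => lieAl_ext (by
      change lieB L _ _ = lieB L _ _ + lieB L _ _
      simp))
    (fun c A B => lieAl_ext (by
      change lieB L _ _ = c • lieB L _ _
      simp))

theorem ad_skew (A B : lieAl L) : ad L A B = -ad L B A := lieAl_ext (op_lie_skew _ _)

theorem ad_jacobi (A B C : lieAl L) :
    ad L A (ad L B C) = ad L (ad L A B) C + ad L B (ad L A C) := lieAl_ext (op_lie_leibniz _ _ _)

theorem act_ad (F : UALDer L) (A B : lieAl L) :
    act L F (ad L A B) = ad L (act L F A) B + ad L A (act L F B) :=
  lieAl_ext ((htDer L F).isUA₁.famAct_lie A.2 B.2)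

/-- The action of `∂_0 f` is the sum of the commutators with the components of `f`. -/
theorem act_bdDer (f : UALChain L 0) (A : lieAl L) :
    (act L (bdDer L f) A : L.Op) = famAct f.fam A := by
  -- By the contraction, `f` differs from the density `h_{-1} ∂_0 f` by the boundary of a 1-chain,
  -- and such a boundary acts by zero.
  have h := famAct_sumFirst_eq_zero (htChain L 0 f).isUA (htChain L 0 f).isSkew A.2
  have h1 : f.fam = (htDer L (bdDer L f)).fam + (bdChain L 0 (htChain L 0 f)).fam := by
    conv_lhs => rw [← htDer_bdDer f]
    rfl
  rw [h1, (htDer L _).isUA₁.add_famAct (bdChain L 0 _).isUA₁ A.2, act_coe]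
  exact (add_eq_left.2 h).symm

/-- The action of derivations on chains. -/
def actChain (L : SpinSystem d) (q : ℕ) (F : UALDer L) : UALChain L q →ₗ[ℝ] UALChain L q where
  toFun a := mkChain (fun j => famAct (htDer L F).fam (a.fn j))
    (isUA_famAct (htDer L F).isUA₁ a.isUA) (isSkew_famAct _ a.isSkew)
  map_add' a b := UALChain.ext (funext fun j =>
    (htDer L F).isUA₁.famAct_add (a.mem_lieAl j) (b.mem_lieAl j))
  map_smul' c _ := UALChain.ext (funext fun _ => famAct_smul _ c _)

theorem actChain_fn {q : ℕ} (F : UALDer L) (a : UALChain L q) (j : Fin (q + 1) → L.Site) :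
    (actChain L q F a).fn j = act L F ⟨a.fn j, a.mem_lieAl j⟩ := rfl

theorem bdChain_actChain {q : ℕ} (F : UALDer L) (a : UALChain L (q + 1)) :
    bdChain L q (actChain L (q + 1) F a) = actChain L q F (bdChain L q a) :=
  UALChain.ext (funext fun j => sumFirst_famAct (htDer L F).isUA₁ a.isUA j)

/-- The two densities of `∂_0 g` differ by a boundary, the action of `F` commutes with boundaries,
and `∂_0` kills them. Hence the bracket of derivations does not depend on the density used. -/
theorem bdDer_actChain_htDer (F : UALDer L) (g : UALChain L 0) :
    bdDer L (actChain L 0 F (htDer L (bdDer L g))) = bdDer L (actChain L 0 F g) := by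
  conv_rhs => rw [← htDer_bdDer g]
  rw [map_add, map_add, ← bdChain_actChain, bdDer_bdChain, add_zero]

/-- The bracket of derivations. -/
def derBr (L : SpinSystem d) : UALDer L →ₗ[ℝ] UALDer L →ₗ[ℝ] UALDer L :=
  LinearMap.mk₂ ℝ (fun F G => bdDer L (actChain L 0 F (htDer L G)))
    (fun F F' G => by
      rw [← map_add]
      refine congrArg _ (UALChain.ext (funext fun j => ?_))
      change _ = (actChain L 0 F (htDer L G)).fn j + (actChain L 0 F' (htDer L G)).fn j
      simp only [actChain_fn, map_add, LinearMap.add_apply, Submodule.coe_add])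
    (fun c F G => by
      rw [← map_smul]
      refine congrArg _ (UALChain.ext (funext fun j => ?_))
      change _ = c • (actChain L 0 F (htDer L G)).fn j
      simp only [actChain_fn, map_smul, LinearMap.smul_apply, Submodule.coe_smul])
    (fun F G G' => by simp only [map_add])
    (fun c F G => by simp only [map_smul])

theorem derBr_apply (F G : UALDer L) :
    derBr L F G = bdDer L (actChain L 0 F (htDer L G)) := rfl

theorem derBr_bdDer (F : UALDer L) (g : UALChain L 0) :
    derBr L F (bdDer L g) = bdDer L (actChain L 0 F g) := bdDer_actChain_htDer F g

/-- Apply `F` to `∑_x [g_x, A]`, with `g` the density of `G`: by the Leibniz rule for commutators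
one half of the terms is the action of the bracket and the other is `G` acting on `F(A)`. -/
theorem act_derBr (F G : UALDer L) (A : lieAl L) :
    act L (derBr L F G) A = act L F (act L G A) - act L G (act L F A) := by
  refine lieAl_ext (eq_sub_of_add_eq ?_)
  rw [derBr_apply, act_bdDer]
  have h1 := (htDer L G).isUA₁.fam_lie A.2 (0 : EuclideanSpace ℝ (Fin d))
  have h2 : ∀ x, famAct (htDer L F).fam ⁅(htDer L G).fam x, (A : L.Op)⁆ =
      ⁅(actChain L 0 F (htDer L G)).fam x, (A : L.Op)⁆ +
        ⁅(htDer L G).fam x, (act L F A : L.Op)⁆ := fun x =>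
    (htDer L F).isUA₁.famAct_lie ((htDer L G).isUA₁.mem_lieAl x) A.2
  refine Eq.trans ?_ ((htDer L F).isUA₁.famAct_tsum h1).symm
  simp only [h2]
  exact (((actChain L 0 F (htDer L G)).isUA₁.fam_lie A.2
    (0 : EuclideanSpace ℝ (Fin d))).summable.tsum_add ((htDer L G).isUA₁.fam_lie (act L F A).2
    (0 : EuclideanSpace ℝ (Fin d))).summable).symm

/-- The antisymmetrized commutator of two `0`-chains. -/
def comm₂ (f g : UALChain L 0) : UALChain L 1 :=
  mkChain (fun j => ⁅f.fam (j 0), g.fam (j 1)⁆ - ⁅f.fam (j 1), g.fam (j 0)⁆)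
    ⟨fun j => (lieQ L).sub_mem (lie_mem_lieQ (f.mem_lieQ _) (g.mem_lieQ _))
      (lie_mem_lieQ (f.mem_lieQ _) (g.mem_lieQ _)), fun N => by
      obtain ⟨K, hK⟩ := f.isUA₁.loc N
      obtain ⟨M, hM⟩ := g.isUA₁.loc N
      refine ⟨4 ^ N * 32 * (K * M) + 4 ^ N * 32 * (K * M), fun j i => ?_⟩
      have h := fun x y => (hK x).lie (hM y) (f.isUA₁.mem x) (g.isUA₁.mem y)
      have h' := fun x y => (hK x).lie' (hM y) (f.isUA₁.mem x) (g.isUA₁.mem y)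
      refine Fin.cases ?_ (fun i => ?_) i
      · exact (h (j 0) (j 1)).sub (h' (j 1) (j 0))
      · rw [Fin.eq_zero i]
        exact (h' (j 0) (j 1)).sub (h (j 1) (j 0))⟩
    (fun σ j => by
      have h : ∀ σ : Equiv.Perm (Fin 2), σ = 1 ∨ σ = Equiv.swap 0 1 := by decide
      rcases h σ with rfl | rfl
      · simp
      · rw [Equiv.Perm.sign_swap (by simp)]
        simp)

/-- The density of `{F, G} + {G, F}` is the boundary of the antisymmetrized commutator of the two
densities, so its total vanishes. -/
theorem derBr_skew (F G : UALDer L) : derBr L F G = -derBr L G F := by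
  rw [eq_neg_iff_add_eq_zero, derBr_apply, derBr_apply, ← map_add,
    ← bdDer_bdChain (comm₂ (htDer L F) (htDer L G))]
  refine congrArg _ (UALChain.ext (funext fun j => ?_))
  refine Eq.symm (HasSum.tsum_eq ?_)
  have h1 := (htDer L F).isUA₁.hasSum_lie ((htDer L G).mem_lieAl j)
  have h2 := (htDer L G).isUA₁.hasSum_lie ((htDer L F).mem_lieAl j)
  convert h1.add h2 using 2 with x
  · rw [UALChain.fn_eq_fam, UALChain.fn_eq_fam, op_lie_skew ((htDer L G).fam x),
      ← sub_eq_add_neg]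
    rfl
  · rfl

end UAL
end

open scoped NNReal Topology
noncomputable section
namespace UAL
variable {d : ℕ} {L : SpinSystem d}

/-! ### The Lie algebra of derivations and almost local observables -/

/-- Written with a density of `H`, all three terms become `∂_0` of iterated actions on that density,
and `act_derBr` is the identity between them. -/
theorem derBr_jacobi (F G H : UALDer L) :
    derBr L F (derBr L G H) = derBr L (derBr L F G) H + derBr L G (derBr L F H) := by
  rw [derBr_apply G H, derBr_bdDer, derBr_apply F H, derBr_bdDer, derBr_apply (derBr L F G) H,
    ← map_add]
  refine congrArg _ (UALChain.ext (funext fun j => ?_))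
  change (act L F (act L G ⟨(htDer L H).fn j, (htDer L H).mem_lieAl j⟩) : L.Op) =
    (act L (derBr L F G) ⟨(htDer L H).fn j, (htDer L H).mem_lieAl j⟩ : L.Op) +
      (act L G (act L F ⟨(htDer L H).fn j, (htDer L H).mem_lieAl j⟩) : L.Op)
  rw [act_derBr, ← Submodule.coe_add, sub_add_cancel]

/-- The semidirect product of the almost local derivations and the almost local observables. -/
abbrev ExtLie (L : SpinSystem d) : Type := UALDer L × lieAl L

/-- The bracket of the semidirect product. -/
def extBr (L : SpinSystem d) : ExtLie L →ₗ[ℝ] ExtLie L →ₗ[ℝ] ExtLie L :=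
  LinearMap.mk₂ ℝ
    (fun v w => (derBr L v.1 w.1, act L v.1 w.2 - act L w.1 v.2 + ad L v.2 w.2))
    (fun v v' w => Prod.ext (by simp) (by
      simp only [Prod.fst_add, Prod.snd_add, map_add, LinearMap.add_apply]
      abel))
    (fun c v w => Prod.ext (by simp) (by
      simp only [Prod.smul_fst, Prod.smul_snd, map_smul, LinearMap.smul_apply, smul_add,
        smul_sub]))
    (fun v w w' => Prod.ext (by simp) (by
      simp only [Prod.fst_add, Prod.snd_add, map_add, LinearMap.add_apply]
      abel))
    (fun c v w => Prod.ext (by simp) (by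
      simp only [Prod.smul_fst, Prod.smul_snd, map_smul, LinearMap.smul_apply, smul_add,
        smul_sub]))

theorem extBr_fst (v w : ExtLie L) : (extBr L v w).1 = derBr L v.1 w.1 := rfl

theorem extBr_snd (v w : ExtLie L) :
    (extBr L v w).2 = act L v.1 w.2 - act L w.1 v.2 + ad L v.2 w.2 := rfl

theorem extBr_skew (v w : ExtLie L) : extBr L v w = -extBr L w v := by
  refine Prod.ext ?_ ?_
  · rw [Prod.fst_neg, extBr_fst, extBr_fst]
    exact derBr_skew _ _
  · rw [Prod.snd_neg, extBr_snd, extBr_snd, ad_skew w.2]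
    abel

/-- The Jacobi identity in a semidirect product, second component. -/
theorem semidirect_jacobi {D M : Type*} [AddCommGroup M] {act : D → M → M} {ad : M → M → M}
    {br : D → D → D} (act_add : ∀ F A B, act F (A + B) = act F A + act F B)
    (act_sub : ∀ F A B, act F (A - B) = act F A - act F B)
    (ad_add : ∀ A B C, ad A (B + C) = ad A B + ad A C)
    (ad_sub : ∀ A B C, ad A (B - C) = ad A B - ad A C)
    (add_ad : ∀ A B C, ad (A + B) C = ad A C + ad B C)
    (sub_ad : ∀ A B C, ad (A - B) C = ad A C - ad B C)
    (act_br : ∀ F G A, act (br F G) A = act F (act G A) - act G (act F A))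
    (act_ad : ∀ F A B, act F (ad A B) = ad (act F A) B + ad A (act F B))
    (skew : ∀ A B, ad A B = -ad B A)
    (jacobi : ∀ A B C, ad A (ad B C) = ad (ad A B) C + ad B (ad A C))
    (F G H : D) (A B C : M) :
    act F (act G C - act H B + ad B C) - act (br G H) A + ad A (act G C - act H B + ad B C) =
      act (br F G) C - act H (act F B - act G A + ad A B) +
        ad (act F B - act G A + ad A B) C +
      (act G (act F C - act H A + ad A C) - act (br F H) B +
        ad B (act F C - act H A + ad A C)) := by
  simp only [act_add, act_sub, ad_add, ad_sub, add_ad, sub_ad, act_br, act_ad]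
  rw [jacobi A B C, skew (act H A) B]
  abel

/-- This single ungraded identity collects the Jacobi identities of derivations and of observables
and their compatibilities. It is the base case of the graded Jacobi identity in all degrees, so no
case distinction on degrees is needed there. -/
theorem extBr_jacobi (u v w : ExtLie L) :
    extBr L u (extBr L v w) = extBr L (extBr L u v) w + extBr L v (extBr L u w) :=
  Prod.ext (derBr_jacobi u.1 v.1 w.1) (semidirect_jacobi (act := fun F A => act L F A)
    (ad := fun A B => ad L A B) (br := fun F G => derBr L F G) (fun F => (act L F).map_add)
    (fun F => (act L F).map_sub) (fun A => (ad L A).map_add) (fun A => (ad L A).map_sub)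
    (ad L).map_add₂ (ad L).map_sub₂ act_derBr act_ad ad_skew ad_jacobi
    u.1 v.1 w.1 u.2 v.2 w.2)

/-! ### The whole complex as skew functions into one Lie algebra -/

/-- Chains as functions with values in the semidirect product. -/
def embChain (L : SpinSystem d) (q : ℕ) :
    UALChain L q →ₗ[ℝ] ((Fin (q + 1) → L.Site) → ExtLie L) where
  toFun a := fun j => (0, ⟨a.fn j, a.mem_lieAl j⟩)
  map_add' _ _ := funext fun _ => Prod.ext (add_zero _).symm rfl
  map_smul' c _ := funext fun _ => Prod.ext (smul_zero c).symm rfl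

/-- Derivations as constant functions with values in the semidirect product. -/
def embDer (L : SpinSystem d) : UALDer L →ₗ[ℝ] ((Fin 0 → L.Site) → ExtLie L) where
  toFun F := fun _ => (F, 0)
  map_add' _ _ := funext fun _ => Prod.ext rfl (add_zero _).symm
  map_smul' c _ := funext fun _ => Prod.ext rfl (smul_zero c).symm

/-- Elements of shifted degree `n` as functions of `n` sites. -/
def emb (L : SpinSystem d) : ∀ n, NoetherCx L n →ₗ[ℝ] ((Fin n → L.Site) → ExtLie L)
  | 0 => embDer L
  | q + 1 => embChain L q

theorem extBr_embDer_embDer (F G : UALDer L) (j₁ j₂ : Fin 0 → L.Site) :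
    extBr L (embDer L F j₁) (embDer L G j₂) = (derBr L F G, 0) := by
  refine Prod.ext rfl ?_
  rw [extBr_snd]
  change act L F 0 - act L G 0 + ad L 0 0 = 0
  simp only [map_zero, sub_zero, add_zero]

theorem extBr_embDer_embChain {q : ℕ} (F : UALDer L) (a : UALChain L q) (j₁ : Fin 0 → L.Site)
    (j₂ : Fin (q + 1) → L.Site) : extBr L (embDer L F j₁) (embChain L q a j₂) =
      (0, act L F ⟨a.fn j₂, a.mem_lieAl j₂⟩) := by
  refine Prod.ext ((extBr_fst _ _).trans (map_zero _)) ?_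
  rw [extBr_snd]
  change act L F ⟨a.fn j₂, a.mem_lieAl j₂⟩ - act L 0 0 + ad L 0 ⟨a.fn j₂, a.mem_lieAl j₂⟩ =
    act L F ⟨a.fn j₂, a.mem_lieAl j₂⟩
  simp only [map_zero, LinearMap.zero_apply, sub_zero, add_zero]

theorem extBr_embChain_embDer {q : ℕ} (a : UALChain L q) (F : UALDer L)
    (j₁ : Fin (q + 1) → L.Site) (j₂ : Fin 0 → L.Site) :
    extBr L (embChain L q a j₁) (embDer L F j₂) =
      (0, -act L F ⟨a.fn j₁, a.mem_lieAl j₁⟩) := by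
  rw [extBr_skew, extBr_embDer_embChain]
  exact Prod.ext neg_zero rfl

theorem extBr_embChain_embChain {p q : ℕ} (a : UALChain L p) (b : UALChain L q)
    (j₁ : Fin (p + 1) → L.Site) (j₂ : Fin (q + 1) → L.Site) :
    extBr L (embChain L p a j₁) (embChain L q b j₂) =
      (0, ad L ⟨a.fn j₁, a.mem_lieAl j₁⟩ ⟨b.fn j₂, b.mem_lieAl j₂⟩) := by
  refine Prod.ext ((extBr_fst _ _).trans (map_zero _)) ?_
  rw [extBr_snd]
  change act L 0 _ - act L 0 _ + _ = _
  simp only [map_zero, LinearMap.zero_apply, sub_zero, zero_add]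
  rfl

/-- Graded identities can therefore be checked on functions with values in `ExtLie`, where they
concern only `wedge`. -/
theorem emb_injective (n : ℕ) : Function.Injective (emb L n) := by
  intro f g h
  cases n with
  | zero => exact congrArg Prod.fst (congrFun h Fin.elim0)
  | succ q => exact UALChain.ext (funext fun j =>
      congrArg (fun v : ExtLie L => (v.2 : L.Op)) (congrFun h j))

theorem isSkew_emb {n : ℕ} (f : NoetherCx L n) : IsSkew (emb L n f) := by
  cases n with
  | zero => intro σ j; simp [Subsingleton.elim σ 1]
  | succ q =>
    intro σ j
    refine Prod.ext (smul_zero _).symm (lieAl_ext ?_)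
    change UALChain.fn f (j ∘ σ) = _
    rw [UALChain.isSkew f σ j, zsmul_sign_eq, zsmul_sign_eq]
    rfl

/-! ### Construction and seminorm estimates of the graded bracket -/

/-- The norms defining the topology of the complex. -/
def nrm (L : SpinSystem d) : ∀ n, SeminormFamily ℝ (NoetherCx L n) ℕ
  | 0 => UALDer.norms L
  | q + 1 => UALChain.norms L q

theorem nrm_mono {n : ℕ} (f : NoetherCx L n) {α β : ℕ} (h : α ≤ β) :
    nrm L n α f ≤ nrm L n β f := by
  cases n with
  | zero =>
    refine UALDer.norms_le fun Y => le_trans ?_ (UALDer.le_norms f β Y)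
    have := Metric.diam_nonneg (s := Y.1)
    exact mul_le_mul_of_nonneg_right (pow_le_pow_right₀ (by linarith) h) (norm_nonneg _)
  | succ q => exact UALChain.norms_le fun j i => (UALChain.loc_norms f β j i).anti h

theorem UALChain.loc_le {q : ℕ} (a : UALChain L q) {α N : ℕ} (h : α ≤ N)
    (j : Fin (q + 1) → L.Site) (i : Fin (q + 1)) :
    Loc (j i : EuclideanSpace ℝ (Fin d)) α (nrm L (q + 1) N a) (a.fn j) :=
  (a.loc_norms α j i).mono (nrm_mono (n := q + 1) a h)

theorem exists_loc_act (L : SpinSystem d) (α : ℕ) : ∃ (N : ℕ) (C : ℝ), 0 ≤ C ∧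
    ∀ (F : UALDer L) {A : lieAl L} {y : EuclideanSpace ℝ (Fin d)} {M : ℝ},
      Loc y N M (A : L.Op) → Loc y α (C * (nrm L 0 N F * M)) (act L F A : L.Op) := by
  obtain ⟨N, C, hC, h⟩ := exists_loc_famAct L α
  obtain ⟨N', C', hC', h'⟩ := exists_loc_spread_der L N
  refine ⟨max N N', C * C', by positivity, fun F {A y M} hM => ?_⟩
  have h1 : ∀ x : L.Site, Loc (x : EuclideanSpace ℝ (Fin d)) N (C' * nrm L 0 (max N N') F)
      ((htDer L F).fam x) := fun x => (h' F x).mono (mul_le_mul_of_nonneg_left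
    (nrm_mono (n := 0) F (le_max_right N N')) hC')
  rw [mul_assoc, ← mul_assoc C']
  exact h (htDer L F).isUA₁.mem (lieAl_le_lieQ A.2) h1 (hM.anti (le_max_left N N'))

theorem exists_loc_extBr (L : SpinSystem d) (m n α : ℕ) : ∃ (N : ℕ) (C : ℝ), 0 ≤ C ∧
    ∀ (f : NoetherCx L m) (g : NoetherCx L n) (j₁ : Fin m → L.Site) (j₂ : Fin n → L.Site),
      (∀ i, Loc (j₁ i : EuclideanSpace ℝ (Fin d)) α (C * (nrm L m N f * nrm L n N g))
        ((extBr L (emb L m f j₁) (emb L n g j₂)).2 : L.Op)) ∧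
      (∀ i, Loc (j₂ i : EuclideanSpace ℝ (Fin d)) α (C * (nrm L m N f * nrm L n N g))
        ((extBr L (emb L m f j₁) (emb L n g j₂)).2 : L.Op)) := by
  obtain ⟨N, C, hC, h⟩ := exists_loc_act L α
  have key : ∀ {y : EuclideanSpace ℝ (Fin d)} {K : ℝ} {v w : ExtLie L}, v = w →
      Loc y α K (w.2 : L.Op) → Loc y α K (v.2 : L.Op) := fun h1 h2 => h1 ▸ h2
  cases m with
  | zero =>
    cases n with
    -- Without sites there is no localization to verify; the bracket of two derivations is estimated
    -- separately, through brick components.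
    | zero => exact ⟨0, 0, le_rfl, fun f g j₁ j₂ => ⟨fun i => i.elim0, fun i => i.elim0⟩⟩
    | succ q =>
      refine ⟨N, C, hC, fun f g j₁ j₂ => ⟨fun i => i.elim0, fun i => ?_⟩⟩
      exact key (extBr_embDer_embChain f g j₁ j₂) (h f (A := ⟨_, UALChain.mem_lieAl g j₂⟩)
        (UALChain.loc_le g le_rfl j₂ i))
  | succ p =>
    cases n with
    | zero =>
      refine ⟨N, C, hC, fun f g j₁ j₂ => ⟨fun i => ?_, fun i => i.elim0⟩⟩
      refine key (extBr_embChain_embDer f g j₁ j₂) ?_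
      rw [mul_comm (nrm L (p + 1) N f)]
      exact (h g (A := ⟨_, UALChain.mem_lieAl f j₁⟩) (UALChain.loc_le f le_rfl j₁ i)).neg
    | succ q =>
      refine ⟨α, 4 ^ α * 32, by positivity, fun f g j₁ j₂ => ⟨fun i => ?_, fun i => ?_⟩⟩
      · exact key (extBr_embChain_embChain f g j₁ j₂)
          ((UALChain.loc_le f le_rfl j₁ i).lie (UALChain.loc_le g le_rfl j₂ 0)
            (UALChain.mem_lieQ f _) (UALChain.mem_lieQ g _))
      · exact key (extBr_embChain_embChain f g j₁ j₂)
          ((UALChain.loc_le f le_rfl j₁ 0).lie' (UALChain.loc_le g le_rfl j₂ i)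
            (UALChain.mem_lieQ f _) (UALChain.mem_lieQ g _))

theorem wedge_snd {m n k : ℕ} (e : m + n = k) (f : (Fin m → L.Site) → ExtLie L)
    (g : (Fin n → L.Site) → ExtLie L) (j : Fin k → L.Site) :
    ((wedge (extBr L) m n k f g j).2 : L.Op) = (1 / (m.factorial * n.factorial) : ℝ) •
      ∑ σ : Equiv.Perm (Fin k), (Equiv.Perm.sign σ : ℤ) •
        ((extBr L (f (j ∘ σ ∘ lft e)) (g (j ∘ σ ∘ rgt e))).2 : L.Op) := by
  rw [wedge_apply e, rawWedge, Prod.smul_snd, Prod.snd_sum, Submodule.coe_smul,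
    Submodule.coe_sum]
  rfl

theorem wedge_fst {m n k : ℕ} {f : (Fin m → L.Site) → ExtLie L}
    {g : (Fin n → L.Site) → ExtLie L} (h : ∀ j j', derBr L (f j).1 (g j').1 = 0)
    (j : Fin k → L.Site) : (wedge (extBr L) m n k f g j).1 = 0 := by
  by_cases e : m + n = k
  · rw [wedge_apply e, rawWedge, Prod.smul_fst, Prod.fst_sum, Finset.sum_eq_zero, smul_zero]
    intro σ _
    rw [Prod.smul_fst, extBr_fst, h, smul_zero]
  · rw [wedge_of_ne e]
    rfl

theorem lft_or_rgt {m n k : ℕ} (e : m + n = k) (p : Fin k) :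
    (∃ a, p = lft e a) ∨ ∃ b, p = rgt e b := by
  rcases lt_or_ge (p : ℕ) m with h | h
  · exact Or.inl ⟨⟨p, h⟩, rfl⟩
  · exact Or.inr ⟨⟨p - m, by omega⟩, Fin.ext (by simp only [rgt]; omega)⟩

theorem exists_loc_wedge (L : SpinSystem d) {m n k : ℕ} (e : m + n = k) (α : ℕ) :
    ∃ (N : ℕ) (C : ℝ), 0 ≤ C ∧ ∀ (f : NoetherCx L m) (g : NoetherCx L n) (j : Fin k → L.Site) i,
      Loc (j i : EuclideanSpace ℝ (Fin d)) α (C * (nrm L m N f * nrm L n N g))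
        ((wedge (extBr L) m n k (emb L m f) (emb L n g) j).2 : L.Op) := by
  obtain ⟨N, C, hC, h⟩ := exists_loc_extBr L m n α
  set c : ℝ := 1 / (m.factorial * n.factorial)
  refine ⟨N, |c| * (Fintype.card (Equiv.Perm (Fin k)) * C), by positivity, fun f g j i => ?_⟩
  rw [wedge_snd e]
  refine ((Loc.sum (S := Finset.univ)
    (K := fun _ => C * (nrm L m N f * nrm L n N g)) fun σ _ => ?_).smul _).mono
    (le_of_eq ?_)
  · have h1 : Loc (j i : EuclideanSpace ℝ (Fin d)) α (C * (nrm L m N f * nrm L n N g))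
        ((extBr L (emb L m f (j ∘ σ ∘ lft e)) (emb L n g (j ∘ σ ∘ rgt e))).2 : L.Op) := by
      obtain ⟨p, rfl⟩ := σ.surjective i
      rcases lft_or_rgt e p with ⟨a, rfl⟩ | ⟨b, rfl⟩
      · exact (h f g (j ∘ σ ∘ lft e) (j ∘ σ ∘ rgt e)).1 a
      · exact (h f g (j ∘ σ ∘ lft e) (j ∘ σ ∘ rgt e)).2 b
    rw [zsmul_sign_eq]
    refine (h1.smul _).mono (le_of_eq ?_)
    rcases Int.units_eq_one_or (Equiv.Perm.sign σ) with h2 | h2 <;> simp [h2]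
  · rw [Finset.sum_const, Finset.card_univ, nsmul_eq_mul]
    ring

/-- A product with at least one chain has vanishing derivation component, and its observable
component is localized near each site, because every site enters one of the two factors. So the
product comes from a chain. -/
theorem exists_emb_eq {m n k : ℕ} (e : m + n = k) (f : NoetherCx L m) (g : NoetherCx L n) :
    ∃ c : NoetherCx L k, emb L k c = wedge (extBr L) m n k (emb L m f) (emb L n g) := by
  cases k with
  | zero =>
    obtain rfl : m = 0 := by omega
    obtain rfl : n = 0 := by omega
    refine ⟨derBr L f g, funext fun j => ?_⟩
    rw [wedge_zero_zero]
    exact (extBr_embDer_embDer f g j j).symm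
  | succ k =>
    have h1 := fun α => exists_loc_wedge L e α
    refine ⟨mkChain (fun j => ((wedge (extBr L) m n (k + 1) (emb L m f) (emb L n g) j).2 : L.Op))
      ⟨fun j => lieAl_le_lieQ (Subtype.property _), fun α => ?_⟩ fun σ j => ?_,
      funext fun j => Prod.ext (Eq.symm (wedge_fst (fun j j' => ?_) j)) rfl⟩
    · obtain ⟨N, C, -, h⟩ := h1 α
      exact ⟨_, h f g⟩
    · exact congrArg (fun v : ExtLie L => (v.2 : L.Op)) (isSkew_wedge _ _ _ _ _ σ j)
    · cases m with
      | zero =>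
        cases n with
        | zero => omega
        | succ q => exact (derBr L _).map_zero
      | succ p => exact (derBr L).map_zero₂ _

theorem emb_add {n : ℕ} (f g : NoetherCx L n) : emb L n (f + g) = emb L n f + emb L n g :=
  (emb L n).map_add f g

theorem emb_smul {n : ℕ} (c : ℝ) (f : NoetherCx L n) : emb L n (c • f) = c • emb L n f :=
  (emb L n).map_smul c f

/-- The bracket as a function. -/
def bracketFun {m n k : ℕ} (e : m + n = k) (f : NoetherCx L m) (g : NoetherCx L n) :
    NoetherCx L k := (exists_emb_eq e f g).choose

theorem emb_bracketFun {m n k : ℕ} (e : m + n = k) (f : NoetherCx L m) (g : NoetherCx L n) :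
    emb L k (bracketFun e f g) = wedge (extBr L) m n k (emb L m f) (emb L n g) :=
  (exists_emb_eq e f g).choose_spec

/-- The bracket. -/
def bracket (L : SpinSystem d) (m n k : ℕ) (e : m + n = k) :
    NoetherCx L m →ₗ[ℝ] NoetherCx L n →ₗ[ℝ] NoetherCx L k :=
  LinearMap.mk₂ ℝ (bracketFun e)
    (fun f f' g => emb_injective k (by
      rw [emb_add, emb_bracketFun, emb_bracketFun, emb_bracketFun, emb_add, wedge_add_left]))
    (fun c f g => emb_injective k (by
      rw [emb_smul, emb_bracketFun, emb_bracketFun, emb_smul, wedge_smul_left]))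
    (fun f g g' => emb_injective k (by
      rw [emb_add, emb_bracketFun, emb_bracketFun, emb_bracketFun, emb_add, wedge_add_right]))
    (fun c f g => emb_injective k (by
      rw [emb_smul, emb_bracketFun, emb_bracketFun, emb_smul, wedge_smul_right]))

theorem emb_bracket {m n k : ℕ} (e : m + n = k) (f : NoetherCx L m) (g : NoetherCx L n) :
    emb L k (bracket L m n k e f g) = wedge (extBr L) m n k (emb L m f) (emb L n g) :=
  emb_bracketFun e f g

theorem bracket_fn {m n k : ℕ} (e : m + n = k + 1) (f : NoetherCx L m) (g : NoetherCx L n)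
    (j : Fin (k + 1) → L.Site) : UALChain.fn (bracket L m n (k + 1) e f g) j =
      ((wedge (extBr L) m n (k + 1) (emb L m f) (emb L n g) j).2 : L.Op) :=
  congrArg (fun v : ExtLie L => (v.2 : L.Op)) (congrFun (emb_bracket e f g) j)

theorem bracket_zero_zero (F G : NoetherCx L 0) : bracket L 0 0 0 rfl F G = derBr L F G := by
  have h := congrFun (emb_bracket rfl F G) Fin.elim0
  rw [wedge_zero_zero] at h
  exact congrArg Prod.fst h

theorem bracket_zero_succ {q : ℕ} (F : NoetherCx L 0) (a : NoetherCx L (q + 1)) :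
    bracket L 0 (q + 1) (q + 1) (zero_add _) F a = actChain L q F a := by
  refine UALChain.ext (funext fun j => ?_)
  rw [bracket_fn, wedge_zero_apply _ _ (isSkew_emb a)]
  exact congrArg (fun v : ExtLie L => (v.2 : L.Op)) (extBr_embDer_embChain F a Fin.elim0 j)

/-- Graded skew-symmetry. -/
theorem bracket_skew {m n k : ℕ} (e : m + n = k) (e' : n + m = k) (f : NoetherCx L m)
    (g : NoetherCx L n) :
    bracket L m n k e f g = -((-1 : ℝ) ^ (m * n) • bracket L n m k e' g f) := by
  refine emb_injective k ?_
  have h : wedge (extBr L).flip n m k (emb L n g) (emb L m f) =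
      -wedge (extBr L) n m k (emb L n g) (emb L m f) := by
    funext j
    rw [Pi.neg_apply, wedge_apply e', wedge_apply e', ← smul_neg, rawWedge, rawWedge,
      ← Finset.sum_neg_distrib]
    refine congrArg _ (Finset.sum_congr rfl fun σ _ => ?_)
    rw [LinearMap.flip_apply, extBr_skew, smul_neg]
  rw [LinearMap.map_neg, emb_smul, emb_bracket, emb_bracket, wedge_comm e (isSkew_emb f) (isSkew_emb g),
    h, smul_neg]

/-- The graded Jacobi identity, as a graded Leibniz rule. -/
theorem bracket_jacobi {l m n a b c k : ℕ} (ha : m + n = a) (hb : l + m = b) (hc : l + n = c)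
    (h1 : l + a = k) (h2 : b + n = k) (h3 : m + c = k) (f : NoetherCx L l) (g : NoetherCx L m)
    (h : NoetherCx L n) :
    bracket L l a k h1 f (bracket L m n a ha g h) =
      bracket L b n k h2 (bracket L l m b hb f g) h +
        (-1 : ℝ) ^ (l * m) • bracket L m c k h3 g (bracket L l n c hc f h) := by
  refine emb_injective k ?_
  rw [emb_add, emb_smul, emb_bracket, emb_bracket, emb_bracket, emb_bracket, emb_bracket,
    emb_bracket]
  exact wedge_jacobi extBr_jacobi ha hb hc (by omega) (isSkew_emb f) (isSkew_emb g) (isSkew_emb h)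

theorem exists_nrm_bracket_le (L : SpinSystem d) {m n k : ℕ} (e : m + n = k) (α : ℕ) :
    ∃ (N : ℕ) (C : ℝ), 0 ≤ C ∧ ∀ (f : NoetherCx L m) (g : NoetherCx L n),
      nrm L k α (bracket L m n k e f g) ≤ C * (nrm L m N f * nrm L n N g) := by
  cases k with
  | zero =>
    obtain rfl : m = 0 := by omega
    obtain rfl : n = 0 := by omega
    -- The bracket is `∂_0 (F · h_{-1} G)`, so three estimates compose: the total requires order
    -- `N₁` of the acted-on density, which requires order `N₂` of the density of `G`, which requires
    -- order `N₃` of `G`.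
    obtain ⟨N₁, C₁, hC₁, h₁⟩ := exists_norm_total_le L α
    obtain ⟨N₂, C₂, hC₂, h₂⟩ := exists_loc_act L N₁
    obtain ⟨N₃, C₃, hC₃, h₃⟩ := exists_loc_spread_der L N₂
    refine ⟨max N₂ N₃, C₁ * (C₂ * C₃), by positivity, fun F G => ?_⟩
    rw [bracket_zero_zero]
    refine UALDer.norms_le fun Y => ?_
    have h4 : ∀ x : L.Site, Loc (x : EuclideanSpace ℝ (Fin d)) N₁
        (C₂ * (nrm L 0 (max N₂ N₃) F * (C₃ * nrm L 0 (max N₂ N₃) G)))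
        ((actChain L 0 F (htDer L G)).fam x) := by
      intro x
      refine (h₂ F (A := ⟨_, (htDer L G).isUA₁.mem_lieAl x⟩) (h₃ G x)).mono ?_
      refine mul_le_mul_of_nonneg_left (mul_le_mul (nrm_mono (n := 0) F (le_max_left _ _))
        (mul_le_mul_of_nonneg_left (nrm_mono (n := 0) G (le_max_right _ _)) hC₃) ?_
        (apply_nonneg _ _)) hC₂
      exact mul_nonneg hC₃ (apply_nonneg _ _)
    exact (h₁ (fun x => UALChain.mem_lieQ _ _) h4 Y).trans (le_of_eq (by ring))
  | succ k =>
    obtain ⟨N, C, hC, h⟩ := exists_loc_wedge L e α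
    refine ⟨N, C, hC, fun f g => UALChain.norms_le fun j i => ?_⟩
    rw [bracket_fn]
    exact h f g j i

end UAL
end

open scoped NNReal Topology
noncomputable section
namespace UAL
variable {d : ℕ} {L : SpinSystem d}

/-! ### The differential graded Lie algebra -/

/-- The boundary maps. -/
def bd (L : SpinSystem d) : ∀ n, NoetherCx L (n + 1) →ₗ[ℝ] NoetherCx L n
  | 0 => bdDer L
  | q + 1 => bdChain L q

/-- The contracting homotopy. -/
def ht (L : SpinSystem d) : ∀ n, NoetherCx L n →ₗ[ℝ] NoetherCx L (n + 1)
  | 0 => htDer L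
  | q + 1 => htChain L q

theorem bd_bd (n : ℕ) (a : NoetherCx L (n + 2)) : bd L n (bd L (n + 1) a) = 0 := by
  cases n with
  | zero => exact bdDer_bdChain a
  | succ q => exact bdChain_bdChain a

theorem ht_bd (n : ℕ) (a : NoetherCx L (n + 1)) :
    ht L n (bd L n a) + bd L (n + 1) (ht L (n + 1) a) = a := by
  cases n with
  | zero => exact htDer_bdDer a
  | succ q => exact htChain_bdChain a

theorem bd_ht (F : NoetherCx L 0) : bd L 0 (ht L 0 F) = F := bdDer_htDer F

theorem eq_bd_ht {n : ℕ} {a : NoetherCx L (n + 1)} (h : bd L n a = 0) :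
    a = bd L (n + 1) (ht L (n + 1) a) := by
  have := ht_bd n a
  rw [h, LinearMap.map_zero, zero_add] at this
  exact this.symm

theorem bd_bracket_der (n : ℕ) (F : NoetherCx L 0) (g : NoetherCx L (n + 1)) :
    bd L n (bracket L 0 (n + 1) (n + 1) (zero_add _) F g) =
      bracket L 0 n n (zero_add _) F (bd L n g) := by
  rw [bracket_zero_succ]
  cases n with
  | zero =>
    rw [bracket_zero_zero]
    exact (derBr_bdDer F g).symm
  | succ q =>
    rw [bracket_zero_succ]
    exact bdChain_actChain F g

/-- Summing the fixed first variable of `f` inside a bracket puts `∂f` there. For a 0-chain the sum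
of commutators is the action of the derivation `∂_0 f`, so this degree obeys the same rule. -/
theorem hasSum_extBr_contr {m : ℕ} (f : NoetherCx L (m + 1)) (j₁ : Fin m → L.Site) {q : ℕ}
    (g : UALChain L q) (j₂ : Fin (q + 1) → L.Site) :
    HasSum (fun x => ((extBr L (contr x (emb L (m + 1) f) j₁) (embChain L q g j₂)).2 : L.Op))
      ((extBr L (emb L m (bd L m f) j₁) (embChain L q g j₂)).2 : L.Op) := by
  have h1 : ∀ x, ((extBr L (contr x (emb L (m + 1) f) j₁) (embChain L q g j₂)).2 : L.Op) =
      ⁅UALChain.fn f (Fin.cons x j₁), g.fn j₂⁆ := fun x =>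
    congrArg (fun v : ExtLie L => (v.2 : L.Op)) (extBr_embChain_embChain f g (Fin.cons x j₁) j₂)
  simp only [h1]
  cases m with
  | zero =>
    have h2 : ((extBr L (emb L 0 (bd L 0 f) j₁) (embChain L q g j₂)).2 : L.Op) =
        famAct (UALChain.fam f) (g.fn j₂) :=
      (congrArg (fun v : ExtLie L => (v.2 : L.Op))
        (extBr_embDer_embChain (bdDer L f) g j₁ j₂)).trans (act_bdDer f _)
    rw [h2]
    have h3 := (UALChain.isUA₁ f).hasSum_lie (g.mem_lieAl j₂)
    convert h3 using 4 with x
    exact UALChain.fn_eq_fam f (Fin.cons x j₁)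
  | succ p =>
    have h2 : ((extBr L (emb L (p + 1) (bd L (p + 1) f) j₁) (embChain L q g j₂)).2 : L.Op) =
        ⁅sumFirst (UALChain.fn f) j₁, g.fn j₂⁆ :=
      congrArg (fun v : ExtLie L => (v.2 : L.Op))
        (extBr_embChain_embChain (bdChain L p f) g j₁ j₂)
    rw [h2]
    exact hasSum_lie_left _ ((UALChain.isUA f).fam j₁ 0).summable.hasSum

theorem hasSum_extBr_contr' {m : ℕ} (f : NoetherCx L (m + 1)) (j₁ : Fin m → L.Site) {q : ℕ}
    (g : UALChain L q) (j₂ : Fin (q + 1) → L.Site) :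
    HasSum (fun x => ((extBr L (embChain L q g j₂) (contr x (emb L (m + 1) f) j₁)).2 : L.Op))
      ((extBr L (embChain L q g j₂) (emb L m (bd L m f) j₁)).2 : L.Op) := by
  have h := (hasSum_extBr_contr f j₁ g j₂).neg
  have h1 : ∀ v w : ExtLie L, -((extBr L v w).2 : L.Op) = (extBr L w v).2 := fun v w => by
    rw [extBr_skew w v]
    rfl
  simpa only [h1] using h

/-- The graded Leibniz rule. -/
theorem bd_bracket (m n : ℕ) (e : m + 1 + (n + 1) = m + n + 2) (e₁ : m + (n + 1) = m + n + 1)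
    (e₂ : m + 1 + n = m + n + 1) (f : NoetherCx L (m + 1)) (g : NoetherCx L (n + 1)) :
    bd L (m + n + 1) (bracket L (m + 1) (n + 1) (m + n + 2) e f g) =
      bracket L m (n + 1) (m + n + 1) e₁ (bd L m f) g +
        (-1 : ℝ) ^ (m + 1) • bracket L (m + 1) n (m + n + 1) e₂ f (bd L n g) := by
  refine UALChain.ext (funext fun j => ?_)
  have h1 : HasSum (fun x => ((wedge (extBr L) m (n + 1) (m + n + 1)
      (contr x (emb L (m + 1) f)) (emb L (n + 1) g) j).2 : L.Op))
      ((wedge (extBr L) m (n + 1) (m + n + 1) (emb L m (bd L m f)) (emb L (n + 1) g) j).2 :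
        L.Op) := by
    simp only [wedge_snd e₁]
    refine HasSum.const_smul _ (hasSum_sum fun σ _ => HasSum.const_smul _ ?_)
    exact hasSum_extBr_contr f _ g _
  have h2 : HasSum (fun x => ((wedge (extBr L) (m + 1) n (m + n + 1)
      (emb L (m + 1) f) (contr x (emb L (n + 1) g)) j).2 : L.Op))
      ((wedge (extBr L) (m + 1) n (m + n + 1) (emb L (m + 1) f) (emb L n (bd L n g)) j).2 :
        L.Op) := by
    simp only [wedge_snd e₂]
    refine HasSum.const_smul _ (hasSum_sum fun σ _ => HasSum.const_smul _ ?_)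
    exact hasSum_extBr_contr' g _ f _
  have h3 := h1.add (h2.const_smul ((-1 : ℝ) ^ (m + 1)))
  -- Fixing the first variable of the product splits it by the antiderivation rule; the sum over
  -- that variable then yields the two boundary terms with the Leibniz sign.
  have h4 : ∀ x, UALChain.fn (bracket L (m + 1) (n + 1) (m + n + 2) e f g) (Fin.cons x j) =
      ((wedge (extBr L) m (n + 1) (m + n + 1)
        (contr x (emb L (m + 1) f)) (emb L (n + 1) g) j).2 : L.Op) +
      (-1 : ℝ) ^ (m + 1) • ((wedge (extBr L) (m + 1) n (m + n + 1)
        (emb L (m + 1) f) (contr x (emb L (n + 1) g)) j).2 : L.Op) := fun x =>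
    (bracket_fn e f g (Fin.cons x j)).trans (congrArg (fun v : ExtLie L => (v.2 : L.Op))
      (congrFun (contr_wedge (B := extBr L) e (isSkew_emb f) (isSkew_emb g) x) j))
  simp only [← h4] at h3
  refine h3.tsum_eq.trans ?_
  rw [← bracket_fn e₁, ← bracket_fn e₂]
  rfl

theorem bracket_der_right (m : ℕ) (f : NoetherCx L m) (G : NoetherCx L 0) :
    bracket L m 0 m (add_zero _) f G = -bracket L 0 m m (zero_add _) G f := by
  rw [bracket_skew (add_zero m) (zero_add m), mul_zero, pow_zero, one_smul]

theorem bd_bracket_der_right (m : ℕ) (f : NoetherCx L (m + 1)) (G : NoetherCx L 0) :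
    bd L m (bracket L (m + 1) 0 (m + 1) rfl f G) = bracket L m 0 m rfl (bd L m f) G := by
  rw [bracket_der_right, bracket_der_right, LinearMap.map_neg, bd_bracket_der]

theorem bd_bracket_one_one (f g : NoetherCx L 1) :
    bd L 1 (bracket L 1 1 2 rfl f g) =
      bracket L 0 1 1 rfl (bd L 0 f) g + bracket L 0 1 1 rfl (bd L 0 g) f := by
  refine (bd_bracket 0 0 rfl rfl rfl f g).trans ?_
  have h := bracket_der_right 1 f (bd L 0 g)
  change bracket L 0 1 1 rfl (bd L 0 f) g +
    (-1 : ℝ) ^ 1 • bracket L 1 0 1 rfl f (bd L 0 g) = _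
  rw [pow_one, neg_one_smul, h, neg_neg]

/-! ### Conserved currents from exactness -/

theorem energy_current_iff (η : NoetherCx L 1) (j : NoetherCx L 2) :
    bracket L 0 1 1 rfl (bd L 0 η) η = -bd L 1 j ↔
      ∃ c : NoetherCx L 3, j = -((1 / 2 : ℝ) • bracket L 1 1 2 rfl η η) + bd L 2 c := by
  -- The Leibniz rule gives `∂{η, η} = 2 {∂η, η}`, hence the factor one half; any other current
  -- differs by a cycle, and every 1-cycle is a boundary.
  have h : bd L 1 ((1 / 2 : ℝ) • bracket L 1 1 2 rfl η η) =
      bracket L 0 1 1 rfl (bd L 0 η) η := by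
    rw [LinearMap.map_smul, bd_bracket_one_one, ← two_smul ℝ, smul_smul]
    norm_num
  constructor
  · intro hj
    refine ⟨ht L 2 (j + (1 / 2 : ℝ) • bracket L 1 1 2 rfl η η), ?_⟩
    have h0 : bd L 1 (j + (1 / 2 : ℝ) • bracket L 1 1 2 rfl η η) = 0 := by
      rw [LinearMap.map_add, h, hj, add_neg_cancel]
    rw [← eq_bd_ht h0]
    abel
  · rintro ⟨c, rfl⟩
    rw [LinearMap.map_add, LinearMap.map_neg, h, bd_bd, add_zero, neg_neg]

theorem exists_symmetry_current (H : NoetherCx L 0) (ρ : NoetherCx L 1)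
    (h : bracket L 0 0 0 rfl (bd L 0 ρ) H = 0) : ∃ j₀ : NoetherCx L 2, ∀ j : NoetherCx L 2,
      bracket L 0 1 1 rfl H ρ = -bd L 1 j ↔ ∃ c : NoetherCx L 3, j = j₀ + bd L 2 c := by
  -- The invariance of the charge says exactly that `{H, ρ}` is a cycle, so the homotopy supplies a
  -- primitive and hence the current `j₀`.
  have h0 : bd L 0 (bracket L 0 1 1 rfl H ρ) = 0 := by
    refine (bd_bracket_der 0 H ρ).trans ?_
    rw [bracket_skew rfl rfl, h, smul_zero, neg_zero]
  have h1 := eq_bd_ht h0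
  refine ⟨-ht L 1 (bracket L 0 1 1 rfl H ρ), fun j => ⟨fun hj => ?_, ?_⟩⟩
  · have h2 : bd L 1 (j + ht L 1 (bracket L 0 1 1 rfl H ρ)) = 0 := by
      rw [LinearMap.map_add, ← h1, hj, add_neg_cancel]
    refine ⟨ht L 2 (j + ht L 1 (bracket L 0 1 1 rfl H ρ)), ?_⟩
    rw [← eq_bd_ht h2]
    abel
  · rintro ⟨c, rfl⟩
    rw [LinearMap.map_add, LinearMap.map_neg, ← h1, bd_bd, add_zero, neg_neg]

theorem symmetry_current_of_density (η ρ : NoetherCx L 1)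
    (h : bracket L 0 1 1 rfl (bd L 0 ρ) η = 0) :
    bracket L 0 1 1 rfl (bd L 0 η) ρ = -bd L 1 (-(bracket L 1 1 2 rfl η ρ)) := by
  rw [LinearMap.map_neg, neg_neg, bd_bracket_one_one, h, add_zero]

/-- The Leibniz form of Jacobi is rearranged by graded skew-symmetry of one inner and one outer
bracket; the signs agree because each exponent occurring twice cancels. -/
theorem cyclic_jacobi (l m n : ℕ) (e₁ : l + (m + n) = l + m + n) (e₂ : m + (n + l) = l + m + n)
    (e₃ : n + (l + m) = l + m + n) (f : NoetherCx L l) (g : NoetherCx L m) (c : NoetherCx L n) :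
    (-1 : ℝ) ^ (l * n) • bracket L l (m + n) (l + m + n) e₁ f (bracket L m n (m + n) rfl g c) +
    (-1 : ℝ) ^ (m * l) • bracket L m (n + l) (l + m + n) e₂ g (bracket L n l (n + l) rfl c f) +
    (-1 : ℝ) ^ (n * m) • bracket L n (l + m) (l + m + n) e₃ c (bracket L l m (l + m) rfl f g) =
      0 := by
  rw [bracket_jacobi (b := l + m) (c := n + l) rfl rfl (add_comm l n) e₁ rfl e₂ f g c,
    bracket_skew (add_comm l n) rfl f c, bracket_skew rfl e₃ (bracket L l m (l + m) rfl f g) c,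
    LinearMap.map_neg, LinearMap.map_smul]
  simp only [smul_add, smul_neg, smul_smul]
  have hs : ∀ a : ℕ, (-1 : ℝ) ^ a * (-1) ^ a = 1 := fun a => by rw [← mul_pow]; simp
  have h1 : (-1 : ℝ) ^ (l * n) * (-1) ^ ((l + m) * n) = (-1) ^ (n * m) := by
    rw [add_mul, pow_add, ← mul_assoc, hs, one_mul, mul_comm n m]
  have h2 : (-1 : ℝ) ^ (l * n) * ((-1) ^ (l * m) * (-1) ^ (l * n)) = (-1) ^ (m * l) := by
    rw [mul_comm ((-1 : ℝ) ^ (l * m)), ← mul_assoc, hs, one_mul, mul_comm l m]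
  rw [h1, h2]
  abel

/-! ### Bounds and continuity -/

theorem exists_nrm_bd_le (L : SpinSystem d) (n α : ℕ) : ∃ (N : ℕ) (C : ℝ), 0 ≤ C ∧
    ∀ a : NoetherCx L (n + 1), nrm L n α (bd L n a) ≤ C * nrm L (n + 1) N a := by
  cases n with
  | zero =>
    obtain ⟨N, C, hC, h⟩ := exists_norm_total_le L α
    exact ⟨N, C, hC, fun a => UALDer.norms_le fun Y => h (fun x => UALChain.mem_lieQ _ _)
      (fun x => UALChain.loc_norms a N (fun _ => x) 0) Y⟩
  | succ q =>
    obtain ⟨N, C, hC, h⟩ := exists_loc_sumFirst L α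
    exact ⟨N, C, hC, fun a => UALChain.norms_le fun j i => h (UALChain.mem_lieQ a)
      (UALChain.loc_norms a N) j i⟩

theorem exists_nrm_ht_le (L : SpinSystem d) (n α : ℕ) : ∃ (N : ℕ) (C : ℝ), 0 ≤ C ∧
    ∀ a : NoetherCx L n, nrm L (n + 1) α (ht L n a) ≤ C * nrm L n N a := by
  cases n with
  | zero =>
    obtain ⟨N, C, hC, h⟩ := exists_loc_spread_der L α
    exact ⟨N, C, hC, fun F => UALChain.norms_le fun j i => by
      rw [Fin.eq_zero i]
      exact h F (j 0)⟩
  | succ q =>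
    obtain ⟨N, C, hC, h⟩ := exists_loc_parts L q α
    exact ⟨N, C, hC, fun a => UALChain.norms_le fun j i => h (UALChain.mem_lieQ a)
      (UALChain.loc_norms a N) j i⟩

theorem withSeminorms_nrm (n : ℕ) : WithSeminorms (nrm L n) := by
  cases n with
  | zero => exact ⟨rfl⟩
  | succ q => exact ⟨rfl⟩

theorem continuous_of_nrm_le {m n : ℕ} (T : NoetherCx L m →ₗ[ℝ] NoetherCx L n)
    (h : ∀ α, ∃ (N : ℕ) (C : ℝ), 0 ≤ C ∧ ∀ a, nrm L n α (T a) ≤ C * nrm L m N a) :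
    Continuous T := by
  refine WithSeminorms.continuous_of_isBounded (withSeminorms_nrm m) (withSeminorms_nrm n) T
    fun α => ?_
  obtain ⟨N, C, hC, h⟩ := h α
  refine ⟨{N}, ⟨C, hC⟩, fun a => ?_⟩
  rw [Finset.sup_singleton]
  exact h a

theorem continuous_of_nrm_le₂ {m n k : ℕ}
    (T : NoetherCx L m →ₗ[ℝ] NoetherCx L n →ₗ[ℝ] NoetherCx L k)
    (h : ∀ α, ∃ (N : ℕ) (C : ℝ), 0 ≤ C ∧ ∀ a b, nrm L k α (T a b) ≤
      C * (nrm L m N a * nrm L n N b)) :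
    Continuous fun x : NoetherCx L m × NoetherCx L n => T x.1 x.2 := by
  rw [continuous_iff_continuousAt]
  rintro ⟨a₀, b₀⟩
  rw [ContinuousAt, (withSeminorms_nrm k).tendsto_nhds]
  intro α ε hε
  obtain ⟨N, C, hC, h⟩ := h α
  have hcm : Continuous (nrm L m N) := (withSeminorms_nrm m).continuous_seminorm N
  have hcn : Continuous (nrm L n N) := (withSeminorms_nrm n).continuous_seminorm N
  have h1 : Continuous fun x : NoetherCx L m × NoetherCx L n =>
      C * (nrm L m N (x.1 - a₀) * nrm L n N (x.2 - b₀)) +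
      C * (nrm L m N (x.1 - a₀) * nrm L n N b₀) + C * (nrm L m N a₀ * nrm L n N (x.2 - b₀)) := by
    have h2 : Continuous fun x : NoetherCx L m × NoetherCx L n => nrm L m N (x.1 - a₀) :=
      hcm.comp (continuous_fst.sub continuous_const)
    have h3 : Continuous fun x : NoetherCx L m × NoetherCx L n => nrm L n N (x.2 - b₀) :=
      hcn.comp (continuous_snd.sub continuous_const)
    exact ((continuous_const.mul (h2.mul h3)).add
      (continuous_const.mul (h2.mul continuous_const))).add
      (continuous_const.mul (continuous_const.mul h3))
  have h2 := h1.tendsto (a₀, b₀)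
  simp only [sub_self, map_zero, zero_mul, mul_zero, add_zero] at h2
  filter_upwards [h2.eventually (gt_mem_nhds hε)] with x hx
  refine lt_of_le_of_lt ?_ hx
  have h3 : T x.1 x.2 - T a₀ b₀ = T (x.1 - a₀) (x.2 - b₀) + T (x.1 - a₀) b₀ +
      T a₀ (x.2 - b₀) := by
    rw [LinearMap.map_sub₂, LinearMap.map_sub₂, LinearMap.map_sub, LinearMap.map_sub]
    abel
  rw [h3]
  exact (map_add_le_add _ _ _).trans (add_le_add ((map_add_le_add _ _ _).trans
    (add_le_add (h _ _) (h _ _))) (h _ _))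

/-- The boundary maps, as continuous linear maps. -/
def bdL (L : SpinSystem d) (n : ℕ) : NoetherCx L (n + 1) →L[ℝ] NoetherCx L n :=
  ⟨bd L n, continuous_of_nrm_le _ (exists_nrm_bd_le L n)⟩

/-- The contracting homotopy, as continuous linear maps. -/
def htL (L : SpinSystem d) (n : ℕ) : NoetherCx L n →L[ℝ] NoetherCx L (n + 1) :=
  ⟨ht L n, continuous_of_nrm_le _ (exists_nrm_ht_le L n)⟩

theorem continuous_bracket {m n k : ℕ} (e : m + n = k) :
    Continuous fun x : NoetherCx L m × NoetherCx L n => bracket L m n k e x.1 x.2 :=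
  continuous_of_nrm_le₂ _ (exists_nrm_bracket_le L e)

end UAL
end

open scoped NNReal Topology
noncomputable section
namespace UAL
variable {d : ℕ} {L : SpinSystem d}

/-! ### Completeness and density -/

/-- Countably many seminorms make the uniformity countably generated, so Cauchy sequences suffice
for completeness. The seminorm of order zero alone separates points. -/
theorem isFrechet_of {E : Type} [AddCommGroup E] [Module ℝ E] [TopologicalSpace E]
    [IsTopologicalAddGroup E] {p : SeminormFamily ℝ E ℕ} (hp : WithSeminorms p)
    (h0 : ∀ x, p 0 x = 0 → x = 0)
    (hc : ∀ u : ℕ → E, (∀ i, ∀ ε > 0, ∃ N, ∀ m ≥ N, ∀ n ≥ N, p i (u m - u n) ≤ ε) →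
      ∃ x, ∀ i, ∀ ε > 0, ∃ N, ∀ n ≥ N, p i (u n - x) ≤ ε) : IsFrechet E := by
  have hT1 : T1Space E := hp.T1_of_separating fun x hx => ⟨0, fun h => hx (h0 x h)⟩
  refine ⟨inferInstance, ?_, p, hp⟩
  let _ : UniformSpace E := IsTopologicalAddGroup.rightUniformSpace E
  have : IsUniformAddGroup E := isUniformAddGroup_of_addCommGroup
  have h1 : (𝓝 (0 : E)).IsCountablyGenerated := by
    rw [p.withSeminorms_iff_nhds_eq_iInf.mp hp]
    exact Filter.iInf.isCountablyGenerated _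
  have h2 : (uniformity E).IsCountablyGenerated :=
    IsUniformAddGroup.uniformity_countably_generated
  refine UniformSpace.complete_of_cauchySeq_tendsto fun u hu => ?_
  obtain ⟨x, hx⟩ := hc u fun i ε hε => by
    have h3 : {y : E | p i y < ε} ∈ 𝓝 (0 : E) :=
      (isOpen_lt (hp.continuous_seminorm i) continuous_const).mem_nhds (by simpa using hε)
    have h4 : {z : E × E | p i (z.2 - z.1) < ε} ∈ uniformity E := by
      rw [uniformity_eq_comap_nhds_zero]
      exact Filter.preimage_mem_comap h3
    obtain ⟨N, hN⟩ := cauchySeq_iff.1 hu _ h4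
    exact ⟨N, fun m hm n hn => (hN n hn m hm).le⟩
  refine ⟨x, (hp.tendsto_nhds_atTop u x).2 fun i ε hε => ?_⟩
  obtain ⟨N, hN⟩ := hx i (ε / 2) (half_pos hε)
  exact ⟨N, fun n hn => (hN n hn).trans_lt (half_lt_self hε)⟩

theorem dense_of_approx {E : Type} [AddCommGroup E] [Module ℝ E] [TopologicalSpace E]
    {p : SeminormFamily ℝ E ℕ} (hp : WithSeminorms p) {S : Set E}
    (h : ∀ a, ∃ u : ℕ → E, (∀ n, u n ∈ S) ∧
      ∀ i, ∃ C, ∀ n : ℕ, p i (u n - a) ≤ C * ((n : ℝ) + 1)⁻¹) : Dense S := by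
  intro a
  obtain ⟨u, hu, hC⟩ := h a
  refine mem_closure_of_tendsto (f := u) (b := Filter.atTop) ?_ (Filter.Eventually.of_forall hu)
  rw [hp.tendsto_nhds]
  intro i ε hε
  obtain ⟨C, hC⟩ := hC i
  have h1 : Filter.Tendsto (fun n : ℕ => C * ((n : ℝ) + 1)⁻¹) Filter.atTop (𝓝 0) := by
    have := (tendsto_one_div_add_atTop_nhds_zero_nat (𝕜 := ℝ)).const_mul C
    simpa only [one_div, mul_zero] using this
  filter_upwards [h1.eventually (gt_mem_nhds hε)] with n hn
  exact (hC n).trans_lt hn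

theorem Loc.of_tendsto {x : EuclideanSpace ℝ (Fin d)} {α : ℕ} {K : ℝ} {u : ℕ → L.Op} {A : L.Op}
    (hu : Filter.Tendsto u Filter.atTop (𝓝 A)) (h : ∀ᶠ n in Filter.atTop, Loc x α K (u n)) :
    Loc x α K A := fun r => by
  have hc : Continuous fun B : L.Op => (1 + (r : ℝ)) ^ α * locErr L x r B :=
    continuous_const.mul (Metric.continuous_infDist_pt _)
  exact le_of_tendsto ((hc.tendsto A).comp hu) (h.mono fun n hn => hn r)

theorem exists_tendsto_of_cauchy {u : ℕ → L.Op}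
    (h : ∀ ε > (0 : ℝ), ∃ N, ∀ m ≥ N, ∀ n ≥ N, ‖u m - u n‖ ≤ ε) :
    ∃ A, Filter.Tendsto u Filter.atTop (𝓝 A) := by
  refine cauchySeq_tendsto_of_complete (Metric.cauchySeq_iff.2 fun ε hε => ?_)
  obtain ⟨N, hN⟩ := h (ε / 2) (half_pos hε)
  exact ⟨N, fun m hm n hn => by
    rw [dist_eq_norm]
    exact (hN m hm n hn).trans_lt (half_lt_self hε)⟩

theorem UALChain.norm_fn_le {q : ℕ} (a : UALChain L q) (j : Fin (q + 1) → L.Site) :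
    ‖a.fn j‖ ≤ 4 * UALChain.norms L q 0 a := (a.loc_norms 0 j 0).norm_le (a.mem_lieQ j)

theorem UALDer.norm_fn_le (F : UALDer L) (Y : Brick d) : ‖F.fn Y‖ ≤ UALDer.norms L 0 F := by
  simpa using F.le_norms 0 Y

theorem UALChain.isFrechet (L : SpinSystem d) (q : ℕ) : IsFrechet (UALChain L q) := by
  refine isFrechet_of (p := UALChain.norms L q) ⟨rfl⟩ (fun a ha => UALChain.ext (funext fun j => ?_))
    fun u hu => ?_
  · have := a.norm_fn_le j
    rw [ha, mul_zero] at this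
    exact norm_le_zero_iff.1 this
  · have h1 : ∀ j, ∃ A, Filter.Tendsto (fun n => (u n).fn j) Filter.atTop (𝓝 A) := fun j =>
      exists_tendsto_of_cauchy fun ε hε => by
        obtain ⟨N, hN⟩ := hu 0 (ε / 4) (by positivity)
        refine ⟨N, fun m hm n hn => ?_⟩
        have := (u m - u n).norm_fn_le j
        rw [map_sub] at this
        exact this.trans (by linarith [hN m hm n hn])
    choose a ha using h1
    have h2 : ∀ α, ∀ ε > 0, ∃ N, ∀ n ≥ N, ∀ j i,
        Loc (j i : EuclideanSpace ℝ (Fin d)) α ε ((u n).fn j - a j) := fun α ε hε => by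
      obtain ⟨N, hN⟩ := hu α ε hε
      -- In the Cauchy estimate for `u n - u m`, let `m` tend to infinity: localization with a given
      -- constant is a closed condition.
      refine ⟨N, fun n hn j i => Loc.of_tendsto (tendsto_const_nhds.sub (ha j)) ?_⟩
      filter_upwards [Filter.eventually_ge_atTop N] with m hm
      have := ((u n - u m).loc_norms α j i).mono (hN n hn m hm)
      rwa [map_sub] at this
    have h3 : IsUA a := ⟨fun j => isClosed_lieQ.mem_of_tendsto (ha j)
      (Filter.Eventually.of_forall fun n => (u n).mem_lieQ j), fun α => by
        obtain ⟨N, hN⟩ := h2 α 1 one_pos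
        refine ⟨UALChain.norms L q α (u N) + 1, fun j i => ?_⟩
        have := ((u N).loc_norms α j i).sub (hN N le_rfl j i)
        rwa [sub_sub_cancel] at this⟩
    have h4 : IsSkew a := fun σ j => by
      refine tendsto_nhds_unique (ha (j ∘ σ)) ?_
      have := (ha j).const_smul ((Equiv.Perm.sign σ : ℤ))
      refine this.congr fun n => ?_
      exact ((u n).isSkew σ j).symm
    refine ⟨mkChain a h3 h4, fun α ε hε => ?_⟩
    obtain ⟨N, hN⟩ := h2 α ε hε
    exact ⟨N, fun n hn => UALChain.norms_le fun j i => by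
      rw [map_sub]
      exact hN n hn j i⟩

/-- The elements of the sequence equal their own components in `Y`, and taking components is
continuous, so the limit equals its component. -/
theorem brickSpace_of_tendsto {Y : Brick d} {u : ℕ → L.Op} {A : L.Op}
    (hu : Filter.Tendsto u Filter.atTop (𝓝 A)) (h : ∀ n, u n ∈ brickSpace L Y) :
    A ∈ brickSpace L Y := by
  have hA : A ∈ lieQ L := isClosed_lieQ.mem_of_tendsto hu
    (Filter.Eventually.of_forall fun n => brickSpace_lieQ (h n))
  have h1 : Filter.Tendsto (fun n => u n - brickComp Y A) Filter.atTop (𝓝 0) := by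
    have h2 : Filter.Tendsto (fun n => 4 ^ d * ‖u n - A‖) Filter.atTop (𝓝 0) := by
      have := (tendsto_iff_norm_sub_tendsto_zero.1 hu).const_mul (4 ^ d : ℝ)
      rwa [mul_zero] at this
    refine squeeze_zero_norm (fun n => ?_) h2
    have hn := brickSpace_lieQ (h n)
    have := norm_brickComp_le Y (sub_mem hn hA)
    rwa [brickComp_sub Y hn hA, brickComp_self (h n)] at this
  have h2 : A = brickComp Y A :=
    sub_eq_zero.1 (tendsto_nhds_unique (hu.sub_const (brickComp Y A)) h1)
  rw [h2]
  exact brickComp_mem Y hA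

theorem UALDer.isFrechet (L : SpinSystem d) : IsFrechet (UALDer L) := by
  refine isFrechet_of (p := UALDer.norms L) ⟨rfl⟩ (fun a ha => UALDer.ext (funext fun j => ?_))
    fun u hu => ?_
  · have := a.norm_fn_le j
    rw [ha] at this
    exact norm_le_zero_iff.1 this
  · have h1 : ∀ Y, ∃ A, Filter.Tendsto (fun n => (u n).fn Y) Filter.atTop (𝓝 A) := fun Y =>
      exists_tendsto_of_cauchy fun ε hε => by
        obtain ⟨N, hN⟩ := hu 0 ε hε
        refine ⟨N, fun m hm n hn => ?_⟩
        have := (u m - u n).norm_fn_le Y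
        rw [map_sub] at this
        exact this.trans (hN m hm n hn)
    choose a ha using h1
    have h2 : ∀ α, ∀ ε > 0, ∃ N, ∀ n ≥ N, ∀ Y : Brick d,
        (1 + Metric.diam Y.1) ^ α * ‖(u n).fn Y - a Y‖ ≤ ε := fun α ε hε => by
      obtain ⟨N, hN⟩ := hu α ε hε
      refine ⟨N, fun n hn Y => le_of_tendsto
        (((tendsto_const_nhds.sub (ha Y)).norm).const_mul _) ?_⟩
      filter_upwards [Filter.eventually_ge_atTop N] with m hm
      have := ((u n - u m).le_norms α Y).trans (hN n hn m hm)
      rwa [map_sub] at this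
    refine ⟨mkDer a (fun Y => brickSpace_of_tendsto (ha Y) fun n => (u n).mem Y) fun α => ?_,
      fun α ε hε => ?_⟩
    · obtain ⟨N, hN⟩ := h2 α 1 one_pos
      refine ⟨UALDer.norms L α (u N) + 1, fun Y => ?_⟩
      have h3 := (u N).le_norms α Y
      have h4 := hN N le_rfl Y
      have h5 := Metric.diam_nonneg (s := Y.1)
      have h6 : ‖a Y‖ ≤ ‖(u N).fn Y‖ + ‖(u N).fn Y - a Y‖ := by
        rw [norm_sub_rev]; exact norm_le_norm_add_norm_sub' _ _
      calc _ ≤ (1 + Metric.diam Y.1) ^ α * (‖(u N).fn Y‖ + ‖(u N).fn Y - a Y‖) := by gcongr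
        _ ≤ _ := by rw [mul_add]; exact add_le_add h3 h4
    · obtain ⟨N, hN⟩ := h2 α ε hε
      exact ⟨N, fun n hn => UALDer.norms_le fun Y => by
        rw [map_sub]
        exact hN n hn Y⟩

theorem isFrechet_noetherCx (L : SpinSystem d) (n : ℕ) : IsFrechet (NoetherCx L n) := by
  cases n with
  | zero => exact UALDer.isFrechet L
  | succ q => exact UALChain.isFrechet L q

/-! ### Density of the uniformly local elements -/

theorem UALDer.dense_isUL (L : SpinSystem d) : Dense {F : UALDer L | F.IsUL} := by
  classical
  refine dense_of_approx (p := UALDer.norms L) ⟨rfl⟩ fun F => ?_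
  -- Discard all bricks of diameter above `n`. On those, one extra power of `1 + diam Y` exceeds `n
  -- + 1`, which gives the rate `1/(n + 1)` in every seminorm.
  let u : ℕ → UALDer L := fun n =>
    mkDer (fun Y => if Metric.diam Y.1 ≤ n then F.fn Y else 0)
      (fun Y => by split_ifs; exacts [F.mem Y, zero_mem _])
      fun α => ⟨UALDer.norms L α F, fun Y => by
        split_ifs
        · exact F.le_norms α Y
        · rw [norm_zero, mul_zero]; exact apply_nonneg _ _⟩
  have hu : ∀ n Y, (u n).fn Y = if Metric.diam Y.1 ≤ n then F.fn Y else 0 := fun n Y => rfl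
  refine ⟨u, fun n => ⟨⟨UALDer.norms L 0 F, fun Y => ?_⟩, n, fun Y hY => ?_⟩,
    fun α => ⟨UALDer.norms L (α + 1) F, fun n => UALDer.norms_le fun Y => ?_⟩⟩
  · rw [hu]
    split_ifs
    · exact F.norm_fn_le Y
    · rw [norm_zero]; exact apply_nonneg _ _
  · rw [hu, if_neg (not_le.2 hY)]
  · have h0 : 0 ≤ UALDer.norms L (α + 1) F := apply_nonneg _ _
    rw [map_sub, Pi.sub_apply, hu]
    split_ifs with h
    · rw [sub_self, norm_zero, mul_zero]; positivity
    · have h1 := F.le_norms (α + 1) Y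
      rw [zero_sub, norm_neg, ← div_eq_mul_inv, le_div_iff₀ (by positivity)]
      rw [pow_succ] at h1
      refine le_trans ?_ h1
      have h2 := Metric.diam_nonneg (s := Y.1)
      have h3 : (1 + Metric.diam Y.1) ^ α * ‖F.fn Y‖ * (n + 1) ≤
          (1 + Metric.diam Y.1) ^ α * ‖F.fn Y‖ * (1 + Metric.diam Y.1) :=
        mul_le_mul_of_nonneg_left (by linarith [not_le.1 h]) (by positivity)
      exact h3.trans_eq (by ring)

/-- The expectation on an intersection is the composite of the individual ones, and contractivity
makes their errors add. -/
theorem norm_sub_condExp_iInter_le {ι : Type*} {S : Finset ι} (hS : S.Nonempty)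
    {X : ι → Set (EuclideanSpace ℝ (Fin d))} (hX : ∀ i, Bornology.IsBounded (X i)) {A : L.Op}
    (hA : A ∈ QL L) :
    ‖A - condExp (sites L (⋂ i ∈ S, X i)) A‖ ≤ ∑ i ∈ S, 2 * distAlg L (X i) A := by
  classical
  induction hS using Finset.Nonempty.cons_induction with
  | singleton i => simpa using norm_sub_condExp_le (hX i) hA
  | cons i S hi hS ih =>
    have hb : Bornology.IsBounded (⋂ i ∈ S, X i) :=
      let ⟨k, hk⟩ := hS
      (hX k).subset (Set.biInter_subset_of_mem (show k ∈ (S : Set ι) from hk))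
    have h1 : (⋂ j ∈ Finset.cons i S hi, X j) = X i ∩ ⋂ j ∈ S, X j := by
      simp
    have h2 : sites L (⋂ j ∈ Finset.cons i S hi, X j) = sites L (X i) ∩ sites L (⋂ j ∈ S, X j) := by
      ext x
      rw [Finset.mem_inter, h1, mem_sites ((hX i).subset Set.inter_subset_left),
        mem_sites (hX i), mem_sites hb, Set.mem_inter_iff]
    have hE := condExp_mem_QL (sites L (⋂ j ∈ S, X j)) hA
    have h3 : A - condExp (sites L (⋂ j ∈ Finset.cons i S hi, X j)) A =
        (A - condExp (sites L (X i)) A) +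
          condExp (sites L (X i)) (A - condExp (sites L (⋂ j ∈ S, X j)) A) := by
      rw [condExp_sub _ hA hE, condExp_condExp _ _ hA, h2]
      abel
    rw [h3, Finset.sum_cons]
    exact (norm_add_le _ _).trans (add_le_add (norm_sub_condExp_le (hX i) hA)
      ((norm_condExp_le _ (sub_mem hA hE)).trans ih))

theorem IsUA.of_mem {m : ℕ} {a : (Fin m → L.Site) → L.Op} {C R : ℝ} (hR : 0 ≤ R)
    (hq : ∀ j, a j ∈ lieQ L) (hC : ∀ j, ‖a j‖ ≤ C)
    (h : ∀ j k, a j ∈ alg L (Metric.ball (j k : EuclideanSpace ℝ (Fin d)) R)) : IsUA a :=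
  ⟨hq, fun N => ⟨(1 + R) ^ N * C, fun j i => (Loc.of_mem hR Metric.ball_subset_closedBall
    (h j i)).mono (mul_le_mul_of_nonneg_left (hC j) (by positivity))⟩⟩

/-- Project each component to the intersection of the balls of radius `n` about all its indices. The
intersection is symmetric in the indices, so skew-symmetry survives, and the result is local around
every index at once. -/
theorem UALChain.dense_isUL (L : SpinSystem d) (q : ℕ) : Dense {a : UALChain L q | a.IsUL} := by
  refine dense_of_approx (p := UALChain.norms L q) ⟨rfl⟩ fun a => ?_
  let X : ℕ → (Fin (q + 1) → L.Site) → Set (EuclideanSpace ℝ (Fin d)) := fun n j =>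
    ⋂ i ∈ (Finset.univ : Finset (Fin (q + 1))), Metric.ball (j i : EuclideanSpace ℝ (Fin d)) n
  have hXs : ∀ n j k, X n j ⊆ Metric.ball (j k : EuclideanSpace ℝ (Fin d)) n := fun n j k =>
    Set.biInter_subset_of_mem (Finset.mem_coe.2 (Finset.mem_univ k))
  have hXb : ∀ n j, Bornology.IsBounded (X n j) := fun n j =>
    Metric.isBounded_ball.subset (hXs n j 0)
  let f : ℕ → (Fin (q + 1) → L.Site) → L.Op := fun n j => condExp (sites L (X n j)) (a.fn j)
  have hq : ∀ n j, f n j ∈ lieQ L := fun n j => condExp_mem_lieQ _ (a.mem_lieQ j)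
  have hC : ∀ n j, ‖f n j‖ ≤ 4 * UALChain.norms L q 0 a := fun n j =>
    (norm_condExp_le _ (a.mem_lieQ j).1).trans (a.norm_fn_le j)
  have hm : ∀ (n : ℕ) j k, f n j ∈ alg L (Metric.ball (j k : EuclideanSpace ℝ (Fin d)) n) :=
    fun n j k => alg_mono (hXs n j k) (condExp_sites_mem (hXb n j) (a.mem_lieQ j).1)
  have hs : ∀ n, IsSkew (f n) := fun n σ j => by
    have h1 : X n (j ∘ σ) = X n j := by
      simp only [X, Finset.mem_univ, Set.iInter_true, Function.comp_apply]
      exact σ.iInf_comp (g := fun i => Metric.ball (j i : EuclideanSpace ℝ (Fin d)) n)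
    change condExp (sites L (X n (j ∘ σ))) (a.fn (j ∘ σ)) = _
    rw [h1, a.isSkew σ j, zsmul_sign_eq, zsmul_sign_eq, condExp_real_smul _ _ (a.mem_lieQ j).1]
  refine ⟨fun n => mkChain (f n) (IsUA.of_mem n.cast_nonneg (hq n) (hC n) (hm n)) (hs n),
    -- The radius and the bound must be positive, hence `n + 1` rather than `n`, and the added 1 in
    -- the norm bound.
    fun n => ⟨4 * UALChain.norms L q 0 a + 1, ?_, n + 1, by positivity, fun j => ⟨?_, fun k => ?_⟩⟩,
    fun α => ⟨(2 * (q + 1) + 1) * UALChain.norms L q (α + 1) a, fun n =>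
      UALChain.norms_le fun j i r => ?_⟩⟩
  · have : 0 ≤ UALChain.norms L q 0 a := apply_nonneg _ _
    positivity
  · exact (hC n j).trans (by linarith)
  · exact alg_mono (Metric.ball_subset_ball (by linarith)) (hm n j k)
  · rw [map_sub, Pi.sub_apply, mkChain_fn]
    set K := UALChain.norms L q (α + 1) a with hK
    have hK0 : 0 ≤ K := apply_nonneg _ _
    have h1 : locErr L (j i) r (f n j - a.fn j) = locErr L (j i) r (a.fn j - f n j) :=
      map_sub_rev _ _ _
    rw [h1, ← div_eq_mul_inv, le_div_iff₀ (by positivity)]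
    have hr0 : (0 : ℝ) ≤ r := r.2
    -- For `r ≤ n` the norm of the error already suffices, being a sum of `q + 1` localization
    -- errors at radius `n`. For `r > n` the approximant lies in the ball, so the error is as
    -- localized as `a` itself, and the spare power gives `r + 1 ≥ n + 1`.
    by_cases hr : (r : ℝ) ≤ n
    · have h2 : ‖a.fn j - f n j‖ ≤ 2 * (q + 1) * (K / (1 + n) ^ (α + 1)) := by
        refine (norm_sub_condExp_iInter_le Finset.univ_nonempty
          (fun i => Metric.isBounded_ball) (a.mem_lieQ j).1).trans ?_
        refine (Finset.sum_le_card_nsmul _ _ (2 * (K / (1 + n) ^ (α + 1))) fun k _ => ?_).trans_eq ?_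
        · exact mul_le_mul_of_nonneg_left ((a.loc_norms (α + 1) j k).locErr_le n) zero_le_two
        · rw [Finset.card_univ, Fintype.card_fin, nsmul_eq_mul]; push_cast; ring
      have h3 : locErr L (j i) r (a.fn j - f n j) ≤ 2 * (q + 1) * (K / (1 + n) ^ (α + 1)) :=
        (distAlg_le_norm _ _).trans h2
      calc (1 + (r : ℝ)) ^ α * locErr L (j i) r (a.fn j - f n j) * (n + 1)
          ≤ (1 + (n : ℝ)) ^ α * (2 * (q + 1) * (K / (1 + n) ^ (α + 1))) * (n + 1) := by gcongr
        _ = 2 * (q + 1) * K := by rw [pow_succ]; field_simp; ring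
        _ ≤ (2 * (q + 1) + 1) * K := mul_le_mul_of_nonneg_right (by linarith) hK0
    · have hr' := (not_le.1 hr).le
      have h2 : locErr L (j i) r (a.fn j - f n j) ≤ locErr L (j i) r (a.fn j) := by
        refine (map_sub_le_add _ _ _).trans_eq ?_
        rw [locErr, distAlg_eq_zero (alg_mono (Metric.ball_subset_ball hr') (hm n j i)), add_zero]
      have h3 := a.loc_norms (α + 1) j i r
      rw [← hK, pow_succ] at h3
      calc (1 + (r : ℝ)) ^ α * locErr L (j i) r (a.fn j - f n j) * (n + 1)
          ≤ (1 + (r : ℝ)) ^ α * locErr L (j i) r (a.fn j) * (r + 1) := by gcongr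
        _ = (1 + (r : ℝ)) ^ α * (1 + r) * locErr L (j i) r (a.fn j) := by ring
        _ ≤ K := h3
        _ ≤ (2 * (q + 1) + 1) * K := le_mul_of_one_le_left hK0 (by linarith [q.cast_nonneg (α := ℝ)])

theorem dense_isUL (L : SpinSystem d) (n : ℕ) : Dense {a : NoetherCx L n | IsUL n a} := by
  cases n with
  | zero => exact UALDer.dense_isUL L
  | succ q => exact UALChain.dense_isUL L q

end UAL
end

open scoped NNReal Topology
noncomputable section
namespace UAL
variable {d : ℕ} {L : SpinSystem d}

/-! ### The operations on uniformly local elements -/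

section Local

variable {A B : L.Op} {x y : EuclideanSpace ℝ (Fin d)} {r s : ℝ}

theorem tsum_mem_alg {ι : Type*} {X : Set (EuclideanSpace ℝ (Fin d))}
    (hX : Bornology.IsBounded X) {u : ι → L.Op} (h : ∀ i, u i ∈ alg L X) :
    ∑' i, u i ∈ alg L X := by
  rw [alg_eq_algFin hX] at *
  exact tsum_mem (isClosed_algFin _) h

theorem real_smul_mem_alg {X : Set (EuclideanSpace ℝ (Fin d))} (c : ℝ) (hA : A ∈ alg L X) :
    c • A ∈ alg L X := by
  rw [real_smul_op]
  exact (alg L X).smul_mem _ hA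

theorem eq_zero_of_mem_ball (hA : A ∈ lieQ L) (hx : A ∈ alg L (Metric.ball x r))
    (hy : A ∈ alg L (Metric.ball y s)) (h : r + s ≤ dist x y) : A = 0 := by
  have h1 := norm_le_of_disjoint Metric.isBounded_ball Metric.isBounded_ball
    (Metric.ball_disjoint_ball h) hA
  rw [distAlg_eq_zero hx, distAlg_eq_zero hy, add_zero, mul_zero] at h1
  exact norm_le_zero_iff.1 h1

theorem lie_eq_zero_of_mem_ball (hA : A ∈ alg L (Metric.ball x r))
    (hB : B ∈ alg L (Metric.ball y s)) (h : r + s ≤ dist x y) : ⁅A, B⁆ = 0 :=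
  alg_lie_eq_zero (Metric.ball_disjoint_ball h) hA hB

theorem lie_mem_ball_right (hr : 0 ≤ r) (hA : A ∈ alg L (Metric.ball x r))
    (hB : B ∈ alg L (Metric.ball y s)) : ⁅A, B⁆ ∈ alg L (Metric.ball y (s + 2 * r)) := by
  by_cases h : r + s ≤ dist x y
  · rw [lie_eq_zero_of_mem_ball hA hB h]
    exact zero_mem _
  · exact lie_mem_alg (alg_mono (Metric.ball_subset_ball' (by linarith)) hA)
      (alg_mono (Metric.ball_subset_ball (by linarith)) hB)

theorem lie_mem_ball_left (hs : 0 ≤ s) (hA : A ∈ alg L (Metric.ball x r))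
    (hB : B ∈ alg L (Metric.ball y s)) : ⁅A, B⁆ ∈ alg L (Metric.ball x (r + 2 * s)) := by
  rw [op_lie_skew]
  exact neg_mem (lie_mem_ball_right hs hB hA)

/-- A brick protruding from the enlarged ball has a face layer missing the original ball, and that
face kills the component. -/
theorem brickComp_eq_zero_of_mem_ball (hr : 0 ≤ r) (hA : A ∈ lieQ L)
    (hAx : A ∈ alg L (Metric.ball x r)) {Y : Brick d}
    (hY : ¬ Y.1 ⊆ Metric.closedBall x (d * (r + 1))) : brickComp Y A = 0 := by
  rcases Y.cases with h | ⟨n, m, h, rfl⟩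
  · exact brickComp_empty h hA
  · by_contra h0
    exact hY (box_subset_closedBall hr fun k hk =>
      h0 (brickComp_eq_zero h Metric.isBounded_ball hk hA hAx))

/-- On bricks of diameter at most `D` the summand of `exists_brick_sum_le` is bounded below, so the
uniform bound on the sum limits their number. -/
theorem finite_bricks (x : EuclideanSpace ℝ (Fin d)) (D : ℝ) :
    {Y : Brick d | x ∈ Y.1 ∧ Metric.diam Y.1 ≤ D}.Finite := by
  obtain ⟨C, -, h⟩ := exists_brick_sum_le d
  by_contra hinf
  obtain ⟨N, hN⟩ := exists_nat_gt (C * (1 + D) ^ sumExp d)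
  obtain ⟨S, hS, rfl⟩ := Set.Infinite.exists_subset_card_eq hinf N
  have h1 := h x S fun Y hY => (hS hY).1
  rcases S.eq_empty_or_nonempty with rfl | ⟨Y₀, hY₀⟩
  · rw [Finset.sum_empty] at h1
    obtain ⟨Y, -, hY⟩ := Set.Infinite.nonempty hinf
    have h2 := Metric.diam_nonneg.trans hY
    have : 0 ≤ C * (1 + D) ^ sumExp d := by positivity
    rw [Finset.card_empty, Nat.cast_zero] at hN
    linarith
  · have h0 : 0 ≤ D := Metric.diam_nonneg.trans (hS hY₀).2
    have h2 : (S.card : ℝ) * ((1 + D) ^ sumExp d)⁻¹ ≤ C := by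
      refine le_trans ?_ h1
      rw [← nsmul_eq_mul]
      refine Finset.card_nsmul_le_sum _ _ _ fun Y hY => ?_
      have h3 := Metric.diam_nonneg (s := Y.1)
      have h4 : Metric.diam Y.1 ≤ D := (hS hY).2
      gcongr
    rw [← div_eq_mul_inv, div_le_iff₀ (by positivity)] at h2
    linarith

end Local

/-- A chain whose components are localized in balls of radius `R` around the sites. -/
def LocalIn {m : ℕ} (R : ℝ) (a : (Fin m → L.Site) → L.Op) : Prop :=
  ∀ j k, a j ∈ alg L (Metric.ball (j k : EuclideanSpace ℝ (Fin d)) R)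

/-- The norm bound is automatic for almost local chains, being contained in the seminorm of order
zero; only the range has to be tracked. -/
theorem UALChain.isUL_iff {q : ℕ} {a : UALChain L q} : a.IsUL ↔ ∃ R > 0, LocalIn R a.fn := by
  constructor
  · rintro ⟨C, -, R, hR, h⟩
    exact ⟨R, hR, fun j k => (h j).2 k⟩
  · rintro ⟨R, hR, h⟩
    have h0 : 0 ≤ UALChain.norms L q 0 a := apply_nonneg _ _
    exact ⟨4 * UALChain.norms L q 0 a + 1, by positivity, R, hR, fun j =>
      ⟨(a.norm_fn_le j).trans (by linarith), h j⟩⟩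

theorem UALDer.isUL_iff {F : UALDer L} :
    F.IsUL ↔ ∃ D, ∀ Y : Brick d, D < Metric.diam Y.1 → F.fn Y = 0 :=
  ⟨And.right, fun h => ⟨⟨_, F.norm_fn_le⟩, h⟩⟩

theorem finite_support_of_ball {f : L.Site → L.Op} (p : EuclideanSpace ℝ (Fin d)) (R : ℝ)
    (h : ∀ x : L.Site, R ≤ dist (x : EuclideanSpace ℝ (Fin d)) p → f x = 0) :
    (Function.support f).Finite :=
  (finite_sites (L := L) (Metric.isBounded_ball (x := p) (r := R))).subset fun x hx => by
    by_contra hx'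
    exact hx (h x (not_lt.1 hx'))

/-! #### Boundary maps -/

theorem LocalIn.sumFirst {m : ℕ} {R : ℝ} {a : (Fin (m + 1) → L.Site) → L.Op} (h : LocalIn R a) :
    LocalIn R (sumFirst a) := fun j k =>
  tsum_mem_alg Metric.isBounded_ball fun x => by simpa using h (Fin.cons x j) k.succ

/-- A traceless component supported both near `x` and near a distant `j 0` vanishes, so only
finitely many `x` contribute. -/
theorem LocalIn.sumFirst_eq {q : ℕ} {R : ℝ} {a : (Fin (q + 2) → L.Site) → L.Op} (h : LocalIn R a)
    (hq : ∀ j, a j ∈ lieQ L) : UAL.sumFirst a = bdry a := funext fun j =>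
  tsum_eq_finsum (finite_support_of_ball (j 0 : EuclideanSpace ℝ (Fin d)) (R + R) fun x hx =>
    eq_zero_of_mem_ball (hq _) (by simpa using h (Fin.cons x j) 0)
      (by simpa using h (Fin.cons x j) 1) hx)

theorem bdChain_isUL {q : ℕ} {a : UALChain L (q + 1)} (ha : a.IsUL) : (bdChain L q a).IsUL := by
  obtain ⟨R, hR, h⟩ := UALChain.isUL_iff.1 ha
  exact UALChain.isUL_iff.2 ⟨R, hR, h.sumFirst⟩

theorem bdChain_eq_bdry {q : ℕ} {a : UALChain L (q + 1)} (ha : a.IsUL) :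
    (bdChain L q a).fn = bdry a.fn := by
  obtain ⟨R, -, h⟩ := UALChain.isUL_iff.1 ha
  exact h.sumFirst_eq a.mem_lieQ

theorem UALChain.brickComp_eq_zero {f : UALChain L 0} {R : ℝ} (hR : 0 ≤ R) (h : LocalIn R f.fn)
    {Y : Brick d} {x : L.Site} (hY : ¬ Y.1 ⊆ Metric.closedBall (x : EuclideanSpace ℝ (Fin d))
      (d * (R + 1))) : brickComp Y (f.fam x) = 0 :=
  brickComp_eq_zero_of_mem_ball hR (f.mem_lieQ _) (h (fun _ => x) 0) hY

theorem bdDer_isUL {f : UALChain L 0} (hf : f.IsUL) : (bdDer L f).IsUL := by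
  obtain ⟨R, hR, h⟩ := UALChain.isUL_iff.1 hf
  refine UALDer.isUL_iff.2 ⟨2 * (d * (R + 1)), fun Y hY => ?_⟩
  change ∑' x, brickComp Y (f.fam x) = 0
  have h1 : ∀ x, brickComp Y (f.fam x) = 0 := fun x =>
    UALChain.brickComp_eq_zero hR.le h fun hx => absurd hY (not_lt.2
      ((Metric.diam_mono hx Metric.isBounded_closedBall).trans
        (Metric.diam_closedBall (by positivity))))
  simp only [h1, tsum_zero]

theorem bdDer_eq_bdryZero {f : UALChain L 0} (hf : f.IsUL) :
    (bdDer L f).fn = bdryZero f.fn := by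
  obtain ⟨R, hR, h⟩ := UALChain.isUL_iff.1 hf
  funext Y
  change ∑' x, brickComp Y (f.fam x) = ∑ᶠ x, brickComp Y (f.fam x)
  refine tsum_eq_finsum ?_
  rcases Set.eq_empty_or_nonempty Y.1 with hY | ⟨p, hp⟩
  · exact finite_support_of_ball 0 0 fun x _ => brickComp_empty hY (f.mem_lieQ _)
  · refine finite_support_of_ball p (d * (R + 1) + 1) fun x hx =>
      UALChain.brickComp_eq_zero hR.le h fun hx' => ?_
    have := Metric.mem_closedBall'.1 (hx' hp)
    linarith

/-! #### The contracting homotopy -/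

theorem finite_support_spread (x : L.Site) {G : Brick d → L.Op} {D : ℝ}
    (h : ∀ Y : Brick d, (x : EuclideanSpace ℝ (Fin d)) ∈ Y.1 → D < Metric.diam Y.1 → G Y = 0) :
    (Function.support fun Y => brickWeight L Y x • G Y).Finite := by
  refine (finite_bricks (x : EuclideanSpace ℝ (Fin d)) D).subset fun Y hY => ?_
  have h1 : (x : EuclideanSpace ℝ (Fin d)) ∈ Y.1 := by
    by_contra h1
    exact hY (by simp only [brickWeight_of_notMem h1, zero_smul])
  refine ⟨h1, ?_⟩
  by_contra h2
  exact hY (by simp only [h Y h1 (not_le.1 h2), smul_zero])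

theorem spread_mem_alg (x : L.Site) {G : Brick d → L.Op} {X : Set (EuclideanSpace ℝ (Fin d))}
    (hX : Bornology.IsBounded X) (h : ∀ Y : Brick d, (x : EuclideanSpace ℝ (Fin d)) ∈ Y.1 →
      G Y ∈ alg L X) : spread x G ∈ alg L X := by
  refine tsum_mem_alg hX fun Y => ?_
  by_cases hY : (x : EuclideanSpace ℝ (Fin d)) ∈ Y.1
  · exact real_smul_mem_alg _ (h Y hY)
  · rw [brickWeight_of_notMem hY, zero_smul]
    exact zero_mem _

theorem Brick.subset_ball {Y : Brick d} {x : EuclideanSpace ℝ (Fin d)} {D : ℝ} (hx : x ∈ Y.1)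
    (hD : Metric.diam Y.1 ≤ D) : Y.1 ⊆ Metric.ball x (D + 1) := fun z hz => by
  have := (Metric.dist_le_diam_of_mem Y.isBounded hz hx).trans hD
  exact Metric.mem_ball.2 (by linarith)

theorem htDer_isUL {F : UALDer L} (hF : F.IsUL) : (htDer L F).IsUL := by
  obtain ⟨D, h⟩ := UALDer.isUL_iff.1 hF
  refine UALChain.isUL_iff.2 ⟨max D 0 + 1, by positivity, fun j k => ?_⟩
  rw [Fin.eq_zero k]
  refine spread_mem_alg (j 0) Metric.isBounded_ball fun Y hY => ?_
  by_cases hD : D < Metric.diam Y.1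
  · rw [h Y hD]
    exact zero_mem _
  · exact alg_mono (Brick.subset_ball hY ((not_lt.1 hD).trans (le_max_left _ _)))
      (brickSpace_alg (F.mem Y))

theorem htDer_eq_htpyNeg {F : UALDer L} (hF : F.IsUL) : (htDer L F).fn = htpyNeg F.fn := by
  obtain ⟨D, h⟩ := UALDer.isUL_iff.1 hF
  exact funext fun j => tsum_eq_finsum (finite_support_spread (j 0) fun Y _ => h Y)

section Part

variable {x : L.Site} {y : EuclideanSpace ℝ (Fin d)} {A : L.Op} {R : ℝ}

theorem brickComp_eq_zero_of_diam (hR : 0 ≤ R) (hA : A ∈ lieQ L)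
    (hAy : A ∈ alg L (Metric.ball y R)) {Y : Brick d}
    (hY : 2 * (d * (R + 1)) < Metric.diam Y.1) : brickComp Y A = 0 :=
  brickComp_eq_zero_of_mem_ball hR hA hAy fun hy => absurd hY (not_lt.2
    ((Metric.diam_mono hy Metric.isBounded_closedBall).trans
      (Metric.diam_closedBall (by positivity))))

theorem finite_support_part (hR : 0 ≤ R) (hA : A ∈ lieQ L) (hAy : A ∈ alg L (Metric.ball y R)) :
    (Function.support fun Y => brickWeight L Y x • brickComp Y A).Finite :=
  finite_support_spread x fun _ _ h => brickComp_eq_zero_of_diam hR hA hAy h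

theorem part_mem_ball_self (hR : 0 ≤ R) (hA : A ∈ lieQ L) (hAy : A ∈ alg L (Metric.ball y R)) :
    part x A ∈ alg L (Metric.ball (x : EuclideanSpace ℝ (Fin d)) (2 * (d * (R + 1)) + 1)) := by
  refine spread_mem_alg x Metric.isBounded_ball fun Y hY => ?_
  by_cases hD : 2 * (d * (R + 1)) < Metric.diam Y.1
  · rw [brickComp_eq_zero_of_diam hR hA hAy hD]
    exact zero_mem _
  · exact alg_mono (Brick.subset_ball hY (not_lt.1 hD)) (brickComp_alg Y hA)

theorem part_mem_ball (hR : 0 ≤ R) (hA : A ∈ lieQ L) (hAy : A ∈ alg L (Metric.ball y R)) :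
    part x A ∈ alg L (Metric.ball y (2 * (d * (R + 1)) + 1)) := by
  refine spread_mem_alg x Metric.isBounded_ball fun Y hY => ?_
  by_cases hD : Y.1 ⊆ Metric.closedBall y (d * (R + 1))
  · refine alg_mono (hD.trans (Metric.closedBall_subset_ball ?_)) (brickComp_alg Y hA)
    have : 0 ≤ d * (R + 1) := by positivity
    linarith
  · rw [brickComp_eq_zero_of_mem_ball hR hA hAy hD]
    exact zero_mem _

end Part

theorem htChain_isUL {q : ℕ} {a : UALChain L q} (ha : a.IsUL) : (htChain L q a).IsUL := by
  obtain ⟨R, hR, h⟩ := UALChain.isUL_iff.1 ha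
  refine UALChain.isUL_iff.2 ⟨2 * (d * (R + 1)) + 1, by positivity, fun j i => ?_⟩
  change ∑ k : Fin (q + 2), (-1 : ℝ) ^ (k : ℕ) • part (j k) (a.fn (k.removeNth j)) ∈ _
  refine sum_mem fun k _ => real_smul_mem_alg _ ?_
  rcases Fin.eq_self_or_eq_succAbove k i with rfl | ⟨i, rfl⟩
  · exact part_mem_ball_self hR.le (a.mem_lieQ _) (h _ 0)
  · exact part_mem_ball hR.le (a.mem_lieQ _) (h (k.removeNth j) i)

theorem htChain_eq_htpy {q : ℕ} {a : UALChain L q} (ha : a.IsUL) :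
    (htChain L q a).fn = htpy a.fn := by
  obtain ⟨R, hR, h⟩ := UALChain.isUL_iff.1 ha
  funext j
  have hs : ∀ k : Fin (q + 2), (Function.support fun Y =>
      brickWeight L Y (j k) • brickComp Y (a.fn (k.removeNth j))).Finite := fun k =>
    finite_support_part hR.le (a.mem_lieQ _) (h (k.removeNth j) 0)
  have hs' : ∀ k : Fin (q + 2), (Function.support fun Y => ((-1 : ℝ) ^ (k : ℕ) *
      brickWeight L Y (j k)) • brickComp Y (a.fn (k.removeNth j))).Finite := fun k =>
    (hs k).subset fun Y hY hY' => hY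
      ((mul_smul _ _ _).trans ((congrArg _ hY').trans (smul_zero _)))
  change ∑ k : Fin (q + 2), (-1 : ℝ) ^ (k : ℕ) • part (j k) (a.fn (k.removeNth j)) = _
  unfold htpy
  rw [finsum_sum_comm _ _ fun k _ => hs' k]
  refine Finset.sum_congr rfl fun k _ => ?_
  rw [part, spread, tsum_eq_finsum (hs k), smul_finsum]
  simp only [mul_smul]

/-! #### The bracket -/

theorem famAct_mem_ball {f : L.Site → L.Op} {A : L.Op} {y : EuclideanSpace ℝ (Fin d)} {R S : ℝ}
    (hR : 0 ≤ R) (hf : ∀ x : L.Site, f x ∈ alg L (Metric.ball (x : EuclideanSpace ℝ (Fin d)) R))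
    (hA : A ∈ alg L (Metric.ball y S)) : famAct f A ∈ alg L (Metric.ball y (S + 2 * R)) :=
  tsum_mem_alg Metric.isBounded_ball fun x => lie_mem_ball_right hR (hf x) hA

theorem famAct_eq_finsum {f : L.Site → L.Op} {A : L.Op} {y : EuclideanSpace ℝ (Fin d)} {R S : ℝ}
    (hf : ∀ x : L.Site, f x ∈ alg L (Metric.ball (x : EuclideanSpace ℝ (Fin d)) R))
    (hA : A ∈ alg L (Metric.ball y S)) : famAct f A = ∑ᶠ x, ⁅f x, A⁆ :=
  tsum_eq_finsum (finite_support_of_ball y (R + S) fun x hx =>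
    lie_eq_zero_of_mem_ball (hf x) hA hx)

theorem actChain_isUL {q : ℕ} {F : UALDer L} {a : UALChain L q} (hF : F.IsUL) (ha : a.IsUL) :
    (actChain L q F a).IsUL := by
  obtain ⟨R, hR, h⟩ := UALChain.isUL_iff.1 (htDer_isUL hF)
  obtain ⟨S, hS, h'⟩ := UALChain.isUL_iff.1 ha
  exact UALChain.isUL_iff.2 ⟨S + 2 * R, by positivity, fun j k =>
    famAct_mem_ball hR.le (fun x => h (fun _ => x) 0) (h' j k)⟩

/-- A component not commuting with `A` must involve a site in the ball of `A`. Its brick then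
contains one of finitely many sites and has bounded diameter. -/
theorem finite_support_derAct {F : UALDer L} (hF : F.IsUL) {A : L.Op}
    {y : EuclideanSpace ℝ (Fin d)} {R : ℝ} (hA : A ∈ alg L (Metric.ball y R)) :
    (Function.support fun Y => ⁅F.fn Y, A⁆).Finite := by
  obtain ⟨D, h⟩ := UALDer.isUL_iff.1 hF
  refine (Set.Finite.biUnion (finite_sites (L := L) (Metric.isBounded_ball (x := y) (r := R)))
    fun x _ => finite_bricks (x : EuclideanSpace ℝ (Fin d)) D).subset fun Y hY => ?_
  have h1 : Metric.diam Y.1 ≤ D := by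
    by_contra h1
    refine hY ?_
    simp only [h Y (not_le.1 h1)]
    exact map_zero ((lieB L).flip A)
  by_contra h2
  refine hY ?_
  obtain ⟨Γ, hΓ, hFY⟩ := mem_alg.1 (brickSpace_alg (F.mem Y))
  refine alg_lie_eq_zero (X := (fun x : L.Site => (x : EuclideanSpace ℝ (Fin d))) '' Γ) ?_
    (mem_alg.2 ⟨Γ, fun x hx => Set.mem_image_of_mem _ hx, hFY⟩) hA
  rw [Set.disjoint_left]
  rintro _ ⟨x, hx, rfl⟩ hxy
  exact h2 (Set.mem_biUnion (show x ∈ _ from hxy) ⟨hΓ x hx, h1⟩)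

/-- Only finitely many bricks have a nonzero commutator with `A`, so the sums over sites and bricks
may be exchanged; for each brick the weights of its sites add up to one. -/
theorem famAct_htDer_eq_derAct {F : UALDer L} (hF : F.IsUL) {A : L.Op}
    {y : EuclideanSpace ℝ (Fin d)} {R : ℝ} (hA : A ∈ alg L (Metric.ball y R)) :
    famAct (htDer L F).fam A = derAct F.fn A := by
  have hs := finite_support_derAct hF hA
  have hmul : ∀ (c : ℝ) (B : L.Op), ⁅c • B, A⁆ = c • ⁅B, A⁆ := fun c B =>
    map_smul ((lieB L).flip A) c B
  have h1 : ∀ x, ⁅(htDer L F).fam x, A⁆ =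
      ∑ Y ∈ hs.toFinset, brickWeight L Y x • ⁅F.fn Y, A⁆ := fun x => by
    have h2 := hasSum_lie_left A (F.summable_spread x).hasSum
    simp only [hmul] at h2
    refine h2.unique (hasSum_sum_of_ne_finset_zero fun Y hY => ?_)
    have : ⁅F.fn Y, A⁆ = 0 := by
      by_contra h3
      exact hY (hs.mem_toFinset.2 h3)
    rw [this, smul_zero]
  have h2 : HasSum (fun x => ⁅(htDer L F).fam x, A⁆) (∑ Y ∈ hs.toFinset, ⁅F.fn Y, A⁆) := by
    simp only [h1]
    refine hasSum_sum fun Y _ => ?_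
    have h3 := hasSum_lie_left A (hasSum_brickWeight_smul (F.mem Y))
    simpa only [hmul] using h3
  rw [derAct, finsum_eq_sum _ hs]
  exact h2.tsum_eq

theorem bracket_chain_eq {p q : ℕ} (f : NoetherCx L (p + 1)) (g : NoetherCx L (q + 1)) :
    chain (q := p + 1 + q) (bracket L (p + 1) (q + 1) (p + 1 + (q + 1)) rfl f g) =
      chainBracket (chain f) (chain g) := by
  funext j
  refine (bracket_fn (m := p + 1) (n := q + 1) (k := p + 1 + q) rfl f g j).trans ?_
  refine (wedge_snd (m := p + 1) (n := q + 1) (k := p + 1 + q + 1) rfl _ _ j).trans ?_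
  refine congrArg _ (Finset.sum_congr rfl fun σ _ => congrArg _ ?_)
  exact congrArg (fun v : ExtLie L => (v.2 : L.Op)) (extBr_embChain_embChain f g _ _)

/-- Each site is an index of `f` or of `g` in every term. The commutator stays within `R + 2S` of it
in the first case and `S + 2R` in the second, since distant factors commute; the stated radius
covers both. -/
theorem chainBracket_localIn {p q : ℕ} {R S : ℝ} (hR : 0 ≤ R) (hS : 0 ≤ S)
    {f : (Fin (p + 1) → L.Site) → L.Op} {g : (Fin (q + 1) → L.Site) → L.Op}
    (hf : LocalIn R f) (hg : LocalIn S g) : LocalIn (2 * R + 2 * S) (chainBracket f g) := by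
  intro j k
  refine real_smul_mem_alg _ (sum_mem fun σ _ => zsmul_mem ?_ _)
  obtain ⟨k, rfl⟩ := σ.surjective k
  refine Fin.addCases (fun i => ?_) (fun i => ?_) k
  · exact alg_mono (Metric.ball_subset_ball (by linarith)) (lie_mem_ball_left hS
      (hf (fun i => j (σ (Fin.castAdd (q + 1) i))) i) (hg _ 0))
  · exact alg_mono (Metric.ball_subset_ball (by linarith)) (lie_mem_ball_right hR (hf _ 0)
      (hg (fun i => j (σ (Fin.natAdd (p + 1) i))) i))

theorem UALChain.IsUL.neg {q : ℕ} {a : UALChain L q} (ha : a.IsUL) : (-a).IsUL := by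
  obtain ⟨R, hR, h⟩ := UALChain.isUL_iff.1 ha
  exact UALChain.isUL_iff.2 ⟨R, hR, fun j k => by
    rw [map_neg]
    exact neg_mem (h j k)⟩

theorem derBr_isUL {F G : UALDer L} (hF : F.IsUL) (hG : G.IsUL) : (derBr L F G).IsUL := by
  rw [derBr_apply]
  exact bdDer_isUL (actChain_isUL hF (htDer_isUL hG))

theorem bracket_zero_isUL {n : ℕ} {F : NoetherCx L 0} {g : NoetherCx L n} (hF : IsUL 0 F)
    (hg : IsUL n g) : IsUL n (bracket L 0 n n (zero_add n) F g) := by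
  cases n with
  | zero =>
    rw [bracket_zero_zero]
    exact derBr_isUL hF hg
  | succ q =>
    rw [bracket_zero_succ]
    exact actChain_isUL hF hg

theorem bracket_isUL {m n k : ℕ} (e : m + n = k) {f : NoetherCx L m} {g : NoetherCx L n}
    (hf : IsUL m f) (hg : IsUL n g) : IsUL k (bracket L m n k e f g) := by
  cases m with
  | zero =>
    obtain rfl : n = k := by omega
    exact bracket_zero_isUL hf hg
  | succ p =>
    cases n with
    | zero =>
      obtain rfl : p + 1 = k := e
      rw [bracket_der_right]
      exact (bracket_zero_isUL hg hf).neg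
    | succ q =>
      obtain rfl : p + 1 + q + 1 = k := e
      obtain ⟨R, hR, h⟩ := UALChain.isUL_iff.1 hf
      obtain ⟨S, hS, h'⟩ := UALChain.isUL_iff.1 hg
      refine UALChain.isUL_iff.2 ⟨2 * R + 2 * S, by positivity, ?_⟩
      have h1 := chainBracket_localIn hR.le hS.le h h'
      exact (congrArg (LocalIn (2 * R + 2 * S)) (bracket_chain_eq f g)).mpr h1

/-- The bracket may be computed from the density `g` in place of the canonical one, and `∂_0 f` acts
by the sum of commutators with `f`; locality makes that sum finite. -/
theorem derBr_bdDer_bdDer {f g : UALChain L 0} (hf : f.IsUL) (hg : g.IsUL) :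
    (derBr L (bdDer L f) (bdDer L g)).fn = bdryZero (derivedBracket f.fn g.fn) := by
  obtain ⟨R, hR, h⟩ := UALChain.isUL_iff.1 hf
  obtain ⟨S, hS, h'⟩ := UALChain.isUL_iff.1 hg
  rw [derBr_bdDer, bdDer_eq_bdryZero (actChain_isUL (bdDer_isUL hf) hg)]
  refine congrArg _ (funext fun j => ?_)
  rw [actChain_fn, act_bdDer]
  exact famAct_eq_finsum (fun x => h (fun _ => x) 0) (h' j 0)

theorem bracket_zero_zero_eq {f g : NoetherCx L 1} (hf : IsUL 1 f) (hg : IsUL 1 g) :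
    der (bracket L 0 0 0 rfl (bd L 0 f) (bd L 0 g)) =
      bdryZero (derivedBracket (chain f) (chain g)) := by
  rw [bracket_zero_zero]
  exact derBr_bdDer_bdDer hf hg

theorem bracket_der_chain_eq {q : ℕ} {F : NoetherCx L 0} {g : NoetherCx L (q + 1)}
    (hF : IsUL 0 F) (hg : IsUL (q + 1) g) :
    chain (bracket L 0 (q + 1) (q + 1) (zero_add _) F g) =
      fun j => derAct (der F) (chain g j) := by
  obtain ⟨R, -, h⟩ := UALChain.isUL_iff.1 hg
  rw [bracket_zero_succ]
  exact funext fun j => famAct_htDer_eq_derAct hF (h j 0)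

end UAL
end

/-! ### Assembly of the theorem -/

theorem mainTheorem8 {d : ℕ} (L : SpinSystem d) :
    -- the terms of the complex are Fréchet spaces, and are completions of the uniformly local ones
    (∀ n, IsFrechet (NoetherCx L n) ∧ Dense {a : NoetherCx L n | IsUL n a}) ∧
    ∃ (bd : ∀ n, NoetherCx L (n + 1) →L[ℝ] NoetherCx L n)
      (h : ∀ n, NoetherCx L n →L[ℝ] NoetherCx L (n + 1))
      (br : ∀ m n k, m + n = k → NoetherCx L m →ₗ[ℝ] NoetherCx L n →ₗ[ℝ] NoetherCx L k),
      -- the boundary maps extend those of the uniformly local complex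
      (∀ n a, IsUL (n + 1) a → IsUL n (bd n a)) ∧
      (∀ (q : ℕ) (a : NoetherCx L (q + 2)), IsUL (q + 2) a →
        chain (bd (q + 1) a) = bdry (chain a)) ∧
      (∀ a : NoetherCx L 1, IsUL 1 a → der (bd 0 a) = bdryZero (chain a)) ∧
      -- the contracting homotopy extends the uniformly local one
      (∀ n a, IsUL n a → IsUL (n + 1) (h n a)) ∧
      (∀ (q : ℕ) (a : NoetherCx L (q + 1)), IsUL (q + 1) a →
        chain (h (q + 1) a) = htpy (chain a)) ∧
      (∀ F : NoetherCx L 0, IsUL 0 F → chain (h 0 F) = htpyNeg (der F)) ∧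
      -- the augmented complex is a complex, contracted by `h`
      (∀ n a, bd n (bd (n + 1) a) = 0) ∧
      (∀ n a, h n (bd n a) + bd (n + 1) (h (n + 1) a) = a) ∧
      (∀ F, bd 0 (h 0 F) = F) ∧
      -- the bracket extends the uniformly local one and is jointly continuous
      (∀ m n k (e : m + n = k) f g, IsUL m f → IsUL n g → IsUL k (br m n k e f g)) ∧
      (∀ (p q : ℕ) (f : NoetherCx L (p + 1)) (g : NoetherCx L (q + 1)),
        IsUL (p + 1) f → IsUL (q + 1) g →
        chain (q := p + 1 + q) (br (p + 1) (q + 1) (p + 1 + (q + 1)) rfl f g) =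
          chainBracket (chain f) (chain g)) ∧
      (∀ (q : ℕ) (F : NoetherCx L 0) (g : NoetherCx L (q + 1)), IsUL 0 F → IsUL (q + 1) g →
        chain (br 0 (q + 1) (q + 1) (zero_add _) F g) = fun j => derAct (der F) (chain g j)) ∧
      (∀ f g : NoetherCx L 1, IsUL 1 f → IsUL 1 g →
        der (br 0 0 0 rfl (bd 0 f) (bd 0 g)) = bdryZero (derivedBracket (chain f) (chain g))) ∧
      (∀ m n k (e : m + n = k),
        Continuous fun x : NoetherCx L m × NoetherCx L n => br m n k e x.1 x.2) ∧
      -- graded skew-symmetry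
      (∀ m n k (e : m + n = k) (e' : n + m = k) f g,
        br m n k e f g = -((-1 : ℝ) ^ (m * n) • br n m k e' g f)) ∧
      -- graded Jacobi identity
      (∀ l m n f g c,
        (-1 : ℝ) ^ (l * n) • br l (m + n) (l + m + n) (by omega) f (br m n (m + n) rfl g c) +
        (-1 : ℝ) ^ (m * l) • br m (n + l) (l + m + n) (by omega) g (br n l (n + l) rfl c f) +
        (-1 : ℝ) ^ (n * m) • br n (l + m) (l + m + n) (by omega) c (br l m (l + m) rfl f g) = 0) ∧
      -- graded Leibniz rule, the differential being zero on `NoetherCx L 0`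
      (∀ m n (f : NoetherCx L (m + 1)) (g : NoetherCx L (n + 1)),
        bd (m + n + 1) (br (m + 1) (n + 1) (m + n + 2) (by omega) f g) =
          br m (n + 1) (m + n + 1) (by omega) (bd m f) g +
          (-1 : ℝ) ^ (m + 1) • br (m + 1) n (m + n + 1) (by omega) f (bd n g)) ∧
      (∀ n (F : NoetherCx L 0) (g : NoetherCx L (n + 1)),
        bd n (br 0 (n + 1) (n + 1) (zero_add _) F g) = br 0 n n (zero_add _) F (bd n g)) ∧
      (∀ m (f : NoetherCx L (m + 1)) (G : NoetherCx L 0),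
        bd m (br (m + 1) 0 (m + 1) rfl f G) = br m 0 m rfl (bd m f) G) ∧
      -- energy currents: `H = ∂η` for an energy density `η`
      (∀ (η : NoetherCx L 1) (j : NoetherCx L 2),
        br 0 1 1 rfl (bd 0 η) η = -bd 1 j ↔
          ∃ c : NoetherCx L 3, j = -((1 / 2 : ℝ) • br 1 1 2 rfl η η) + bd 2 c) ∧
      -- currents of a symmetry of `H` generated by a charge density `ρ`
      (∀ (H : NoetherCx L 0) (ρ : NoetherCx L 1), br 0 0 0 rfl (bd 0 ρ) H = 0 →
        ∃ j₀ : NoetherCx L 2, ∀ j : NoetherCx L 2,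
          br 0 1 1 rfl H ρ = -bd 1 j ↔ ∃ c : NoetherCx L 3, j = j₀ + bd 2 c) ∧
      (∀ η ρ : NoetherCx L 1, br 0 1 1 rfl (bd 0 ρ) η = 0 →
        br 0 1 1 rfl (bd 0 η) ρ = -bd 1 (-(br 1 1 2 rfl η ρ))) := by
  refine ⟨fun n => ⟨isFrechet_noetherCx L n, dense_isUL L n⟩, bdL L, htL L, bracket L,
    fun n a ha => ?_, fun q a ha => bdChain_eq_bdry ha, fun a ha => bdDer_eq_bdryZero ha,
    fun n a ha => ?_, fun q a ha => htChain_eq_htpy ha, fun F hF => htDer_eq_htpyNeg hF,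
    fun n a => bd_bd n a, fun n a => ht_bd n a, fun F => bd_ht F,
    fun m n k e f g hf hg => bracket_isUL e hf hg, fun p q f g _ _ => bracket_chain_eq f g,
    fun q F g hF hg => bracket_der_chain_eq hF hg, fun f g hf hg => bracket_zero_zero_eq hf hg,
    fun m n k e => continuous_bracket e, fun m n k e e' f g => bracket_skew e e' f g,
    fun l m n f g c => cyclic_jacobi l m n _ _ _ f g c,
    fun m n f g => bd_bracket m n _ _ _ f g, fun n F g => bd_bracket_der n F g,
    fun m f G => bd_bracket_der_right m f G, fun η j => energy_current_iff η j,
    fun H ρ h => exists_symmetry_current H ρ h, fun η ρ h => symmetry_current_of_density η ρ h⟩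
  · cases n with
    | zero => exact bdDer_isUL ha
    | succ q => exact bdChain_isUL ha
  · cases n with
    | zero => exact htDer_isUL ha
    | succ q => exact htChain_isUL ha
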